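/- Let $F$ be an algebraically closed field of characteristic $p>3$. Let $\mathcal O(2)$ be the divided power algebra with basis $x_1^{(i)}x_2^{(j)}$ ($i,j\ge 0$) and partial derivatives $D_1,D_2$, let $\mathcal O(2;(2,1))$ be its subalgebra spanned by the $x_1^{(i)}x_2^{(j)}$ with $i<p^2$, $j<p$, put $W(2;(2,1))=\mathcal O(2;(2,1))D_1+\mathcal O(2;(2,1))D_2$ and $D_H(f)=D_1(f)D_2-D_2(f)D_1$. Let $G=H(2;(2,1))=\{D_H(f)\mid f\in\mathcal O(2)\}\cap W(2;(2,1))$ and $S=G^{(2)}$, and let $S_{(0)}$ be the set of all $f_1D_1+f_2D_2\in S$ with $f_1,f_2$ without constant term. $S$ is an ideal of $G$; view $G$ inside $\mathrm{Der}\,S$, with $p$-map $x^{[p]}=x^p$, and let $S_p$ and $\mathcal G$ be the $p$-envelopes of $S$ and $G$ in $\mathrm{Der}\,S$. The group $\mathrm{Aut}\,S$ acts on $\mathrm{Der}\,S$ by conjugation. An element $x$ is toral if $x^{[p]}=x$, and $p$-semisimple if it lies in the span of the $x^{[p]^i}$, $i\ge1$; a torus of $\mathcal G$ is an abelian subalgebra,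 closed under the $p$-map, that consists of $p$-semisimple elements. Write $\mathcal O_{(k)}[x_1]$ for the span of the $x_1^{(i)}$ with $k\le i<p^2$, and $u'=D_1(u)$. For $\mu\in\{0,1\}$ set $\tilde r=x_1+\mu x_1^{(p)}$, $r=1+\mu x_1^{(p-1)}$, and $$t_\mu=D_H\big(\tilde r+\tilde r\,r\,x_2^{(p-1)}\big),\quad h_\mu=D_H\big(r^{-1}x_2-x_2^{(p)}\big),\quad n_\mu=D_1^p+\mu D_H(x_2^{(p)}),$$ $$\varphi_a(v)=\sum_{i=0}^{p-1}a^iD_H(r^{-i}vx_2^{(i)})+a^{p-1}D_H(\tilde r v'x_2^{(p-1)})\qquad(a\in F,\ v\in\mathcal O_{(0)}[x_1]).$$ Let $C_\mu=\mathfrak c_{\mathcal G}(t_\mu)$, and let $C_\mu'$ be the span of $D_H(x_1^{(p^2)})$ and all $D_H(u+u'\tilde rx_2^{(p-1)})$ with $u\in\mathcal O_{(0)}[x_1]$. Let $Z(t_\mu)$ be the stabilizer of $t_\mu$ in $\mathrm{Aut}\,S$. 1. Every toral element of $S_p$ that lies in $S\setminus S_{(0)}$ is conjugate under $\mathrm{Aut}\,S$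 to $t_\mu$ for some $\mu\in\{0,1\}$. Both $t_0$ and $t_1$ are toral. 2. Let $\mu\in\{0,1\}$. (i) $C_\mu'$ is an abelian ideal of codimension $2$ in $C_\mu$, and $C_\mu=Fn_\mu\oplus Fh_\mu\oplus C_\mu'$. (ii) For every $k\in\mathbb F_p^\times$ the $k$-eigenspace of $\mathrm{ad}\,t_\mu$ in $\mathcal G$ lies in $S$, has dimension $p^2$ and is spanned by all $\varphi_k(u)$ with $u\in\mathcal O_{(0)}[x_1]$. (iii) $h_\mu^{[p]}=-\mu h_\mu-n_\mu$ and $n_\mu^{[p]}=0$. (iv) If $\mu=0$, then $C_\mu$ is nilpotent and $Ft_\mu$ is a maximal torus of $\mathcal G$. 3. Let $\mu\in\{0,1\}$, $\mu\neq0$. (i) For $3\le m\le p^2$ and $c\in F$ the operator $D=\mathrm{ad}\,D_H(x_1^{(m)}+x_1^{(m-1)}\tilde rx_2^{(p-1)})$ on $S$ satisfies $D^p=0$, and $\exp(cD)=\sum_{i<p}c^iD^i/i!$ belongs to $Z(t_\mu)$. Let $h\in G\cap C_\mu$, $h\notin C_\mu'$. (ii) There are $z\in Z(t_\mu)$, $a\in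 F^\times$ and $b,s\in F$ with $z(h)=ah_\mu+bt_\mu+sD_H(x_1^{(p^2)})$. (iii) For every $k\in\mathbb F_p^\times$ there is $v_k\in 1+\mathcal O_{(1)}[x_1]$ such that $\varphi_k(v_k)$ is an eigenvector of $\mathrm{ad}\,h$ and $\varphi_k(v_k)^{[p]}$ is a nonzero $p$-semisimple element of $\mathcal G$. (iv) There is a nonzero $x\in\mathfrak c_S(t_\mu)$ such that $\mathrm{ad}\,x$ is not nilpotent and $[h,x]=\lambda x$ for some $\lambda\in F^\times$. 4. Every toral element of $S_p$ not contained in $S$ is conjugate under $\mathrm{Aut}\,S$ to $D_1^p+D_1+D_H(x_1x_2)$. -/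

import Mathlib

attribute [local instance 100] LieRing.ofAssociativeRing

namespace Ham21

noncomputable section

/-! ## The divided power algebra `𝒪(2)` -/

/-- The divided power algebra `𝒪(2)` in two variables over `F`: the vector space with basis
`x₁^{(i)} x₂^{(j)}`, `i j : ℕ`. -/
def O2 (F : Type*) [Field F] : Type _ := ℕ × ℕ →₀ F

section Algebra

variable {F : Type*} [Field F]

instance : AddCommGroup (O2 F) := inferInstanceAs (AddCommGroup (ℕ × ℕ →₀ F))

instance : Module F (O2 F) := inferInstanceAs (Module F (ℕ × ℕ →₀ F))

/-- The monomial `x₁^{(i)} x₂^{(j)}`, where `a = (i, j)`. -/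
def mon (a : ℕ × ℕ) : O2 F := Finsupp.single a (1 : F)

/-- The coefficient of `x₁^{(i)} x₂^{(j)}` in an element of `𝒪(2)`. -/
def coeff (a : ℕ × ℕ) : O2 F →ₗ[F] F := Finsupp.lapply a

/-- The linear map which is prescribed on monomials. -/
def ofMon {M : Type*} [AddCommGroup M] [Module F M] (v : ℕ × ℕ → M) : O2 F →ₗ[F] M :=
  Finsupp.linearCombination F v

@[simp] theorem ofMon_mon {M : Type*} [AddCommGroup M] [Module F M] (v : ℕ × ℕ → M)
    (a : ℕ × ℕ) : ofMon v (mon a : O2 F) = v a := by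
  refine (Finsupp.linearCombination_single F (1 : F) a).trans (one_smul F (v a))

theorem hom_ext {M : Type*} [AddCommGroup M] [Module F M] {f g : O2 F →ₗ[F] M}
    (h : ∀ a, f (mon a) = g (mon a)) : f = g := by
  apply Finsupp.lhom_ext'
  intro a
  apply LinearMap.ext_ring
  exact h a

/-- The structure constant in `x^{(a)} x^{(b)} = binom(a + b, a) x^{(a + b)}`. -/
def binom2 (a b : ℕ × ℕ) : ℕ := (a.1 + b.1).choose a.1 * (a.2 + b.2).choose a.2

/-- The multiplication of `𝒪(2)` as a bilinear map. -/
def mulL : O2 F →ₗ[F] O2 F →ₗ[F] O2 F :=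
  ofMon fun a => ofMon fun b => (binom2 a b : F) • mon (a + b)

theorem mulL_mon (a b : ℕ × ℕ) :
    mulL (mon a : O2 F) (mon b) = (binom2 a b : F) • mon (a + b) := by
  simp [mulL]

theorem choose_assoc (i j k : ℕ) :
    (i + j).choose i * (i + j + k).choose (i + j) =
      (j + k).choose j * (i + (j + k)).choose i := by
  have h := Nat.choose_mul (n := i + j + k) (k := i + j) (s := i) (by omega)
  have e1 : i + j + k - i = j + k := by omega
  have e2 : i + j - i = j := by omega
  rw [e1, e2] at h
  rw [mul_comm, h, ← add_assoc, mul_comm]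

theorem binom2_assoc (a b c : ℕ × ℕ) :
    binom2 a b * binom2 (a + b) c = binom2 b c * binom2 a (b + c) := by
  have h1 := choose_assoc a.1 b.1 c.1
  have h2 := choose_assoc a.2 b.2 c.2
  simp only [binom2, Prod.fst_add, Prod.snd_add]
  calc _ = ((a.1 + b.1).choose a.1 * (a.1 + b.1 + c.1).choose (a.1 + b.1)) *
      ((a.2 + b.2).choose a.2 * (a.2 + b.2 + c.2).choose (a.2 + b.2)) := by ring
    _ = _ := by rw [h1, h2]; ring

theorem mulL_assoc (f g h : O2 F) : mulL (mulL f g) h = mulL f (mulL g h) := by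
  have h1 : ∀ a b, mulL (mulL (mon a) (mon b)) =
      (mulL (F := F) (mon a)).comp (mulL (mon b)) := by
    intro a b
    apply hom_ext; intro c
    simp only [LinearMap.comp_apply, mulL_mon, map_smul, LinearMap.smul_apply, smul_smul]
    rw [add_assoc, ← Nat.cast_mul, ← Nat.cast_mul, binom2_assoc]
  have h2 : ∀ a, (mulL.flip h).comp (mulL (F := F) (mon a)) =
      (mulL (mon a)).comp (mulL.flip h) := by
    intro a
    apply hom_ext; intro b
    exact congrArg (fun T => T h) (h1 a b)
  have h3 : (mulL.flip h).comp (mulL.flip g) = (mulL (F := F)).flip (mulL g h) := by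
    apply hom_ext; intro a
    exact congrArg (fun T => T g) (h2 a)
  exact congrArg (fun T => T f) h3

theorem mulL_comm (f g : O2 F) : mulL f g = mulL g f := by
  have key : (mulL (F := F)) = mulL.flip := by
    apply hom_ext; intro a
    apply hom_ext; intro b
    rw [LinearMap.flip_apply, mulL_mon, mulL_mon, add_comm]
    congr 2
    simp only [binom2]
    rw [Nat.choose_symm_add, Nat.choose_symm_add, add_comm a.1, add_comm a.2]
  exact congrArg (fun T => T f g) key

theorem one_mulL (f : O2 F) : mulL (mon 0) f = f := by
  have key : mulL (F := F) (mon 0) = LinearMap.id := by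
    apply hom_ext; intro a
    rw [mulL_mon]
    simp [binom2]
  exact congrArg (fun T => T f) key

instance : CommRing (O2 F) :=
  { (inferInstance : AddCommGroup (O2 F)) with
    mul := fun f g => mulL f g
    one := mon 0
    mul_assoc := mulL_assoc
    mul_comm := mulL_comm
    one_mul := one_mulL
    mul_one := fun f => (mulL_comm f (mon 0)).trans (one_mulL f)
    left_distrib := fun f g h => map_add (mulL f) g h
    right_distrib := fun f g h => by
      change mulL (f + g) h = mulL f h + mulL g h
      rw [map_add, LinearMap.add_apply]
    zero_mul := fun f => by
      change mulL 0 f = 0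
      rw [map_zero, LinearMap.zero_apply]
    mul_zero := fun f => map_zero (mulL f) }

theorem mul_def (f g : O2 F) : f * g = mulL f g := rfl

theorem one_def : (1 : O2 F) = mon 0 := rfl

theorem mon_mul_mon (a b : ℕ × ℕ) :
    (mon a * mon b : O2 F) = (binom2 a b : F) • mon (a + b) := mulL_mon a b

instance : Algebra F (O2 F) :=
  Algebra.ofModule
    (fun c f g => by rw [mul_def, mul_def, map_smul, LinearMap.smul_apply])
    (fun c f g => by rw [mul_def, mul_def, map_smul])

/-! ## Derivations -/

/-- The lowering maps `x₁^{(i)} x₂^{(j)} ↦ x₁^{(i-1)} x₂^{(j)}` (and `0` if `i = 0`). -/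
def low1 : O2 F →ₗ[F] O2 F := ofMon fun a => if a.1 = 0 then 0 else mon (a.1 - 1, a.2)

/-- The lowering maps `x₁^{(i)} x₂^{(j)} ↦ x₁^{(i)} x₂^{(j-1)}` (and `0` if `j = 0`). -/
def low2 : O2 F →ₗ[F] O2 F := ofMon fun a => if a.2 = 0 then 0 else mon (a.1, a.2 - 1)

theorem leibniz_of_mon (T : O2 F →ₗ[F] O2 F)
    (h : ∀ a b, T (mon a * mon b) = mon a * T (mon b) + mon b * T (mon a)) (f g : O2 F) :
    T (f * g) = f * T g + g * T f := by
  have key : (mulL (F := F)).compr₂ T =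
      (mulL (F := F)).compl₂ T + ((mulL (F := F)).compl₂ T).flip := by
    apply hom_ext; intro a
    apply hom_ext; intro b
    exact h a b
  exact congrArg (fun S => S f g) key

theorem low1_mon (a : ℕ × ℕ) :
    low1 (mon a : O2 F) = if a.1 = 0 then 0 else mon (a.1 - 1, a.2) := by
  simp [low1]

theorem low2_mon (a : ℕ × ℕ) :
    low2 (mon a : O2 F) = if a.2 = 0 then 0 else mon (a.1, a.2 - 1) := by
  simp [low2]

theorem low1_leibniz (f g : O2 F) : low1 (f * g) = f * low1 g + g * low1 f := by
  refine leibniz_of_mon low1 ?_ f g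
  rintro ⟨i, j⟩ ⟨k, l⟩
  have c2 : (l + j).choose l = (j + l).choose j := by rw [add_comm, Nat.choose_symm_add]
  rw [mon_mul_mon, map_smul, low1_mon, low1_mon, low1_mon]
  rcases i with _ | i <;> rcases k with _ | k
  · simp
  · simp [mon_mul_mon, binom2, ← add_assoc]
  · rw [add_comm l j] at c2
    simp [mon_mul_mon, binom2, c2, add_comm l j]
  · have e : i + 1 + (k + 1) = (i + 1 + k) + 1 := by ring
    have e' : k + 1 + i = i + 1 + k := by ring
    have c1 : (k + 1 + i).choose (k + 1) = (i + 1 + k).choose i := by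
      rw [e', show i + 1 + k = (k + 1) + i by ring, Nat.choose_symm_add]
    simp only [mon_mul_mon, binom2, Prod.mk_add_mk, Nat.add_sub_cancel, Nat.succ_ne_zero,
      if_false, c1, c2]
    rw [e, if_neg (Nat.succ_ne_zero _), Nat.add_sub_cancel, e', add_comm l j,
      Nat.choose_succ_succ, ← add_smul]
    push_cast
    congr 1
    ring

theorem low2_leibniz (f g : O2 F) : low2 (f * g) = f * low2 g + g * low2 f := by
  refine leibniz_of_mon low2 ?_ f g
  rintro ⟨j, i⟩ ⟨l, k⟩
  have c2 : (l + j).choose l = (j + l).choose j := by rw [add_comm, Nat.choose_symm_add]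
  rw [mon_mul_mon, map_smul, low2_mon, low2_mon, low2_mon]
  rcases i with _ | i <;> rcases k with _ | k
  · simp
  · simp [mon_mul_mon, binom2, ← add_assoc]
  · rw [add_comm l j] at c2
    simp [mon_mul_mon, binom2, c2, add_comm l j]
  · have e : i + 1 + (k + 1) = (i + 1 + k) + 1 := by ring
    have e' : k + 1 + i = i + 1 + k := by ring
    have c1 : (k + 1 + i).choose (k + 1) = (i + 1 + k).choose i := by
      rw [e', show i + 1 + k = (k + 1) + i by ring, Nat.choose_symm_add]
    simp only [mon_mul_mon, binom2, Prod.mk_add_mk, Nat.add_sub_cancel, Nat.succ_ne_zero,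
      if_false, c1, c2]
    rw [e, if_neg (Nat.succ_ne_zero _), Nat.add_sub_cancel, e', add_comm l j,
      Nat.choose_succ_succ, ← add_smul]
    push_cast
    congr 1
    ring

/-- The partial derivative `D₁` of `𝒪(2)`. -/
def D1 : Derivation F (O2 F) (O2 F) := Derivation.mk' low1 low1_leibniz

/-- The partial derivative `D₂` of `𝒪(2)`. -/
def D2 : Derivation F (O2 F) (O2 F) := Derivation.mk' low2 low2_leibniz

theorem D1_mon (a : ℕ × ℕ) :
    D1 (mon a : O2 F) = if a.1 = 0 then 0 else mon (a.1 - 1, a.2) := low1_mon a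

theorem D2_mon (a : ℕ × ℕ) :
    D2 (mon a : O2 F) = if a.2 = 0 then 0 else mon (a.1, a.2 - 1) := low2_mon a

theorem D1_D2_comm (f : O2 F) : D1 (D2 f) = D2 (D1 f) := by
  have key : (low1 (F := F)).comp low2 = low2.comp low1 := by
    apply hom_ext
    rintro ⟨i, j⟩
    simp only [LinearMap.comp_apply, low1_mon, low2_mon]
    by_cases hi : i = 0 <;> by_cases hj : j = 0 <;> simp [hi, hj, low1_mon, low2_mon]
  exact congrArg (fun T => T f) key

/-- The Hamiltonian derivation `D_H(f) = D₁(f) D₂ - D₂(f) D₁`. -/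
def dH : O2 F →ₗ[F] Derivation F (O2 F) (O2 F) where
  toFun f := D1 f • D2 - D2 f • D1
  map_add' f g := by simp only [map_add, add_smul]; abel
  map_smul' c f := by
    simp only [Derivation.map_smul, smul_assoc, RingHom.id_apply, smul_sub]

theorem dH_apply (f g : O2 F) : dH f g = D1 f * D2 g - D2 f * D1 g := rfl

theorem lie_dH (f g : O2 F) : ⁅dH f, dH g⁆ = dH (D1 f * D2 g - D2 f * D1 g) := by
  ext h
  rw [Derivation.commutator_apply]
  rw [dH_apply (_ - _)]
  simp only [dH_apply, map_sub, Derivation.leibniz, smul_eq_mul]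
  simp only [D1_D2_comm]
  ring

/-- The Hamiltonian algebra `H(2) = {D_H(f) | f ∈ 𝒪(2)}`. -/
def H2 (F : Type*) [Field F] : LieSubalgebra F (Derivation F (O2 F) (O2 F)) :=
  { LinearMap.range (dH (F := F)) with
    lie_mem' := by
      rintro _ _ ⟨f, rfl⟩ ⟨g, rfl⟩
      exact ⟨_, (lie_dH f g).symm⟩ }

end Algebra

/-! ## The truncated algebra `𝒪(2;(2,1))` and the Lie algebra `H(2;(2,1))` -/

section Truncated

variable (F : Type*) [Field F] (p : ℕ)

/-- The linear span of the monomials `x₁^{(i)} x₂^{(j)}` with `(i, j) ∈ s`. -/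
def monSpan (s : Set (ℕ × ℕ)) : Submodule F (O2 F) := Submodule.span F (mon '' s)

variable {F} {p} in
theorem dvd_choose_pow_add (hp : p.Prime) {n a b : ℕ} (hn : n ≠ 0) (ha : a < p ^ n)
    (hb : b < p ^ n) (h : p ^ n ≤ a + b) : p ∣ (a + b).choose a := by
  have hc : (a + b).choose a = (b + a).choose a := by rw [add_comm]
  rw [hc, ← pow_one p]
  apply pow_dvd_of_le_emultiplicity
  rw [Nat.Prime.emultiplicity_choose' hp (Nat.lt_succ_self _)]
  norm_cast
  rw [Finset.one_le_card]
  refine ⟨n, Finset.mem_filter.2 ⟨Finset.mem_Ico.2 ⟨Nat.one_le_iff_ne_zero.2 hn, ?_⟩, ?_⟩⟩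
  · rw [Nat.lt_succ_iff]
    refine Nat.le_log_of_pow_le hp.one_lt ?_
    rw [add_comm]; exact h
  · rw [Nat.mod_eq_of_lt ha, Nat.mod_eq_of_lt hb]; exact h

/-- The exponents of the basis monomials of `𝒪(2;(2,1))`. -/
def box : Set (ℕ × ℕ) := {a | a.1 < p ^ 2 ∧ a.2 < p}

variable [Fact p.Prime] [CharP F p]

/-- The divided power algebra `𝒪(2;(2,1))`, the subalgebra of `𝒪(2)` spanned by all
`x₁^{(i)} x₂^{(j)}` with `0 ≤ i < p²`, `0 ≤ j < p`. -/
def O21 : Subalgebra F (O2 F) :=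
  Submodule.toSubalgebra (monSpan F (box p))
    (Submodule.subset_span ⟨0, ⟨by
      have := (Fact.out : p.Prime).pos
      exact ⟨pow_pos this 2, this⟩, rfl⟩⟩)
    (by
      have hp : p.Prime := Fact.out
      intro f g hf hg
      have h1 : ∀ a ∈ box p, ∀ b ∈ box p, (mon a * mon b : O2 F) ∈ monSpan F (box p) := by
        intro a ha b hb
        rw [mon_mul_mon]
        by_cases hab : a + b ∈ box p
        · exact Submodule.smul_mem _ _ (Submodule.subset_span ⟨_, hab, rfl⟩)
        · have : p ∣ binom2 a b := by
            by_cases h : a.1 + b.1 < p ^ 2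
            · have h' : p ^ 1 ≤ a.2 + b.2 := by
                by_contra hc
                rw [pow_one, not_le] at hc
                exact hab ⟨h, hc⟩
              exact Dvd.dvd.mul_left (dvd_choose_pow_add hp one_ne_zero
                (by simpa using ha.2) (by simpa using hb.2) h') _
            · exact Dvd.dvd.mul_right (dvd_choose_pow_add hp two_ne_zero ha.1 hb.1
                (not_lt.1 h)) _
          rw [(CharP.cast_eq_zero_iff F p _).2 this, zero_smul]
          exact Submodule.zero_mem _
      induction hf using Submodule.span_induction with
      | mem x hx =>
        obtain ⟨a, ha, rfl⟩ := hx
        induction hg using Submodule.span_induction with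
        | mem y hy => obtain ⟨b, hb, rfl⟩ := hy; exact h1 a ha b hb
        | zero => rw [mul_zero]; exact Submodule.zero_mem _
        | add y z _ _ hy hz => rw [mul_add]; exact Submodule.add_mem _ hy hz
        | smul c y _ hy => rw [mul_smul_comm]; exact Submodule.smul_mem _ c hy
      | zero => rw [zero_mul]; exact Submodule.zero_mem _
      | add y z _ _ hy hz => rw [add_mul]; exact Submodule.add_mem _ hy hz
      | smul c y _ hy => rw [smul_mul_assoc]; exact Submodule.smul_mem _ c hy)

variable {F} {p}

theorem mem_O21_iff {f : O2 F} : f ∈ O21 F p ↔ f ∈ monSpan F (box p) := Iff.rfl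

theorem mon_mem_O21 {i j : ℕ} (hi : i < p ^ 2) (hj : j < p) : (mon (i, j) : O2 F) ∈ O21 F p :=
  mem_O21_iff.2 (Submodule.subset_span ⟨_, ⟨hi, hj⟩, rfl⟩)

theorem D1_mem_O21 {f : O2 F} (hf : f ∈ O21 F p) : D1 f ∈ O21 F p := by
  rw [mem_O21_iff] at hf
  induction hf using Submodule.span_induction with
  | mem x hx =>
    obtain ⟨⟨i, j⟩, ⟨hi, hj⟩, rfl⟩ := hx
    rw [D1_mon]
    split_ifs
    · exact zero_mem _
    · exact mon_mem_O21 (lt_of_le_of_lt (Nat.sub_le _ _) hi) hj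
  | zero => rw [map_zero]; exact zero_mem _
  | add y z _ _ hy hz => rw [map_add]; exact add_mem hy hz
  | smul c y _ hy => rw [Derivation.map_smul]; exact (O21 F p).smul_mem hy c

theorem D2_mem_O21 {f : O2 F} (hf : f ∈ O21 F p) : D2 f ∈ O21 F p := by
  rw [mem_O21_iff] at hf
  induction hf using Submodule.span_induction with
  | mem x hx =>
    obtain ⟨⟨i, j⟩, ⟨hi, hj⟩, rfl⟩ := hx
    rw [D2_mon]
    split_ifs
    · exact zero_mem _
    · exact mon_mem_O21 hi (lt_of_le_of_lt (Nat.sub_le _ _) hj)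
  | zero => rw [map_zero]; exact zero_mem _
  | add y z _ _ hy hz => rw [map_add]; exact add_mem hy hz
  | smul c y _ hy => rw [Derivation.map_smul]; exact (O21 F p).smul_mem hy c

variable (F p)

/-- The Jacobson-Witt algebra `W(2;(2,1)) = 𝒪(2;(2,1)) D₁ + 𝒪(2;(2,1)) D₂`. -/
def W21 : LieSubalgebra F (Derivation F (O2 F) (O2 F)) where
  carrier := {E | ∃ f ∈ O21 F p, ∃ g ∈ O21 F p, E = f • D1 + g • D2}
  zero_mem' := ⟨0, zero_mem _, 0, zero_mem _, by simp⟩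
  add_mem' := by
    rintro _ _ ⟨f, hf, g, hg, rfl⟩ ⟨f', hf', g', hg', rfl⟩
    refine ⟨f + f', add_mem hf hf', g + g', add_mem hg hg', ?_⟩
    simp only [add_smul]; abel
  smul_mem' := by
    rintro c _ ⟨f, hf, g, hg, rfl⟩
    refine ⟨c • f, (O21 F p).smul_mem hf c, c • g, (O21 F p).smul_mem hg c, ?_⟩
    simp only [smul_add, smul_assoc]
  lie_mem' := by
    rintro _ _ ⟨f, hf, g, hg, rfl⟩ ⟨f', hf', g', hg', rfl⟩
    refine ⟨f * D1 f' + g * D2 f' - f' * D1 f - g' * D2 f,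
      sub_mem (sub_mem (add_mem (mul_mem hf (D1_mem_O21 hf')) (mul_mem hg (D2_mem_O21 hf')))
        (mul_mem hf' (D1_mem_O21 hf))) (mul_mem hg' (D2_mem_O21 hf)),
      f * D1 g' + g * D2 g' - f' * D1 g - g' * D2 g,
      sub_mem (sub_mem (add_mem (mul_mem hf (D1_mem_O21 hg')) (mul_mem hg (D2_mem_O21 hg')))
        (mul_mem hf' (D1_mem_O21 hg))) (mul_mem hg' (D2_mem_O21 hg)), ?_⟩
    ext h
    rw [Derivation.commutator_apply]
    simp only [Derivation.add_apply, Derivation.smul_apply, smul_eq_mul, map_add,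
      Derivation.leibniz, D1_D2_comm]
    ring

/-- `G = H(2;(2,1)) = H(2) ∩ W(2;(2,1))`. -/
def GAlg : LieSubalgebra F (Derivation F (O2 F) (O2 F)) := H2 F ⊓ W21 F p

/-- `S = H(2;(2,1))^{(2)}`, the second derived algebra of `G`, an ideal of `G`. -/
def SAlg : LieIdeal F (GAlg F p) := LieAlgebra.derivedSeries F (GAlg F p) 2

/-- The component `W_{(k)}`, `k ≥ 0`, of the standard filtration of `W(2;(2,1))`: all
`f D₁ + g D₂` with `f`, `g` in the span of the monomials of total degree `≥ k + 1`. -/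
def WFil (k : ℕ) : Submodule F (Derivation F (O2 F) (O2 F)) where
  carrier := {E | ∃ f ∈ monSpan F {a | a ∈ box p ∧ k + 1 ≤ a.1 + a.2},
    ∃ g ∈ monSpan F {a | a ∈ box p ∧ k + 1 ≤ a.1 + a.2}, E = f • D1 + g • D2}
  zero_mem' := ⟨0, zero_mem _, 0, zero_mem _, by simp⟩
  add_mem' := by
    rintro _ _ ⟨f, hf, g, hg, rfl⟩ ⟨f', hf', g', hg', rfl⟩
    refine ⟨f + f', add_mem hf hf', g + g', add_mem hg hg', ?_⟩
    simp only [add_smul]; abel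
  smul_mem' := by
    rintro c _ ⟨f, hf, g, hg, rfl⟩
    refine ⟨c • f, Submodule.smul_mem _ c hf, c • g, Submodule.smul_mem _ c hg, ?_⟩
    simp only [smul_add, smul_assoc]

/-- The component `S_{(k)} = S ∩ W_{(k)}`, `k ≥ 0`, of the standard filtration of `S`. -/
def SFil (k : ℕ) : Set (SAlg F p) :=
  {s | ((s : GAlg F p) : Derivation F (O2 F) (O2 F)) ∈ WFil F p k}

/-! ## The `p`-envelopes inside `Der S`

`Der S` is closed under commutators and `p`-th powers inside `Module.End F S`, its `p`-map is
the `p`-th power of endomorphisms, and so `p`-envelopes in `Der S` may be formed inside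
`Module.End F S`. -/

/-- The algebra of linear endomorphisms of `S`. -/
abbrev EndS : Type _ := Module.End F (SAlg F p)

/-- The embedding `G → Der S`, `E ↦ (s ↦ [E, s])`. -/
def rho : GAlg F p →ₗ⁅F⁆ EndS F p := LieModule.toEnd F (GAlg F p) (SAlg F p)

variable {F p} in
/-- The `p`-envelope of a set of endomorphisms of `S`: the smallest Lie subalgebra
that contains the set and is closed under `x ↦ x^p`. -/
def pEnvelope (M : Set (EndS F p)) : LieSubalgebra F (EndS F p) :=
  sInf {K | M ⊆ K ∧ ∀ x ∈ K, x ^ p ∈ K}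

/-- The image of `S` in `Der S`. -/
def SIm : Set (EndS F p) := {x | ∃ s : SAlg F p, x = rho F p s}

/-- `S_p`, the `p`-envelope of `S` in `Der S`. -/
def Sp : LieSubalgebra F (EndS F p) := pEnvelope (SIm F p)

/-- `𝒢`, the `p`-envelope of `G` in `Der S`. -/
def GG : LieSubalgebra F (EndS F p) := pEnvelope (Set.range (rho F p))

variable {F p}

/-- The action of `Aut S` on `Der S`, `g(D) = g ∘ D ∘ g⁻¹`. -/
def autAct (g : SAlg F p ≃ₗ⁅F⁆ SAlg F p) (x : EndS F p) : EndS F p :=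
  g.toLinearEquiv.conj x

/-- Toral elements: `x^{[p]} = x`. -/
def IsToral (x : EndS F p) : Prop := x ^ p = x

/-- `p`-semisimple elements: `x` lies in the `p`-envelope of `x^{[p]}`, which is the span of
the `x^{[p]^i}` with `i ≥ 1`. -/
def IsPSemisimple (x : EndS F p) : Prop :=
  x ∈ Submodule.span F {y | ∃ i : ℕ, 1 ≤ i ∧ y = x ^ p ^ i}

/-- Tori of `𝒢`: abelian subalgebras, closed under the `p`-map, which consist of
`p`-semisimple elements. -/
def IsTorus (T : LieSubalgebra F (EndS F p)) : Prop :=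
  T ≤ GG F p ∧ (∀ x ∈ T, x ^ p ∈ T) ∧ (∀ x ∈ T, ∀ y ∈ T, x * y = y * x) ∧
    ∀ x ∈ T, IsPSemisimple x

/-- Maximal tori of `𝒢`. -/
def IsMaximalTorus (T : LieSubalgebra F (EndS F p)) : Prop :=
  IsTorus T ∧ ∀ T' : LieSubalgebra F (EndS F p), IsTorus T' → T ≤ T' → T' = T

variable (F p)

/-- A space of functions `f ∈ 𝒪(2)` whose Hamiltonian derivation `D_H(f)` lies in `G`. -/
def Pot : Submodule F (O2 F) where
  carrier := {f | D1 f ∈ O21 F p ∧ D2 f ∈ O21 F p}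
  zero_mem' := by simp [zero_mem]
  add_mem' := by
    rintro f g ⟨h1, h2⟩ ⟨h3, h4⟩
    exact ⟨by rw [map_add]; exact add_mem h1 h3, by rw [map_add]; exact add_mem h2 h4⟩
  smul_mem' := by
    rintro c f ⟨h1, h2⟩
    exact ⟨by rw [Derivation.map_smul]; exact (O21 F p).smul_mem h1 c,
      by rw [Derivation.map_smul]; exact (O21 F p).smul_mem h2 c⟩

variable {F p}

theorem dH_mem_GAlg {f : O2 F} (hf : f ∈ Pot F p) :
    (dH f : Derivation F (O2 F) (O2 F)) ∈ GAlg F p := by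
  refine ⟨⟨f, rfl⟩, ⟨-(D2 (F := F) f), neg_mem hf.2, D1 (F := F) f, hf.1, ?_⟩⟩
  change D1 f • (D2 : Derivation F (O2 F) (O2 F)) - D2 f • (D1 : Derivation F (O2 F) (O2 F)) = _
  rw [neg_smul]; abel

/-- `D_H(f)` as an element of `G`. -/
def DG (f : O2 F) (hf : f ∈ Pot F p) : GAlg F p := ⟨dH f, dH_mem_GAlg hf⟩

theorem O21_le_Pot {f : O2 F} (hf : f ∈ O21 F p) : f ∈ Pot F p :=
  ⟨D1_mem_O21 hf, D2_mem_O21 hf⟩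

theorem prime_lt_sq : p < p ^ 2 := by
  have h := (Fact.out : p.Prime).two_le
  nlinarith

theorem pos_p : 0 < p := (Fact.out : p.Prime).pos

theorem x1_mem_Pot {m : ℕ} (hm : m ≤ p ^ 2) : (mon (m, 0) : O2 F) ∈ Pot F p := by
  refine ⟨?_, ?_⟩
  · rw [D1_mon]
    split_ifs with h
    · exact zero_mem _
    · exact mon_mem_O21 (by dsimp only at h ⊢; omega) pos_p
  · rw [D2_mon, if_pos rfl]; exact zero_mem _

theorem x2_mem_Pot {m : ℕ} (hm : m ≤ p) : (mon (0, m) : O2 F) ∈ Pot F p := by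
  refine ⟨?_, ?_⟩
  · rw [D1_mon, if_pos rfl]; exact zero_mem _
  · rw [D2_mon]
    split_ifs with h
    · exact zero_mem _
    · exact mon_mem_O21 (pow_pos pos_p 2) (by dsimp only at h ⊢; omega)

/-- The span `𝒪(2;(2,1))_{(k)}[x₁]` of all `x₁^{(i)}` with `k ≤ i < p²`. -/
def O21x1 (F : Type*) [Field F] (p k : ℕ) : Submodule F (O2 F) :=
  monSpan F {a | k ≤ a.1 ∧ a.1 < p ^ 2 ∧ a.2 = 0}

theorem O21x1_le {k : ℕ} {f : O2 F} (hf : f ∈ O21x1 F p k) : f ∈ O21 F p := by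
  refine mem_O21_iff.2 (Submodule.span_mono (Set.image_mono ?_) hf)
  rintro ⟨i, j⟩ ⟨_, hi, hj⟩
  exact ⟨hi, lt_of_eq_of_lt hj pos_p⟩

variable (p)

/-- `r̃ = x₁ + μ x₁^{(p)}`. -/
def rTilde (μ : F) : O2 F := mon (1, 0) + μ • mon (p, 0)

/-- `r = 1 + μ x₁^{(p-1)}`. -/
def rEl (μ : F) : O2 F := 1 + μ • mon (p - 1, 0)

/-- `r⁻¹ = 1 - μ x₁^{(p-1)}`. -/
def rInv (μ : F) : O2 F := 1 - μ • mon (p - 1, 0)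

theorem rEl_mul_rInv (hp2 : p ≠ 2) (μ : F) : rEl p μ * rInv p μ = 1 := by
  have hp : p.Prime := Fact.out
  have h3 : 3 ≤ p := by have := hp.two_le; omega
  have h : (mon (p - 1, 0) * mon (p - 1, 0) : O2 F) = 0 := by
    have hd : p ∣ binom2 (p - 1, 0) (p - 1, 0) :=
      Dvd.dvd.mul_right (hp.dvd_choose_add (a := p - 1) (b := p - 1) (by omega) (by omega)
        (by omega)) _
    rw [mon_mul_mon, (CharP.cast_eq_zero_iff F p _).2 hd, zero_smul]
  have : rEl p μ * rInv p μ =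
      (1 : O2 F) - (μ • mon (p - 1, 0)) * (μ • mon (p - 1, 0)) := by
    rw [rEl, rInv]; ring
  rw [this, smul_mul_smul_comm, h, smul_zero, sub_zero]

theorem rTilde_mem (μ : F) : rTilde p μ ∈ O21 F p :=
  add_mem (mon_mem_O21 (lt_of_le_of_lt pos_p prime_lt_sq) pos_p)
    ((O21 F p).smul_mem (mon_mem_O21 prime_lt_sq pos_p) μ)

theorem x1_pred_mem : (mon (p - 1, 0) : O2 F) ∈ O21 F p :=
  mon_mem_O21 (lt_of_le_of_lt (Nat.sub_le _ _) prime_lt_sq) pos_p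

theorem x2_mem {j : ℕ} (hj : j < p) : (mon (0, j) : O2 F) ∈ O21 F p :=
  mon_mem_O21 (pow_pos pos_p 2) hj

theorem x2_pred_mem : (mon (0, p - 1) : O2 F) ∈ O21 F p :=
  x2_mem p (Nat.sub_lt pos_p one_pos)

theorem rEl_mem (μ : F) : rEl p μ ∈ O21 F p :=
  add_mem (one_mem _) ((O21 F p).smul_mem (x1_pred_mem p) μ)

theorem rInv_mem (μ : F) : rInv p μ ∈ O21 F p :=
  sub_mem (one_mem _) ((O21 F p).smul_mem (x1_pred_mem p) μ)

/-- `t_μ = D_H(x₁ + μ x₁^{(p)} + (x₁ + μ x₁^{(p)}) r x₂^{(p-1)})`. -/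
def tEl (μ : F) : GAlg F p :=
  DG (rTilde p μ + rTilde p μ * rEl p μ * mon (0, p - 1))
    (O21_le_Pot (add_mem (rTilde_mem p μ)
      (mul_mem (mul_mem (rTilde_mem p μ) (rEl_mem p μ)) (x2_pred_mem p))))

/-- `h_μ = D_H(r⁻¹ x₂ - x₂^{(p)})`. -/
def hEl (μ : F) : GAlg F p :=
  DG (rInv p μ * mon (0, 1) - mon (0, p))
    (sub_mem (O21_le_Pot (mul_mem (rInv_mem p μ) (x2_mem p (Fact.out : p.Prime).one_lt))) (x2_mem_Pot le_rfl))

/-- `D_H(x₁^{(p²)})`. -/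
def vEl (F : Type*) [Field F] [CharP F p] : GAlg F p := DG (mon (p ^ 2, 0)) (x1_mem_Pot le_rfl)

/-- `D₁ = -D_H(x₂)` as an element of `G`. -/
def d1El (F : Type*) [Field F] [CharP F p] : GAlg F p :=
  ⟨D1, ⟨⟨-mon (0, 1), by
      refine Derivation.ext fun f => ?_
      rw [map_neg, Derivation.neg_apply, dH_apply, D1_mon, D2_mon]
      simp [show (mon (0, 0) : O2 F) = 1 from rfl]⟩,
    ⟨1, one_mem _, 0, zero_mem _, by simp⟩⟩⟩

/-- `n_μ = D₁^p + μ D_H(x₂^{(p)})`, an element of `𝒢`. -/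
def nEl (μ : F) : EndS F p :=
  rho F p (d1El p F) ^ p + μ • rho F p (DG (mon (0, p)) (x2_mem_Pot le_rfl))

theorem cEl_mem (μ : F) {u : O2 F} (hu : u ∈ Pot F p) :
    u + D1 u * rTilde p μ * mon (0, p - 1) ∈ Pot F p :=
  add_mem hu (O21_le_Pot (mul_mem (mul_mem hu.1 (rTilde_mem p μ)) (x2_pred_mem p)))

/-- `D_H(u + u' r̃ x₂^{(p-1)})`, where `u' = D₁(u)`. -/
def cEl (μ : F) (u : O2 F) (hu : u ∈ Pot F p) : GAlg F p :=
  DG (u + D1 u * rTilde p μ * mon (0, p - 1)) (cEl_mem p μ hu)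

/-- `φ_a(v) = ∑_{i=0}^{p-1} a^i D_H(r^{-i} v x₂^{(i)}) + a^{p-1} D_H(r̃ v' x₂^{(p-1)})` for
`a ∈ F`, `v ∈ 𝒪(2;(2,1))[x₁]`. -/
def phi (μ a : F) (v : O2 F) (hv : v ∈ O21x1 F p 0) : GAlg F p :=
  (∑ i : Fin p, a ^ (i : ℕ) • DG (rInv p μ ^ (i : ℕ) * v * mon (0, (i : ℕ)))
    (O21_le_Pot (mul_mem (mul_mem (pow_mem (rInv_mem p μ) _) (O21x1_le hv)) (x2_mem p i.2)))) +
  a ^ (p - 1) • DG (rTilde p μ * D1 v * mon (0, p - 1))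
    (O21_le_Pot (mul_mem (mul_mem (rTilde_mem p μ) (D1_mem_O21 (O21x1_le hv)))
      (x2_pred_mem p)))

/-- The centralizer `C_μ` of `t_μ` in `𝒢`. -/
def Cmu (μ : F) : LieSubalgebra F (EndS F p) :=
  GG F p ⊓
  { carrier := {x | rho F p (tEl p μ) * x - x * rho F p (tEl p μ) = 0}
    zero_mem' := by simp
    add_mem' := fun {x y} hx hy => by
      rw [Set.mem_ofPred_eq, sub_eq_zero] at hx hy ⊢
      rw [mul_add, add_mul, hx, hy]
    smul_mem' := fun c x hx => by
      rw [Set.mem_ofPred_eq, sub_eq_zero] at hx ⊢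
      rw [mul_smul_comm, smul_mul_assoc, hx]
    lie_mem' := fun {x y} hx hy => by
      change _ - _ = 0 at hx
      change _ - _ = 0 at hy
      change _ * (x * y - y * x) - (x * y - y * x) * _ = 0
      rw [sub_eq_zero] at hx hy ⊢
      rw [mul_sub, sub_mul, ← mul_assoc, ← mul_assoc, hx, hy, mul_assoc, mul_assoc, hx, hy,
        mul_assoc, mul_assoc] }

/-- `C_μ'`, the span of all `D_H(u + u' r̃ x₂^{(p-1)})` with `u ∈ 𝒪(2;(2,1))[x₁]` and of
`D_H(x₁^{(p²)})`. -/
def CmuPrime (μ : F) : Submodule F (EndS F p) :=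
  Submodule.span F
    ({x | ∃ (u : O2 F) (hu : u ∈ O21x1 F p 0),
        x = rho F p (cEl p μ u (O21_le_Pot (O21x1_le hu)))} ∪ {rho F p (vEl p F)})

/-- The `a`-eigenspace of `ad t_μ` in `𝒢`. -/
def eigenT (μ a : F) : Submodule F (EndS F p) :=
  (GG F p).toSubmodule ⊓
  { carrier := {x | rho F p (tEl p μ) * x - x * rho F p (tEl p μ) = a • x}
    zero_mem' := by simp
    add_mem' := fun {x y} hx hy => by
      rw [Set.mem_ofPred_eq] at hx hy ⊢
      rw [mul_add, add_mul, smul_add, ← hx, ← hy]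
      abel
    smul_mem' := fun c x hx => by
      rw [Set.mem_ofPred_eq] at hx ⊢
      rw [mul_smul_comm, smul_mul_assoc, ← smul_sub, hx, smul_comm] }

/-- The stabilizer `Z(t_μ)` of the element `t_μ` of `S` in `Aut S`. -/
def Zt (μ : F) : Set (SAlg F p ≃ₗ⁅F⁆ SAlg F p) :=
  {z | ∃ s : SAlg F p, (s : GAlg F p) = tEl p μ ∧ z s = s}

end Truncated

end

end Ham21

open Ham21

/-! Everything is transported from `S` to the finite-dimensional algebra B = 𝒪(2;(2,1)). As an
associative algebra B is a truncated polynomial ring in the three generators x₁, x₁^{(p)}, x₂, so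
homomorphisms and derivations are determined by three values. For the bracket {f,g} = D₁f·D₂g −
D₂f·D₁g every Poisson derivation is D_H(f) + b·D₁^p (`IsPD.exists_op`), and `S` is the space of f
without the highest monomial, modulo constants. A derivation of B is determined by the endomorphism
of `S` that it induces (`Rep.der_eq`), and a linear bijection of B preserving the bracket induces an
automorphism of `S` (`exists_aut`). Hence all claims become identities of Poisson derivations of B.

The main device is a frame adapted to t_μ. Put q = x₂^{(p-1)}. A function u of x₁ is sent to j(u) =
u + u'·r̃·q. This is multiplicative because q² = 0, its image is Poisson commutative, and the
truncated exponential y of r⁻¹x₂ satisfies y^p = 1 and {j(u), y} = j(∂u)·y with ∂ = r⁻¹D₁. Since ∂r̃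
= 1 and t_μ has potential j(r̃), the element t_μ multiplies j(u)·y^k by k. So t_μ is toral, and B is
the direct sum of the eigenspaces j(·)·y^k for k < p. In the frame h_μ acts on j(u) as −∂ and n_μ as
D₁^p, and both kill y. The element D_H(x₁^{(p²)}) kills j(u) and multiplies y by j(x₁^{(p²-1)}).
Thus the centralizer is governed by the two operators ∂ and D₁^p on functions of x₁, and ∂^p = D₁^p
− μ∂ (`dd_pow_p`) is the formula for h_μ^p. If μ = 0 then ∂ = D₁ is nilpotent, so C_0 is nilpotent.
A p-semisimple element of C_0 is then central, and the common centralizer argument leaves only the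
multiples of t_0.

The substitutions y ↦ j(b)·y with b(0) = 1 fix t_μ. They act on h as gauge transformations by ∂b/b,
and every ∂u is such a logarithmic derivative up to a constant and a multiple of x₁^{(p²-1)}
(`hasLog`). This gives the normal form of h. An eigenvector j(v)·y^k of h can be taken with v(0) =
1, so v = b^k and a substitution carries y^k to it. The p-th power of {y^k, ·} is k·h_μ^p, which is
p-semisimple for μ ≠ 0.

For conjugacy, let f be the potential of a toral element with D₁f(0) ≠ 0. The equation {f,a} = k·a
can be solved for D₂a, so setting x₂ = 0 is injective on every eigenspace. A dimension count makes
it bijective (`exists_eigen_lift`). The question becomes one about the derivation G·D₁ of functions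
of x₁ with G·D₁f = 1 at x₂ = 0. Either it is nilpotent, which gives μ = 0, or it has a nonzero
eigenvalue, which gives μ = 1 (`exists_normal_form`). Lifting the normal coordinates back gives a
frame, and two frames differ by an automorphism (`IsFrame.exists_equiv`). Toral elements outside `S`
involve D₁^p. They are treated in the same way with x₁^{(p)} = 0 in place of x₂ = 0, which yields
canonical coordinates (`exists_canonical`). -/

namespace Ham21

noncomputable section

set_option linter.unusedSectionVars false

variable {F : Type*} [Field F] {p : ℕ} [Fact p.Prime] [CharP F p]

/-! ## The algebra `𝒪(2;(2,1))` as a truncated polynomial ring -/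

/-- The divided power algebra `𝒪(2;(2,1))` as a type. -/
abbrev BAlg (F : Type*) [Field F] (p : ℕ) [Fact p.Prime] [CharP F p] : Type _ := ↥(O21 F p)

theorem coeff_mon (a b : ℕ × ℕ) : coeff a (mon b : O2 F) = if b = a then 1 else 0 := by
  exact Finsupp.single_apply

theorem O2_ext {f g : O2 F} (h : ∀ a, coeff a f = coeff a g) : f = g := Finsupp.ext h

theorem coeff_eq_zero_of_mem_monSpan {s : Set (ℕ × ℕ)} {f : O2 F} (hf : f ∈ monSpan F s)
    {a : ℕ × ℕ} (ha : a ∉ s) : coeff a f = 0 := by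
  induction hf using Submodule.span_induction with
  | mem x hx =>
    obtain ⟨b, hb, rfl⟩ := hx
    rw [coeff_mon, if_neg]
    rintro rfl
    exact ha hb
  | zero => simp
  | add y z _ _ hy hz => rw [map_add, hy, hz, add_zero]
  | smul c y _ hy => rw [map_smul, hy, smul_zero]

theorem eq_sum_coeff (f : O2 F) :
    f = Finsupp.sum (show ℕ × ℕ →₀ F from f) fun a c => c • (mon a : O2 F) := by
  have h := (Finsupp.sum_single (show ℕ × ℕ →₀ F from f)).symm
  refine h.trans ?_
  refine Finsupp.sum_congr fun a _ => ?_
  have : (Finsupp.single a (1 : F) : ℕ × ℕ →₀ F) = (mon a : O2 F) := rfl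
  exact (Finsupp.smul_single_one a _).symm

theorem mem_monSpan_iff {s : Set (ℕ × ℕ)} {f : O2 F} :
    f ∈ monSpan F s ↔ ∀ a ∉ s, coeff a f = 0 := by
  refine ⟨fun hf a ha => coeff_eq_zero_of_mem_monSpan hf ha, fun h => ?_⟩
  rw [eq_sum_coeff f]
  refine Submodule.sum_mem _ fun a ha => ?_
  by_cases has : a ∈ s
  · exact Submodule.smul_mem _ _ (Submodule.subset_span ⟨a, has, rfl⟩)
  · exact absurd (h a has) (Finsupp.mem_support_iff.1 ha)

theorem coeff_D1 (i j : ℕ) (f : O2 F) : coeff (i, j) (D1 f) = coeff (i + 1, j) f := by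
  have key : (coeff (F := F) (i, j)).comp low1 = coeff (i + 1, j) := by
    apply hom_ext
    rintro ⟨k, l⟩
    rw [LinearMap.comp_apply, low1_mon, coeff_mon]
    rcases k with _ | k
    · simp
    · simp [coeff_mon]
  exact congrArg (fun T => T f) key

theorem coeff_D2 (i j : ℕ) (f : O2 F) : coeff (i, j) (D2 f) = coeff (i, j + 1) f := by
  have key : (coeff (F := F) (i, j)).comp low2 = coeff (i, j + 1) := by
    apply hom_ext
    rintro ⟨k, l⟩
    rw [LinearMap.comp_apply, low2_mon, coeff_mon]
    rcases l with _ | l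
    · simp
    · simp [coeff_mon]
  exact congrArg (fun T => T f) key

/-- The derivation `D₁` of `𝒪(2;(2,1))`. -/
def d1 : Derivation F (BAlg F p) (BAlg F p) :=
  Derivation.mk'
    { toFun := fun f => ⟨D1 (f : O2 F), D1_mem_O21 f.2⟩
      map_add' := fun f g => Subtype.ext (map_add D1 (f : O2 F) g)
      map_smul' := fun c f => Subtype.ext (Derivation.map_smul D1 c (f : O2 F)) }
    (fun f g => Subtype.ext (Derivation.leibniz D1 (f : O2 F) g))

/-- The derivation `D₂` of `𝒪(2;(2,1))`. -/
def d2 : Derivation F (BAlg F p) (BAlg F p) :=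
  Derivation.mk'
    { toFun := fun f => ⟨D2 (f : O2 F), D2_mem_O21 f.2⟩
      map_add' := fun f g => Subtype.ext (map_add D2 (f : O2 F) g)
      map_smul' := fun c f => Subtype.ext (Derivation.map_smul D2 c (f : O2 F)) }
    (fun f g => Subtype.ext (Derivation.leibniz D2 (f : O2 F) g))

@[simp] theorem coe_d1 (f : BAlg F p) : ((d1 f : BAlg F p) : O2 F) = D1 (f : O2 F) := rfl

@[simp] theorem coe_d2 (f : BAlg F p) : ((d2 f : BAlg F p) : O2 F) = D2 (f : O2 F) := rfl

theorem d1_d2_comm (f : BAlg F p) : d1 (d2 f) = d2 (d1 f) := Subtype.ext (D1_D2_comm _)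

/-- The coefficient of `x₁^{(i)} x₂^{(j)}`. -/
def cf (i j : ℕ) : BAlg F p →ₗ[F] F := (coeff (i, j)).comp (O21 F p).val.toLinearMap

theorem cf_def (i j : ℕ) (f : BAlg F p) : cf i j f = coeff (i, j) (f : O2 F) := rfl

theorem cf_d1 (i j : ℕ) (f : BAlg F p) : cf i j (d1 f) = cf (i + 1) j f := coeff_D1 i j _

theorem cf_d2 (i j : ℕ) (f : BAlg F p) : cf i j (d2 f) = cf i (j + 1) f := coeff_D2 i j _

theorem cf_eq_zero (f : BAlg F p) {i j : ℕ} (h : ¬ (i < p ^ 2 ∧ j < p)) : cf i j f = 0 :=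
  coeff_eq_zero_of_mem_monSpan (mem_O21_iff.1 f.2) h

theorem BAlg_ext {f g : BAlg F p} (h : ∀ i j, cf i j f = cf i j g) : f = g :=
  Subtype.ext (O2_ext fun a => h a.1 a.2)

/-- The monomial `x₁^{(i)} x₂^{(j)}` of `𝒪(2;(2,1))`, zero outside of the box. -/
def mb (i j : ℕ) : BAlg F p := if h : i < p ^ 2 ∧ j < p then ⟨mon (i, j), mon_mem_O21 h.1 h.2⟩ else 0

theorem coe_mb {i j : ℕ} (hi : i < p ^ 2) (hj : j < p) :
    ((mb i j : BAlg F p) : O2 F) = mon (i, j) := by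
  rw [mb, dif_pos ⟨hi, hj⟩]

theorem mb_eq {i j : ℕ} (hi : i < p ^ 2) (hj : j < p) :
    (mb i j : BAlg F p) = ⟨mon (i, j), mon_mem_O21 hi hj⟩ := by
  rw [mb, dif_pos ⟨hi, hj⟩]

theorem mb_eq_zero {i j : ℕ} (h : ¬ (i < p ^ 2 ∧ j < p)) : (mb i j : BAlg F p) = 0 := by
  rw [mb, dif_neg h]

theorem cf_mb {i j : ℕ} (hi : i < p ^ 2) (hj : j < p) (k l : ℕ) :
    cf k l (mb i j : BAlg F p) = if i = k ∧ j = l then 1 else 0 := by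
  rw [cf_def, coe_mb hi hj, coeff_mon]
  simp only [Prod.mk.injEq]

theorem d1_mb_succ {i j : ℕ} (hi : i + 1 < p ^ 2) (hj : j < p) :
    d1 (mb (i + 1) j : BAlg F p) = mb i j := by
  apply Subtype.ext
  rw [coe_d1, coe_mb hi hj, coe_mb (by omega) hj, D1_mon]
  simp

theorem d2_mb_succ {i j : ℕ} (hi : i < p ^ 2) (hj : j + 1 < p) :
    d2 (mb i (j + 1) : BAlg F p) = mb i j := by
  apply Subtype.ext
  rw [coe_d2, coe_mb hi hj, coe_mb hi (by omega), D2_mon]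
  simp

theorem d1_mb_zero (j : ℕ) : d1 (mb 0 j : BAlg F p) = 0 := by
  apply BAlg_ext; intro k l
  rw [cf_d1]
  by_cases h : j < p
  · rw [cf_mb (pow_pos pos_p 2) h]; simp
  · rw [mb_eq_zero (by tauto)]; simp

theorem d2_mb_zero (i : ℕ) : d2 (mb i 0 : BAlg F p) = 0 := by
  apply BAlg_ext; intro k l
  rw [cf_d2]
  by_cases h : i < p ^ 2
  · rw [cf_mb h pos_p]; simp
  · rw [mb_eq_zero (by tauto)]; simp

theorem mb_zero_zero : (mb 0 0 : BAlg F p) = 1 := by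
  apply Subtype.ext
  rw [coe_mb (pow_pos pos_p 2) pos_p]; rfl

theorem span_mb : Submodule.span F
    (Set.range fun a : Fin (p ^ 2) × Fin p => (mb (a.1 : ℕ) (a.2 : ℕ) : BAlg F p)) = ⊤ := by
  rw [eq_top_iff]
  rintro ⟨f, hf⟩ -
  have key : ∀ g (hg : g ∈ monSpan F (box p)), (⟨g, hg⟩ : BAlg F p) ∈ Submodule.span F
    (Set.range fun a : Fin (p ^ 2) × Fin p => (mb (a.1 : ℕ) (a.2 : ℕ) : BAlg F p)) := by
    intro g hg
    induction hg using Submodule.span_induction with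
    | mem x hx =>
      obtain ⟨⟨i, j⟩, ⟨hi, hj⟩, rfl⟩ := hx
      exact Submodule.subset_span ⟨(⟨i, hi⟩, ⟨j, hj⟩), mb_eq hi hj⟩
    | zero => exact Submodule.zero_mem _
    | add y z _ _ hy hz => exact Submodule.add_mem _ hy hz
    | smul c y _ hy => exact Submodule.smul_mem _ c hy
  exact key f hf

theorem BAlg_hom_ext {M : Type*} [AddCommGroup M] [Module F M] {f g : BAlg F p →ₗ[F] M}
    (h : ∀ i j, i < p ^ 2 → j < p → f (mb i j) = g (mb i j)) : f = g := by
  refine LinearMap.ext_on span_mb ?_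
  rintro _ ⟨a, rfl⟩
  exact h _ _ a.1.2 a.2.2

theorem linearIndependent_mb : LinearIndependent F
    (fun a : Fin (p ^ 2) × Fin p => (mb (a.1 : ℕ) (a.2 : ℕ) : BAlg F p)) := by
  rw [Fintype.linearIndependent_iff]
  intro g hg a
  have h := congrArg (cf (a.1 : ℕ) (a.2 : ℕ)) hg
  rw [map_sum, map_zero, Finset.sum_eq_single a] at h
  · simpa [cf_mb a.1.2 a.2.2] using h
  · rintro b - hb
    rw [map_smul, cf_mb b.1.2 b.2.2, if_neg, smul_zero]
    rintro ⟨h1, h2⟩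
    exact hb (Prod.ext (Fin.ext h1) (Fin.ext h2))
  · simp

/-- The monomial basis of `𝒪(2;(2,1))`. -/
def mbBasis : Module.Basis (Fin (p ^ 2) × Fin p) F (BAlg F p) :=
  Module.Basis.mk linearIndependent_mb span_mb.ge

instance : FiniteDimensional F (BAlg F p) := mbBasis.finiteDimensional_of_finite

theorem finrank_BAlg : Module.finrank F (BAlg F p) = p ^ 2 * p := by
  rw [Module.finrank_eq_card_basis (mbBasis (F := F) (p := p))]
  simp

instance : Nontrivial (BAlg F p) := by
  refine ⟨1, 0, fun h => ?_⟩
  have := congrArg (cf 0 0) h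
  rw [← mb_zero_zero, cf_mb (pow_pos pos_p 2) pos_p, map_zero] at this
  simp at this

instance : CharP (BAlg F p) p := charP_of_injective_algebraMap (algebraMap F (BAlg F p)).injective p

/-! ### Divided powers and the universal property -/

section UP

variable {R : Type*} [CommRing R] [Algebra F R]

/-- The truncated divided power `a^n / n!`. -/
def dpw (F : Type*) [Field F] {R : Type*} [CommRing R] [Algebra F R] (a : R) (n : ℕ) : R :=
  ((n.factorial : F))⁻¹ • a ^ n

@[simp] theorem dpw_zero (a : R) : dpw F a 0 = 1 := by simp [dpw]

@[simp] theorem dpw_one (a : R) : dpw F a 1 = a := by simp [dpw]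

variable (p) in
theorem factorial_ne_zero {n : ℕ} (hn : n < p) : (n.factorial : F) ≠ 0 := by
  rw [Ne, CharP.cast_eq_zero_iff F p, (Fact.out : p.Prime).dvd_factorial]
  omega

variable (p) in
theorem cast_ne_zero' {n : ℕ} (h0 : n ≠ 0) (hn : n < p) : (n : F) ≠ 0 := by
  rw [Ne, CharP.cast_eq_zero_iff F p]
  exact fun h => absurd (Nat.le_of_dvd (Nat.pos_of_ne_zero h0) h) (by omega)

theorem dpw_eq_zero {a : R} (ha : a ^ p = 0) {n : ℕ} (hn : p ≤ n) : dpw F a n = 0 := by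
  rw [dpw, pow_eq_zero_of_le hn ha, smul_zero]

/-- Below degree p the factorials are invertible and this is the usual divided power rule. From
degree p on both sides vanish because a^p = 0. -/
theorem dpw_mul {a : R} (ha : a ^ p = 0) (m n : ℕ) :
    dpw F a m * dpw F a n = (((m + n).choose m : ℕ) : F) • dpw F a (m + n) := by
  by_cases h : m + n < p
  · have h1 := factorial_ne_zero (F := F) p h
    have h2 := factorial_ne_zero (F := F) p (show m < p by omega)
    have h3 := factorial_ne_zero (F := F) p (show n < p by omega)
    rw [dpw, dpw, dpw, smul_mul_smul_comm, ← pow_add, smul_smul]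
    congr 1
    have h4 := Nat.add_choose_mul_factorial_mul_factorial m n
    have h5 : (((m + n).choose m : ℕ) : F) * (m.factorial : F) * (n.factorial : F) =
        ((m + n).factorial : F) := by rw [Nat.choose_symm_add]; exact_mod_cast congrArg (Nat.cast (R := F)) h4
    field_simp
    rw [← h5]; ring
  · rw [dpw_eq_zero ha (not_lt.1 h), smul_zero, dpw, dpw, smul_mul_smul_comm, ← pow_add,
      pow_eq_zero_of_le (not_lt.1 h) ha, smul_zero]

variable (p) in
/-- The image of `x₁^{(i)} x₂^{(j)}` under the homomorphism with `x₁ ↦ a`, `x₁^{(p)} ↦ b`,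
`x₂ ↦ c`. -/
def tauMon (F : Type*) [Field F] {R : Type*} [CommRing R] [Algebra F R] (a b c : R)
    (k : ℕ × ℕ) : R := dpw F a (k.1 % p) * dpw F b (k.1 / p) * dpw F c k.2

theorem cast_choose_lucas (m n : ℕ) : ((m.choose n : ℕ) : F) =
    ((m % p).choose (n % p) : ℕ) * ((m / p).choose (n / p) : ℕ) := by
  have h := Choose.choose_modEq_choose_mod_mul_choose_div_nat (n := m) (k := n) (p := p)
  rw [← Nat.cast_mul]
  exact (CharP.natCast_eq_natCast F p).2 h

/-- Lucas' theorem splits the binomial coefficient along the base p digits i % p and i / p. If the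
low digits carry, the binomial coefficient is zero in `F`, and so is the product of the divided
powers of `a`. -/
theorem tauMon_mul {a b c : R} (ha : a ^ p = 0) (hb : b ^ p = 0) (hc : c ^ p = 0)
    (k l : ℕ × ℕ) : tauMon p F a b c k * tauMon p F a b c l =
      (binom2 k l : F) • tauMon p F a b c (k + l) := by
  obtain ⟨i, j⟩ := k
  obtain ⟨i', j'⟩ := l
  have e1 : tauMon p F a b c (i, j) * tauMon p F a b c (i', j') =
      (dpw F a (i % p) * dpw F a (i' % p)) * (dpw F b (i / p) * dpw F b (i' / p)) *
        (dpw F c j * dpw F c j') := by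
    simp only [tauMon]; ring
  rw [e1, dpw_mul hc, dpw_mul hb, dpw_mul ha]
  simp only [tauMon, binom2, Prod.mk_add_mk, Nat.cast_mul]
  rw [cast_choose_lucas (F := F) (p := p) (i + i') i]
  have hpos : 0 < p := pos_p
  have hm1 := Nat.mod_lt i hpos
  have hm2 := Nat.mod_lt i' hpos
  by_cases h : i % p + i' % p < p
  · have h1 : (i + i') % p = i % p + i' % p := by
      rw [Nat.add_mod, Nat.mod_eq_of_lt h]
    have h2 : (i + i') / p = i / p + i' / p := Nat.add_div_eq_of_add_mod_lt h
    rw [h1, h2]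
    simp only [smul_mul_smul_comm]
  · have h1 : (i + i') % p = i % p + i' % p - p := by
      rw [Nat.add_mod, Nat.mod_eq_sub_mod (not_lt.1 h), Nat.mod_eq_of_lt (by omega)]
    rw [h1, Nat.choose_eq_zero_of_lt (by omega : i % p + i' % p - p < i % p),
      dpw_eq_zero ha (not_lt.1 h)]
    simp

/-- The homomorphism `𝒪(2) → R` with `x₁ ↦ a`, `x₁^{(p)} ↦ b`, `x₂ ↦ c`. -/
def tau2 (a b c : R) (ha : a ^ p = 0) (hb : b ^ p = 0) (hc : c ^ p = 0) : O2 F →ₐ[F] R :=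
  AlgHom.ofLinearMap (ofMon (tauMon p F a b c))
    (by
      rw [one_def, ofMon_mon, tauMon]; simp)
    (by
      have key : (mulL (F := F)).compr₂ (ofMon (tauMon p F a b c)) =
          ((LinearMap.mul F R).compl₂ (ofMon (tauMon p F a b c))).comp
            (ofMon (tauMon p F a b c)) := by
        apply hom_ext; intro k
        apply hom_ext; intro l
        simp only [LinearMap.compr₂_apply, mulL_mon, map_smul, ofMon_mon, LinearMap.comp_apply,
          LinearMap.compl₂_apply, LinearMap.mul_apply']
        rw [tauMon_mul ha hb hc]
      intro f g
      exact congrArg (fun S => S f g) key)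

/-- The homomorphism `𝒪(2;(2,1)) → R` with `x₁ ↦ a`, `x₁^{(p)} ↦ b`, `x₂ ↦ c`. -/
def tau (a b c : R) (ha : a ^ p = 0) (hb : b ^ p = 0) (hc : c ^ p = 0) : BAlg F p →ₐ[F] R :=
  (tau2 a b c ha hb hc).comp (O21 F p).val

theorem tau_mb {a b c : R} (ha : a ^ p = 0) (hb : b ^ p = 0) (hc : c ^ p = 0) {i j : ℕ}
    (hi : i < p ^ 2) (hj : j < p) : tau a b c ha hb hc (mb i j : BAlg F p) =
      dpw F a (i % p) * dpw F b (i / p) * dpw F c j := by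
  change ofMon (tauMon p F a b c) ((mb i j : BAlg F p) : O2 F) = _
  rw [coe_mb hi hj, ofMon_mon]; rfl

end UP

/-- The generator `x₁`. -/
def gX : BAlg F p := mb 1 0

/-- The generator `x₁^{(p)}`. -/
def gY : BAlg F p := mb p 0

/-- The generator `x₂`. -/
def gZ : BAlg F p := mb 0 1

variable (p) in
theorem one_lt_p : 1 < p := (Fact.out : p.Prime).one_lt

variable (p) in
theorem one_lt_sq : 1 < p ^ 2 := lt_trans (one_lt_p p) prime_lt_sq

theorem mb_mul_mb {i j k l : ℕ} (h1 : i + k < p ^ 2) (h2 : j + l < p) :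
    (mb i j * mb k l : BAlg F p) = (((i + k).choose i * (j + l).choose j : ℕ) : F) • mb (i + k) (j + l) := by
  apply Subtype.ext
  rw [MulMemClass.coe_mul, coe_mb (by omega) (by omega), coe_mb (by omega) (by omega), mon_mul_mon]
  rw [show ((((((i + k).choose i * (j + l).choose j : ℕ) : F) • mb (i + k) (j + l) : BAlg F p)) : O2 F) =
    (((i + k).choose i * (j + l).choose j : ℕ) : F) • ((mb (i + k) (j + l) : BAlg F p) : O2 F) from rfl,
    coe_mb h1 h2]
  rfl

theorem gX_pow {n : ℕ} (hn : n < p) : (gX : BAlg F p) ^ n = (n.factorial : F) • mb n 0 := by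
  have hp := prime_lt_sq (p := p)
  induction n with
  | zero => simp [mb_zero_zero]
  | succ n ih =>
    rw [pow_succ, ih (by omega), gX, smul_mul_assoc, mb_mul_mb (by omega) (by omega), smul_smul]
    congr 1
    rw [Nat.factorial_succ, Nat.choose_succ_self_right]
    push_cast; simp; ring

theorem gZ_pow {n : ℕ} (hn : n < p) : (gZ : BAlg F p) ^ n = (n.factorial : F) • mb 0 n := by
  have hp := prime_lt_sq (p := p)
  induction n with
  | zero => simp [mb_zero_zero]
  | succ n ih =>
    rw [pow_succ, ih (by omega), gZ, smul_mul_assoc, mb_mul_mb (by omega) (by omega), smul_smul]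
    congr 1
    rw [Nat.factorial_succ, Nat.choose_succ_self_right]
    push_cast; simp; ring

theorem gY_pow {n : ℕ} (hn : n < p) : (gY : BAlg F p) ^ n = (n.factorial : F) • mb (p * n) 0 := by
  have hp := prime_lt_sq (p := p)
  have hpos : 0 < p := pos_p
  induction n with
  | zero => simp [mb_zero_zero]
  | succ n ih =>
    have hlt : p * n + p < p ^ 2 := by rw [← Nat.mul_succ, sq]; exact Nat.mul_lt_mul_of_pos_left hn hpos
    rw [pow_succ, ih (by omega), gY, smul_mul_assoc, mb_mul_mb hlt (by omega), smul_smul,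
      ← Nat.mul_succ]
    congr 1
    rw [Nat.factorial_succ, Nat.cast_mul (Nat.choose _ _), cast_choose_lucas (F := F) (p := p) (p * n.succ)]
    rw [Nat.mul_mod_right, Nat.mul_mod_right, Nat.mul_div_cancel_left _ hpos,
      Nat.mul_div_cancel_left _ hpos, Nat.choose_succ_self_right]
    push_cast; simp; ring

theorem dpw_gX {n : ℕ} (hn : n < p) : dpw F (gX : BAlg F p) n = mb n 0 := by
  rw [dpw, gX_pow hn, smul_smul, inv_mul_cancel₀ (factorial_ne_zero p hn), one_smul]

theorem dpw_gY {n : ℕ} (hn : n < p) : dpw F (gY : BAlg F p) n = mb (p * n) 0 := by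
  rw [dpw, gY_pow hn, smul_smul, inv_mul_cancel₀ (factorial_ne_zero p hn), one_smul]

theorem dpw_gZ {n : ℕ} (hn : n < p) : dpw F (gZ : BAlg F p) n = mb 0 n := by
  rw [dpw, gZ_pow hn, smul_smul, inv_mul_cancel₀ (factorial_ne_zero p hn), one_smul]

theorem mb_eq_dpw {i j : ℕ} (hi : i < p ^ 2) (hj : j < p) :
    (mb i j : BAlg F p) = dpw F gX (i % p) * dpw F gY (i / p) * dpw F gZ j := by
  have hpos : 0 < p := pos_p
  have h1 := Nat.mod_lt i hpos
  have h2 : i / p < p := Nat.div_lt_of_lt_mul (by rwa [← sq])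
  have h3 := Nat.mod_add_div i p
  rw [dpw_gX h1, dpw_gY h2, dpw_gZ hj, mb_mul_mb (by omega) (by omega), smul_mul_assoc,
    mb_mul_mb (by omega) (by omega), smul_smul, h3, Nat.cast_mul (Nat.choose _ _),
    cast_choose_lucas (F := F) (p := p) i (i % p)]
  simp [Nat.div_eq_of_lt h1]

theorem tau_gX {R : Type*} [CommRing R] [Algebra F R] {a b c : R} (ha : a ^ p = 0)
    (hb : b ^ p = 0) (hc : c ^ p = 0) : tau a b c ha hb hc (gX : BAlg F p) = a := by
  rw [gX, tau_mb ha hb hc (one_lt_sq p) pos_p, Nat.mod_eq_of_lt (one_lt_p p),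
    Nat.div_eq_of_lt (one_lt_p p)]
  simp

theorem tau_gY {R : Type*} [CommRing R] [Algebra F R] {a b c : R} (ha : a ^ p = 0)
    (hb : b ^ p = 0) (hc : c ^ p = 0) : tau a b c ha hb hc (gY : BAlg F p) = b := by
  rw [gY, tau_mb ha hb hc prime_lt_sq pos_p, Nat.mod_self, Nat.div_self pos_p]
  simp

theorem tau_gZ {R : Type*} [CommRing R] [Algebra F R] {a b c : R} (ha : a ^ p = 0)
    (hb : b ^ p = 0) (hc : c ^ p = 0) : tau a b c ha hb hc (gZ : BAlg F p) = c := by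
  rw [gZ, tau_mb ha hb hc (pow_pos pos_p 2) (one_lt_p p)]
  simp

theorem adjoin_gen : Algebra.adjoin F ({gX, gY, gZ} : Set (BAlg F p)) = ⊤ := by
  rw [← top_le_iff]
  have h : (⊤ : Submodule F (BAlg F p)) ≤
      Subalgebra.toSubmodule (Algebra.adjoin F ({gX, gY, gZ} : Set (BAlg F p))) := by
    rw [← span_mb, Submodule.span_le]
    rintro _ ⟨a, rfl⟩
    change mb _ _ ∈ Algebra.adjoin F ({gX, gY, gZ} : Set (BAlg F p))
    rw [mb_eq_dpw a.1.2 a.2.2]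
    have hs := Algebra.subset_adjoin (R := F) (s := ({gX, gY, gZ} : Set (BAlg F p)))
    refine mul_mem (mul_mem ?_ ?_) ?_ <;>
    · refine Subalgebra.smul_mem _ (pow_mem (hs ?_) _) _
      simp
  intro x _
  exact h (Submodule.mem_top)

/-- Induction on the generators of `𝒪(2;(2,1))`. -/
theorem gen_induction {P : BAlg F p → Prop} (hX : P gX) (hY : P gY) (hZ : P gZ)
    (hc : ∀ c : F, P (algebraMap F _ c)) (hadd : ∀ f g, P f → P g → P (f + g))
    (hmul : ∀ f g, P f → P g → P (f * g)) (f : BAlg F p) : P f := by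
  have hf : f ∈ Algebra.adjoin F ({gX, gY, gZ} : Set (BAlg F p)) := by
    rw [adjoin_gen]; exact Algebra.mem_top
  induction hf using Algebra.adjoin_induction with
  | mem x hx => rcases hx with rfl | rfl | rfl <;> assumption
  | algebraMap c => exact hc c
  | add x y _ _ hx hy => exact hadd x y hx hy
  | mul x y _ _ hx hy => exact hmul x y hx hy

/-- The constant term. -/
def eps : BAlg F p →ₐ[F] F :=
  tau (0 : F) 0 0 (zero_pow (Fact.out : p.Prime).ne_zero) (zero_pow (Fact.out : p.Prime).ne_zero)
    (zero_pow (Fact.out : p.Prime).ne_zero)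

theorem dpw_zero_left {R : Type*} [CommRing R] [Algebra F R] (n : ℕ) :
    dpw F (0 : R) n = if n = 0 then 1 else 0 := by
  split_ifs with h
  · subst h; simp
  · simp [dpw, h]

@[simp] theorem eps_gX : eps (gX : BAlg F p) = 0 := tau_gX _ _ _
@[simp] theorem eps_gY : eps (gY : BAlg F p) = 0 := tau_gY _ _ _
@[simp] theorem eps_gZ : eps (gZ : BAlg F p) = 0 := tau_gZ _ _ _

theorem eps_eq_cf (f : BAlg F p) : eps f = cf 0 0 f := by
  have key : (eps (F := F) (p := p)).toLinearMap = cf 0 0 := by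
    apply BAlg_hom_ext
    intro i j hi hj
    rw [cf_mb hi hj]
    have hz : (0 : F) ^ p = 0 := zero_pow (Fact.out : p.Prime).ne_zero
    refine (tau_mb hz hz hz hi hj).trans ?_
    simp only [dpw_zero_left]
    have hh : i % p = 0 ∧ i / p = 0 ↔ i = 0 := by
      constructor
      · rintro ⟨h1, h2⟩
        have := Nat.mod_add_div i p
        rw [h1, h2] at this; omega
      · rintro rfl; simp
    by_cases h0 : i = 0
    · subst h0; by_cases hj0 : j = 0 <;> simp [hj0]
    · rw [if_neg (by tauto : ¬ (i = 0 ∧ j = 0))]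
      by_cases h1 : i % p = 0
      · rw [if_neg (fun h2 => h0 (hh.1 ⟨h1, h2⟩) : ¬ i / p = 0)]; simp
      · rw [if_neg h1]; simp
  exact congrArg (fun T => T f) key

/-! ### The Frobenius map and the units of 𝒪(2;(2,1)) -/

theorem gX_pow_p : (gX : BAlg F p) ^ p = 0 := by
  have h1 : 1 < p := one_lt_p p
  have hp := prime_lt_sq (p := p)
  obtain ⟨n, hn⟩ : ∃ n, p = n + 1 := ⟨p - 1, by omega⟩
  have h2 : (gX : BAlg F p) ^ p = gX ^ n * gX := by rw [← pow_succ, ← hn]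
  rw [h2, gX_pow (by omega), gX, smul_mul_assoc, mb_mul_mb (by omega) (by omega), ← hn]
  have : (((p.choose n * (0 + 0).choose 0 : ℕ)) : F) = 0 := by
    rw [CharP.cast_eq_zero_iff F p]
    exact Dvd.dvd.mul_right ((Fact.out : p.Prime).dvd_choose_self (by omega) (by omega)) _
  rw [this, zero_smul, smul_zero]

/-- The p-th power of a monomial is a multiple of the monomial with exponents multiplied by p, which
lies outside the box, whereas the power itself is supported in the box. -/
theorem coe_pow_p_eq_zero {i j : ℕ} (h : ¬ (p * i < p ^ 2 ∧ p * j < p)) (hi : i < p ^ 2) (hj : j < p) :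
    (mb i j : BAlg F p) ^ p = 0 := by
  have key : ∀ n : ℕ, ∃ c : F, (mon (i, j) : O2 F) ^ n = c • mon (n * i, n * j) := by
    intro n
    induction n with
    | zero => exact ⟨1, by simp [one_def]; rfl⟩
    | succ n ih =>
      obtain ⟨c, hc⟩ := ih
      refine ⟨c * (binom2 (n * i, n * j) (i, j) : F), ?_⟩
      rw [pow_succ, hc, smul_mul_assoc, mon_mul_mon, smul_smul]
      simp [add_mul]
  obtain ⟨c, hc⟩ := key p
  apply BAlg_ext
  intro k l
  rw [map_zero]
  by_cases hkl : k < p ^ 2 ∧ l < p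
  · rw [cf_def, SubmonoidClass.coe_pow, coe_mb hi hj, hc, map_smul, coeff_mon, if_neg, smul_zero]
    intro he
    rw [Prod.mk.injEq] at he
    exact h (by rw [he.1, he.2]; exact hkl)
  · exact cf_eq_zero _ hkl

theorem gY_pow_p : (gY : BAlg F p) ^ p = 0 :=
  coe_pow_p_eq_zero (by rw [sq]; omega) prime_lt_sq pos_p

theorem gZ_pow_p : (gZ : BAlg F p) ^ p = 0 :=
  coe_pow_p_eq_zero (by omega) (pow_pos pos_p 2) (one_lt_p p)

/-- Frobenius is additive and multiplicative and kills the three generators. Consequently the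
algebra is local with residue map `eps`, and invertibility can be tested at the origin. -/
theorem pow_p_eq (f : BAlg F p) : f ^ p = algebraMap F _ (eps f ^ p) := by
  have hp0 : p ≠ 0 := (Fact.out : p.Prime).ne_zero
  induction f using gen_induction with
  | hX => rw [gX_pow_p, eps_gX, zero_pow hp0, map_zero]
  | hY => rw [gY_pow_p, eps_gY, zero_pow hp0, map_zero]
  | hZ => rw [gZ_pow_p, eps_gZ, zero_pow hp0, map_zero]
  | hc c => rw [← map_pow, AlgHom.commutes]; rfl
  | hadd f g hf hg => rw [add_pow_char, hf, hg, map_add, add_pow_char, map_add]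
  | hmul f g hf hg => rw [mul_pow, hf, hg, map_mul, mul_pow, map_mul]

theorem pow_p_eq_zero {f : BAlg F p} (hf : eps f = 0) : f ^ p = 0 := by
  rw [pow_p_eq, hf, zero_pow (Fact.out : p.Prime).ne_zero, map_zero]

theorem pow_p_eq_one {f : BAlg F p} (hf : eps f = 1) : f ^ p = 1 := by
  rw [pow_p_eq, hf, one_pow, map_one]

theorem isUnit_of_eps {f : BAlg F p} (hf : eps f ≠ 0) : IsUnit f := by
  have h : IsUnit (f ^ p) := by
    rw [pow_p_eq]
    exact (IsUnit.mk0 _ (pow_ne_zero _ hf)).map _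
  exact (isUnit_pow_iff (Fact.out : p.Prime).ne_zero).1 h

theorem d1_gX : d1 (gX : BAlg F p) = 1 := by
  rw [gX, ← mb_zero_zero]; exact d1_mb_succ (one_lt_sq p) pos_p

theorem d2_gX : d2 (gX : BAlg F p) = 0 := d2_mb_zero _

theorem d2_gY : d2 (gY : BAlg F p) = 0 := d2_mb_zero _

theorem d1_gZ : d1 (gZ : BAlg F p) = 0 := d1_mb_zero _

theorem d2_gZ : d2 (gZ : BAlg F p) = 1 := by
  rw [gZ, ← mb_zero_zero]; exact d2_mb_succ (pow_pos pos_p 2) (one_lt_p p)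

theorem d1_gY_mb : d1 (gY : BAlg F p) = mb (p - 1) 0 := by
  have h := one_lt_p p
  have h2 := prime_lt_sq (p := p)
  have := d1_mb_succ (F := F) (p := p) (i := p - 1) (j := 0) (by omega) pos_p
  rwa [show p - 1 + 1 = p by omega] at this

theorem factorial_pred : ((p - 1).factorial : F) = -1 := by
  have h := ZMod.wilsons_lemma p
  have h2 : ((((p - 1).factorial : ℕ) + 1 : ℕ) : F) = 0 := by
    rw [CharP.cast_eq_zero_iff F p, ← ZMod.natCast_eq_zero_iff]
    push_cast; rw [h]; ring
  push_cast at h2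
  linear_combination h2

theorem mb_pred : (mb (p - 1) 0 : BAlg F p) = -gX ^ (p - 1) := by
  have h := one_lt_p p
  rw [gX_pow (by omega), factorial_pred, neg_smul, one_smul, neg_neg]

theorem mb_zero_pred : (mb 0 (p - 1) : BAlg F p) = -gZ ^ (p - 1) := by
  have h := one_lt_p p
  rw [gZ_pow (by omega), factorial_pred, neg_smul, one_smul, neg_neg]

theorem d1_gY : d1 (gY : BAlg F p) = -gX ^ (p - 1) := by rw [d1_gY_mb, mb_pred]

/-! ## Poisson derivations -/

/-- The Poisson bracket of `𝒪(2;(2,1))`. -/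
def pb (f g : BAlg F p) : BAlg F p := d1 f * d2 g - d2 f * d1 g

theorem pb_add_left (f g h : BAlg F p) : pb (f + g) h = pb f h + pb g h := by
  simp only [pb, map_add]; ring

theorem pb_add_right (f g h : BAlg F p) : pb f (g + h) = pb f g + pb f h := by
  simp only [pb, map_add]; ring

theorem pb_smul_left (c : F) (f g : BAlg F p) : pb (c • f) g = c • pb f g := by
  simp only [pb, Derivation.map_smul, smul_mul_assoc, smul_sub]

theorem pb_smul_right (c : F) (f g : BAlg F p) : pb f (c • g) = c • pb f g := by
  simp only [pb, Derivation.map_smul, mul_smul_comm, smul_sub]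

theorem pb_comm (f g : BAlg F p) : pb f g = -pb g f := by simp only [pb]; ring

@[simp] theorem pb_self (f : BAlg F p) : pb f f = 0 := by simp only [pb]; ring

theorem pb_mul_right (f g h : BAlg F p) : pb f (g * h) = g * pb f h + h * pb f g := by
  simp only [pb, Derivation.leibniz, smul_eq_mul]; ring

theorem pb_mul_left (f g h : BAlg F p) : pb (f * g) h = f * pb g h + g * pb f h := by
  simp only [pb, Derivation.leibniz, smul_eq_mul]; ring

@[simp] theorem pb_one_left (f : BAlg F p) : pb 1 f = 0 := by simp [pb]

@[simp] theorem pb_zero_right (f : BAlg F p) : pb f 0 = 0 := by simp [pb]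

@[simp] theorem pb_zero_left (f : BAlg F p) : pb 0 f = 0 := by simp [pb]

theorem pb_sub_left (f g h : BAlg F p) : pb (f - g) h = pb f h - pb g h := by
  simp only [pb, map_sub]; ring

theorem pb_sub_right (f g h : BAlg F p) : pb f (g - h) = pb f g - pb f h := by
  simp only [pb, map_sub]; ring

theorem pb_neg_left (f g : BAlg F p) : pb (-f) g = -pb f g := by simp only [pb, map_neg]; ring

theorem pb_neg_right (f g : BAlg F p) : pb f (-g) = -pb f g := by simp only [pb, map_neg]; ring

theorem pb_jacobi (f g h : BAlg F p) : pb f (pb g h) = pb (pb f g) h + pb g (pb f h) := by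
  simp only [pb, map_sub, Derivation.leibniz, smul_eq_mul, d1_d2_comm]; ring

/-- The bracket as a bilinear map. -/
def pbL : BAlg F p →ₗ[F] BAlg F p →ₗ[F] BAlg F p :=
  LinearMap.mk₂ F pb pb_add_left pb_smul_left pb_add_right pb_smul_right

@[simp] theorem pbL_apply (f g : BAlg F p) : pbL f g = pb f g := rfl

/-- The algebra of endomorphisms of `𝒪(2;(2,1))`. -/
abbrev EndB (F : Type*) [Field F] (p : ℕ) [Fact p.Prime] [CharP F p] : Type _ :=
  Module.End F (BAlg F p)

/-- Derivations of the associative product. -/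
def IsDer (T : EndB F p) : Prop := ∀ f g, T (f * g) = f * T g + g * T f

/-- Derivations of the associative product and of the Poisson bracket. -/
def IsPD (T : EndB F p) : Prop :=
  IsDer T ∧ ∀ f g, T (pb f g) = pb (T f) g + pb f (T g)

theorem Derivation.isDer (D : Derivation F (BAlg F p) (BAlg F p)) :
    IsDer (D : BAlg F p →ₗ[F] BAlg F p) := fun f g => D.leibniz f g

namespace IsDer

variable {T T' : EndB F p}

theorem map_one (hT : IsDer T) : T 1 = 0 := by
  have h := hT 1 1
  simp only [one_mul] at h
  simpa using h

theorem map_algebraMap (hT : IsDer T) (c : F) : T (algebraMap F _ c) = 0 := by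
  rw [Algebra.algebraMap_eq_smul_one, map_smul, hT.map_one, smul_zero]

theorem add (hT : IsDer T) (hT' : IsDer T') : IsDer (T + T') := fun f g => by
  simp only [LinearMap.add_apply, hT f g, hT' f g]; ring

theorem sub (hT : IsDer T) (hT' : IsDer T') : IsDer (T - T') := fun f g => by
  simp only [LinearMap.sub_apply, hT f g, hT' f g]; ring

theorem smul (hT : IsDer T) (c : F) : IsDer (c • T) := fun f g => by
  simp only [LinearMap.smul_apply, hT f g, smul_add, mul_smul_comm]

theorem lie (hT : IsDer T) (hT' : IsDer T') : IsDer (T * T' - T' * T) := fun f g => by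
  simp only [LinearMap.sub_apply, Module.End.mul_apply, hT f g, hT' f g, map_add,
    hT _ _, hT' _ _]
  ring

theorem mulLeft (hT : IsDer T) (a : BAlg F p) : IsDer (LinearMap.mulLeft F a * T) :=
  fun f g => by
    simp only [Module.End.mul_apply, LinearMap.mulLeft_apply, hT f g]; ring

theorem map_pow_succ (hT : IsDer T) (f : BAlg F p) (n : ℕ) :
    T (f ^ (n + 1)) = ((n + 1 : ℕ) : F) • (f ^ n * T f) := by
  induction n with
  | zero => simp
  | succ n ih =>
    rw [pow_succ, hT, ih]
    simp only [Algebra.smul_def, map_natCast]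
    push_cast
    ring

/-- Derivations which agree on the generators are equal. -/
theorem ext (hT : IsDer T) (hT' : IsDer T') (hX : T gX = T' gX) (hY : T gY = T' gY)
    (hZ : T gZ = T' gZ) : T = T' := by
  refine LinearMap.ext fun f => ?_
  induction f using gen_induction with
  | hX => exact hX
  | hY => exact hY
  | hZ => exact hZ
  | hc c => rw [hT.map_algebraMap, hT'.map_algebraMap]
  | hadd f g hf hg => rw [map_add, map_add, hf, hg]
  | hmul f g hf hg => rw [hT, hT', hf, hg]

end IsDer

/-- On the tensor product A⊗1 and 1⊗B commute, so in characteristic p the p-th power of their sum is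
the sum of their p-th powers. This one argument shows that p-th powers of derivations are
derivations, for the product, the Poisson bracket and the module of 1-forms alike. -/
theorem leibniz_pow_char {M N P : Type*} [AddCommGroup M] [Module F M] [AddCommGroup N]
    [Module F N] [AddCommGroup P] [Module F P] (m : M →ₗ[F] N →ₗ[F] P) (A : Module.End F M)
    (B : Module.End F N) (C : Module.End F P) (h : ∀ x y, C (m x y) = m (A x) y + m x (B y))
    (x : M) (y : N) : (C ^ p) (m x y) = m ((A ^ p) x) y + m x ((B ^ p) y) := by
  let A' : Module.End F (TensorProduct F M N) := LinearMap.rTensor N A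
  let B' : Module.End F (TensorProduct F M N) := LinearMap.lTensor M B
  have hc : Commute A' B' := by
    apply TensorProduct.ext'
    intro a b
    simp [A', B']
  have hl : ∀ n : ℕ, (C ^ n).comp (TensorProduct.lift m) =
      (TensorProduct.lift m).comp ((A' + B') ^ n) := by
    intro n
    induction n with
    | zero => rfl
    | succ n ih =>
      have h1 : C.comp (TensorProduct.lift m) = (TensorProduct.lift m).comp (A' + B') := by
        apply TensorProduct.ext'
        intro a b
        simp [A', B', h]
      rw [pow_succ, pow_succ', Module.End.mul_eq_comp, Module.End.mul_eq_comp,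
        LinearMap.comp_assoc, h1, ← LinearMap.comp_assoc, ih, LinearMap.comp_assoc,
        ← Module.End.mul_eq_comp, ← Module.End.mul_eq_comp, ← pow_succ, ← pow_succ']
  have hA : ∀ n : ℕ, (A' ^ n) (x ⊗ₜ[F] y) = ((A ^ n) x) ⊗ₜ[F] y := by
    intro n
    induction n with
    | zero => rfl
    | succ n ih => rw [pow_succ', pow_succ', Module.End.mul_apply, ih]; rfl
  have hB : ∀ n : ℕ, (B' ^ n) (x ⊗ₜ[F] y) = x ⊗ₜ[F] ((B ^ n) y) := by
    intro n
    induction n with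
    | zero => rfl
    | succ n ih => rw [pow_succ', pow_succ', Module.End.mul_apply, ih]; rfl
  obtain ⟨r, hr⟩ := hc.exists_add_pow_prime_eq (Fact.out : p.Prime)
  have hp0 : ((p : ℕ) : Module.End F (TensorProduct F M N)) = 0 := by
    rw [← map_natCast (algebraMap F (Module.End F (TensorProduct F M N))), CharP.cast_eq_zero,
      map_zero]
  rw [hp0] at hr
  have h2 := congrArg (fun T => T (x ⊗ₜ[F] y)) (hl p)
  simp only [LinearMap.comp_apply, TensorProduct.lift.tmul, hr] at h2
  rw [h2]
  simp [hA, hB]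

namespace IsDer

variable {T : EndB F p}

theorem pow_p (hT : IsDer T) : IsDer (T ^ p) := fun f g => by
  have h := leibniz_pow_char (p := p) (LinearMap.mul F (BAlg F p)) T T T
    (fun x y => by simp only [LinearMap.mul_apply', hT x y]; ring) f g
  simp only [LinearMap.mul_apply'] at h
  rw [h]; ring

end IsDer

namespace IsPD

variable {T T' : EndB F p}

theorem add (hT : IsPD T) (hT' : IsPD T') : IsPD (T + T') :=
  ⟨hT.1.add hT'.1, fun f g => by
    simp only [LinearMap.add_apply, hT.2 f g, hT'.2 f g, pb_add_left, pb_add_right]; abel⟩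

theorem sub (hT : IsPD T) (hT' : IsPD T') : IsPD (T - T') :=
  ⟨hT.1.sub hT'.1, fun f g => by
    simp only [LinearMap.sub_apply, hT.2 f g, hT'.2 f g, pb_sub_left, pb_sub_right]; abel⟩

theorem smul (hT : IsPD T) (c : F) : IsPD (c • T) :=
  ⟨hT.1.smul c, fun f g => by
    simp only [LinearMap.smul_apply, hT.2 f g, smul_add, pb_smul_left, pb_smul_right]⟩

theorem lie (hT : IsPD T) (hT' : IsPD T') : IsPD (T * T' - T' * T) :=
  ⟨hT.1.lie hT'.1, fun f g => by
    simp only [LinearMap.sub_apply, Module.End.mul_apply, hT.2 _ _, hT'.2 _ _, map_add,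
      pb_sub_left, pb_sub_right]
    abel⟩

theorem pow_p (hT : IsPD T) : IsPD (T ^ p) :=
  ⟨hT.1.pow_p, fun f g => leibniz_pow_char (p := p) pbL T T T (fun x y => hT.2 x y) f g⟩

theorem pb_left (f : BAlg F p) : IsPD (pbL f) :=
  ⟨fun g h => pb_mul_right f g h, fun g h => pb_jacobi f g h⟩

end IsPD

/-- The derivation `D₁^p`. -/
def Del (F : Type*) [Field F] (p : ℕ) [Fact p.Prime] [CharP F p] : EndB F p := ((d1 (F := F) (p := p) : BAlg F p →ₗ[F] BAlg F p) : EndB F p) ^ p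

theorem d1_pow_cf (n i j : ℕ) (f : BAlg F p) :
    cf i j ((((d1 (F := F) (p := p) : BAlg F p →ₗ[F] BAlg F p) : EndB F p) ^ n) f) =
      cf (i + n) j f := by
  induction n generalizing f with
  | zero => rfl
  | succ n ih =>
    rw [pow_succ, Module.End.mul_apply, ih]
    exact cf_d1 _ _ _

theorem cf_Del (i j : ℕ) (f : BAlg F p) : cf i j (Del F p f) = cf (i + p) j f := d1_pow_cf p i j f

theorem Del_isPD : IsPD (Del F p) := by
  have h : (((d1 (F := F) (p := p) : BAlg F p →ₗ[F] BAlg F p) : EndB F p)) = pbL (-gZ) := by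
    refine LinearMap.ext fun f => ?_
    simp [pb, d1_gZ, d2_gZ]
  rw [Del, h]
  exact (IsPD.pb_left _).pow_p

theorem Del_gX : Del F p gX = 0 := by
  have h := one_lt_p p
  apply BAlg_ext; intro i j
  rw [cf_Del, gX, cf_mb (one_lt_sq p) pos_p, if_neg (by omega), map_zero]

theorem Del_gY : Del F p gY = 1 := by
  apply BAlg_ext; intro i j
  rw [cf_Del, gY, cf_mb prime_lt_sq pos_p, ← mb_zero_zero, cf_mb (pow_pos pos_p 2) pos_p]
  congr 1
  simp only [eq_iff_iff]; omega

theorem Del_gZ : Del F p gZ = 0 := by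
  have h := one_lt_p p
  apply BAlg_ext; intro i j
  rw [cf_Del, gZ, cf_mb (pow_pos pos_p 2) (one_lt_p p), if_neg (by omega), map_zero]

theorem Del_pow_p : (Del F p) ^ p = 0 := by
  refine LinearMap.ext fun f => BAlg_ext fun i j => ?_
  rw [Del, ← pow_mul, d1_pow_cf, LinearMap.zero_apply, map_zero]
  exact cf_eq_zero _ (by rw [sq]; exact fun h => absurd h.1 (Nat.not_lt.2 (Nat.le_add_left _ _)))

theorem Del_d1 (f : BAlg F p) : Del F p (d1 f) = d1 (Del F p f) := by
  apply BAlg_ext; intro i j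
  rw [cf_Del, cf_d1, cf_d1, cf_Del, add_right_comm]

theorem Del_d2 (f : BAlg F p) : Del F p (d2 f) = d2 (Del F p f) := by
  apply BAlg_ext; intro i j
  rw [cf_Del, cf_d2, cf_d2, cf_Del]

/-- The derivation of `𝒪(2;(2,1))` defined by `D_H(f)`. -/
def op : Pot F p →ₗ[F] EndB F p where
  toFun f :=
    { toFun := fun g => ⟨D1 (f : O2 F), f.2.1⟩ * d2 g - ⟨D2 (f : O2 F), f.2.2⟩ * d1 g
      map_add' := fun g h => by simp only [map_add]; ring
      map_smul' := fun c g => by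
        simp only [Derivation.map_smul, mul_smul_comm, smul_sub, RingHom.id_apply] }
  map_add' f g := by
    refine LinearMap.ext fun h => Subtype.ext ?_
    simp; ring
  map_smul' c f := by
    refine LinearMap.ext fun h => Subtype.ext ?_
    simp [smul_sub]

theorem op_apply (f : Pot F p) (g : BAlg F p) :
    op f g = ⟨D1 (f : O2 F), f.2.1⟩ * d2 g - ⟨D2 (f : O2 F), f.2.2⟩ * d1 g := rfl

theorem coe_op_apply (f : Pot F p) (g : BAlg F p) :
    ((op f g : BAlg F p) : O2 F) = D1 (f : O2 F) * D2 (g : O2 F) - D2 (f : O2 F) * D1 (g : O2 F) := rfl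

/-- The inclusion of `𝒪(2;(2,1))` into the space of potentials. -/
def inB : BAlg F p →ₗ[F] Pot F p where
  toFun f := ⟨f, O21_le_Pot f.2⟩
  map_add' _ _ := rfl
  map_smul' _ _ := rfl

@[simp] theorem coe_inB (f : BAlg F p) : ((inB f : Pot F p) : O2 F) = f := rfl

theorem op_inB (f : BAlg F p) : op (inB f) = pbL f := rfl

theorem op_inB_apply (f g : BAlg F p) : op (inB f) g = pb f g := rfl

theorem op_isPD (f : Pot F p) : IsPD (op f) := by
  refine ⟨fun g h => ?_, fun g h => ?_⟩
  · simp only [op_apply, Derivation.leibniz, smul_eq_mul]; ring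
  · have hh : d1 (⟨D2 (f : O2 F), f.2.2⟩ : BAlg F p) = d2 (⟨D1 (f : O2 F), f.2.1⟩ : BAlg F p) :=
      Subtype.ext (D1_D2_comm _)
    simp only [op_apply, pb, map_sub, Derivation.leibniz, smul_eq_mul, d1_d2_comm, hh]
    ring

/-! ### The Poincaré lemma -/

/-- Integration with respect to the first variable. -/
def up1 : O2 F →ₗ[F] O2 F := ofMon fun a => mon (a.1 + 1, a.2)

/-- Integration of the part which is free of `x₁` with respect to the second variable. -/
def up2 : O2 F →ₗ[F] O2 F := ofMon fun a => if a.1 = 0 then mon (0, a.2 + 1) else 0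

theorem D1_up1 (f : O2 F) : D1 (up1 f) = f := by
  have key : (low1 (F := F)).comp up1 = LinearMap.id := by
    apply hom_ext; intro a
    simp [up1, low1_mon]
  exact congrArg (fun T => T f) key

theorem D2_up1 (f : O2 F) : D2 (up1 f) = up1 (D2 f) := by
  have key : (low2 (F := F)).comp up1 = up1.comp low2 := by
    apply hom_ext; rintro ⟨i, j⟩
    by_cases hj : j = 0 <;> simp [up1, low2_mon, hj]
  exact congrArg (fun T => T f) key

theorem D1_up2 (f : O2 F) : D1 (up2 f) = 0 := by
  have key : (low1 (F := F)).comp up2 = 0 := by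
    apply hom_ext; rintro ⟨i, j⟩
    by_cases hi : i = 0 <;> simp [up2, low1_mon, hi]
  exact congrArg (fun T => T f) key

theorem D2_up2 (f : O2 F) : D2 (up2 f) = f - up1 (D1 f) := by
  have key : (low2 (F := F)).comp up2 = LinearMap.id - up1.comp low1 := by
    apply hom_ext; rintro ⟨i, j⟩
    rcases i with _ | i <;> simp [up2, up1, low1_mon, low2_mon]
  exact congrArg (fun T => T f) key

theorem exists_potential {a c : O2 F} (h : D2 a = D1 c) : ∃ f : O2 F, D1 f = a ∧ D2 f = c := by
  refine ⟨up1 a + up2 c, ?_, ?_⟩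
  · rw [map_add, D1_up1, D1_up2, add_zero]
  · rw [map_add, D2_up1, D2_up2, h]; abel

theorem O2_const_of_D {f : O2 F} (h1 : D1 f = 0) (h2 : D2 f = 0) :
    f = coeff (0, 0) f • (1 : O2 F) := by
  apply O2_ext
  rintro ⟨i, j⟩
  rw [map_smul, one_def, coeff_mon]
  rcases i with _ | i
  · rcases j with _ | j
    · simp [Prod.ext_iff]
    · rw [← coeff_D2, h2]; simp [Prod.ext_iff]
  · rw [← coeff_D1, h1]; simp [Prod.ext_iff]

theorem BAlg_const_of_d {f : BAlg F p} (h1 : d1 f = 0) (h2 : d2 f = 0) :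
    f = algebraMap F _ (eps f) := by
  apply Subtype.ext
  rw [O2_const_of_D (congrArg Subtype.val h1) (congrArg Subtype.val h2), eps_eq_cf,
    Algebra.algebraMap_eq_smul_one]
  rfl

/-- The relation {x₁, x₂} = 1 makes the pair (T x₁, T x₂) a closed form, so some D_H(f) has the same
values there. The difference kills x₁ and x₂. The brackets of x₁^{(p)} with x₁ and x₂ then force its
value on x₁^{(p)} to be a constant b, which is the value of b·D₁^p. -/
theorem IsPD.exists_op {T : EndB F p} (hT : IsPD T) :
    ∃ (f : Pot F p) (b : F), T = op f + b • Del F p := by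
  have hXZ : pb gX gZ = (1 : BAlg F p) := by simp [pb, d1_gX, d2_gX, d1_gZ, d2_gZ]
  have h1 : d1 (T gX) + d2 (T gZ) = 0 := by
    have h := hT.2 gX gZ
    rw [hXZ, hT.1.map_one] at h
    simpa [pb, d1_gX, d2_gX, d1_gZ, d2_gZ] using h.symm
  have h2 : D2 ((T gZ : BAlg F p) : O2 F) = D1 (-((T gX : BAlg F p) : O2 F)) := by
    have := congrArg Subtype.val h1
    rw [map_neg]
    exact eq_neg_of_add_eq_zero_right this
  obtain ⟨f, hf1, hf2⟩ := exists_potential h2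
  have hf : f ∈ Pot F p := ⟨by rw [hf1]; exact (T gZ).2, by rw [hf2]; exact neg_mem (T gX).2⟩
  let f' : Pot F p := ⟨f, hf⟩
  have hfX : op f' gX = T gX := by
    apply Subtype.ext
    rw [coe_op_apply]
    change D1 f * D2 _ - D2 f * D1 _ = _
    rw [hf2, ← coe_d1, ← coe_d2, d1_gX, d2_gX]; simp
  have hfZ : op f' gZ = T gZ := by
    apply Subtype.ext
    rw [coe_op_apply]
    change D1 f * D2 _ - D2 f * D1 _ = _
    rw [hf1, ← coe_d1, ← coe_d2, d1_gZ, d2_gZ]; simp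
  have hS : IsPD (T - op f') := hT.sub (op_isPD f')
  set S := T - op f' with hSdef
  have hSX : S gX = 0 := by simp [hSdef, hfX]
  have hSZ : S gZ = 0 := by simp [hSdef, hfZ]
  have hYZ : pb gY gZ = (-gX ^ (p - 1) : BAlg F p) := by
    simp [pb, d1_gY, d2_gY, d1_gZ, d2_gZ]
  have hYX : pb gY gX = (0 : BAlg F p) := by simp [pb, d2_gY, d1_gX, d2_gX]
  obtain ⟨n, hn⟩ : ∃ n, p - 1 = n + 1 := ⟨p - 2, by have := one_lt_p p; omega⟩
  have e1 : d1 (S gY) = 0 := by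
    have h := hS.2 gY gZ
    rw [hYZ, hSZ, map_neg, hn, hS.1.map_pow_succ, hSX] at h
    simpa [pb, d1_gZ, d2_gZ] using h.symm
  have e2 : d2 (S gY) = 0 := by
    have h := hS.2 gY gX
    rw [hYX, hSX] at h
    simpa [pb, d1_gX, d2_gX] using h.symm
  refine ⟨f', eps (S gY), ?_⟩
  have : S = eps (S gY) • Del F p := by
    refine hS.1.ext (Del_isPD.1.smul _) ?_ ?_ ?_
    · rw [hSX, LinearMap.smul_apply, Del_gX, smul_zero]
    · rw [LinearMap.smul_apply, Del_gY, ← Algebra.algebraMap_eq_smul_one]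
      exact BAlg_const_of_d e1 e2
    · rw [hSZ, LinearMap.smul_apply, Del_gZ, smul_zero]
  rw [← this, hSdef]
  abel

/-! ## The algebras `G` and `S` in terms of potentials -/

/-- The coefficient of the highest monomial `x₁^{(p²-1)} x₂^{(p-1)}`. -/
def top : BAlg F p →ₗ[F] F := cf (p ^ 2 - 1) (p - 1)

/-! ### Poisson derivations do not reach the highest monomial -/

theorem top_d1 (f : BAlg F p) : top (d1 f) = 0 := by
  have := one_lt_sq p
  rw [top, cf_d1]
  exact cf_eq_zero _ (by omega)

theorem top_d2 (f : BAlg F p) : top (d2 f) = 0 := by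
  have := one_lt_p p
  rw [top, cf_d2]
  exact cf_eq_zero _ (by omega)

/-- The highest coefficient is an integral: it vanishes on all derivatives, and a Hamiltonian
derivation has divergence zero, so its values are total derivatives. -/
theorem top_op (f : Pot F p) (g : BAlg F p) : top (op f g) = 0 := by
  have hh : d1 (⟨D2 (f : O2 F), f.2.2⟩ : BAlg F p) = d2 (⟨D1 (f : O2 F), f.2.1⟩ : BAlg F p) :=
    Subtype.ext (D1_D2_comm _)
  have : op f g = d2 (g * (⟨D1 (f : O2 F), f.2.1⟩ : BAlg F p)) -
      d1 (g * (⟨D2 (f : O2 F), f.2.2⟩ : BAlg F p)) := by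
    simp only [op_apply, Derivation.leibniz, smul_eq_mul, hh]; ring
  rw [this, map_sub, top_d1, top_d2, sub_zero]

theorem top_pb (f g : BAlg F p) : top (pb f g) = 0 := top_op (inB f) g

theorem top_Del (f : BAlg F p) : top (Del F p f) = 0 := by
  have := one_lt_p p
  have := one_lt_sq p
  rw [top, cf_Del]
  exact cf_eq_zero _ (by omega)

theorem top_one : top (1 : BAlg F p) = 0 := by
  have := one_lt_p p
  rw [← mb_zero_zero, top, cf_mb (pow_pos pos_p 2) pos_p, if_neg (by omega)]

theorem top_algebraMap (c : F) : top (algebraMap F (BAlg F p) c) = 0 := by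
  rw [Algebra.algebraMap_eq_smul_one, map_smul, top_one, smul_zero]

theorem IsPD.top_apply {T : EndB F p} (hT : IsPD T) (f : BAlg F p) : top (T f) = 0 := by
  obtain ⟨g, b, rfl⟩ := hT.exists_op
  rw [LinearMap.add_apply, map_add, top_op, LinearMap.smul_apply, map_smul, top_Del, smul_zero,
    add_zero]

theorem eq_sum_mb (f : BAlg F p) :
    f = ∑ a : Fin (p ^ 2) × Fin p, cf (a.1 : ℕ) (a.2 : ℕ) f • mb (a.1 : ℕ) (a.2 : ℕ) := by
  apply BAlg_ext
  intro i j
  rw [map_sum]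
  by_cases h : i < p ^ 2 ∧ j < p
  · rw [Finset.sum_eq_single (⟨i, h.1⟩, ⟨j, h.2⟩)]
    · rw [map_smul, cf_mb h.1 h.2]; simp
    · rintro b - hb
      rw [map_smul, cf_mb b.1.2 b.2.2, if_neg, smul_zero]
      rintro ⟨h1, h2⟩
      exact hb (Prod.ext (Fin.ext h1) (Fin.ext h2))
    · simp
  · rw [cf_eq_zero _ h, Finset.sum_eq_zero]
    intro b _
    rw [map_smul, cf_eq_zero _ h, smul_zero]

/-- A subspace contains all elements without highest coefficient if it contains all other
monomials. -/
theorem mem_of_top_eq_zero {V : Submodule F (BAlg F p)}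
    (h1 : ∀ i j, i + 1 < p ^ 2 → j < p → mb i j ∈ V)
    (h2 : ∀ i j, i < p ^ 2 → j + 1 < p → mb i j ∈ V) {f : BAlg F p} (hf : top f = 0) :
    f ∈ V := by
  rw [eq_sum_mb f]
  refine Submodule.sum_mem _ fun a _ => ?_
  by_cases ha1 : (a.1 : ℕ) + 1 < p ^ 2
  · exact Submodule.smul_mem _ _ (h1 _ _ ha1 a.2.2)
  by_cases ha2 : (a.2 : ℕ) + 1 < p
  · exact Submodule.smul_mem _ _ (h2 _ _ a.1.2 ha2)
  have e1 : (a.1 : ℕ) = p ^ 2 - 1 := by have := a.1.2; omega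
  have e2 : (a.2 : ℕ) = p - 1 := by have := a.2.2; omega
  rw [e1, e2]
  change top f • _ ∈ _
  rw [hf, zero_smul]
  exact V.zero_mem

theorem pb_mb_gZ {i j : ℕ} (hi : i + 1 < p ^ 2) (hj : j < p) :
    pb (mb (i + 1) j : BAlg F p) gZ = mb i j := by
  rw [pb, d1_gZ, d2_gZ, d1_mb_succ hi hj]; ring

theorem pb_gX_mb {i j : ℕ} (hi : i < p ^ 2) (hj : j + 1 < p) :
    pb gX (mb i (j + 1) : BAlg F p) = mb i j := by
  rw [pb, d1_gX, d2_gX, d2_mb_succ hi hj]; ring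

/-- Every monomial except the highest one is a bracket with x₁ or with x₂. -/
theorem mem_span_pb {f : BAlg F p} (hf : top f = 0) :
    f ∈ Submodule.span F {x : BAlg F p | ∃ g h, x = pb g h} :=
  mem_of_top_eq_zero (V := Submodule.span F {x : BAlg F p | ∃ g h, x = pb g h})
    (fun _ _ hi hj => Submodule.subset_span ⟨_, _, (pb_mb_gZ hi hj).symm⟩)
    (fun _ _ hi hj => Submodule.subset_span ⟨_, _, (pb_gX_mb hi hj).symm⟩) hf

/-- `D_H(f)` as an element of `G`, as a linear map. -/
def DGL : Pot F p →ₗ[F] GAlg F p where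
  toFun f := DG f f.2
  map_add' f g := Subtype.ext (map_add dH (f : O2 F) g)
  map_smul' c f := Subtype.ext (map_smul dH c (f : O2 F))

theorem coe_DGL (f : Pot F p) :
    ((DGL f : GAlg F p) : Derivation F (O2 F) (O2 F)) = dH (f : O2 F) := rfl

theorem dH_mon_one_zero (f : O2 F) : dH f (mon (1, 0)) = -D2 f := by
  rw [dH_apply, D1_mon, D2_mon]
  simp [show (mon (0, 0) : O2 F) = 1 from rfl]

theorem dH_mon_zero_one (f : O2 F) : dH f (mon (0, 1)) = D1 f := by
  rw [dH_apply, D1_mon, D2_mon]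
  simp [show (mon (0, 0) : O2 F) = 1 from rfl]

theorem DGL_surjective : Function.Surjective (DGL : Pot F p →ₗ[F] GAlg F p) := by
  rintro ⟨E, ⟨f, rfl⟩, ⟨a, ha, b, hb, hE⟩⟩
  have h1 : -D2 f = a := by
    rw [← dH_mon_one_zero, hE]
    simp [D1_mon, D2_mon, show (mon (0, 0) : O2 F) = 1 from rfl]
  have h2 : D1 f = b := by
    rw [← dH_mon_zero_one, hE]
    simp [D1_mon, D2_mon, show (mon (0, 0) : O2 F) = 1 from rfl]
  refine ⟨⟨f, by rw [h2]; exact hb, ?_⟩, rfl⟩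
  rw [← neg_neg (D2 f), h1]
  exact neg_mem ha

theorem DGL_eq_zero_iff {f : Pot F p} : DGL f = 0 ↔ D1 (f : O2 F) = 0 ∧ D2 (f : O2 F) = 0 := by
  constructor
  · intro h
    have h' : dH (f : O2 F) = 0 := congrArg Subtype.val h
    constructor
    · rw [← dH_mon_zero_one, h']; rfl
    · rw [← neg_eq_zero, ← dH_mon_one_zero, h']; rfl
  · rintro ⟨h1, h2⟩
    apply Subtype.ext
    rw [coe_DGL]
    refine Derivation.ext fun g => ?_
    rw [dH_apply, h1, h2]; simp

theorem DGL_inB_eq_zero_iff {f : BAlg F p} : DGL (inB f) = 0 ↔ d1 f = 0 ∧ d2 f = 0 := by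
  rw [DGL_eq_zero_iff, Subtype.ext_iff, Subtype.ext_iff]; rfl

theorem DGL_inB_algebraMap (c : F) : DGL (inB (algebraMap F (BAlg F p) c)) = 0 :=
  DGL_inB_eq_zero_iff.2 ⟨Derivation.map_algebraMap _ _, Derivation.map_algebraMap _ _⟩

theorem DGL_inB_eq_iff {f g : BAlg F p} :
    DGL (inB f) = DGL (inB g) ↔ ∃ c : F, f = g + algebraMap F _ c := by
  rw [← sub_eq_zero, ← map_sub, ← map_sub]
  constructor
  · intro h
    obtain ⟨h1, h2⟩ := DGL_inB_eq_zero_iff.1 h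
    exact ⟨eps (f - g), by rw [← BAlg_const_of_d h1 h2]; ring⟩
  · rintro ⟨c, rfl⟩
    rw [add_sub_cancel_left, DGL_inB_algebraMap]

theorem lie_DGL_aux (f g : Pot F p) :
    D1 (f : O2 F) * D2 (g : O2 F) - D2 (f : O2 F) * D1 (g : O2 F) ∈ O21 F p :=
  sub_mem (mul_mem f.2.1 g.2.2) (mul_mem f.2.2 g.2.1)

/-- The Poisson bracket of two potentials. -/
def pbP (f g : Pot F p) : BAlg F p := ⟨_, lie_DGL_aux f g⟩

theorem lie_DGL (f g : Pot F p) : ⁅DGL f, DGL g⁆ = DGL (inB (pbP f g)) :=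
  Subtype.ext (lie_dH (f : O2 F) g)

theorem lie_DGL_inB (f : Pot F p) (g : BAlg F p) :
    ⁅DGL f, DGL (inB g)⁆ = DGL (inB (op f g)) := lie_DGL f (inB g)

theorem lie_DGL_inB_inB (f g : BAlg F p) :
    ⁅DGL (inB f), DGL (inB g)⁆ = DGL (inB (pb f g)) := lie_DGL (inB f) (inB g)

theorem mem_lie_top {V : LieIdeal F (GAlg F p)} {W : LieIdeal F (GAlg F p)}
    {x y : GAlg F p} (hx : x ∈ V) (hy : y ∈ W) : ⁅x, y⁆ ∈ ⁅V, W⁆ := LieSubmodule.lie_mem_lie hx hy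

-- The highest monomial is not a sum of brackets of elements of 𝒪(2;(2,1)), but it is the bracket of
-- the potentials x₁^{(p²)} and x₂^{(p)}, both of which lie outside. Hence it appears in the first
-- derived algebra and is lost in the second.
variable (F p) in
theorem derived_one : (LieAlgebra.derivedSeries F (GAlg F p) 1).toSubmodule =
    LinearMap.range ((DGL : Pot F p →ₗ[F] GAlg F p).comp inB) := by
  have h1 : LieAlgebra.derivedSeries F (GAlg F p) 1 =
      ⁅(⊤ : LieIdeal F (GAlg F p)), (⊤ : LieIdeal F (GAlg F p))⁆ := rfl
  apply le_antisymm
  · rw [h1, LieSubmodule.lieIdeal_oper_eq_linear_span', Submodule.span_le]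
    rintro _ ⟨x, -, y, -, rfl⟩
    obtain ⟨f, rfl⟩ := DGL_surjective x
    obtain ⟨g, rfl⟩ := DGL_surjective y
    exact ⟨pbP f g, (lie_DGL f g).symm⟩
  · rintro _ ⟨f, rfl⟩
    have key : ∀ i j, i < p ^ 2 → j < p → DGL (inB (mb i j : BAlg F p)) ∈
        LieAlgebra.derivedSeries F (GAlg F p) 1 := by
      intro i j hi hj
      rw [h1]
      by_cases hi' : i + 1 < p ^ 2
      · rw [← pb_mb_gZ hi' hj, ← lie_DGL_inB_inB]
        exact mem_lie_top (LieSubmodule.mem_top _) (LieSubmodule.mem_top _)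
      by_cases hj' : j + 1 < p
      · rw [← pb_gX_mb hi hj', ← lie_DGL_inB_inB]
        exact mem_lie_top (LieSubmodule.mem_top _) (LieSubmodule.mem_top _)
      have hi2 : p ^ 2 = i + 1 := by omega
      have hj2 : p = j + 1 := by omega
      have e : mb i j = pbP (⟨mon (p ^ 2, 0), x1_mem_Pot le_rfl⟩ : Pot F p)
          ⟨mon (0, p), x2_mem_Pot le_rfl⟩ := by
        apply Subtype.ext
        rw [coe_mb hi hj]
        change _ = D1 (mon (p ^ 2, 0) : O2 F) * D2 (mon (0, p) : O2 F) -
          D2 (mon (p ^ 2, 0) : O2 F) * D1 (mon (0, p) : O2 F)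
        have hp2 : p ^ 2 ≠ 0 := by omega
        have hp0 : p ≠ 0 := by omega
        rw [D1_mon, D2_mon, D2_mon, D1_mon, if_neg hp2, if_neg hp0, if_pos rfl, zero_mul, sub_zero,
          mon_mul_mon]
        have e1 : p ^ 2 - 1 = i := by omega
        have e2 : p - 1 = j := by omega
        simp [e1, e2, binom2]
      rw [e, ← lie_DGL]
      exact mem_lie_top (LieSubmodule.mem_top _) (LieSubmodule.mem_top _)
    have h2 : (⊤ : Submodule F (BAlg F p)) ≤ Submodule.comap
        ((DGL : Pot F p →ₗ[F] GAlg F p).comp inB)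
        (LieAlgebra.derivedSeries F (GAlg F p) 1).toSubmodule := by
      rw [← span_mb, Submodule.span_le]
      rintro _ ⟨a, rfl⟩
      exact key _ _ a.1.2 a.2.2
    exact h2 Submodule.mem_top

theorem DGL_inB_mem_derived_one (f : BAlg F p) :
    DGL (inB f) ∈ LieAlgebra.derivedSeries F (GAlg F p) 1 := by
  have : DGL (inB f) ∈ (LieAlgebra.derivedSeries F (GAlg F p) 1).toSubmodule := by
    rw [derived_one]; exact ⟨f, rfl⟩
  exact this

theorem DGL_pb_mem_SAlg (f g : BAlg F p) : DGL (inB (pb f g)) ∈ SAlg F p := by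
  rw [← lie_DGL_inB_inB]
  exact mem_lie_top (V := LieAlgebra.derivedSeries F (GAlg F p) 1)
    (W := LieAlgebra.derivedSeries F (GAlg F p) 1)
    (DGL_inB_mem_derived_one f) (DGL_inB_mem_derived_one g)

theorem DGL_mem_SAlg {f : BAlg F p} (hf : top f = 0) : DGL (inB f) ∈ SAlg F p := by
  have h : Submodule.span F {x : BAlg F p | ∃ g h, x = pb g h} ≤
      Submodule.comap ((DGL : Pot F p →ₗ[F] GAlg F p).comp inB) (SAlg F p).toSubmodule := by
    rw [Submodule.span_le]
    rintro _ ⟨g, h, rfl⟩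
    exact DGL_pb_mem_SAlg g h
  exact h (mem_span_pb hf)

theorem exists_of_mem_SAlg {x : GAlg F p} (hx : x ∈ SAlg F p) :
    ∃ f : BAlg F p, top f = 0 ∧ x = DGL (inB f) := by
  have h : (SAlg F p).toSubmodule ≤
      (LinearMap.ker (top : BAlg F p →ₗ[F] F)).map ((DGL : Pot F p →ₗ[F] GAlg F p).comp inB) := by
    have h1 : SAlg F p = ⁅LieAlgebra.derivedSeries F (GAlg F p) 1,
      LieAlgebra.derivedSeries F (GAlg F p) 1⁆ := rfl
    rw [h1, LieSubmodule.lieIdeal_oper_eq_linear_span', Submodule.span_le]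
    rintro _ ⟨x, hx, y, hy, rfl⟩
    have hx' : x ∈ (LieAlgebra.derivedSeries F (GAlg F p) 1).toSubmodule := hx
    have hy' : y ∈ (LieAlgebra.derivedSeries F (GAlg F p) 1).toSubmodule := hy
    rw [derived_one] at hx' hy'
    obtain ⟨f, rfl⟩ := hx'
    obtain ⟨g, rfl⟩ := hy'
    exact ⟨pb f g, top_pb f g, (lie_DGL_inB_inB f g).symm⟩
  obtain ⟨f, hf, rfl⟩ := h hx
  exact ⟨f, hf, rfl⟩

/-! ### The projection of `𝒪(2;(2,1))` onto `S` -/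

/-- The highest monomial. -/
def topMon : BAlg F p := mb (p ^ 2 - 1) (p - 1)

theorem top_topMon : top (topMon : BAlg F p) = 1 := by
  have := one_lt_p p
  have := one_lt_sq p
  rw [top, topMon, cf_mb (by omega) (by omega)]; simp

/-- The map `f ↦ D_H(f)` onto `S`, extended by zero to the highest monomial. -/
def K : BAlg F p →ₗ[F] SAlg F p where
  toFun f := ⟨DGL (inB (f - top f • topMon)), DGL_mem_SAlg (by
    rw [map_sub, map_smul, top_topMon]; simp)⟩
  map_add' f g := by
    apply Subtype.ext
    change DGL _ = DGL _ + DGL _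
    rw [← map_add, ← map_add]; congr 2; rw [map_add, add_smul]; abel
  map_smul' c f := by
    apply Subtype.ext
    change DGL _ = c • DGL _
    rw [← map_smul, ← map_smul]; congr 2
    rw [map_smul, smul_sub, smul_smul]; rfl

theorem coe_K {f : BAlg F p} (hf : top f = 0) : ((K f : SAlg F p) : GAlg F p) = DGL (inB f) := by
  change DGL (inB (f - top f • topMon)) = _
  rw [hf, zero_smul, sub_zero]

theorem exists_K (s : SAlg F p) : ∃ f : BAlg F p, top f = 0 ∧ s = K f := by
  obtain ⟨f, hf, h⟩ := exists_of_mem_SAlg s.2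
  exact ⟨f, hf, Subtype.ext (h.trans (coe_K hf).symm)⟩

theorem K_eq_iff {f g : BAlg F p} (hf : top f = 0) (hg : top g = 0) :
    (K f : SAlg F p) = K g ↔ ∃ c : F, f = g + algebraMap F _ c := by
  rw [← DGL_inB_eq_iff, Subtype.ext_iff, coe_K hf, coe_K hg]

theorem lie_K {f g : BAlg F p} (hf : top f = 0) (hg : top g = 0) :
    ⁅(K f : SAlg F p), K g⁆ = K (pb f g) := by
  apply Subtype.ext
  rw [coe_K (top_pb f g), ← lie_DGL_inB_inB, ← coe_K hf, ← coe_K hg]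
  rfl

instance : FiniteDimensional F (SAlg F p) :=
  Module.Finite.of_surjective (K : BAlg F p →ₗ[F] SAlg F p) fun s => by
    obtain ⟨f, -, h⟩ := exists_K s
    exact ⟨f, h.symm⟩

/-! ### Endomorphisms of `S` which are induced by endomorphisms of `𝒪(2;(2,1))` -/

/-- The endomorphism `x` of `S` is induced by the endomorphism `T` of `𝒪(2;(2,1))`. -/
def Rep (x : EndS F p) (T : EndB F p) : Prop :=
  ∀ f : BAlg F p, top f = 0 → top (T f) = 0 ∧ x (K f) = K (T f)

namespace Rep

variable {x y : EndS F p} {T T' : EndB F p}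

theorem add (h : Rep x T) (h' : Rep y T') : Rep (x + y) (T + T') := fun f hf => by
  simp only [LinearMap.add_apply, map_add, (h f hf).1, (h' f hf).1, (h f hf).2, (h' f hf).2]
  simp

theorem sub (h : Rep x T) (h' : Rep y T') : Rep (x - y) (T - T') := fun f hf => by
  simp only [LinearMap.sub_apply, map_sub, (h f hf).1, (h' f hf).1, (h f hf).2, (h' f hf).2]
  simp

theorem smul (h : Rep x T) (c : F) : Rep (c • x) (c • T) := fun f hf => by
  simp only [LinearMap.smul_apply, map_smul, (h f hf).1, (h f hf).2]
  simp

theorem mul (h : Rep x T) (h' : Rep y T') : Rep (x * y) (T * T') := fun f hf => by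
  obtain ⟨h1, h2⟩ := h' f hf
  obtain ⟨h3, h4⟩ := h _ h1
  exact ⟨h3, by rw [Module.End.mul_apply, h2, h4]; rfl⟩

theorem one : Rep (1 : EndS F p) 1 := fun _ hf => ⟨hf, rfl⟩

theorem zero : Rep (0 : EndS F p) 0 := fun _ _ => ⟨by simp, by simp⟩

theorem pow (h : Rep x T) (n : ℕ) : Rep (x ^ n) (T ^ n) := by
  induction n with
  | zero => exact one
  | succ n ih => rw [pow_succ, pow_succ]; exact ih.mul h

theorem sum {ι : Type*} {s : Finset ι} {x : ι → EndS F p} {T : ι → EndB F p}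
    (h : ∀ i ∈ s, Rep (x i) (T i)) : Rep (∑ i ∈ s, x i) (∑ i ∈ s, T i) := by
  classical
  induction s using Finset.induction_on with
  | empty => exact zero
  | insert a s ha ih =>
    rw [Finset.sum_insert ha, Finset.sum_insert ha]
    exact (h a (Finset.mem_insert_self _ _)).add
      (ih fun i hi => h i (Finset.mem_insert_of_mem hi))

theorem unique (h : Rep x T) (h' : Rep y T) : x = y := by
  refine LinearMap.ext fun s => ?_
  obtain ⟨f, hf, rfl⟩ := exists_K s
  rw [(h f hf).2, (h' f hf).2]

end Rep

/-! ### Derivations are determined by their action on `S` -/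

theorem two_ne_zero' (hp : 3 < p) : (2 : F) ≠ 0 := by
  exact_mod_cast cast_ne_zero' (F := F) p (n := 2) (by omega) (by omega)

theorem cf_top_gX_sq (hp : 3 < p) : top ((gX : BAlg F p) ^ 2) = 0 := by
  rw [gX_pow (by omega), map_smul, top, cf_mb (lt_trans (by omega) prime_lt_sq) pos_p,
    if_neg (by omega), smul_zero]

theorem cf_top_gZ_sq (hp : 3 < p) : top ((gZ : BAlg F p) ^ 2) = 0 := by
  have := prime_lt_sq (p := p)
  rw [gZ_pow (by omega), map_smul, top, cf_mb (by omega) (by omega),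
    if_neg (by omega), smul_zero]

theorem cf_top_gY_sq (hp : 3 < p) : top ((gY : BAlg F p) ^ 2) = 0 := by
  rw [gY_pow (by omega), map_smul, top, cf_mb (by rw [sq]; nlinarith) pos_p,
    if_neg (by omega), smul_zero]

theorem cf_top_gX (hp : 3 < p) : top (gX : BAlg F p) = 0 := by
  rw [gX, top, cf_mb (one_lt_sq p) pos_p, if_neg (by omega)]

theorem cf_top_gY (hp : 3 < p) : top (gY : BAlg F p) = 0 := by
  rw [gY, top, cf_mb prime_lt_sq pos_p, if_neg (by omega)]

theorem cf_top_gZ (hp : 3 < p) : top (gZ : BAlg F p) = 0 := by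
  have := prime_lt_sq (p := p)
  rw [gZ, top, cf_mb (by omega) (one_lt_p p), if_neg (by omega)]

/-- A derivation is determined by the endomorphism of `S` which it induces. -/
theorem Rep.der_eq_zero (hp : 3 < p) {T : EndB F p} (h : Rep (0 : EndS F p) T)
    (hT : IsDer T) : T = 0 := by
  -- Inducing zero on `S` only says that T g and T(g²) are constants c and c'. From 2·g·c = c' at
  -- the origin follows c' = 0, so c·g = 0, and either alternative gives T g = 0.
  have key : ∀ g : BAlg F p, top g = 0 → top (g ^ 2) = 0 → eps g = 0 → T g = 0 := by
    intro g h1 h2 h3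
    have c0 : ∀ f : BAlg F p, top f = 0 → ∃ c : F, T f = algebraMap F _ c := by
      intro f hf
      obtain ⟨e1, e2⟩ := h f hf
      rw [LinearMap.zero_apply] at e2
      obtain ⟨c, hc⟩ := (K_eq_iff e1 (map_zero _)).1 (e2.symm.trans (map_zero K).symm)
      exact ⟨c, by rw [hc, zero_add]⟩
    obtain ⟨c, hc⟩ := c0 g h1
    obtain ⟨c', hc'⟩ := c0 _ h2
    have h4 := hT.map_pow_succ g 1
    rw [hc', hc] at h4
    have h5 := congrArg eps h4
    rw [map_smul, map_mul, pow_one, h3, zero_mul, smul_zero, AlgHom.commutes] at h5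
    have h6 : c' = 0 := h5
    rw [h6, map_zero, pow_one] at h4
    by_cases hc0 : c = 0
    · rw [hc, hc0, map_zero]
    have h7 : ((1 + 1 : ℕ) : F) ≠ 0 := by exact_mod_cast two_ne_zero' (F := F) hp
    have h8 : g * algebraMap F _ c = 0 := by
      rcases smul_eq_zero.1 h4.symm with h | h
      · exact absurd h h7
      · exact h
    have h9 : g = 0 := by
      have := congrArg (fun x => x * algebraMap F (BAlg F p) c⁻¹) h8
      simpa [mul_assoc, ← map_mul, mul_inv_cancel₀ hc0] using this
    rw [h9, map_zero]
  refine hT.ext (T' := 0) (fun f g => by simp) ?_ ?_ ?_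
  · exact key _ (cf_top_gX hp) (cf_top_gX_sq hp) eps_gX
  · exact key _ (cf_top_gY hp) (cf_top_gY_sq hp) eps_gY
  · exact key _ (cf_top_gZ hp) (cf_top_gZ_sq hp) eps_gZ

theorem Rep.der_eq (hp : 3 < p) {x : EndS F p} {T T' : EndB F p} (h : Rep x T) (h' : Rep x T')
    (hT : IsDer T) (hT' : IsDer T') : T = T' := by
  have h0 := h.sub h'
  rw [sub_self] at h0
  exact sub_eq_zero.1 (h0.der_eq_zero hp (hT.sub hT'))

theorem rep_rho (f : Pot F p) : Rep (rho F p (DGL f)) (op f) := by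
  intro g hg
  refine ⟨top_op f g, Subtype.ext ?_⟩
  rw [coe_K (top_op f g), ← lie_DGL_inB, ← coe_K hg]
  rfl

theorem rep_rho_inB (f : BAlg F p) : Rep (rho F p (DGL (inB f))) (pbL f) := rep_rho (inB f)

theorem d1El_eq : d1El p F = DGL (inB (-gZ : BAlg F p)) := by
  apply Subtype.ext
  rw [coe_DGL]
  refine Derivation.ext fun f => ?_
  rw [dH_apply, coe_inB]
  have : ((-gZ : BAlg F p) : O2 F) = -mon (0, 1) := by
    rw [← coe_mb (p := p) (pow_pos pos_p 2) (one_lt_p p)]; rfl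
  rw [this, map_neg, map_neg, D1_mon, D2_mon]
  simp [show (mon (0, 0) : O2 F) = 1 from rfl]
  rfl

theorem pbL_neg_gZ : pbL (-gZ : BAlg F p) = ((d1 : Derivation F (BAlg F p) (BAlg F p)) : BAlg F p →ₗ[F] BAlg F p) := by
  refine LinearMap.ext fun f => ?_
  simp [pb, d1_gZ, d2_gZ]

theorem rep_d1El : Rep (rho F p (d1El p F)) ((d1 : Derivation F (BAlg F p) (BAlg F p)) : BAlg F p →ₗ[F] BAlg F p) := by
  rw [d1El_eq, ← pbL_neg_gZ]; exact rep_rho_inB _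

theorem rep_d1El_pow : Rep (rho F p (d1El p F) ^ p) (Del F p) := rep_d1El.pow p

/-! ### The `p`-envelopes -/

theorem lie_EndS (x y : EndS F p) : ⁅x, y⁆ = x * y - y * x := rfl

theorem mem_pEnvelope_of_subset {M : Set (EndS F p)} {K : LieSubalgebra F (EndS F p)}
    (h1 : M ⊆ K) (h2 : ∀ x ∈ K, x ^ p ∈ K) {x : EndS F p} (hx : x ∈ pEnvelope M) : x ∈ K :=
  (sInf_le (show K ∈ {K : LieSubalgebra F (EndS F p) | M ⊆ K ∧ ∀ x ∈ K, x ^ p ∈ K} from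
    ⟨h1, h2⟩) : pEnvelope M ≤ K) hx

theorem subset_pEnvelope {M : Set (EndS F p)} {x : EndS F p} (hx : x ∈ M) : x ∈ pEnvelope M := by
  rw [pEnvelope, ← SetLike.mem_coe, LieSubalgebra.coe_sInf, Set.mem_iInter₂]
  rintro K ⟨h1, -⟩
  exact h1 hx

theorem pow_mem_pEnvelope {M : Set (EndS F p)} {x : EndS F p} (hx : x ∈ pEnvelope M) :
    x ^ p ∈ pEnvelope M := by
  rw [pEnvelope, ← SetLike.mem_coe, LieSubalgebra.coe_sInf, Set.mem_iInter₂] at hx ⊢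
  rintro K ⟨h1, h2⟩
  exact h2 _ (hx K ⟨h1, h2⟩)

theorem rho_mem_GG (x : GAlg F p) : rho F p x ∈ GG F p := subset_pEnvelope ⟨x, rfl⟩

/-- The endomorphisms induced by Poisson derivations form a Lie algebra closed under p-th powers
which contains the image of `G`. -/
theorem GG_exists {x : EndS F p} (hx : x ∈ GG F p) : ∃ T, IsPD T ∧ Rep x T := by
  let M : LieSubalgebra F (EndS F p) :=
    { carrier := {x | ∃ T, IsPD T ∧ Rep x T}
      zero_mem' := ⟨0, ⟨fun f g => by simp, fun f g => by simp⟩, Rep.zero⟩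
      add_mem' := by
        rintro _ _ ⟨T, h1, h2⟩ ⟨T', h1', h2'⟩
        exact ⟨_, h1.add h1', h2.add h2'⟩
      smul_mem' := by
        rintro c _ ⟨T, h1, h2⟩
        exact ⟨_, h1.smul c, h2.smul c⟩
      lie_mem' := by
        rintro _ _ ⟨T, h1, h2⟩ ⟨T', h1', h2'⟩
        exact ⟨_, h1.lie h1', (h2.mul h2').sub (h2'.mul h2)⟩ }
  refine mem_pEnvelope_of_subset (K := M) ?_ ?_ hx
  · rintro _ ⟨y, rfl⟩
    obtain ⟨f, rfl⟩ := DGL_surjective y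
    exact ⟨_, op_isPD f, rep_rho f⟩
  · rintro x ⟨T, h1, h2⟩
    exact ⟨_, h1.pow_p, h2.pow p⟩

/-- The Lie derivative of 1-forms `g₁ dx₁ + g₂ dx₂` along a derivation. -/
def lieDer (T : EndB F p) : Module.End F (BAlg F p × BAlg F p) where
  toFun v := (T v.1 + v.1 * d1 (T gX) + v.2 * d1 (T gZ), T v.2 + v.1 * d2 (T gX) + v.2 * d2 (T gZ))
  map_add' v w := by
    ext1 <;> simp only [Prod.fst_add, Prod.snd_add, map_add, add_mul] <;> abel
  map_smul' c v := by
    ext1 <;> simp only [Prod.smul_fst, Prod.smul_snd, map_smul, smul_mul_assoc, smul_add,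
      RingHom.id_apply]

/-- The differential of a function. -/
def dif (f : BAlg F p) : BAlg F p × BAlg F p := (d1 f, d2 f)

theorem lieDer_dif {T : EndB F p} (hT : IsPD T) (g : BAlg F p) :
    lieDer T (dif g) = dif (T g) := by
  obtain ⟨f, b, rfl⟩ := hT.exists_op
  have hh : d1 (⟨D2 (f : O2 F), f.2.2⟩ : BAlg F p) = d2 (⟨D1 (f : O2 F), f.2.1⟩ : BAlg F p) :=
    Subtype.ext (D1_D2_comm _)
  simp only [lieDer, dif, LinearMap.coe_mk, AddHom.coe_mk, LinearMap.add_apply,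
    LinearMap.smul_apply, op_apply, d1_gX, d2_gX, d1_gZ, d2_gZ, Del_gX, Del_gZ, map_add, map_sub,
    Derivation.leibniz, Derivation.map_smul, smul_eq_mul, Del_d1, Del_d2, d1_d2_comm, hh,
    mul_zero, mul_one, smul_zero, add_zero, sub_zero, zero_sub, map_neg]
  ext1 <;> simp only <;> ring

theorem lieDer_smul {T : EndB F p} (hT : IsDer T) (h : BAlg F p) (v : BAlg F p × BAlg F p) :
    lieDer T (h • v) = T h • v + h • lieDer T v := by
  ext1 <;>
  · simp only [lieDer, LinearMap.coe_mk, AddHom.coe_mk, Prod.smul_fst, Prod.smul_snd,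
      smul_eq_mul, hT _ _, Prod.fst_add, Prod.snd_add]
    ring

theorem lieDer_pow_dif {T : EndB F p} (hT : IsPD T) (n : ℕ) (g : BAlg F p) :
    (lieDer T ^ n) (dif g) = dif ((T ^ n) g) := by
  induction n with
  | zero => rfl
  | succ n ih =>
    rw [pow_succ', Module.End.mul_apply, ih, lieDer_dif hT, ← Module.End.mul_apply, ← pow_succ']

/-- Apply the Lie derivative along T to θ = x₁dx₂. It sends θ to the exact form d(x₁·D₁f − f), so
its p-th power sends θ to dg' with g' = T^{p-1}(x₁·D₁f − f), an element in the image of T. By the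
characteristic p Leibniz rule it also sends θ to (T^p x₁)dx₂ + x₁d(T^p x₂). Comparison gives f' =
x₁·D₁f' − g' + const for the potential f' of T^p. As x₁·D₁f' = D₁(x₁f') − f', the highest
coefficient of f' satisfies 2·top f' = 0. -/
theorem pow_p_of_inB (hp : 3 < p) (f : BAlg F p) (b : F) :
    ∃ (f' : BAlg F p) (b' : F), top f' = 0 ∧ (pbL f + b • Del F p) ^ p = pbL f' + b' • Del F p := by
  set T := pbL f + b • Del F p with hTdef
  have hT : IsPD T := (IsPD.pb_left f).add (Del_isPD.smul b)
  obtain ⟨f', b', hf'⟩ := hT.pow_p.exists_op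
  have hTX : T gX = -d2 f := by
    simp [hTdef, pb, d1_gX, d2_gX, Del_gX]
  have hTZ : T gZ = d1 f := by
    simp [hTdef, pb, d1_gZ, d2_gZ, Del_gZ]
  let θ : BAlg F p × BAlg F p := (gX : BAlg F p) • dif gZ
  have h1 : lieDer T θ = dif (gX * d1 f - f) := by
    rw [lieDer_smul hT.1, lieDer_dif hT, hTX, hTZ]
    ext1 <;> simp [dif, d1_gZ, d2_gZ, d1_gX, d2_gX] <;> ring
  obtain ⟨m, hm⟩ : ∃ m, p = m + 1 + 1 := ⟨p - 2, by omega⟩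
  have h2 : (lieDer T ^ p) θ = dif ((T ^ (m + 1)) (gX * d1 f - f)) := by
    rw [← lieDer_pow_dif hT, ← h1, ← Module.End.mul_apply, ← pow_succ, ← hm]
  have h3 : (lieDer T ^ p) θ = (T ^ p) (gX : BAlg F p) • dif gZ + (gX : BAlg F p) • dif ((T ^ p) gZ) := by
    have := leibniz_pow_char (p := p) (F := F)
      (LinearMap.mk₂ F (fun (h : BAlg F p) (v : BAlg F p × BAlg F p) => h • v)
        (fun _ _ _ => add_smul _ _ _) (fun _ _ _ => smul_assoc _ _ _)
        (fun _ _ _ => smul_add _ _ _) (fun _ _ _ => smul_comm _ _ _)) T (lieDer T) (lieDer T)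
      (fun h v => lieDer_smul hT.1 h v) gX (dif gZ)
    simp only [LinearMap.mk₂_apply] at this
    rw [← lieDer_pow_dif hT]
    exact this
  set g' := (T ^ (m + 1)) (gX * d1 f - f) with hg'
  have htop : top g' = 0 := by
    rw [hg', pow_succ', Module.End.mul_apply]
    exact hT.top_apply _
  rw [h2] at h3
  have hX' : (T ^ p) gX = -(⟨D2 (f' : O2 F), f'.2.2⟩ : BAlg F p) := by
    rw [hf']; simp [op_apply, d1_gX, d2_gX, Del_gX]
  have hZ' : (T ^ p) gZ = (⟨D1 (f' : O2 F), f'.2.1⟩ : BAlg F p) := by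
    rw [hf']; simp [op_apply, d1_gZ, d2_gZ, Del_gZ]
  rw [hX', hZ'] at h3
  have e1 := congrArg Prod.fst h3
  have e2 := congrArg Prod.snd h3
  simp only [dif, Prod.fst_add, Prod.smul_fst, Prod.snd_add, Prod.smul_snd, d1_gZ, d2_gZ,
    smul_eq_mul, mul_zero, zero_add, mul_one] at e1 e2
  have hconst : ∃ c : F, (f' : O2 F) = ((gX * (⟨D1 (f' : O2 F), f'.2.1⟩ : BAlg F p) - g' +
      algebraMap F _ c : BAlg F p) : O2 F) := by
    have e3 := O2_const_of_D (f := (f' : O2 F) -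
      ((gX * (⟨D1 (f' : O2 F), f'.2.1⟩ : BAlg F p) - g' : BAlg F p) : O2 F)) ?_ ?_
    · refine ⟨coeff (0, 0) ((f' : O2 F) - ((gX * (⟨D1 (f' : O2 F), f'.2.1⟩ : BAlg F p) - g' :
        BAlg F p) : O2 F)), (sub_eq_iff_eq_add'.1 e3).trans ?_⟩
      rw [Algebra.algebraMap_eq_smul_one]
      rfl
    · rw [map_sub, ← coe_d1, map_sub, e1, Derivation.leibniz, d1_gX]
      simp
    · rw [map_sub, ← coe_d2, map_sub, e2, Derivation.leibniz, d2_gX]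
      simp
  obtain ⟨c, hc⟩ := hconst
  set f'' : BAlg F p := gX * (⟨D1 (f' : O2 F), f'.2.1⟩ : BAlg F p) - g' + algebraMap F _ c with hf''
  have hin : f' = inB f'' := Subtype.ext hc
  refine ⟨f'', b', ?_, by rw [hf', hin, op_inB]⟩
  have h4 : (⟨D1 (f' : O2 F), f'.2.1⟩ : BAlg F p) = d1 f'' := Subtype.ext (by
    change D1 (f' : O2 F) = D1 (f'' : O2 F); rw [hc])
  have h5 : f'' = d1 (gX * f'') - f'' - g' + algebraMap F _ c := by
    have : d1 (gX * f'') = gX * d1 f'' + f'' := by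
      rw [Derivation.leibniz, d1_gX]; simp
    rw [this, ← h4, hf'']; ring
  have h6 : top f'' = top (d1 (gX * f'')) - top f'' - top g' + top (algebraMap F (BAlg F p) c) := by
    rw [← map_sub, ← map_sub, ← map_add, ← h5]
  rw [top_d1, htop, top_algebraMap] at h6
  have h7 : (2 : F) * top f'' = 0 := by linear_combination h6
  exact (mul_eq_zero.1 h7).resolve_left (two_ne_zero' hp)

theorem pbL_lie (f g : BAlg F p) : pbL f * pbL g - pbL g * pbL f = pbL (pb f g) := by
  refine LinearMap.ext fun h => ?_
  simp only [LinearMap.sub_apply, Module.End.mul_apply, pbL_apply]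
  rw [pb_jacobi f g h]; abel

theorem IsPD.lie_pbL {T : EndB F p} (hT : IsPD T) (f : BAlg F p) :
    T * pbL f - pbL f * T = pbL (T f) := by
  refine LinearMap.ext fun h => ?_
  simp only [LinearMap.sub_apply, Module.End.mul_apply, pbL_apply]
  rw [hT.2]; abel

/-- The p-th powers neither leave 𝒪(2;(2,1)) nor produce the highest monomial, by `pow_p_of_inB`. So
only D₁^p is added to `S`, and membership of an element of `S_p` in `S` is decided by its
coefficient b. -/
theorem Sp_exists (hp : 3 < p) {x : EndS F p} (hx : x ∈ Sp F p) :
    ∃ (f : BAlg F p) (b : F), top f = 0 ∧ Rep x (pbL f + b • Del F p) := by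
  let M : LieSubalgebra F (EndS F p) :=
    { carrier := {x | ∃ (f : BAlg F p) (b : F), top f = 0 ∧ Rep x (pbL f + b • Del F p)}
      zero_mem' := ⟨0, 0, map_zero _, by simpa using Rep.zero⟩
      add_mem' := by
        rintro _ _ ⟨f, b, h1, h2⟩ ⟨f', b', h1', h2'⟩
        refine ⟨f + f', b + b', by rw [map_add, h1, h1', add_zero], ?_⟩
        have := h2.add h2'
        rwa [add_add_add_comm, ← map_add, ← add_smul] at this
      smul_mem' := by
        rintro c _ ⟨f, b, h1, h2⟩
        refine ⟨c • f, c * b, by rw [map_smul, h1, smul_zero], ?_⟩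
        have := h2.smul c
        rwa [smul_add, smul_smul, ← map_smul] at this
      lie_mem' := by
        rintro x y ⟨f, b, h1, h2⟩ ⟨f', b', h1', h2'⟩
        refine ⟨pb f f' + b • Del F p f' - b' • Del F p f, 0, ?_, ?_⟩
        · rw [map_sub, map_add, map_smul, map_smul, top_pb, top_Del, top_Del]; simp
        · have h3 := (h2.mul h2').sub (h2'.mul h2)
          have e1 := Del_isPD.lie_pbL (F := F) (p := p) f
          have e2 := Del_isPD.lie_pbL (F := F) (p := p) f'
          have e3 := pbL_lie f f'
          rw [lie_EndS]
          convert h3 using 1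
          rw [zero_smul, add_zero, map_sub, map_add, map_smul, map_smul, ← e1, ← e2, ← e3]
          simp only [add_mul, mul_add, smul_mul_assoc, mul_smul_comm, smul_sub, smul_add]
          rw [smul_comm b' b]
          abel }
  refine mem_pEnvelope_of_subset (K := M) ?_ ?_ hx
  · rintro _ ⟨s, rfl⟩
    obtain ⟨f, hf, rfl⟩ := exists_K s
    refine ⟨f, 0, hf, ?_⟩
    rw [zero_smul, add_zero, coe_K hf]
    exact rep_rho_inB f
  · rintro x ⟨f, b, h1, h2⟩
    obtain ⟨f', b', h3, h4⟩ := pow_p_of_inB hp f b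
    exact ⟨f', b', h3, by rw [← h4]; exact h2.pow p⟩

/-! ### Automorphisms of `S` -/

/-- The kernel is stable under D₁ and D₂, which are brackets with x₂ and x₁. Induction on the degree
reduces a kernel element to a constant, and constants are excluded by the value at 1. -/
theorem injective_of_pb {Φ : BAlg F p →ₗ[F] BAlg F p}
    (hΦ : ∀ f g, Φ (pb f g) = pb (Φ f) (Φ g)) (h1 : Φ 1 ≠ 0) : Function.Injective Φ := by
  rw [← LinearMap.ker_eq_bot, eq_bot_iff]
  have key : ∀ n : ℕ, ∀ f : BAlg F p, Φ f = 0 → (∀ i j, cf i j f ≠ 0 → i + j < n) → f = 0 := by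
    intro n
    induction n with
    | zero =>
      intro f _ h
      apply BAlg_ext; intro i j
      by_contra hc
      exact absurd (h i j (by simpa using hc)) (by omega)
    | succ n ih =>
      intro f hf h
      have e1 : d1 f = 0 := by
        apply ih
        · have : d1 f = pb f gZ := by simp [pb, d1_gZ, d2_gZ]
          rw [this, hΦ, hf, pb_zero_left]
        · intro i j hc
          rw [cf_d1] at hc
          have := h _ _ hc
          omega
      have e2 : d2 f = 0 := by
        apply ih
        · have : d2 f = pb gX f := by simp [pb, d1_gX, d2_gX]
          rw [this, hΦ, hf, pb_zero_right]
        · intro i j hc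
          rw [cf_d2] at hc
          have := h _ _ hc
          omega
      have e3 := BAlg_const_of_d e1 e2
      rw [e3, Algebra.algebraMap_eq_smul_one, map_smul] at hf
      rcases smul_eq_zero.1 hf with h0 | h0
      · rw [e3, h0, map_zero]
      · exact absurd h0 h1
  intro f hf
  refine key (p ^ 2 + p) f hf fun i j hc => ?_
  by_contra hn
  exact hc (cf_eq_zero _ (by omega))

theorem top_map_of_pb {Φ : BAlg F p →ₗ[F] BAlg F p}
    (hΦ : ∀ f g, Φ (pb f g) = pb (Φ f) (Φ g)) {f : BAlg F p} (hf : top f = 0) :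
    top (Φ f) = 0 := by
  have h : Submodule.span F {x : BAlg F p | ∃ g h, x = pb g h} ≤
      Submodule.comap Φ (LinearMap.ker top) := by
    rw [Submodule.span_le]
    rintro _ ⟨g, h, rfl⟩
    change top _ = 0
    rw [hΦ, top_pb]
  exact h (mem_span_pb hf)

theorem map_const_of_pb {Φ : BAlg F p ≃ₗ[F] BAlg F p}
    (hΦ : ∀ f g, Φ (pb f g) = pb (Φ f) (Φ g)) (c : F) :
    ∃ c' : F, Φ (algebraMap F _ c) = algebraMap F _ c' := by
  have h0 : ∀ g, pb (Φ (algebraMap F _ c)) g = 0 := by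
    intro g
    rw [← Φ.apply_symm_apply g, ← hΦ, Algebra.algebraMap_eq_smul_one, pb_smul_left, pb_one_left,
      smul_zero, map_zero]
  refine ⟨_, BAlg_const_of_d ?_ ?_⟩
  · simpa [pb, d1_gZ, d2_gZ] using h0 gZ
  · simpa [pb, d1_gX, d2_gX] using h0 gX

theorem K_map_congr {Φ : BAlg F p ≃ₗ[F] BAlg F p}
    (hΦ : ∀ f g, Φ (pb f g) = pb (Φ f) (Φ g)) {f g : BAlg F p} (hf : top f = 0) (hg : top g = 0)
    (h : (K f : SAlg F p) = K g) : (K (Φ f) : SAlg F p) = K (Φ g) := by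
  obtain ⟨c, rfl⟩ := (K_eq_iff hf hg).1 h
  obtain ⟨e, he⟩ := map_const_of_pb hΦ c
  exact (K_eq_iff (top_map_of_pb (Φ := Φ.toLinearMap) hΦ hf)
    (top_map_of_pb (Φ := Φ.toLinearMap) hΦ hg)).2 ⟨e, by rw [map_add]; exact congrArg _ he⟩

/-- Automorphisms of the Poisson bracket of `𝒪(2;(2,1))` induce automorphisms of `S`. -/
theorem exists_aut (Φ : BAlg F p ≃ₗ[F] BAlg F p) (hΦ : ∀ f g, Φ (pb f g) = pb (Φ f) (Φ g)) :
    ∃ g : SAlg F p ≃ₗ⁅F⁆ SAlg F p, (∀ f, top f = 0 → g (K f) = K (Φ f)) ∧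
      ∀ x T, Rep x T →
        Rep (autAct g x) (Φ.toLinearMap.comp (T.comp Φ.symm.toLinearMap)) := by
  have hΨ : ∀ f g, Φ.symm (pb f g) = pb (Φ.symm f) (Φ.symm g) := by
    intro f g
    apply Φ.injective
    rw [hΦ]; simp
  have ht : ∀ {f}, top f = 0 → top (Φ f) = 0 := fun hf =>
    top_map_of_pb (Φ := Φ.toLinearMap) hΦ hf
  have ht' : ∀ {f}, top f = 0 → top (Φ.symm f) = 0 := fun hf =>
    top_map_of_pb (Φ := Φ.symm.toLinearMap) hΨ hf
  -- A potential is chosen for each element of `S`. Two potentials differ by a constant, and Φ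
  -- preserves constants because they are the centre of the bracket, so `hk` and `hk'` make the
  -- choice irrelevant.
  choose σ hσ1 hσ2 using exists_K (F := F) (p := p)
  have hk : ∀ f, top f = 0 → (K (Φ (σ (K f))) : SAlg F p) = K (Φ f) := fun f hf =>
    K_map_congr hΦ (hσ1 _) hf (hσ2 _).symm
  have hk' : ∀ f, top f = 0 → (K (Φ.symm (σ (K f))) : SAlg F p) = K (Φ.symm f) := fun f hf =>
    K_map_congr hΨ (hσ1 _) hf (hσ2 _).symm
  let g : SAlg F p ≃ₗ⁅F⁆ SAlg F p :=
    { toFun := fun s => K (Φ (σ s))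
      invFun := fun s => K (Φ.symm (σ s))
      map_add' := fun s s' => by
        obtain ⟨f, hf, rfl⟩ := exists_K s
        obtain ⟨f', hf', rfl⟩ := exists_K s'
        rw [← map_add, hk _ (by rw [map_add, hf, hf', add_zero]), hk _ hf, hk _ hf', map_add,
          map_add]
      map_smul' := fun c s => by
        obtain ⟨f, hf, rfl⟩ := exists_K s
        rw [← map_smul, hk _ (by rw [map_smul, hf, smul_zero]), hk _ hf, map_smul, map_smul]
        rfl
      map_lie' := fun {s s'} => by
        obtain ⟨f, hf, rfl⟩ := exists_K s
        obtain ⟨f', hf', rfl⟩ := exists_K s'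
        change K (Φ (σ ⁅K f, K f'⁆)) = ⁅K (Φ (σ (K f))), K (Φ (σ (K f')))⁆
        rw [lie_K hf hf', hk _ (top_pb _ _), hk _ hf, hk _ hf', hΦ, lie_K (ht hf) (ht hf')]
      left_inv := fun s => by
        obtain ⟨f, hf, rfl⟩ := exists_K s
        change K (Φ.symm (σ (K (Φ (σ (K f)))))) = _
        rw [hk f hf, hk' _ (ht hf), Φ.symm_apply_apply]
      right_inv := fun s => by
        obtain ⟨f, hf, rfl⟩ := exists_K s
        change K (Φ (σ (K (Φ.symm (σ (K f)))))) = _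
        rw [hk' f hf, hk _ (ht' hf), Φ.apply_symm_apply] }
  refine ⟨g, hk, fun x T h f hf => ?_⟩
  have hs : g.symm (K f) = K (Φ.symm f) := hk' f hf
  obtain ⟨e1, e2⟩ := h _ (ht' hf)
  refine ⟨ht e1, ?_⟩
  have : autAct g x (K f) = g (x (g.symm (K f))) := rfl
  rw [this, hs, e2]
  exact hk _ e1

/-! ### Eigenspace decomposition of toral operators -/

-- On the prime field 1 − (X − k)^{p-1} is the indicator function of k. The sum has degree below p
-- and takes the value 1 at p points.
open Polynomial in
theorem sum_eigenPoly : ∑ k ∈ Finset.range p, ((1 : F[X]) - (X - C (k : F)) ^ (p - 1)) = 1 := by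
  classical
  have hpp : p.Prime := Fact.out
  refine Polynomial.eq_of_degree_sub_lt_of_eval_finset_eq
    ((Finset.range p).image (fun k : ℕ => (k : F))) ?_ ?_
  · rw [Finset.card_image_of_injOn]
    · rw [Finset.card_range]
      refine lt_of_le_of_lt (degree_sub_le _ _) (max_lt ?_ ?_)
      · refine (degree_sum_le _ _).trans_lt ((Finset.sup_lt_iff ?_).2 ?_)
        · exact WithBot.bot_lt_coe _
        intro k _
        refine lt_of_le_of_lt (degree_sub_le _ _) (max_lt ?_ ?_)
        · rw [degree_one]; exact_mod_cast hpp.pos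
        · refine lt_of_le_of_lt (degree_pow_le _ _) ?_
          rw [degree_X_sub_C, nsmul_eq_mul, mul_one]
          exact_mod_cast Nat.sub_lt hpp.pos one_pos
      · rw [degree_one]; exact_mod_cast hpp.pos
    · intro a ha b hb hab
      have ha' := Finset.mem_range.1 (Finset.mem_coe.1 ha)
      have hb' := Finset.mem_range.1 (Finset.mem_coe.1 hb)
      have := (CharP.natCast_eq_natCast F p).1 hab
      rwa [Nat.ModEq, Nat.mod_eq_of_lt ha', Nat.mod_eq_of_lt hb'] at this
  · intro x hx
    obtain ⟨m, hm, rfl⟩ := Finset.mem_image.1 hx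
    rw [eval_finsetSum, Finset.sum_eq_single m]
    · simp [Nat.sub_ne_zero_of_lt hpp.one_lt]
    · intro k hk hkm
      have hne : (m : F) - (k : F) ≠ 0 := by
        intro h0
        have := (CharP.natCast_eq_natCast F p).1 (sub_eq_zero.1 h0)
        rw [Nat.ModEq, Nat.mod_eq_of_lt (Finset.mem_range.1 hm),
          Nat.mod_eq_of_lt (Finset.mem_range.1 hk)] at this
        exact hkm this.symm
      have h1 : ((m : F) - (k : F)) ^ p = (m : F) - (k : F) := by
        rw [sub_pow_char, ← Nat.cast_pow, ← Nat.cast_pow]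
        congr 1 <;>
        · rw [CharP.natCast_eq_natCast F p, ← ZMod.natCast_eq_natCast_iff]
          simp [ZMod.pow_card]
      have h2 : ((m : F) - (k : F)) ^ (p - 1) = 1 := by
        apply mul_right_cancel₀ hne
        rw [← pow_succ, Nat.sub_add_cancel hpp.one_lt.le, h1, one_mul]
      simp [h2]
    · intro h; exact absurd hm h

theorem cast_pow_p (k : ℕ) : (k : F) ^ p = k := by
  rw [← Nat.cast_pow, CharP.natCast_eq_natCast F p, ← ZMod.natCast_eq_natCast_iff]
  simp [ZMod.pow_card]

/-- The projection to an eigenspace of a toral operator. -/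
def eproj (T : EndB F p) (k : ℕ) : EndB F p := 1 - (T - (k : F) • 1) ^ (p - 1)

theorem sum_eproj (T : EndB F p) : ∑ k ∈ Finset.range p, eproj T k = 1 := by
  have := congrArg (Polynomial.aeval T) (sum_eigenPoly (F := F) (p := p))
  simp only [map_sum, map_sub, map_one, map_pow, Polynomial.aeval_X, Polynomial.aeval_C,
    Algebra.algebraMap_eq_smul_one] at this
  exact this

theorem apply_eproj {T : EndB F p} (hT : T ^ p = T) (k : ℕ) (a : BAlg F p) :
    T (eproj T k a) = (k : F) • eproj T k a := by
  have h : (T - (k : F) • 1) * eproj T k = 0 := by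
    have e : (T - (k : F) • 1) ^ p = T - (k : F) • 1 := by
      have := congrArg (Polynomial.aeval T)
        (sub_pow_char (p := p) (Polynomial.X : Polynomial F) (Polynomial.C (k : F)))
      rw [← Polynomial.C_pow, cast_pow_p] at this
      simp only [map_sub, map_pow, Polynomial.aeval_X, Polynomial.aeval_C,
        Algebra.algebraMap_eq_smul_one, hT] at this
      exact this
    rw [eproj, mul_sub, mul_one, ← pow_succ', Nat.sub_add_cancel (one_lt_p p).le, e, sub_self]
  have := LinearMap.congr_fun h a
  simpa [sub_eq_zero] using this

/-- A linear map of rank at most `p²` which is injective on all eigenspaces of a toral operator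
maps every eigenspace onto its image. -/
theorem exists_eigen_lift {T : EndB F p} (hT : T ^ p = T) (e : EndB F p)
    (hr : Module.finrank F (LinearMap.range e) ≤ p ^ 2)
    (hinj : ∀ k < p, ∀ a, T a = (k : F) • a → e a = 0 → a = 0) {k : ℕ} (hk : k < p)
    (r : BAlg F p) : ∃ a, T a = (k : F) • a ∧ e a = e r := by
  classical
  -- Ψ records e on all p eigencomponents at once. It is injective, and its target has dimension at
  -- most p·p² = dim 𝒪(2;(2,1)), so it is bijective.
  let Ψ : BAlg F p →ₗ[F] (Fin p → LinearMap.range e) :=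
    LinearMap.pi fun k => e.rangeRestrict.comp (eproj T k)
  have hΨ : Function.Injective Ψ := by
    rw [injective_iff_map_eq_zero]
    intro a ha
    have h0 : ∀ k < p, eproj T k a = 0 := fun k hk => by
      refine hinj k hk _ (apply_eproj hT k a) ?_
      have := congrArg (fun v => ((v ⟨k, hk⟩ : LinearMap.range e) : BAlg F p)) ha
      exact this
    have h1 := LinearMap.congr_fun (sum_eproj T) a
    rw [LinearMap.sum_apply] at h1
    rw [← Module.End.one_apply (R := F) a, ← h1]
    exact Finset.sum_eq_zero fun k hk => h0 k (Finset.mem_range.1 hk)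
  have hle := LinearMap.finrank_le_finrank_of_injective hΨ
  have hfr : Module.finrank F (Fin p → LinearMap.range e) =
      p * Module.finrank F (LinearMap.range e) := by
    rw [Module.finrank_pi_fintype]; simp
  have heq : Module.finrank F (BAlg F p) = Module.finrank F (Fin p → LinearMap.range e) := by
    refine le_antisymm hle ?_
    rw [hfr, finrank_BAlg, mul_comm]
    exact Nat.mul_le_mul_right _ hr
  have hsurj := (LinearMap.injective_iff_surjective_of_finrank_eq_finrank heq).1 hΨ
  obtain ⟨a, ha⟩ := hsurj (Pi.single ⟨k, hk⟩ ⟨e r, ⟨r, rfl⟩⟩)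
  refine ⟨eproj T k a, apply_eproj hT k a, ?_⟩
  have := congrArg (fun v => ((v ⟨k, hk⟩ : LinearMap.range e) : BAlg F p)) ha
  simpa [Ψ] using this

/-- If `E a` is a combination of `a` and derivatives of `a` which commute with `E` and `ev`, then
`a` vanishes as soon as `ev a` does. -/
theorem eq_zero_of_ev {ev : BAlg F p →ₐ[F] BAlg F p} {E d d' : EndB F p} (hE : IsDer E)
    (hd : ∀ a, d (E a) = E (d a)) (hd' : ∀ a, d' (E a) = E (d' a))
    (hev : ∀ a, ev (d a) = d (ev a)) (hev' : ∀ a, ev (d' a) = d' (ev a))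
    (hsep : ∀ a, (∀ n, ev ((E ^ n) a) = 0) → a = 0) {a c c₁ c₂ : BAlg F p}
    (h : E a = c * a + c₁ * d a + c₂ * d' a) (h0 : ev a = 0) : a = 0 := by
  -- The J m are ideals stable under d and d', the vanishing orders along the locus of `ev` in the
  -- direction of E. By the equation, a ∈ J m implies E a ∈ J m, and with ev a = 0 this gives a ∈ J
  -- (m + 1).
  let J : ℕ → Set (BAlg F p) := fun m => {b | ∀ n < m, ev ((E ^ n) b) = 0}
  have Jsucc : ∀ m b, b ∈ J (m + 1) ↔ ev b = 0 ∧ E b ∈ J m := by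
    intro m b
    constructor
    · intro hb
      refine ⟨hb 0 (Nat.succ_pos _), fun n hn => ?_⟩
      have := hb (n + 1) (by omega)
      rwa [pow_succ, Module.End.mul_apply] at this
    · rintro ⟨h1, h2⟩ n hn
      rcases n with _ | n
      · exact h1
      · rw [pow_succ, Module.End.mul_apply]; exact h2 n (by omega)
  have Jle : ∀ m b, b ∈ J (m + 1) → b ∈ J m := fun m b hb n hn => hb n (by omega)
  have Jadd : ∀ m b b', b ∈ J m → b' ∈ J m → b + b' ∈ J m := by
    intro m b b' hb hb' n hn
    rw [map_add, map_add, hb n hn, hb' n hn, add_zero]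
  have Jmul : ∀ m b x, x ∈ J m → b * x ∈ J m := by
    intro m
    induction m with
    | zero => intro b x _ n hn; omega
    | succ m ih =>
      intro b x hx
      obtain ⟨h1, h2⟩ := (Jsucc m x).1 hx
      refine (Jsucc m _).2 ⟨by rw [map_mul, h1, mul_zero], ?_⟩
      rw [hE]
      refine Jadd _ _ _ (ih _ _ h2) ?_
      rw [mul_comm]
      exact ih _ _ (Jle _ _ hx)
  have hcomm : ∀ {δ : EndB F p}, (∀ a, δ (E a) = E (δ a)) → ∀ n a, (E ^ n) (δ a) = δ ((E ^ n) a) := by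
    intro δ hδ n
    induction n with
    | zero => intro a; rfl
    | succ n ih => intro a; rw [pow_succ, Module.End.mul_apply, ← hδ, ih]; rfl
  have Jd : ∀ m b, b ∈ J m → d b ∈ J m := fun m b hb n hn => by
    rw [hcomm hd, hev, hb n hn, map_zero]
  have Jd' : ∀ m b, b ∈ J m → d' b ∈ J m := fun m b hb n hn => by
    rw [hcomm hd', hev', hb n hn, map_zero]
  have key : ∀ m, a ∈ J m := by
    intro m
    induction m with
    | zero => intro n hn; omega
    | succ m ih =>
      refine (Jsucc m a).2 ⟨h0, ?_⟩
      rw [h]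
      exact Jadd _ _ _ (Jadd _ _ _ (Jmul _ _ _ ih) (Jmul _ _ _ (Jd _ _ ih)))
        (Jmul _ _ _ (Jd' _ _ ih))
  exact hsep a fun n => key (n + 1) n (Nat.lt_succ_self n)

/-! ### The evaluations at `x₂ = 0` and at `x₁^{(p)} = 0` -/

/-- Evaluation at `x₂ = 0`. -/
def ev : BAlg F p →ₐ[F] BAlg F p :=
  tau gX gY 0 gX_pow_p gY_pow_p (zero_pow (Fact.out : p.Prime).ne_zero)

/-- Evaluation at `x₁^{(p)} = 0`. -/
def evY : BAlg F p →ₐ[F] BAlg F p :=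
  tau gX 0 gZ gX_pow_p (zero_pow (Fact.out : p.Prime).ne_zero) gZ_pow_p

@[simp] theorem ev_gX : ev (gX : BAlg F p) = gX := tau_gX _ _ _
@[simp] theorem ev_gY : ev (gY : BAlg F p) = gY := tau_gY _ _ _
@[simp] theorem ev_gZ : ev (gZ : BAlg F p) = 0 := tau_gZ _ _ _
@[simp] theorem evY_gX : evY (gX : BAlg F p) = gX := tau_gX _ _ _
@[simp] theorem evY_gY : evY (gY : BAlg F p) = 0 := tau_gY _ _ _
@[simp] theorem evY_gZ : evY (gZ : BAlg F p) = gZ := tau_gZ _ _ _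

theorem algHom_ext_gen {R : Type*} [CommRing R] [Algebra F R] {φ ψ : BAlg F p →ₐ[F] R}
    (hX : φ gX = ψ gX) (hY : φ gY = ψ gY) (hZ : φ gZ = ψ gZ) : φ = ψ := by
  ext f
  induction f using gen_induction with
  | hX => exact hX
  | hY => exact hY
  | hZ => exact hZ
  | hc c => rw [AlgHom.commutes, AlgHom.commutes]
  | hadd f g hf hg => rw [map_add, map_add, hf, hg]
  | hmul f g hf hg => rw [map_mul, map_mul, hf, hg]

@[simp] theorem ev_ev (f : BAlg F p) : ev (ev f) = ev f := by
  have : (ev (F := F) (p := p)).comp ev = ev := algHom_ext_gen (by simp) (by simp) (by simp)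
  exact congrArg (fun φ => φ f) this

@[simp] theorem eps_ev (f : BAlg F p) : eps (ev f) = eps f := by
  have : (eps (F := F) (p := p)).comp ev = eps := algHom_ext_gen (by simp) (by simp) (by simp)
  exact congrArg (fun φ => φ f) this

@[simp] theorem eps_evY (f : BAlg F p) : eps (evY f) = eps f := by
  have : (eps (F := F) (p := p)).comp evY = eps := algHom_ext_gen (by simp) (by simp) (by simp)
  exact congrArg (fun φ => φ f) this

/-- Two derivations along an algebra homomorphism agree if they agree on the generators. -/
theorem derivation_along_ext {φ : BAlg F p →ₐ[F] BAlg F p} {A B : EndB F p}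
    (hA : ∀ f g, A (f * g) = φ f * A g + φ g * A f) (hB : ∀ f g, B (f * g) = φ f * B g + φ g * B f)
    (hX : A gX = B gX) (hY : A gY = B gY) (hZ : A gZ = B gZ) : A = B := by
  have h1 : ∀ {A : EndB F p}, (∀ f g, A (f * g) = φ f * A g + φ g * A f) → A 1 = 0 := by
    intro A hA
    have := hA 1 1
    rw [mul_one, map_one φ, one_mul] at this
    simpa using this
  refine LinearMap.ext fun f => ?_
  induction f using gen_induction with
  | hX => exact hX
  | hY => exact hY
  | hZ => exact hZ
  | hc c => rw [Algebra.algebraMap_eq_smul_one, map_smul, map_smul, h1 hA, h1 hB]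
  | hadd f g hf hg => rw [map_add, map_add, hf, hg]
  | hmul f g hf hg => rw [hA, hB, hf, hg]

/-- An algebra endomorphism intertwines two derivations if it does so on the generators. -/
theorem map_der_of_gen {φ : BAlg F p →ₐ[F] BAlg F p} {D D' : EndB F p} (hD : IsDer D)
    (hD' : IsDer D') (hX : φ (D gX) = D' (φ gX)) (hY : φ (D gY) = D' (φ gY))
    (hZ : φ (D gZ) = D' (φ gZ)) (f : BAlg F p) : φ (D f) = D' (φ f) := by
  have := derivation_along_ext (φ := φ) (A := φ.toLinearMap.comp D) (B := D'.comp φ.toLinearMap)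
    (fun f g => by simp [hD f g]) (fun f g => by simp [hD' (φ f) (φ g)]) hX hY hZ
  exact LinearMap.congr_fun this f

/-- `D₁` as an endomorphism. -/
def d1L (F : Type*) [Field F] (p : ℕ) [Fact p.Prime] [CharP F p] : EndB F p :=
  ((d1 : Derivation F (BAlg F p) (BAlg F p)) : BAlg F p →ₗ[F] BAlg F p)

/-- `D₂` as an endomorphism. -/
def d2L (F : Type*) [Field F] (p : ℕ) [Fact p.Prime] [CharP F p] : EndB F p :=
  ((d2 : Derivation F (BAlg F p) (BAlg F p)) : BAlg F p →ₗ[F] BAlg F p)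

@[simp] theorem d1L_apply (f : BAlg F p) : d1L F p f = d1 f := rfl

@[simp] theorem d2L_apply (f : BAlg F p) : d2L F p f = d2 f := rfl

theorem d1_isDer : IsDer (d1L F p) := Derivation.isDer d1

theorem d2_isDer : IsDer (d2L F p) := Derivation.isDer d2

/-! ### Evaluations, derivations and coefficients -/

theorem ev_d1 (f : BAlg F p) : ev (d1 f) = d1 (ev f) :=
  map_der_of_gen d1_isDer d1_isDer (by simp [d1_gX]) (by simp [d1_gY]) (by simp [d1_gZ]) f

theorem ev_Del (f : BAlg F p) : ev (Del F p f) = Del F p (ev f) :=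
  map_der_of_gen Del_isPD.1 Del_isPD.1 (by simp [Del_gX]) (by simp [Del_gY]) (by simp [Del_gZ]) f

theorem d2_ev (f : BAlg F p) : d2 (ev f) = 0 := by
  have := derivation_along_ext (φ := ev)
    (A := (d2L F p).comp
      (ev (F := F) (p := p)).toLinearMap) (B := 0) (fun f g => by simp) (fun f g => by simp)
    (by simp [d2_gX]) (by simp [d2_gY]) (by simp)
  exact LinearMap.congr_fun this f

theorem evY_d2 (f : BAlg F p) : evY (d2 f) = d2 (evY f) :=
  map_der_of_gen d2_isDer d2_isDer (by simp [d2_gX]) (by simp [d2_gY]) (by simp [d2_gZ]) f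

theorem Del_evY (f : BAlg F p) : Del F p (evY f) = 0 := by
  have := derivation_along_ext (φ := evY)
    (A := (Del F p).comp (evY (F := F) (p := p)).toLinearMap) (B := 0)
    (fun f g => by simp [Del_isPD.1 (evY f) (evY g)]) (fun f g => by simp)
    (by simp [Del_gX]) (by simp) (by simp [Del_gZ])
  exact LinearMap.congr_fun this f

theorem ev_mb (i j : ℕ) : ev (mb i j : BAlg F p) = if j = 0 then mb i 0 else 0 := by
  by_cases h : i < p ^ 2 ∧ j < p
  · rw [ev, tau_mb _ _ _ h.1 h.2, dpw_zero_left]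
    split_ifs
    · rw [mb_eq_dpw h.1 pos_p]; simp
    · simp
  · rw [mb_eq_zero h, map_zero]
    split_ifs with hj
    · rw [mb_eq_zero fun h' => h ⟨h'.1, by omega⟩]
    · rfl

theorem evY_mb (i j : ℕ) : evY (mb i j : BAlg F p) = if i < p then mb i j else 0 := by
  by_cases h : i < p ^ 2 ∧ j < p
  · rw [evY, tau_mb _ _ _ h.1 h.2, dpw_zero_left]
    have : i / p = 0 ↔ i < p := by
      rw [Nat.div_eq_zero_iff]; have := pos_p (p := p); omega
    simp only [this]
    split_ifs with hi
    · rw [mb_eq_dpw h.1 h.2, Nat.div_eq_of_lt hi]; simp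
    · simp
  · rw [mb_eq_zero h, map_zero]
    split_ifs <;> rfl

theorem cf_ev (i : ℕ) (f : BAlg F p) : cf i 0 (ev f) = cf i 0 f := by
  have : (cf i 0).comp (ev (F := F) (p := p)).toLinearMap = cf i 0 := by
    refine BAlg_hom_ext fun k l hk hl => ?_
    simp only [LinearMap.comp_apply, AlgHom.toLinearMap_apply, ev_mb]
    split_ifs with h
    · rw [h]
    · rw [cf_mb hk hl, if_neg fun hh => h hh.2, map_zero]
  exact LinearMap.congr_fun this f

theorem cf_evY {i : ℕ} (hi : i < p) (j : ℕ) (f : BAlg F p) : cf i j (evY f) = cf i j f := by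
  have : (cf i j).comp (evY (F := F) (p := p)).toLinearMap = cf i j := by
    refine BAlg_hom_ext fun k l hk hl => ?_
    simp only [LinearMap.comp_apply, AlgHom.toLinearMap_apply, evY_mb]
    split_ifs with h
    · rfl
    · rw [cf_mb hk hl, if_neg fun hh => h (by omega), map_zero]
  exact LinearMap.congr_fun this f

theorem finrank_range_ev :
    Module.finrank F (LinearMap.range (ev (F := F) (p := p)).toLinearMap) ≤ p ^ 2 := by
  have h : LinearMap.range (ev (F := F) (p := p)).toLinearMap ≤
      Submodule.span F (Set.range fun i : Fin (p ^ 2) => (mb (i : ℕ) 0 : BAlg F p)) := by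
    rw [LinearMap.range_eq_map, ← span_mb, Submodule.map_span, Submodule.span_le]
    rintro _ ⟨_, ⟨a, rfl⟩, rfl⟩
    simp only [AlgHom.toLinearMap_apply, ev_mb]
    split_ifs
    · exact Submodule.subset_span ⟨a.1, rfl⟩
    · exact zero_mem _
  refine (Submodule.finrank_mono h).trans ((finrank_range_le_card _).trans ?_)
  simp

theorem finrank_range_evY :
    Module.finrank F (LinearMap.range (evY (F := F) (p := p)).toLinearMap) ≤ p ^ 2 := by
  have h : LinearMap.range (evY (F := F) (p := p)).toLinearMap ≤
      Submodule.span F (Set.range fun i : Fin p × Fin p => (mb (i.1 : ℕ) (i.2 : ℕ) : BAlg F p)) := by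
    rw [LinearMap.range_eq_map, ← span_mb, Submodule.map_span, Submodule.span_le]
    rintro _ ⟨_, ⟨a, rfl⟩, rfl⟩
    simp only [AlgHom.toLinearMap_apply, evY_mb]
    split_ifs with hh
    · exact Submodule.subset_span ⟨(⟨a.1, hh⟩, a.2), rfl⟩
    · exact zero_mem _
  refine (Submodule.finrank_mono h).trans ((finrank_range_le_card _).trans ?_)
  simp [sq]

theorem eq_zero_of_ev_d2 (a : BAlg F p)
    (h : ∀ n, ev ((d2L F p ^ n) a) = 0) : a = 0 := by
  refine BAlg_ext fun i j => ?_
  have hj : ∀ n k (a : BAlg F p), cf i k ((d2L F p ^ n) a) = cf i (k + n) a := by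
    intro n
    induction n with
    | zero => intro k a; rfl
    | succ n ih =>
      intro k a
      rw [pow_succ, Module.End.mul_apply, ih]
      exact cf_d2 i (k + n) a
  have := hj j 0 a
  rw [← cf_ev, h j, map_zero, zero_add] at this
  rw [← this, map_zero]

theorem eq_zero_of_evY_Del (a : BAlg F p) (h : ∀ n, evY ((Del F p ^ n) a) = 0) : a = 0 := by
  refine BAlg_ext fun i j => ?_
  have hj : ∀ n k (a : BAlg F p), cf k j ((Del F p ^ n) a) = cf (k + p * n) j a := by
    intro n
    induction n with
    | zero => intro k a; rfl
    | succ n ih =>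
      intro k a
      rw [pow_succ, Module.End.mul_apply, ih, cf_Del, mul_add, mul_one, add_assoc]
  have := hj (i / p) (i % p) a
  rw [← cf_evY (Nat.mod_lt _ pos_p), h, map_zero, Nat.mod_add_div] at this
  rw [← this, map_zero]

theorem exists_mul_eq_one {f : BAlg F p} (hf : eps f ≠ 0) : ∃ g, g * f = 1 := by
  obtain ⟨u, rfl⟩ := isUnit_of_eps hf
  exact ⟨((u⁻¹ : (BAlg F p)ˣ) : BAlg F p), u.inv_mul⟩

/-- For a potential `f` with `D₁ f` invertible, eigenvectors of `{f, ·}` are determined by their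
values at `x₂ = 0`. -/
theorem eq_zero_of_pb_eigen {f a : BAlg F p} (hf : eps (d1 f) ≠ 0) {k : F}
    (h : pb f a = k • a) (h0 : ev a = 0) : a = 0 := by
  obtain ⟨g, hg⟩ := exists_mul_eq_one hf
  -- With g the inverse of D₁f, the eigenvalue equation reads D₂a = k·g·a + g·D₂f·D₁a.
  refine eq_zero_of_ev (ev := ev) (E := d2L F p) (d := d1L F p) (d' := 0)
    (c := algebraMap F _ k * g) (c₁ := g * d2 f) (c₂ := 0) d2_isDer
    (fun a => d1_d2_comm a) (by simp) (fun a => ev_d1 a) (by simp) eq_zero_of_ev_d2 ?_ h0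
  rw [zero_mul, add_zero, d2L_apply, d1L_apply]
  have h' : d1 f * d2 a - d2 f * d1 a = algebraMap F _ k * a := by
    rw [← Algebra.smul_def]; exact h
  linear_combination g * h' - d2 a * hg

theorem ev_eigen_lift {f : BAlg F p} (hf : eps (d1 f) ≠ 0) (hT : (pbL f : EndB F p) ^ p = pbL f)
    {k : ℕ} (hk : k < p) (r : BAlg F p) : ∃ a, pb f a = (k : F) • a ∧ ev a = ev r :=
  exists_eigen_lift hT ev.toLinearMap finrank_range_ev
    (fun _ _ _ h h0 => eq_zero_of_pb_eigen hf h h0) hk r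

/-! ### Truncated exponentials -/

/-- The truncated exponential `∑_{i < p} (c w)^i / i!`. -/
def ex (c : F) (w : BAlg F p) : BAlg F p := ∑ i ∈ Finset.range p, c ^ i • dpw F w i

theorem dpw_pred (w : BAlg F p) : dpw F w (p - 1) = -w ^ (p - 1) := by
  rw [dpw, factorial_pred, inv_neg, inv_one, neg_smul, one_smul]

theorem IsDer.map_dpw_succ {D : EndB F p} (hD : IsDer D) (w : BAlg F p) {i : ℕ} (hi : i + 1 < p) :
    D (dpw F w (i + 1)) = D w * dpw F w i := by
  rw [dpw, map_smul, hD.map_pow_succ, smul_smul, dpw, Nat.factorial_succ, Nat.cast_mul, mul_inv,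
    mul_comm ((((i + 1 : ℕ) : F))⁻¹), mul_assoc,
    inv_mul_cancel₀ (cast_ne_zero' p (Nat.succ_ne_zero i) hi), mul_one, mul_comm (w ^ i),
    mul_smul_comm]

/-- Differentiating lowers the index, so the last term of the truncated series is missing. Since
(p−1)! = −1, this term is −(cw)^{p-1}. The defect is the source of most corrections below. -/
theorem IsDer.map_ex {D : EndB F p} (hD : IsDer D) (c : F) (w : BAlg F p) :
    D (ex c w) = c • (D w * (ex c w + c ^ (p - 1) • w ^ (p - 1))) := by
  obtain ⟨m, hm⟩ : ∃ m, p = m + 1 := ⟨p - 1, by have := one_lt_p p; omega⟩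
  have hm' : p - 1 = m := by omega
  have h1 : ex c w + c ^ (p - 1) • w ^ (p - 1) = ∑ i ∈ Finset.range m, c ^ i • dpw F w i := by
    rw [ex, show Finset.range p = Finset.range (m + 1) by rw [← hm], Finset.sum_range_succ,
      ← hm', dpw_pred]
    simp
  rw [h1, ex, show Finset.range p = Finset.range (m + 1) by rw [← hm], Finset.sum_range_succ',
    map_add, map_sum]
  simp only [dpw_zero, map_smul, hD.map_one, smul_zero, add_zero]
  rw [Finset.mul_sum, Finset.smul_sum]
  refine Finset.sum_congr rfl fun i hi => ?_
  rw [hD.map_dpw_succ w (by have := Finset.mem_range.1 hi; omega), pow_succ', mul_smul_comm,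
    smul_smul]

/-- Products of total degree at least p vanish because w^p = 0. What remains is the binomial
theorem. -/
theorem ex_mul {w : BAlg F p} (hw : w ^ p = 0) (c c' : F) : ex c w * ex c' w = ex (c + c') w := by
  have h := Finset.sum_range_diag_flip p
    (fun i k => (c ^ i • dpw F w i) * (c' ^ k • dpw F w k))
  have h2 : ex c w * ex c' w = ∑ m ∈ Finset.range p, ∑ k ∈ Finset.range (p - m),
      (c ^ m • dpw F w m) * (c' ^ k • dpw F w k) := by
    rw [ex, ex, Finset.sum_mul_sum]
    refine Finset.sum_congr rfl fun m hm => ?_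
    symm
    refine Finset.sum_subset (Finset.range_mono (Nat.sub_le _ _)) fun k _ hk => ?_
    rw [smul_mul_smul_comm, dpw_mul hw,
      dpw_eq_zero hw (by have := mt Finset.mem_range.2 hk; omega), smul_zero, smul_zero]
  rw [h2, ← h, ex]
  refine Finset.sum_congr rfl fun m hm => ?_
  rw [add_pow, Finset.sum_smul]
  refine Finset.sum_congr rfl fun k hk => ?_
  have hkm : k + (m - k) = m := by have := Finset.mem_range.1 hk; omega
  rw [smul_mul_smul_comm, dpw_mul hw, hkm, smul_smul]

@[simp] theorem ex_zero (w : BAlg F p) : ex (0 : F) w = 1 := by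
  rw [ex, Finset.sum_eq_single 0]
  · simp
  · intro i _ hi; simp [hi]
  · intro h; exact absurd (Finset.mem_range.2 pos_p) h

theorem ex_pow {w : BAlg F p} (hw : w ^ p = 0) (c : F) (k : ℕ) : ex c w ^ k = ex (k * c) w := by
  induction k with
  | zero => simp
  | succ k ih => rw [pow_succ, ih, ex_mul hw]; congr 1; push_cast; ring

theorem eps_ex {w : BAlg F p} (hw : eps w = 0) (c : F) : eps (ex c w) = 1 := by
  rw [ex, map_sum, Finset.sum_eq_single 0]
  · simp
  · intro i _ hi
    simp [dpw, hw, hi]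
  · intro h; exact absurd (Finset.mem_range.2 pos_p) h

theorem map_ex (φ : BAlg F p →ₐ[F] BAlg F p) (c : F) (w : BAlg F p) : φ (ex c w) = ex c (φ w) := by
  simp [ex, dpw]

theorem ex_zero_right (c : F) : ex c (0 : BAlg F p) = 1 := by
  rw [ex, Finset.sum_eq_single 0]
  · simp
  · intro i _ hi; simp [dpw, hi]
  · intro h; exact absurd (Finset.mem_range.2 pos_p) h

theorem exists_ex_eq (c : F) (w : BAlg F p) : ∃ g, ex c w = 1 + w * g := by
  obtain ⟨m, hm⟩ : ∃ m, p = m + 1 := ⟨p - 1, by have := one_lt_p p; omega⟩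
  refine ⟨∑ i ∈ Finset.range m, (c ^ (i + 1) * (((i + 1).factorial : F))⁻¹) • w ^ i, ?_⟩
  rw [ex, show Finset.range p = Finset.range (m + 1) by rw [← hm], Finset.sum_range_succ',
    Finset.mul_sum, add_comm]
  simp only [dpw, mul_smul_comm, pow_succ', smul_smul]
  simp

/-! ### The elements `r̃`, `r`, `r⁻¹` and `x₂^{(p-1)}` -/

/-- `r̃` -/
def rt (μ : F) : BAlg F p := gX + μ • gY
/-- `r` -/
def rr (μ : F) : BAlg F p := 1 + μ • mb (p - 1) 0
/-- `r⁻¹` -/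
def ri (μ : F) : BAlg F p := 1 - μ • mb (p - 1) 0
/-- `x₂^{(p-1)}` -/
def qq (F : Type*) [Field F] (p : ℕ) [Fact p.Prime] [CharP F p] : BAlg F p := mb 0 (p - 1)

theorem gX_mul_pow_pred : (gX : BAlg F p) * gX ^ (p - 1) = 0 := by
  rw [← pow_succ', Nat.sub_add_cancel (one_lt_p p).le, gX_pow_p]

theorem gX_mul_xp : (gX : BAlg F p) * mb (p - 1) 0 = 0 := by
  rw [mb_pred, mul_neg, gX_mul_pow_pred, neg_zero]

theorem gX_pow_mul_xp {n : ℕ} (hn : n ≠ 0) : (gX : BAlg F p) ^ n * mb (p - 1) 0 = 0 := by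
  obtain ⟨m, rfl⟩ := Nat.exists_eq_succ_of_ne_zero hn
  rw [pow_succ, mul_assoc, gX_mul_xp, mul_zero]

theorem xp_mul_mb {n : ℕ} (hn : n ≠ 0) (hnp : n < p) : (mb (p - 1) 0 : BAlg F p) * mb n 0 = 0 := by
  rw [← dpw_gX hnp, dpw, mul_smul_comm, mul_comm, gX_pow_mul_xp hn, smul_zero]

theorem xp_mul_xp : (mb (p - 1) 0 : BAlg F p) * mb (p - 1) 0 = 0 :=
  xp_mul_mb (by have := one_lt_p p; omega) (by have := one_lt_p p; omega)

theorem rr_mul_ri (μ : F) : (rr μ * ri μ : BAlg F p) = 1 := by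
  rw [rr, ri]
  have : (1 + μ • mb (p - 1) 0) * (1 - μ • mb (p - 1) 0) =
    (1 : BAlg F p) - (μ • mb (p - 1) 0) * (μ • mb (p - 1) 0) := by ring
  rw [this, smul_mul_smul_comm, xp_mul_xp, smul_zero, sub_zero]

theorem eps_mb {i j : ℕ} (h : i ≠ 0 ∨ j ≠ 0) : eps (mb i j : BAlg F p) = 0 := by
  rw [eps_eq_cf]
  by_cases hb : i < p ^ 2 ∧ j < p
  · rw [cf_mb hb.1 hb.2, if_neg (by omega)]
  · rw [mb_eq_zero hb, map_zero]

@[simp] theorem eps_ri (μ : F) : eps (ri μ : BAlg F p) = 1 := by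
  rw [ri, map_sub, map_one, map_smul, eps_mb (Or.inl (by have := one_lt_p p; omega))]; simp

@[simp] theorem eps_rr (μ : F) : eps (rr μ : BAlg F p) = 1 := by
  rw [rr, map_add, map_one, map_smul, eps_mb (Or.inl (by have := one_lt_p p; omega))]; simp

theorem ri_pow_pred (μ : F) : (ri μ : BAlg F p) ^ (p - 1) = rr μ := by
  have h : (ri μ : BAlg F p) ^ (p - 1) * ri μ = 1 := by
    rw [← pow_succ, Nat.sub_add_cancel (one_lt_p p).le, pow_p_eq_one (eps_ri μ)]
  calc (ri μ : BAlg F p) ^ (p - 1) = ri μ ^ (p - 1) * (rr μ * ri μ) := by rw [rr_mul_ri, mul_one]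
    _ = (ri μ ^ (p - 1) * ri μ) * rr μ := by ring
    _ = rr μ := by rw [h, one_mul]

theorem d1_rt (μ : F) : d1 (rt μ : BAlg F p) = rr μ := by
  rw [rt, map_add, Derivation.map_smul, d1_gX, d1_gY_mb, rr]

@[simp] theorem ev_mb_zero (i : ℕ) : ev (mb i 0 : BAlg F p) = mb i 0 := by rw [ev_mb, if_pos rfl]

@[simp] theorem ev_rt (μ : F) : ev (rt μ : BAlg F p) = rt μ := by simp [rt]
@[simp] theorem ev_rr (μ : F) : ev (rr μ : BAlg F p) = rr μ := by simp [rr]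
@[simp] theorem ev_ri (μ : F) : ev (ri μ : BAlg F p) = ri μ := by simp [ri]

theorem qq_eq : qq F p = -gZ ^ (p - 1) := mb_zero_pred

theorem gZ_mul_qq : gZ * qq F p = 0 := by
  rw [qq_eq, mul_neg, ← pow_succ', Nat.sub_add_cancel (one_lt_p p).le, gZ_pow_p, neg_zero]

theorem qq_mul_gZ_pow {n : ℕ} (hn : n ≠ 0) : qq F p * gZ ^ n = 0 := by
  obtain ⟨m, rfl⟩ := Nat.exists_eq_succ_of_ne_zero hn
  rw [pow_succ', ← mul_assoc, mul_comm (qq F p), gZ_mul_qq, zero_mul]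

theorem qq_mul_qq : qq F p * qq F p = 0 := by
  have h := qq_mul_gZ_pow (F := F) (p := p) (n := p - 1) (by have := one_lt_p p; omega)
  have e := qq_eq (F := F) (p := p)
  linear_combination (qq F p) * e - h

theorem d2_qq : d2 (qq F p) = gZ ^ (p - 2) := by
  obtain ⟨m, hm⟩ : ∃ m, p = m + 2 := ⟨p - 2, by have := one_lt_p p; omega⟩
  have h := d2_isDer.map_pow_succ (gZ : BAlg F p) m
  rw [d2L_apply, d2L_apply, d2_gZ, mul_one] at h
  rw [qq_eq, map_neg, show p - 1 = m + 1 by omega, h, show p - 2 = m by omega]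
  have : ((m + 1 : ℕ) : F) = -1 := by
    have h0 : ((p : ℕ) : F) = 0 := CharP.cast_eq_zero F p
    rw [hm] at h0
    push_cast at h0 ⊢
    linear_combination h0
  rw [this]; simp

theorem qq_mul_d2_qq (hp : 3 < p) : qq F p * d2 (qq F p) = 0 := by
  rw [d2_qq, qq_mul_gZ_pow (by omega)]

theorem gZ_mul_d2_qq : gZ * d2 (qq F p) = -qq F p := by
  rw [d2_qq, ← pow_succ', qq_eq, neg_neg]
  congr 1; have := one_lt_p p; omega

theorem d1_qq : d1 (qq F p) = 0 := d1_mb_zero _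

@[simp] theorem ev_qq : ev (qq F p) = 0 := by
  rw [qq, ev_mb, if_neg (by have := one_lt_p p; omega)]

theorem Del_qq : Del F p (qq F p) = 0 := by
  refine BAlg_ext fun i j => ?_
  rw [cf_Del, qq, cf_mb (pow_pos pos_p 2) (by have := one_lt_p p; omega),
    if_neg (by have := one_lt_p p; omega), map_zero]

theorem Del_xp : Del F p (mb (p - 1) 0) = 0 := by
  refine BAlg_ext fun i j => ?_
  rw [cf_Del, cf_mb (lt_of_le_of_lt (Nat.sub_le _ _) prime_lt_sq) pos_p,
    if_neg (by have := one_lt_p p; omega), map_zero]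

theorem Del_ri (μ : F) : Del F p (ri μ) = 0 := by
  rw [ri, map_sub, map_smul, Del_xp, Del_isPD.1.map_one, smul_zero, sub_zero]

theorem Del_rt (μ : F) : Del F p (rt μ) = algebraMap F _ μ := by
  rw [rt, map_add, map_smul, Del_gX, Del_gY, zero_add, Algebra.algebraMap_eq_smul_one]

theorem d2_ri (μ : F) : d2 (ri μ : BAlg F p) = 0 := by rw [← ev_ri, d2_ev]

theorem d2_rt (μ : F) : d2 (rt μ : BAlg F p) = 0 := by rw [← ev_rt, d2_ev]

/-! ### The homomorphism `u ↦ u + u' r̃ x₂^{(p-1)}` -/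

/-- `u ↦ u + u' r̃ x₂^{(p-1)}` for functions `u` of `x₁`, extended by `x₂ ↦ 0`. -/
def jh (μ : F) : BAlg F p →ₐ[F] BAlg F p :=
  AlgHom.ofLinearMap
    ((ev (F := F) (p := p)).toLinearMap +
      (LinearMap.mulLeft F (rt μ * qq F p)).comp ((d1L F p).comp ev.toLinearMap))
    (by simp)
    -- Multiplicativity: u ↦ r̃·q·u' is a derivation, and the product of two such terms contains q²
    -- = 0.
    (fun u v => by
      simp only [LinearMap.add_apply, LinearMap.comp_apply, AlgHom.toLinearMap_apply, d1L_apply,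
        LinearMap.mulLeft_apply, map_mul, Derivation.leibniz, smul_eq_mul]
      linear_combination (-(d1 (ev u) * d1 (ev v) * rt μ * rt μ)) * (qq_mul_qq (F := F) (p := p)))

theorem jh_apply (μ : F) (u : BAlg F p) : jh μ u = ev u + rt μ * qq F p * d1 (ev u) := rfl

@[simp] theorem jh_ev (μ : F) (u : BAlg F p) : jh μ (ev u) = jh μ u := by
  rw [jh_apply, jh_apply, ev_ev]

@[simp] theorem ev_jh (μ : F) (u : BAlg F p) : ev (jh μ u) = ev u := by
  rw [jh_apply, map_add, map_mul, map_mul, ev_qq, ev_ev]; ring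

@[simp] theorem eps_jh (μ : F) (u : BAlg F p) : eps (jh μ u) = eps u := by
  rw [← eps_ev, ev_jh, eps_ev]

theorem jh_mul_qq (μ : F) (u : BAlg F p) : jh μ u * qq F p = ev u * qq F p := by
  rw [jh_apply]
  linear_combination (rt μ * d1 (ev u)) * (qq_mul_qq (F := F) (p := p))

theorem d1_jh (μ : F) (u : BAlg F p) :
    d1 (jh μ u) = d1 (ev u) + (rr μ * d1 (ev u) + rt μ * d1 (d1 (ev u))) * qq F p := by
  rw [jh_apply, map_add]
  simp only [Derivation.leibniz, smul_eq_mul, d1_rt, d1_qq]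
  ring

theorem d2_jh (μ : F) (u : BAlg F p) : d2 (jh μ u) = rt μ * d2 (qq F p) * d1 (ev u) := by
  rw [jh_apply, map_add, d2_ev]
  simp only [Derivation.leibniz, smul_eq_mul, d2_rt, ← ev_d1, d2_ev]
  ring

/-- D₂ of j(u) is u'·r̃·D₂q, and D₁ of j(u) is u' plus a multiple of q. The main terms are symmetric
in u and v and cancel. The others contain q·D₂q = 0. -/
theorem pb_jh_jh (hp : 3 < p) (μ : F) (u v : BAlg F p) : pb (jh μ u) (jh μ v) = 0 := by
  rw [pb, d1_jh, d1_jh, d2_jh, d2_jh]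
  have h := qq_mul_d2_qq (F := F) hp
  linear_combination ((rr μ * d1 (ev u) + rt μ * d1 (d1 (ev u))) * rt μ * d1 (ev v) -
    (rr μ * d1 (ev v) + rt μ * d1 (d1 (ev v))) * rt μ * d1 (ev u)) * h

/-- `∂ = r⁻¹ D₁` -/
def dd (μ : F) : EndB F p := LinearMap.mulLeft F (ri μ) * d1L F p

theorem dd_apply (μ : F) (u : BAlg F p) : dd μ u = ri μ * d1 u := rfl

theorem dd_isDer (μ : F) : IsDer (dd μ : EndB F p) := d1_isDer.mulLeft _

theorem ev_dd (μ : F) (u : BAlg F p) : ev (dd μ u) = dd μ (ev u) := by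
  rw [dd_apply, dd_apply, map_mul, ev_ri, ev_d1]

/-- `z = r⁻¹ x₂` -/
def zz (μ : F) : BAlg F p := ri μ * gZ

theorem eps_zz (μ : F) : eps (zz μ : BAlg F p) = 0 := by simp [zz]

theorem zz_pow_p (μ : F) : (zz μ : BAlg F p) ^ p = 0 := pow_p_eq_zero (eps_zz μ)

theorem zz_mul_qq (μ : F) : zz μ * qq F p = 0 := by
  rw [zz, mul_assoc, gZ_mul_qq, mul_zero]

theorem zz_pow_pred (μ : F) : (zz μ : BAlg F p) ^ (p - 1) = -(qq F p * rr μ) := by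
  rw [zz, mul_pow, ri_pow_pred, qq_eq]; ring

theorem d1_zz (μ : F) : d1 (zz μ : BAlg F p) = gZ * d1 (ri μ) := by
  rw [zz, Derivation.leibniz, d1_gZ]; simp

theorem d2_zz (μ : F) : d2 (zz μ : BAlg F p) = ri μ := by
  rw [zz, Derivation.leibniz, d2_gZ, d2_ri]; simp

/-- The variable z = r⁻¹x₂ is conjugate to j only up to the defect u'·q. The defect comes from
x₂·D₂q = −q, and passing to the exponential removes it. -/
theorem pb_jh_zz (μ : F) (u : BAlg F p) :
    pb (jh μ u) (zz μ) = jh μ (dd μ u) + d1 (ev u) * qq F p := by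
  rw [pb, d1_jh, d2_jh, d1_zz, d2_zz, jh_apply, ev_dd, dd_apply, Derivation.leibniz, smul_eq_mul,
    smul_eq_mul]
  have h1 := gZ_mul_d2_qq (F := F) (p := p)
  have h2 := rr_mul_ri (F := F) (p := p) μ
  linear_combination (-(rt μ * d1 (ev u) * d1 (ri μ))) * h1 + (d1 (ev u) * qq F p) * h2

/-- The truncated exponential of `r⁻¹ x₂`. -/
def y0 (μ : F) : BAlg F p := ex 1 (zz μ)

theorem eps_y0 (μ : F) : eps (y0 μ : BAlg F p) = 1 := eps_ex (eps_zz μ) 1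

theorem y0_pow_p (μ : F) : (y0 μ : BAlg F p) ^ p = 1 := pow_p_eq_one (eps_y0 μ)

@[simp] theorem ev_y0 (μ : F) : ev (y0 μ : BAlg F p) = 1 := by
  rw [y0, map_ex, zz, map_mul, ev_gZ, mul_zero, ex_zero_right]

theorem y0_mul_qq (μ : F) : y0 μ * qq F p = qq F p := by
  obtain ⟨g, hg⟩ := exists_ex_eq (1 : F) (zz μ : BAlg F p)
  rw [y0, hg]
  linear_combination g * zz_mul_qq (F := F) (p := p) μ

theorem IsDer.map_y0 {D : EndB F p} (hD : IsDer D) (μ : F) :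
    D (y0 μ) = D (zz μ) * (y0 μ - qq F p * rr μ) := by
  rw [y0, hD.map_ex, one_smul, one_pow, one_smul, zz_pow_pred, sub_eq_add_neg]

/-- Two errors cancel: the defect u'·q of `pb_jh_zz`, and the missing last term z^{p-1} = −q·r of
the truncated exponential. The cancellation uses y·q = q. -/
theorem pb_jh_y0 (μ : F) (u : BAlg F p) : pb (jh μ u) (y0 μ) = jh μ (dd μ u) * y0 μ := by
  have h := (IsPD.pb_left (jh μ u)).1.map_y0 μ
  rw [pbL_apply, pbL_apply, pb_jh_zz] at h
  rw [h]
  have h1 := jh_mul_qq μ (dd μ u)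
  rw [ev_dd, dd_apply μ (ev u)] at h1
  have h2 := y0_mul_qq (F := F) (p := p) μ
  have h3 := qq_mul_qq (F := F) (p := p)
  have h4 := rr_mul_ri (F := F) (p := p) μ
  linear_combination (-rr μ) * h1 + (d1 (ev u)) * h2 - (d1 (ev u) * rr μ) * h3
    - (d1 (ev u) * qq F p) * h4

theorem IsDer.map_pow {D : EndB F p} (hD : IsDer D) {y c : BAlg F p} (h : D y = c * y) (k : ℕ) :
    D (y ^ k) = (k : F) • (c * y ^ k) := by
  induction k with
  | zero => simp [hD.map_one]
  | succ k ih =>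
    rw [pow_succ, hD, h, ih]
    push_cast
    rw [add_smul, one_smul, mul_smul_comm]
    rw [Algebra.smul_def, Algebra.smul_def]
    ring

theorem pb_jh_y0_pow (μ : F) (u : BAlg F p) (k : ℕ) :
    pb (jh μ u) (y0 μ ^ k) = (k : F) • (jh μ (dd μ u) * y0 μ ^ k) :=
  (IsPD.pb_left (jh μ u)).1.map_pow (pb_jh_y0 μ u) k

theorem exists_ex_sub_one_eq (w : BAlg F p) : ∃ g, ex (1 : F) w - 1 = w * (1 + w * g) := by
  obtain ⟨m, hm⟩ : ∃ m, p = m + 2 := ⟨p - 2, by have := one_lt_p p; omega⟩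
  refine ⟨∑ i ∈ Finset.range m, (((i + 2).factorial : F))⁻¹ • w ^ i, ?_⟩
  have h : ∀ i, (1 : F) ^ (i + 1 + 1) • dpw F w (i + 1 + 1) =
      w * (w * ((((i + 2).factorial : F))⁻¹ • w ^ i)) := by
    intro i
    rw [dpw, one_pow, one_smul, mul_smul_comm, mul_smul_comm, ← mul_assoc, ← sq, ← pow_add,
      add_comm 2 i]
  rw [ex, show Finset.range p = Finset.range (m + 1 + 1) by rw [hm],
    Finset.sum_range_succ', Finset.sum_range_succ', Finset.sum_congr rfl fun i _ => h i,
    ← Finset.mul_sum, ← Finset.mul_sum, zero_add, pow_one, pow_zero, one_smul, one_smul, dpw_one,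
    dpw_zero]
  ring

/-- The difference is w times an element 1 + w·g, and w^{p-1} absorbs every further factor w. -/
theorem ex_sub_one_pow_pred {w : BAlg F p} (hw : w ^ p = 0) :
    (ex (1 : F) w - 1) ^ (p - 1) = w ^ (p - 1) := by
  have h0 : w * w ^ (p - 1) = 0 := by
    rw [← pow_succ', Nat.sub_add_cancel (one_lt_p p).le, hw]
  obtain ⟨g, hg⟩ := exists_ex_sub_one_eq (F := F) w
  obtain ⟨c, hc⟩ : (w * g) ∣ ((1 + w * g) ^ (p - 1) - 1 : BAlg F p) := by
    have := sub_dvd_pow_sub_pow (1 + w * g : BAlg F p) 1 (p - 1)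
    rwa [one_pow, add_sub_cancel_left] at this
  rw [hg, mul_pow]
  linear_combination (w ^ (p - 1)) * hc + (g * c) * h0

theorem y0_sub_one_pow (μ : F) : (y0 μ - 1 : BAlg F p) ^ (p - 1) = -(qq F p * rr μ) := by
  rw [y0, ex_sub_one_pow_pred (zz_pow_p μ), zz_pow_pred]

/-- A derivation which kills all `u + u' r̃ x₂^{(p-1)}` and the exponential of `r⁻¹ x₂` is zero. -/
theorem IsDer.eq_zero_of_frame {D : EndB F p} (hD : IsDer D) (μ : F) (h1 : ∀ u, D (jh μ u) = 0)
    (h2 : D (y0 μ) = 0) : D = 0 := by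
  have hker : ∀ {a b}, D a = 0 → D b = 0 → D (a * b) = 0 := fun ha hb => by
    rw [hD, ha, hb, mul_zero, mul_zero, add_zero]
  have hpow : ∀ {a} (n : ℕ), D a = 0 → D (a ^ n) = 0 := fun n ha => by
    rcases n with _ | n
    · rw [pow_zero, hD.map_one]
    · rw [hD.map_pow_succ, ha, mul_zero, smul_zero]
  have hn := y0_sub_one_pow (F := F) (p := p) μ
  -- The frame generates the algebra. First q is recovered as −j(r⁻¹)(y − 1)^{p-1}, then the
  -- functions of x₁ as j(u) − j(r̃)·q·j(u'), and finally x₂ from z.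
  have hq : D (qq F p) = 0 := by
    have : qq F p = -(jh μ (ri μ) * (y0 μ - 1) ^ (p - 1)) := by
      rw [hn]
      have e := jh_mul_qq μ (ri μ : BAlg F p)
      rw [ev_ri] at e
      have e2 := rr_mul_ri (F := F) (p := p) μ
      linear_combination (-rr μ) * e - (qq F p) * e2
    rw [this, map_neg, hker (h1 _) (hpow _ _), neg_zero]
    rw [map_sub, h2, hD.map_one, sub_zero]
  have hu : ∀ u, ev u = u → d1 u = ev (d1 u) → D u = 0 := by
    intro u hu hu'
    have : u = jh μ u - jh μ (rt μ) * qq F p * jh μ (d1 u) := by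
      have e1 := jh_mul_qq μ (rt μ : BAlg F p)
      have e2 := jh_mul_qq μ (d1 u : BAlg F p)
      rw [← hu'] at e2
      rw [ev_rt] at e1
      rw [jh_apply μ u, hu]
      linear_combination (jh μ (d1 u)) * e1 + rt μ * e2
    rw [this, map_sub, h1, hker (hker (h1 _) hq) (h1 _), sub_zero]
  have hX : D gX = 0 := hu _ ev_gX (by rw [ev_d1, ev_gX])
  have hY : D gY = 0 := hu _ ev_gY (by rw [ev_d1, ev_gY])
  have hr : D (rr μ) = 0 := hu _ (ev_rr μ) (by rw [ev_d1, ev_rr])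
  -- D y is D z times an element with constant term 1.
  have hz : D (zz μ) = 0 := by
    have h := hD.map_y0 μ
    rw [h2] at h
    obtain ⟨g, hg⟩ := exists_mul_eq_one (f := (y0 μ - qq F p * rr μ : BAlg F p)) (by
      rw [map_sub, map_mul, eps_y0, ← eps_ev (qq F p), ev_qq, map_zero]; simp)
    linear_combination (-g) * h - D (zz μ) * hg
  have hZ : D gZ = 0 := by
    have : (gZ : BAlg F p) = rr μ * zz μ := by
      rw [zz, ← mul_assoc, rr_mul_ri, one_mul]
    rw [this]; exact hker hr hz
  exact hD.ext (T' := 0) (fun _ _ => by simp) hX hY hZ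

theorem IsDer.eq_of_frame {D D' : EndB F p} (hD : IsDer D) (hD' : IsDer D') (μ : F)
    (h1 : ∀ u, D (jh μ u) = D' (jh μ u)) (h2 : D (y0 μ) = D' (y0 μ)) : D = D' :=
  sub_eq_zero.1 ((hD.sub hD').eq_zero_of_frame μ
    (fun u => by rw [LinearMap.sub_apply, h1, sub_self]) (by rw [LinearMap.sub_apply, h2, sub_self]))

/-! ### The toral element and the decomposition of `𝒪(2;(2,1))` -/

/-- The potential of `t_μ`. -/
def tt (μ : F) : BAlg F p := jh μ (rt μ)

theorem dd_rt (μ : F) : dd μ (rt μ : BAlg F p) = 1 := by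
  rw [dd_apply, d1_rt, mul_comm, rr_mul_ri]

theorem pb_tt_jh (hp : 3 < p) (μ : F) (u : BAlg F p) : pb (tt μ) (jh μ u) = 0 :=
  pb_jh_jh hp μ _ _

theorem pb_tt_y0_pow (μ : F) (k : ℕ) : pb (tt μ : BAlg F p) (y0 μ ^ k) = (k : F) • y0 μ ^ k := by
  rw [tt, pb_jh_y0_pow, dd_rt, map_one, one_mul]

theorem pb_tt_jh_y0_pow (hp : 3 < p) (μ : F) (u : BAlg F p) (k : ℕ) :
    pb (tt μ) (jh μ u * y0 μ ^ k) = (k : F) • (jh μ u * y0 μ ^ k) := by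
  rw [pb_mul_right, pb_tt_jh hp, pb_tt_y0_pow, mul_zero, add_zero, mul_smul_comm]

theorem pow_apply_of_eigen {T : EndB F p} {a : BAlg F p} {c : F} (h : T a = c • a) (n : ℕ) :
    (T ^ n) a = c ^ n • a := by
  induction n with
  | zero => simp
  | succ n ih => rw [pow_succ, Module.End.mul_apply, h, map_smul, ih, smul_smul, pow_succ']

/-- Both sides are derivations, so it suffices to compare them on the frame, where the eigenvalues
are 0 and 1. -/
theorem pbL_tt_pow_p (hp : 3 < p) (μ : F) : (pbL (tt μ) : EndB F p) ^ p = pbL (tt μ) := by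
  refine (IsPD.pb_left _).1.pow_p.eq_of_frame (IsPD.pb_left _).1 μ (fun u => ?_) ?_
  · have h : (pbL (tt μ) : EndB F p) (jh μ u) = (0 : F) • jh μ u := by
      rw [pbL_apply, pb_tt_jh hp, zero_smul]
    rw [pow_apply_of_eigen h, zero_pow (by omega), zero_smul, pbL_apply, pb_tt_jh hp]
  · have h : (pbL (tt μ) : EndB F p) (y0 μ) = (1 : F) • y0 μ := by
      have := pb_tt_y0_pow (F := F) (p := p) μ 1
      rwa [pow_one, Nat.cast_one] at this
    rw [pow_apply_of_eigen h, one_pow, h]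

@[simp] theorem eps_qq : eps (qq F p) = 0 := by rw [← eps_ev, ev_qq, map_zero]

theorem eps_d1_jh (μ : F) (u : BAlg F p) : eps (d1 (jh μ u)) = eps (d1 (ev u)) := by
  rw [d1_jh, map_add, map_mul, eps_qq, mul_zero, add_zero]

theorem eps_d1_tt (μ : F) : eps (d1 (tt μ : BAlg F p)) = 1 := by
  rw [tt, eps_d1_jh, ev_rt, d1_rt, eps_rr]

/-- Both sides are eigenvectors of {t_μ, ·} for the same eigenvalue and agree at x₂ = 0, because y
becomes 1 there. -/
theorem eq_jh_mul_y0_pow (hp : 3 < p) {μ : F} {a : BAlg F p} {k : ℕ}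
    (h : pb (tt μ) a = (k : F) • a) : a = jh μ a * y0 μ ^ k := by
  rw [← sub_eq_zero]
  refine eq_zero_of_pb_eigen (f := tt μ) (k := (k : F)) ?_ ?_ ?_
  · rw [eps_d1_tt]; exact one_ne_zero
  · rw [pb_sub_right, h, pb_tt_jh_y0_pow hp, smul_sub]
  · rw [map_sub, map_mul, map_pow, ev_y0, ev_jh, one_pow, mul_one, sub_self]

theorem eq_sum_jh (hp : 3 < p) (μ : F) (f : BAlg F p) :
    f = ∑ k ∈ Finset.range p, jh μ (eproj (pbL (tt μ)) k f) * y0 μ ^ k := by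
  have h := LinearMap.congr_fun (sum_eproj (pbL (tt μ : BAlg F p))) f
  rw [LinearMap.sum_apply, Module.End.one_apply] at h
  refine h.symm.trans (Finset.sum_congr rfl fun k _ => ?_)
  exact eq_jh_mul_y0_pow hp (apply_eproj (pbL_tt_pow_p hp μ) k f)

theorem frame_induction (hp : 3 < p) (μ : F) {P : BAlg F p → Prop}
    (h : ∀ u k, P (jh μ u * y0 μ ^ k)) (hadd : ∀ f g, P f → P g → P (f + g)) (f : BAlg F p) :
    P f := by
  rw [eq_sum_jh hp μ f]
  refine Finset.sum_induction _ P hadd ?_ fun k _ => h _ k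
  have := h 0 0
  rwa [map_zero, zero_mul] at this

theorem natCast_sub_pow_pred {k l : ℕ} (hk : k < p) (hl : l < p) (h : k ≠ l) :
    ((k : F) - (l : F)) ^ (p - 1) = 1 := by
  have hne : (k : F) - (l : F) ≠ 0 := by
    intro h0
    have := (CharP.natCast_eq_natCast F p).1 (sub_eq_zero.1 h0)
    rw [Nat.ModEq, Nat.mod_eq_of_lt hk, Nat.mod_eq_of_lt hl] at this
    exact h this
  apply mul_right_cancel₀ hne
  rw [← pow_succ, Nat.sub_add_cancel (one_lt_p p).le, sub_pow_char, cast_pow_p, cast_pow_p,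
    one_mul]

theorem eproj_of_eigen {T : EndB F p} {a : BAlg F p} {k l : ℕ} (hk : k < p) (hl : l < p)
    (h : T a = (k : F) • a) : eproj T l a = if l = k then a else 0 := by
  have h1 : (T - (l : F) • 1) a = ((k : F) - (l : F)) • a := by
    rw [LinearMap.sub_apply, h, LinearMap.smul_apply, Module.End.one_apply, sub_smul]
  rw [eproj, LinearMap.sub_apply, pow_apply_of_eigen h1, Module.End.one_apply]
  split_ifs with hlk
  · rw [hlk, sub_self, zero_pow (by have := one_lt_p p; omega), zero_smul, sub_zero]
  · rw [natCast_sub_pow_pred hk hl (Ne.symm hlk), one_smul, sub_self]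

theorem pow_mod_p {R : Type*} [Monoid R] {y : R} (hy : y ^ p = 1) (k : ℕ) :
    y ^ (k % p) = y ^ k := by
  conv_rhs => rw [← Nat.mod_add_div k p, pow_add, pow_mul, hy, one_pow, mul_one]

/-! ### Frames -/

/-- A homomorphism `j` defined on the functions of `x₁` and an element `y` with the same brackets,
up to a factor `κ`, as the standard ones. -/
structure IsFrame (μ κ : F) (j : BAlg F p →ₐ[F] BAlg F p) (y : BAlg F p) : Prop where
  ev : ∀ u, j (ev u) = j u
  pow : y ^ p = 1
  comm : ∀ u v, pb (j u) (j v) = 0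
  act : ∀ u, pb (j u) y = κ • (j (dd μ u) * y)

theorem isFrame_jh (hp : 3 < p) (μ : F) : IsFrame (p := p) μ 1 (jh μ) (y0 μ) :=
  ⟨jh_ev μ, y0_pow_p μ, pb_jh_jh hp μ, fun u => by rw [pb_jh_y0, one_smul]⟩

theorem pb_pow_pow (y : BAlg F p) (k l : ℕ) : pb (y ^ k) (y ^ l) = 0 := by
  have h : ∀ f : BAlg F p, pb f y = 0 → ∀ n : ℕ, pb f (y ^ n) = 0 := by
    intro f hf n
    have := (IsPD.pb_left f).1.map_pow (y := y) (c := 0) (by rw [pbL_apply, hf, zero_mul]) n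
    simpa using this
  refine h _ ?_ l
  rw [pb_comm, h y (pb_self y), neg_zero]

namespace IsFrame

variable {μ κ : F} {j : BAlg F p →ₐ[F] BAlg F p} {y : BAlg F p}

theorem act_pow (h : IsFrame μ κ j y) (u : BAlg F p) (k : ℕ) :
    pb (j u) (y ^ k) = (k * κ) • (j (dd μ u) * y ^ k) := by
  have := (IsPD.pb_left (j u)).1.map_pow (y := y) (c := κ • j (dd μ u))
    (by rw [pbL_apply, h.act, smul_mul_assoc]) k
  rwa [smul_mul_assoc, smul_smul] at this

/-- The structure constants depend only on μ and, through an overall factor, on κ. Hence any two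
frames with the same μ are related by a bracket-preserving map after rescaling. -/
theorem bracket (h : IsFrame μ κ j y) (u v : BAlg F p) (k l : ℕ) :
    pb (j u * y ^ k) (j v * y ^ l) =
      κ • (j ((l : F) • (v * dd μ u) - (k : F) • (u * dd μ v)) * y ^ (k + l)) := by
  rw [pb_mul_left, pb_mul_right, pb_mul_right, h.comm, h.act_pow, pb_pow_pow, pb_comm (y ^ k),
    h.act_pow, pow_add]
  simp only [Algebra.smul_def, map_mul, map_sub, AlgHom.commutes]
  ring

/-- The linear map which maps the standard frame to the given one. -/
def map (μ κ : F) (j : BAlg F p →ₐ[F] BAlg F p) (y : BAlg F p) : EndB F p :=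
  κ⁻¹ • ∑ k ∈ Finset.range p, LinearMap.mulRight F (y ^ k) * (j.toLinearMap * eproj (pbL (tt μ)) k)

theorem map_apply (hp : 3 < p) (h : IsFrame μ κ j y) (u : BAlg F p) (k : ℕ) :
    map μ κ j y (jh μ u * y0 μ ^ k) = κ⁻¹ • (j u * y ^ k) := by
  -- Exponents matter only modulo p on both sides, since both y's have p-th power 1.
  rw [← pow_mod_p (y0_pow_p μ), ← pow_mod_p h.pow]
  have hk : k % p < p := Nat.mod_lt _ pos_p
  generalize k % p = k at hk
  have hk' : k ∈ Finset.range p := Finset.mem_range.2 hk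
  rw [map, LinearMap.smul_apply, LinearMap.sum_apply, Finset.sum_eq_single k]
  · rw [Module.End.mul_apply, Module.End.mul_apply,
      eproj_of_eigen hk hk (pb_tt_jh_y0_pow hp μ u k), if_pos rfl, LinearMap.mulRight_apply,
      AlgHom.toLinearMap_apply, ← h.ev, map_mul, map_pow, ev_y0, ev_jh, one_pow, mul_one, h.ev]
  · intro l hl hlk
    rw [Module.End.mul_apply, Module.End.mul_apply,
      eproj_of_eigen hk (Finset.mem_range.1 hl) (pb_tt_jh_y0_pow hp μ u k), if_neg hlk, map_zero,
      map_zero]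
  · intro h'; exact absurd hk' h'

theorem map_pb (hp : 3 < p) (h : IsFrame μ κ j y) (hκ : κ ≠ 0) (f g : BAlg F p) :
    map μ κ j y (pb f g) = pb (map μ κ j y f) (map μ κ j y g) := by
  induction f using frame_induction hp μ with
  | h u k =>
    induction g using frame_induction hp μ with
    | h v l =>
      rw [(isFrame_jh hp μ).bracket, one_smul, h.map_apply hp, h.map_apply hp, h.map_apply hp,
        pb_smul_left, pb_smul_right, h.bracket, smul_smul κ⁻¹ κ, inv_mul_cancel₀ hκ, one_smul]
    | hadd f g hf hg => rw [pb_add_right, map_add, hf, hg, map_add, pb_add_right]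
  | hadd f g hf hg => rw [pb_add_left, map_add, hf, hg, map_add, pb_add_left]

/-- The factor κ⁻¹ in `map` absorbs the κ in the brackets of the second frame. Bijectivity comes
from `injective_of_pb`, since 1 goes to the nonzero constant κ⁻¹. -/
theorem exists_equiv (hp : 3 < p) (h : IsFrame μ κ j y) (hκ : κ ≠ 0) :
    ∃ Φ : BAlg F p ≃ₗ[F] BAlg F p, (∀ f g, Φ (pb f g) = pb (Φ f) (Φ g)) ∧
      ∀ u k, Φ (jh μ u * y0 μ ^ k) = κ⁻¹ • (j u * y ^ k) := by
  have h1 : map μ κ j y 1 = algebraMap F _ κ⁻¹ := by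
    have := h.map_apply hp 1 0
    rwa [map_one, map_one, pow_zero, pow_zero, one_mul, ← Algebra.algebraMap_eq_smul_one] at this
  have hinj : Function.Injective (map μ κ j y) := by
    refine injective_of_pb (fun f g => h.map_pb hp hκ f g) ?_
    rw [h1]
    exact fun h0 => inv_ne_zero hκ ((map_eq_zero _).1 h0)
  refine ⟨LinearEquiv.ofInjectiveEndo _ hinj, fun f g => ?_, fun u k => ?_⟩
  · simp only [LinearEquiv.coe_ofInjectiveEndo]; exact h.map_pb hp hκ f g
  · simp only [LinearEquiv.coe_ofInjectiveEndo]; exact h.map_apply hp u k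

end IsFrame

/-! ### The operators of `h_μ`, `n_μ` and `D_H(x₁^{(p²)})` -/

/-- The operator of `h_μ`. -/
def hop (μ : F) : EndB F p := pbL (zz μ) + LinearMap.mulLeft F (qq F p) * d1L F p

/-- The operator of `n_μ`. -/
def nop (μ : F) : EndB F p := Del F p - μ • (LinearMap.mulLeft F (qq F p) * d1L F p)

/-- The operator of `D_H(x₁^{(p²)})`. -/
def vop (F : Type*) [Field F] (p : ℕ) [Fact p.Prime] [CharP F p] : EndB F p :=
  LinearMap.mulLeft F (mb (p ^ 2 - 1) 0) * d2L F p

theorem hop_apply (μ : F) (f : BAlg F p) : hop μ f = pb (zz μ) f + qq F p * d1 f := rfl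

theorem nop_apply (μ : F) (f : BAlg F p) : nop μ f = Del F p f - μ • (qq F p * d1 f) := rfl

theorem vop_apply (f : BAlg F p) : vop F p f = mb (p ^ 2 - 1) 0 * d2 f := rfl

theorem hop_isDer (μ : F) : IsDer (hop μ : EndB F p) :=
  (IsPD.pb_left _).1.add (d1_isDer.mulLeft _)

theorem nop_isDer (μ : F) : IsDer (nop μ : EndB F p) :=
  Del_isPD.1.sub ((d1_isDer.mulLeft _).smul μ)

theorem vop_isDer : IsDer (vop F p) := d2_isDer.mulLeft _

theorem qq_mul_d1_y0 (μ : F) : qq F p * d1 (y0 μ) = 0 := by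
  have h := d1_isDer.map_y0 (F := F) (p := p) μ
  rw [d1L_apply, d1L_apply, d1_zz] at h
  rw [h]
  linear_combination (d1 (ri μ) * (y0 μ - qq F p * rr μ)) * gZ_mul_qq (F := F) (p := p)

theorem qq_mul_d1_jh (μ : F) (u : BAlg F p) : qq F p * d1 (jh μ u) = qq F p * d1 (ev u) := by
  rw [d1_jh]
  linear_combination (rr μ * d1 (ev u) + rt μ * d1 (d1 (ev u))) * qq_mul_qq (F := F) (p := p)

/-- The term −x₂^{(p)} in the potential of h_μ contributes q·D₁, which cancels the defect u'·q in
the bracket with z. -/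
theorem hop_jh (μ : F) (u : BAlg F p) : hop μ (jh μ u) = -jh μ (dd μ u) := by
  rw [hop_apply, pb_comm, pb_jh_zz, qq_mul_d1_jh]; ring

theorem hop_y0 (μ : F) : hop μ (y0 μ : BAlg F p) = 0 := by
  have h := (IsPD.pb_left (zz μ)).1.map_y0 (F := F) (p := p) μ
  rw [pbL_apply, pbL_apply, pb_self, zero_mul] at h
  rw [hop_apply, qq_mul_d1_y0, h, add_zero]

/-- D₁^p(r̃) = μ, so D₁^p alone would leave an extra μ·q·u' when applied to j(u). The summand
μ·D_H(x₂^{(p)}) of n_μ removes it. -/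
theorem nop_jh (μ : F) (u : BAlg F p) : nop μ (jh μ u) = jh μ (Del F p u) := by
  rw [nop_apply, qq_mul_d1_jh, jh_apply, jh_apply, map_add, Del_isPD.1, Del_isPD.1, Del_qq, Del_rt,
    ev_Del, Del_d1, Algebra.smul_def]
  ring

theorem nop_y0 (μ : F) : nop μ (y0 μ : BAlg F p) = 0 := by
  have h := Del_isPD.1.map_y0 (F := F) (p := p) μ
  have hz : Del F p (zz μ) = 0 := by
    rw [zz, Del_isPD.1, Del_gZ, Del_ri, mul_zero, mul_zero, add_zero]
  rw [nop_apply, qq_mul_d1_y0, h, hz, zero_mul, smul_zero, sub_zero]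

theorem hop_y0_pow (μ : F) (k : ℕ) : hop μ (y0 μ ^ k : BAlg F p) = 0 := by
  rw [(hop_isDer μ).map_pow (c := 0) (by rw [hop_y0, zero_mul]), zero_mul, smul_zero]

theorem topX_mul_mb {i : ℕ} (hi : i ≠ 0) : (mb (p ^ 2 - 1) 0 * mb i 0 : BAlg F p) = 0 := by
  have h1 := one_lt_sq p
  by_cases h : i < p ^ 2
  · apply Subtype.ext
    rw [mb_eq (by omega) pos_p, mb_eq h pos_p]
    change (mon (p ^ 2 - 1, 0) * mon (i, 0) : O2 F) = 0
    have hd : p ∣ binom2 (p ^ 2 - 1, 0) (i, 0) := Dvd.dvd.mul_right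
      (dvd_choose_pow_add (Fact.out : p.Prime) (n := 2) (by norm_num) (by omega) h
        (by omega)) _
    rw [mon_mul_mon, (CharP.cast_eq_zero_iff F p _).2 hd, zero_smul]
  · rw [mb_eq_zero (i := i) (by omega), mul_zero]

theorem topX_mul_rt (μ : F) : (mb (p ^ 2 - 1) 0 * rt μ : BAlg F p) = 0 := by
  rw [rt, mul_add, mul_smul_comm, gX, gY, topX_mul_mb one_ne_zero,
    topX_mul_mb (Fact.out : p.Prime).ne_zero, smul_zero, add_zero]

theorem topX_mul_ri (μ : F) : (mb (p ^ 2 - 1) 0 * ri μ : BAlg F p) = mb (p ^ 2 - 1) 0 := by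
  rw [ri, mul_sub, mul_smul_comm, topX_mul_mb (by have := one_lt_p p; omega), smul_zero, mul_one,
    sub_zero]

theorem topX_mul_rr (μ : F) : (mb (p ^ 2 - 1) 0 * rr μ : BAlg F p) = mb (p ^ 2 - 1) 0 := by
  rw [rr, mul_add, mul_smul_comm, topX_mul_mb (by have := one_lt_p p; omega), smul_zero, mul_one,
    add_zero]

theorem d1_topX_mul_rt (μ : F) :
    (d1 (mb (p ^ 2 - 1) 0) * rt μ : BAlg F p) = -mb (p ^ 2 - 1) 0 := by
  have h := congrArg d1 (topX_mul_rt (F := F) (p := p) μ)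
  rw [Derivation.leibniz, d1_rt, map_zero, smul_eq_mul, smul_eq_mul, topX_mul_rr] at h
  linear_combination h

theorem vop_jh (μ : F) (u : BAlg F p) : vop F p (jh μ u) = 0 := by
  rw [vop_apply, d2_jh]
  linear_combination (d2 (qq F p) * d1 (ev u)) * topX_mul_rt (F := F) (p := p) μ

theorem vop_y0 (μ : F) : vop F p (y0 μ) = jh μ (mb (p ^ 2 - 1) 0) * y0 μ := by
  have h := d2_isDer.map_y0 (F := F) (p := p) μ
  rw [d2L_apply, d2L_apply, d2_zz] at h
  rw [vop_apply, h, jh_apply, ev_mb_zero]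
  linear_combination (y0 μ - qq F p * rr μ) * topX_mul_ri (F := F) (p := p) μ
    - (qq F p) * topX_mul_rr (F := F) (p := p) μ
    - (qq F p * y0 μ) * d1_topX_mul_rt (F := F) (p := p) μ
    + (mb (p ^ 2 - 1) 0) * y0_mul_qq (F := F) (p := p) μ

theorem vop_y0_pow (μ : F) (k : ℕ) :
    vop F p (y0 μ ^ k) = (k : F) • (jh μ (mb (p ^ 2 - 1) 0) * y0 μ ^ k) :=
  vop_isDer.map_pow (vop_y0 μ) k

/-! ### Powers of `∂` -/

theorem d1_mb_of_lt {n : ℕ} (hn : n + 1 < p) : d1 (mb (n + 1) 0 : BAlg F p) = mb n 0 :=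
  d1_mb_succ (lt_trans hn prime_lt_sq) pos_p

theorem dd_mb {μ : F} {n : ℕ} (hn0 : n ≠ 0) (hn : n + 1 < p) :
    dd μ (mb (n + 1) 0 : BAlg F p) = mb n 0 := by
  rw [dd_apply, d1_mb_of_lt hn, ri, sub_mul, one_mul, smul_mul_assoc,
    xp_mul_mb hn0 (by omega), smul_zero, sub_zero]

theorem dd_pow_mb (μ : F) : ∀ {n : ℕ}, n + 1 < p →
    (dd μ ^ (n + 1)) (mb (n + 1) 0 : BAlg F p) = ri μ
  | 0, h => by rw [zero_add, pow_one, dd_apply, d1_mb_of_lt h, mb_zero_zero, mul_one]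
  | n + 1, h => by
    rw [pow_succ, Module.End.mul_apply, dd_mb (Nat.succ_ne_zero n) h,
      dd_pow_mb μ (by omega)]

/-- Both sides are derivations and are compared on the generators. Repeated application of ∂ lowers
x₁^{(p-1)} to r⁻¹ = 1 − μ·x₁^{(p-1)}, which accounts for the term μ∂ on x₁ and for D₁^p on x₁^{(p)}.
-/
theorem dd_pow_p (hp : 3 < p) (μ : F) : (dd μ : EndB F p) ^ p = Del F p - μ • dd μ := by
  obtain ⟨m, hm⟩ : ∃ m, p = m + 1 + 1 := ⟨p - 2, by omega⟩
  have hx : (dd μ ^ (p - 1)) (mb (p - 1) 0 : BAlg F p) = ri μ := by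
    rw [show p - 1 = m + 1 by omega]; exact dd_pow_mb μ (by omega)
  have hsucc : ∀ u : BAlg F p, (dd μ ^ p) u = (dd μ ^ (p - 1)) (dd μ u) := by
    intro u
    rw [← Module.End.mul_apply, ← pow_succ, Nat.sub_add_cancel (one_lt_p p).le]
  have h1 : (dd μ ^ (p - 1)) (1 : BAlg F p) = 0 := by
    rw [show p - 1 = m + 1 by omega, pow_succ, Module.End.mul_apply, (dd_isDer μ).map_one, map_zero]
  refine (dd_isDer μ).pow_p.ext (Del_isPD.1.sub ((dd_isDer μ).smul μ)) ?_ ?_ ?_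
  · rw [hsucc, LinearMap.sub_apply, LinearMap.smul_apply, Del_gX, dd_apply, d1_gX, mul_one]
    conv_lhs => rw [ri, map_sub, map_smul, hx, h1]
  · rw [hsucc, LinearMap.sub_apply, LinearMap.smul_apply, Del_gY, dd_apply, d1_gY_mb]
    have : (ri μ * mb (p - 1) 0 : BAlg F p) = mb (p - 1) 0 := by
      rw [ri, sub_mul, one_mul, smul_mul_assoc, xp_mul_xp, smul_zero, sub_zero]
    rw [this, hx, ri]
  · rw [hsucc, LinearMap.sub_apply, LinearMap.smul_apply, Del_gZ, dd_apply, d1_gZ]; simp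

theorem hop_pow_jh (μ : F) (n : ℕ) (u : BAlg F p) :
    (hop μ ^ n) (jh μ u) = (-1 : F) ^ n • jh μ ((dd μ ^ n) u) := by
  induction n generalizing u with
  | zero => simp
  | succ n ih =>
    rw [pow_succ, Module.End.mul_apply, hop_jh, map_neg, ih, pow_succ (dd μ), Module.End.mul_apply,
      pow_succ, mul_neg_one, neg_smul]

theorem nop_pow_jh (μ : F) (n : ℕ) (u : BAlg F p) :
    (nop μ ^ n) (jh μ u) = jh μ ((Del F p ^ n) u) := by
  induction n generalizing u with
  | zero => simp
  | succ n ih =>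
    rw [pow_succ, Module.End.mul_apply, nop_jh, ih, pow_succ (Del F p), Module.End.mul_apply]

theorem pow_apply_of_zero {T : EndB F p} {a : BAlg F p} (h : T a = 0) {n : ℕ} (hn : n ≠ 0) :
    (T ^ n) a = 0 := by
  obtain ⟨m, rfl⟩ := Nat.exists_eq_succ_of_ne_zero hn
  rw [pow_succ, Module.End.mul_apply, h, map_zero]

/-- On j the operator is −∂, so its p-th power is −∂^p because p is odd, and `dd_pow_p` applies.
Everything vanishes on y. -/
theorem hop_pow_p (hp : 3 < p) (μ : F) : (hop μ : EndB F p) ^ p = (-μ) • hop μ - nop μ := by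
  have hodd : Odd p := (Fact.out : p.Prime).odd_of_ne_two (by omega)
  refine (hop_isDer μ).pow_p.eq_of_frame (((hop_isDer μ).smul (-μ)).sub (nop_isDer μ)) μ
    (fun u => ?_) ?_
  · rw [hop_pow_jh, dd_pow_p hp, hodd.neg_one_pow, LinearMap.sub_apply, LinearMap.sub_apply,
      LinearMap.smul_apply, LinearMap.smul_apply, hop_jh, nop_jh, map_sub, map_smul]
    module
  · rw [pow_apply_of_zero (hop_y0 μ) (by omega), LinearMap.sub_apply,
      LinearMap.smul_apply, hop_y0, nop_y0]
    simp

theorem nop_pow_p (hp : 3 < p) (μ : F) : (nop μ : EndB F p) ^ p = 0 := by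
  refine (nop_isDer μ).pow_p.eq_zero_of_frame μ (fun u => ?_) ?_
  · rw [nop_pow_jh, Del_pow_p, LinearMap.zero_apply, map_zero]
  · rw [pow_apply_of_zero (nop_y0 μ) (by omega)]

/-! ### The elements of `G` in terms of their potentials -/

theorem cf_ev_of_ne (i : ℕ) {j : ℕ} (hj : j ≠ 0) (f : BAlg F p) : cf i j (ev f) = 0 := by
  have : (cf i j).comp (ev (F := F) (p := p)).toLinearMap = 0 := by
    refine BAlg_hom_ext fun k l hk hl => ?_
    simp only [LinearMap.comp_apply, AlgHom.toLinearMap_apply, ev_mb, LinearMap.zero_apply]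
    split_ifs with h
    · rw [cf_mb hk pos_p, if_neg (by omega)]
    · rw [map_zero]
  exact LinearMap.congr_fun this f

theorem ev_eq_self_iff {f : BAlg F p} : ev f = f ↔ ∀ i j, j ≠ 0 → cf i j f = 0 := by
  constructor
  · intro h i j hj
    rw [← h, cf_ev_of_ne i hj]
  · intro h
    refine BAlg_ext fun i j => ?_
    by_cases hj : j = 0
    · rw [hj, cf_ev]
    · rw [cf_ev_of_ne i hj, h i j hj]

theorem ev_mk_of_mem {k : ℕ} {u : O2 F} (hu : u ∈ O21x1 F p k) :
    ev (⟨u, O21x1_le hu⟩ : BAlg F p) = ⟨u, O21x1_le hu⟩ := by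
  refine ev_eq_self_iff.2 fun i j hj => ?_
  exact coeff_eq_zero_of_mem_monSpan hu fun h => hj h.2.2

theorem coe_mem_O21x1 {f : BAlg F p} (hf : ev f = f) : (f : O2 F) ∈ O21x1 F p 0 := by
  refine mem_monSpan_iff.2 ?_
  rintro ⟨i, j⟩ h
  by_cases hj : j = 0
  · refine cf_eq_zero f fun h' => h ⟨Nat.zero_le _, h'.1, hj⟩
  · exact ev_eq_self_iff.1 hf i j hj

theorem coe_mem_O21x1_one {f : BAlg F p} (hf : ev f = f) (h0 : eps f = 0) :
    (f : O2 F) ∈ O21x1 F p 1 := by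
  refine mem_monSpan_iff.2 ?_
  rintro ⟨i, j⟩ h
  by_cases hj : j = 0
  · by_cases hi : i = 0
    · rw [hi, hj]; rw [eps_eq_cf] at h0; exact h0
    · refine cf_eq_zero f fun h' => h ⟨Nat.one_le_iff_ne_zero.2 hi, h'.1, hj⟩
  · exact ev_eq_self_iff.1 hf i j hj

theorem coe_gX : ((gX : BAlg F p) : O2 F) = mon (1, 0) := coe_mb (one_lt_sq p) pos_p

theorem coe_gY : ((gY : BAlg F p) : O2 F) = mon (p, 0) := coe_mb prime_lt_sq pos_p

theorem coe_gZ : ((gZ : BAlg F p) : O2 F) = mon (0, 1) := coe_mb (pow_pos pos_p 2) (one_lt_p p)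

theorem coe_qq : ((qq F p : BAlg F p) : O2 F) = mon (0, p - 1) :=
  coe_mb (pow_pos pos_p 2) (by have := one_lt_p p; omega)

theorem coe_xp : ((mb (p - 1) 0 : BAlg F p) : O2 F) = mon (p - 1, 0) :=
  coe_mb (lt_of_le_of_lt (Nat.sub_le _ _) prime_lt_sq) pos_p

theorem coe_rt (μ : F) : ((rt μ : BAlg F p) : O2 F) = rTilde p μ := by
  rw [rTilde, ← coe_gX (p := p), ← coe_gY (p := p)]; rfl

theorem coe_rr (μ : F) : ((rr μ : BAlg F p) : O2 F) = rEl p μ := by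
  rw [rEl, ← coe_xp (p := p)]; rfl

theorem coe_ri (μ : F) : ((ri μ : BAlg F p) : O2 F) = rInv p μ := by
  rw [rInv, ← coe_xp (p := p)]; rfl

theorem DG_congr {f g : O2 F} {hf : f ∈ Pot F p} {hg : g ∈ Pot F p} (h : f = g) :
    DG f hf = DG g hg := by subst h; rfl

theorem DG_eq_DGL {f : O2 F} {hf : f ∈ Pot F p} {g : BAlg F p} (h : f = g) :
    DG f hf = DGL (inB g) := DG_congr (hg := (inB g).2) h

theorem tEl_eq (μ : F) : tEl p μ = DGL (inB (tt μ : BAlg F p)) := by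
  refine DG_eq_DGL ?_
  rw [tt, jh_apply, ev_rt, d1_rt, ← coe_rt, ← coe_rr, ← coe_qq]
  simp only [Subalgebra.coe_add, Subalgebra.coe_mul]
  ring

theorem cEl_eq {μ : F} {u : BAlg F p} (hu : ev u = u) (hu' : (u : O2 F) ∈ Pot F p) :
    cEl p μ u hu' = DGL (inB (jh μ u)) := by
  refine DG_eq_DGL ?_
  rw [jh_apply, hu, ← coe_rt, ← coe_qq, ← coe_d1]
  simp only [Subalgebra.coe_add, Subalgebra.coe_mul]
  ring

/-- `x₂^{(p)}` as a potential. -/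
def x2Pot (F : Type*) [Field F] (p : ℕ) [Fact p.Prime] [CharP F p] : Pot F p :=
  ⟨mon (0, p), x2_mem_Pot le_rfl⟩

/-- `x₁^{(p²)}` as a potential. -/
def vPot (F : Type*) [Field F] (p : ℕ) [Fact p.Prime] [CharP F p] : Pot F p :=
  ⟨mon (p ^ 2, 0), x1_mem_Pot le_rfl⟩

theorem op_x2Pot (f : BAlg F p) : op (x2Pot F p) f = -(qq F p * d1 f) := by
  apply Subtype.ext
  rw [coe_op_apply]
  change D1 (mon (0, p)) * _ - D2 (mon (0, p)) * _ = -((qq F p : O2 F) * D1 (f : O2 F))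
  rw [D1_mon, D2_mon, coe_qq, if_pos rfl, if_neg (Fact.out : p.Prime).ne_zero]
  ring

theorem op_vPot : op (vPot F p) = vop F p := by
  refine LinearMap.ext fun f => Subtype.ext ?_
  rw [coe_op_apply, vop_apply]
  change D1 (mon (p ^ 2, 0)) * _ - D2 (mon (p ^ 2, 0)) * _ =
    ((mb (p ^ 2 - 1) 0 : BAlg F p) : O2 F) * D2 (f : O2 F)
  rw [D1_mon, D2_mon, coe_mb (by have := one_lt_sq p; omega) pos_p, if_pos rfl,
    if_neg (by have := one_lt_sq p; dsimp only; omega)]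
  ring

theorem vEl_eq : vEl p F = DGL (vPot F p) := rfl

theorem hEl_eq (μ : F) : hEl p μ = DGL (inB (zz μ) - x2Pot F p) := by
  refine DG_congr (hg := (inB (zz μ) - x2Pot F p).2) ?_
  change _ = ((zz μ : BAlg F p) : O2 F) - mon (0, p)
  rw [zz, Subalgebra.coe_mul, coe_ri, coe_gZ]

theorem op_hPot (μ : F) : op (inB (zz μ) - x2Pot F p) = hop μ := by
  refine LinearMap.ext fun f => ?_
  rw [map_sub, LinearMap.sub_apply, op_x2Pot, op_inB_apply, hop_apply, sub_neg_eq_add]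

theorem rep_hEl (μ : F) : Rep (rho F p (hEl p μ)) (hop μ) := by
  rw [hEl_eq, ← op_hPot]; exact rep_rho _

theorem rep_vEl : Rep (rho F p (vEl p F)) (vop F p) := by
  rw [vEl_eq, ← op_vPot]; exact rep_rho _

theorem rep_tEl (μ : F) : Rep (rho F p (tEl p μ)) (pbL (tt μ)) := by
  rw [tEl_eq]; exact rep_rho_inB _

theorem nop_eq (μ : F) : nop μ = Del F p + μ • op (x2Pot F p) := by
  refine LinearMap.ext fun f => ?_
  rw [nop_apply, LinearMap.add_apply, LinearMap.smul_apply, op_x2Pot, smul_neg, sub_eq_add_neg]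

theorem rep_nEl (μ : F) : Rep (nEl p μ) (nop μ : EndB F p) := by
  rw [nop_eq]
  exact rep_d1El_pow.add ((rep_rho (x2Pot F p)).smul μ)

theorem nop_isPD (μ : F) : IsPD (nop μ : EndB F p) := by
  rw [nop_eq]; exact Del_isPD.add ((op_isPD _).smul μ)

theorem hop_isPD (μ : F) : IsPD (hop μ : EndB F p) := by
  rw [← op_hPot]; exact op_isPD _

theorem vop_isPD : IsPD (vop F p) := by
  rw [← op_vPot]; exact op_isPD _

theorem nEl_mem_GG (μ : F) : nEl p μ ∈ GG F p :=
  add_mem (pow_mem_pEnvelope (rho_mem_GG _)) ((GG F p).smul_mem μ (rho_mem_GG _))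

theorem cast_pow_pred {k : ℕ} (hk : 1 ≤ k) (hkp : k < p) : (k : F) ^ (p - 1) = 1 := by
  have := natCast_sub_pow_pred (F := F) (p := p) (k := k) (l := 0) hkp pos_p (by omega)
  simpa using this

/-- The sum over i is the expansion of y^k = exp(k·r⁻¹x₂), and the last term is the correction in
j(u), because q·y^k = q and k^{p-1} = 1. -/
theorem phi_eq {μ : F} {u : BAlg F p} (hu : ev u = u) (hu' : (u : O2 F) ∈ O21x1 F p 0) {k : ℕ}
    (hk : 1 ≤ k) (hkp : k < p) :
    phi p μ (k : F) u hu' = DGL (inB (jh μ u * y0 μ ^ k)) := by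
  have hsum : jh μ u * y0 μ ^ k = (∑ i : Fin p, (k : F) ^ (i : ℕ) •
      (ri μ ^ (i : ℕ) * u * mb 0 (i : ℕ))) + (k : F) ^ (p - 1) • (rt μ * d1 u * qq F p) := by
    have h1 : y0 μ ^ k * qq F p = qq F p := by
      clear hk hkp
      induction k with
      | zero => simp
      | succ k ih => rw [pow_succ, mul_assoc, y0_mul_qq, ih]
    have h2 : y0 μ ^ k = ∑ i : Fin p, (k : F) ^ (i : ℕ) • (ri μ ^ (i : ℕ) * mb 0 (i : ℕ)) := by
      rw [y0, ex_pow (zz_pow_p μ), mul_one, ex, Finset.sum_range]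
      refine Finset.sum_congr rfl fun i _ => ?_
      rw [dpw, zz, mul_pow, ← mul_smul_comm, ← dpw_gZ i.2, dpw]
    rw [cast_pow_pred hk hkp, one_smul]
    have h3 : jh μ u * y0 μ ^ k = u * y0 μ ^ k + rt μ * d1 u * qq F p := by
      rw [jh_apply, hu]
      linear_combination (rt μ * d1 u) * h1
    rw [h3, h2, Finset.mul_sum]
    congr 1
    refine Finset.sum_congr rfl fun i _ => ?_
    rw [mul_smul_comm]; congr 1; ring
  rw [hsum, map_add, map_add, map_sum, map_sum, phi]
  congr 1
  · refine Finset.sum_congr rfl fun i _ => ?_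
    rw [map_smul, map_smul]
    congr 1
    refine DG_eq_DGL ?_
    rw [Subalgebra.coe_mul, Subalgebra.coe_mul, Subalgebra.coe_pow, coe_ri,
      coe_mb (pow_pos pos_p 2) i.2]
  · rw [map_smul, map_smul]
    congr 1
    refine DG_eq_DGL ?_
    rw [Subalgebra.coe_mul, Subalgebra.coe_mul, coe_rt, coe_qq, coe_d1]

theorem cEl_top (μ : F) (h : (mon (p ^ 2, 0) : O2 F) ∈ Pot F p) :
    cEl p μ (mon (p ^ 2, 0)) h = vEl p F := by
  refine DG_congr ?_
  have h1 := one_lt_sq p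
  rw [D1_mon, if_neg (by dsimp only; omega), ← coe_rt,
    ← coe_mb (F := F) (p := p) (i := p ^ 2 - 1) (j := 0) (by omega) pos_p, ← Subalgebra.coe_mul,
    topX_mul_rt]
  simp

/-! ### The shape of Poisson derivations -/

theorem Pot_decomp (f : Pot F p) : ∃ g : BAlg F p,
    f = inB g + coeff (p ^ 2, 0) (f : O2 F) • vPot F p + coeff (0, p) (f : O2 F) • x2Pot F p := by
  have hp0 := pos_p (p := p)
  have hp2 : 0 < p ^ 2 := pow_pos hp0 2
  set g : O2 F := (f : O2 F) - coeff (p ^ 2, 0) (f : O2 F) • mon (p ^ 2, 0) -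
    coeff (0, p) (f : O2 F) • mon (0, p) with hg
  have hgm : g ∈ O21 F p := by
    refine mem_O21_iff.2 (mem_monSpan_iff.2 ?_)
    rintro ⟨i, j⟩ h
    rw [hg, map_sub, map_sub, map_smul, map_smul, coeff_mon, coeff_mon]
    have e1 : ∀ i j, ¬ (i < p ^ 2 ∧ j < p) → coeff (i + 1, j) (f : O2 F) = 0 := by
      intro i j h
      rw [← coeff_D1]
      exact coeff_eq_zero_of_mem_monSpan (mem_O21_iff.1 f.2.1) h
    have e2 : ∀ i j, ¬ (i < p ^ 2 ∧ j < p) → coeff (i, j + 1) (f : O2 F) = 0 := by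
      intro i j h
      rw [← coeff_D2]
      exact coeff_eq_zero_of_mem_monSpan (mem_O21_iff.1 f.2.2) h
    by_cases ha : i = p ^ 2 ∧ j = 0
    · obtain ⟨rfl, rfl⟩ := ha
      rw [if_pos rfl, if_neg (by rw [Prod.mk.injEq]; omega)]
      simp
    by_cases hb : i = 0 ∧ j = p
    · obtain ⟨rfl, rfl⟩ := hb
      rw [if_pos rfl, if_neg (by rw [Prod.mk.injEq]; omega)]
      simp
    rw [if_neg (by rw [Prod.mk.injEq]; omega), if_neg (by rw [Prod.mk.injEq]; omega), smul_zero,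
      smul_zero, sub_zero, sub_zero]
    have h' : ¬ (i < p ^ 2 ∧ j < p) := h
    by_cases hj : j = 0
    · obtain ⟨k, rfl⟩ : ∃ k, i = k + 1 := ⟨i - 1, by omega⟩
      exact e1 k j (by omega)
    · obtain ⟨l, rfl⟩ : ∃ l, j = l + 1 := ⟨j - 1, by omega⟩
      by_cases hil : i < p ^ 2 ∧ l < p
      · obtain ⟨k, rfl⟩ : ∃ k, i = k + 1 := ⟨i - 1, by omega⟩
        exact e1 k (l + 1) (by omega)
      · exact e2 i l hil
  refine ⟨⟨g, hgm⟩, Subtype.ext ?_⟩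
  change (f : O2 F) = g + coeff (p ^ 2, 0) (f : O2 F) • mon (p ^ 2, 0) +
    coeff (0, p) (f : O2 F) • mon (0, p)
  rw [hg]; abel

theorem IsPD.exists_normal {T : EndB F p} (hT : IsPD T) (μ : F) :
    ∃ (β γ s : F) (g : BAlg F p), T = β • nop μ + γ • hop μ + s • vop F p + pbL g := by
  obtain ⟨f, β, rfl⟩ := hT.exists_op
  obtain ⟨g, hg⟩ := Pot_decomp f
  set s := coeff (p ^ 2, 0) (f : O2 F)
  set c := coeff (0, p) (f : O2 F)
  refine ⟨β, β * μ - c, s, g + (c - β * μ) • zz μ, ?_⟩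
  rw [hg, map_add, map_add, map_smul, map_smul, op_inB, op_vPot]
  refine LinearMap.ext fun h => ?_
  simp only [LinearMap.add_apply, LinearMap.smul_apply, map_add, map_smul, op_x2Pot, nop_apply,
    hop_apply, pbL_apply]
  simp only [smul_sub, smul_smul, smul_add, sub_smul, smul_neg]
  module

theorem const_of_pbL_eq_zero {f : BAlg F p} (h : (pbL f : EndB F p) = 0) :
    f = algebraMap F _ (eps f) := by
  refine BAlg_const_of_d ?_ ?_
  · have := LinearMap.congr_fun h gZ
    simpa [pb, d1_gZ, d2_gZ] using this
  · have := LinearMap.congr_fun h gX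
    simpa [pb, d1_gX, d2_gX] using this

theorem pb_algebraMap_right (f : BAlg F p) (c : F) : pb f (algebraMap F _ c) = 0 :=
  (IsPD.pb_left f).1.map_algebraMap c

theorem pbL_algebraMap (c : F) : (pbL (algebraMap F (BAlg F p) c) : EndB F p) = 0 :=
  LinearMap.ext fun f => by rw [pbL_apply, pb_comm, pb_algebraMap_right, neg_zero]; rfl

/-- Bracketing twice with t_μ kills g, so the p-th power of {t_μ, ·} kills it as well. Torality then
gives {t_μ, g} = 0, and g lies in the zero eigenspace. -/
theorem eq_jh_of_pb_tt_const (hp : 3 < p) {μ : F} {g : BAlg F p} {c : F}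
    (h : pb (tt μ) g = algebraMap F _ c) : g = jh μ g := by
  have h2 : ((pbL (tt μ) : EndB F p) ^ 2) g = 0 := by
    rw [sq, Module.End.mul_apply, pbL_apply, pbL_apply, h, pb_algebraMap_right]
  have h3 : pb (tt μ) g = 0 := by
    have := LinearMap.congr_fun (pbL_tt_pow_p (F := F) hp μ) g
    rw [← pow_sub_mul_pow _ (by omega : 2 ≤ p), Module.End.mul_apply, h2, map_zero, pbL_apply]
      at this
    exact this.symm
  have := eq_jh_mul_y0_pow hp (k := 0) (a := g) (μ := μ) (by rw [h3]; simp)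
  rwa [pow_zero, mul_one] at this

/-- Poisson derivations which commute with `t_μ`. -/
theorem IsPD.exists_of_commute (hp : 3 < p) {T : EndB F p} (hT : IsPD T) {μ : F}
    (h : pbL (tt μ) * T - T * pbL (tt μ) = 0) :
    ∃ (β γ s : F) (u : BAlg F p), ev u = u ∧
      T = β • nop μ + γ • hop μ + s • vop F p + pbL (jh μ u) := by
  obtain ⟨β, γ, s, g, rfl⟩ := hT.exists_normal μ
  -- The commutator of T with {t_μ, ·} is again Hamiltonian, with potential T(t_μ) up to sign. So
  -- T(t_μ) is constant, and as n_μ, h_μ and D_H(x₁^{(p²)}) send t_μ to constants, so does {g, ·}.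
  have h1 := hT.lie_pbL (tt μ)
  rw [← neg_sub, h, neg_zero] at h1
  have h2 := const_of_pbL_eq_zero h1.symm
  set c := eps ((β • nop μ + γ • hop μ + s • vop F p + pbL g : EndB F p) (tt μ))
  have h3 : (β • nop μ + γ • hop μ + s • vop F p + pbL g : EndB F p) (tt μ) =
      algebraMap F _ (β * μ - γ) + pb g (tt μ) := by
    simp only [LinearMap.add_apply, LinearMap.smul_apply, pbL_apply]
    rw [tt, nop_jh, hop_jh, vop_jh, Del_rt, dd_rt, AlgHom.commutes, map_one]
    simp only [Algebra.smul_def, map_sub, map_mul]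
    ring
  refine ⟨β, γ, s, ev g, ev_ev g, ?_⟩
  rw [jh_ev, ← eq_jh_of_pb_tt_const hp (c := β * μ - γ - c)]
  rw [pb_comm, map_sub]
  rw [h3] at h2
  linear_combination -h2

theorem rep_lie_tEl {x : EndS F p} {T : EndB F p} (h : Rep x T) (μ : F) :
    Rep (rho F p (tEl p μ) * x - x * rho F p (tEl p μ)) (pbL (tt μ) * T - T * pbL (tt μ)) :=
  ((rep_tEl μ).mul h).sub (h.mul (rep_tEl μ))

theorem rep_jh (μ : F) (u : BAlg F p) : Rep (rho F p (DGL (inB (jh μ u)))) (pbL (jh μ u)) :=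
  rep_rho_inB _

theorem mem_Cmu_iff {μ : F} {x : EndS F p} : x ∈ Cmu p μ ↔
    x ∈ GG F p ∧ rho F p (tEl p μ) * x - x * rho F p (tEl p μ) = 0 := Iff.rfl

theorem exists_of_mem_Cmu (hp : 3 < p) {μ : F} {x : EndS F p} (hx : x ∈ Cmu p μ) :
    ∃ (β γ s : F) (u : BAlg F p), ev u = u ∧
      Rep x (β • nop μ + γ • hop μ + s • vop F p + pbL (jh μ u)) ∧
      x = β • nEl p μ + γ • rho F p (hEl p μ) + s • rho F p (vEl p F) +
        rho F p (DGL (inB (jh μ u))) := by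
  obtain ⟨hx1, hx2⟩ := mem_Cmu_iff.1 hx
  obtain ⟨T, hT, hxT⟩ := GG_exists hx1
  have h := rep_lie_tEl hxT μ
  rw [hx2] at h
  have h0 : pbL (tt μ) * T - T * pbL (tt μ) = 0 :=
    h.der_eq_zero hp ((IsPD.pb_left _).lie hT).1
  obtain ⟨β, γ, s, u, hu, rfl⟩ := hT.exists_of_commute hp h0
  refine ⟨β, γ, s, u, hu, hxT, hxT.unique ?_⟩
  exact ((((rep_nEl μ).smul β).add ((rep_hEl μ).smul γ)).add (rep_vEl.smul s)).add (rep_jh μ u)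

theorem mem_Cmu_of_rep {μ : F} {x : EndS F p} (hx : x ∈ GG F p) {T : EndB F p} (hT : Rep x T)
    (h : pbL (tt μ) * T - T * pbL (tt μ) = 0) : x ∈ Cmu p μ := by
  refine mem_Cmu_iff.2 ⟨hx, ?_⟩
  have := rep_lie_tEl hT μ
  rw [h] at this
  exact this.unique Rep.zero

theorem commute_of_const {T : EndB F p} (hT : IsPD T) {μ c : F} (h : T (tt μ) = algebraMap F _ c) :
    pbL (tt μ) * T - T * pbL (tt μ) = 0 := by
  rw [← neg_sub, hT.lie_pbL, h, pbL_algebraMap, neg_zero]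

theorem nop_tt (μ : F) : nop μ (tt μ : BAlg F p) = algebraMap F _ μ := by
  rw [tt, nop_jh, Del_rt, AlgHom.commutes]

theorem hop_tt (μ : F) : hop μ (tt μ : BAlg F p) = algebraMap F _ (-1) := by
  rw [tt, hop_jh, dd_rt, map_one, map_neg, map_one]

theorem nEl_mem_Cmu (μ : F) : nEl p μ ∈ Cmu p μ :=
  mem_Cmu_of_rep (nEl_mem_GG μ) (rep_nEl μ) (commute_of_const (nop_isPD μ) (nop_tt μ))

theorem hEl_mem_Cmu (μ : F) : rho F p (hEl p μ) ∈ Cmu p μ :=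
  mem_Cmu_of_rep (rho_mem_GG _) (rep_hEl μ) (commute_of_const (hop_isPD μ) (hop_tt μ))

theorem vEl_mem_Cmu (μ : F) : rho F p (vEl p F) ∈ Cmu p μ :=
  mem_Cmu_of_rep (rho_mem_GG _) rep_vEl
    (commute_of_const (c := 0) vop_isPD (by rw [tt, vop_jh, map_zero]))

theorem jh_mem_Cmu (hp : 3 < p) (μ : F) (u : BAlg F p) :
    rho F p (DGL (inB (jh μ u))) ∈ Cmu p μ :=
  mem_Cmu_of_rep (rho_mem_GG _) (rep_jh μ u)
    (commute_of_const (c := 0) (IsPD.pb_left _) (by rw [tt, pbL_apply, pb_jh_jh hp, map_zero]))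

theorem mem_CmuPrime_iff {μ : F} {x : EndS F p} : x ∈ CmuPrime p μ ↔
    ∃ (s : F) (u : BAlg F p), x = s • rho F p (vEl p F) + rho F p (DGL (inB (jh μ u))) := by
  constructor
  · intro hx
    rw [CmuPrime] at hx
    induction hx using Submodule.span_induction with
    | mem x hx =>
      rcases hx with ⟨u, hu, rfl⟩ | rfl
      · refine ⟨0, ⟨u, O21x1_le hu⟩, ?_⟩
        rw [zero_smul, zero_add, ← cEl_eq (ev_mk_of_mem hu)]
      · refine ⟨1, 0, ?_⟩
        rw [one_smul, map_zero, map_zero, map_zero, map_zero, add_zero]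
    | zero => exact ⟨0, 0, by simp⟩
    | add x y _ _ hx hy =>
      obtain ⟨s, u, rfl⟩ := hx
      obtain ⟨s', u', rfl⟩ := hy
      refine ⟨s + s', u + u', ?_⟩
      simp only [map_add, add_smul]
      abel
    | smul c x _ hx =>
      obtain ⟨s, u, rfl⟩ := hx
      refine ⟨c * s, c • u, ?_⟩
      simp only [map_smul, smul_add, smul_smul]
  · rintro ⟨s, u, rfl⟩
    refine add_mem (Submodule.smul_mem _ _ (Submodule.subset_span (Or.inr rfl)))
      (Submodule.subset_span (Or.inl ⟨(ev u : BAlg F p), coe_mem_O21x1 (ev_ev u), ?_⟩))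
    rw [cEl_eq (ev_ev u), jh_ev]

/-! ### The centralizer of `t_μ` -/

theorem Rep.lie {x y : EndS F p} {T T' : EndB F p} (h : Rep x T) (h' : Rep y T') :
    Rep (x * y - y * x) (T * T' - T' * T) := (h.mul h').sub (h'.mul h)

/-- The general element of the centralizer of `t_μ`. -/
def cop (μ β γ s : F) (u : BAlg F p) : EndB F p :=
  β • nop μ + γ • hop μ + s • vop F p + pbL (jh μ u)

theorem cop_isPD (μ β γ s : F) (u : BAlg F p) : IsPD (cop μ β γ s u) :=
  ((((nop_isPD μ).smul β).add ((hop_isPD μ).smul γ)).add (vop_isPD.smul s)).add (IsPD.pb_left _)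

theorem cop_jh (hp : 3 < p) (μ β γ s : F) (u v : BAlg F p) :
    cop μ β γ s u (jh μ v) = jh μ (β • Del F p v - γ • dd μ v) := by
  simp only [cop, LinearMap.add_apply, LinearMap.smul_apply, nop_jh, hop_jh, vop_jh, pbL_apply,
    pb_jh_jh hp, map_sub, map_smul]
  module

theorem cop_y0 (μ β γ s : F) (u : BAlg F p) :
    cop μ β γ s u (y0 μ) = jh μ (s • mb (p ^ 2 - 1) 0 + dd μ u) * y0 μ := by
  simp only [cop, LinearMap.add_apply, LinearMap.smul_apply, nop_y0, hop_y0, vop_y0, pbL_apply,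
    pb_jh_y0, map_add, map_smul, add_mul, smul_mul_assoc]
  module

theorem dd_Del (μ : F) (u : BAlg F p) : dd μ (Del F p u) = Del F p (dd μ u) := by
  rw [dd_apply, dd_apply, Del_isPD.1, Del_ri, Del_d1]; ring

/-- `D_H` of the bracket of `h_μ`, `n_μ` with `D_H(x₁^{(p²)})`. -/
def nvEl (μ : F) : BAlg F p := (dd μ ^ (p - 1)) (mb (p ^ 2 - 1) 0) + μ • mb (p ^ 2 - 1) 0

/-- This is ∂^p + μ∂ = D₁^p applied to x₁^{(p²-1)}. Thus `nvEl` replaces D₁^p(x₁^{(p²)}), which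
cannot be formed directly because x₁^{(p²)} is not in 𝒪(2;(2,1)). -/
theorem dd_nvEl (hp : 3 < p) (μ : F) : dd μ (nvEl μ : BAlg F p) = Del F p (mb (p ^ 2 - 1) 0) := by
  have h := LinearMap.congr_fun (dd_pow_p (F := F) hp μ) (mb (p ^ 2 - 1) 0)
  rw [← mul_pow_sub_one (by omega : p ≠ 0), Module.End.mul_apply] at h
  rw [nvEl, map_add, map_smul, h, LinearMap.sub_apply, LinearMap.smul_apply]
  abel

/-- In the frame an element of C_μ' only multiplies y by some j(w). The action of C_μ on w is
therefore β·D₁^p − γ·∂, which commutes with ∂. -/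
theorem lie_cop_prime (hp : 3 < p) (μ β γ s : F) (u : BAlg F p) (s' : F) (u' : BAlg F p) :
    cop μ β γ s u * cop μ 0 0 s' u' - cop μ 0 0 s' u' * cop μ β γ s u =
      pbL (jh μ (s' • (β • nvEl μ - γ • mb (p ^ 2 - 1) 0) + (β • Del F p u' - γ • dd μ u'))) := by
  refine IsDer.eq_of_frame ((cop_isPD μ β γ s u).lie (cop_isPD μ 0 0 s' u')).1
    (IsPD.pb_left _).1 μ (fun v => ?_) ?_
  · rw [LinearMap.sub_apply, Module.End.mul_apply, Module.End.mul_apply, cop_jh hp, cop_jh hp,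
      cop_jh hp, cop_jh hp, pbL_apply, pb_jh_jh hp]
    simp
  · rw [LinearMap.sub_apply, Module.End.mul_apply, Module.End.mul_apply, cop_y0, cop_y0,
      (cop_isPD _ _ _ _ _).1, (cop_isPD _ _ _ _ _).1, cop_jh hp, cop_jh hp, cop_y0, cop_y0,
      pbL_apply, pb_jh_y0]
    have : dd μ (s' • (β • nvEl μ - γ • mb (p ^ 2 - 1) 0) + (β • Del F p u' - γ • dd μ u')) =
        β • Del F p (s' • mb (p ^ 2 - 1) 0 + dd μ u') -
          γ • dd μ (s' • mb (p ^ 2 - 1) 0 + dd μ u') := by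
      simp only [map_add, map_sub, map_smul, dd_nvEl hp, dd_Del]
      module
    rw [this, zero_smul, zero_smul, sub_zero, map_zero]
    ring

theorem lie_nop_hop (μ β γ β' γ' : F) :
    (β • nop μ + γ • hop μ : EndB F p) * (β' • nop μ + γ' • hop μ) -
      (β' • nop μ + γ' • hop μ) * (β • nop μ + γ • hop μ) = 0 := by
  have h : (nop μ : EndB F p) * hop μ = hop μ * nop μ := by
    refine sub_eq_zero.1 (((nop_isDer μ).lie (hop_isDer μ)).eq_zero_of_frame μ (fun u => ?_) ?_)
    · rw [LinearMap.sub_apply, Module.End.mul_apply, Module.End.mul_apply, hop_jh, nop_jh, map_neg,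
        nop_jh, hop_jh, dd_Del]
      simp
    · rw [LinearMap.sub_apply, Module.End.mul_apply, Module.End.mul_apply, hop_y0, nop_y0, map_zero,
        map_zero, sub_zero]
  simp only [mul_add, add_mul, smul_mul_smul_comm, h, mul_comm β' β, mul_comm γ' γ,
    mul_comm β' γ, mul_comm β γ']
  abel

theorem rep_cop (μ β γ s : F) (u : BAlg F p) :
    Rep (β • nEl p μ + γ • rho F p (hEl p μ) + s • rho F p (vEl p F) +
        rho F p (DGL (inB (jh μ u)))) (cop μ β γ s u) :=
  ((((rep_nEl μ).smul β).add ((rep_hEl μ).smul γ)).add (rep_vEl.smul s)).add (rep_jh μ u)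

theorem rep_prime (μ s : F) (u : BAlg F p) :
    Rep (s • rho F p (vEl p F) + rho F p (DGL (inB (jh μ u)))) (cop μ 0 0 s u) := by
  have := rep_cop (p := p) μ 0 0 s u
  rwa [zero_smul, zero_smul, zero_add, zero_add] at this

theorem CmuPrime_le (hp : 3 < p) (μ : F) : CmuPrime p μ ≤ (Cmu p μ).toSubmodule := by
  intro x hx
  obtain ⟨s, u, rfl⟩ := mem_CmuPrime_iff.1 hx
  exact add_mem ((Cmu p μ).smul_mem s (vEl_mem_Cmu μ)) (jh_mem_Cmu hp μ u)

/-- The bracket of an element of the centralizer with an element of its abelian ideal. -/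
theorem lie_prime_eq (hp : 3 < p) {μ β γ s : F} {u : BAlg F p} {x : EndS F p}
    (hx : Rep x (cop μ β γ s u)) (s' : F) (u' : BAlg F p) :
    x * (s' • rho F p (vEl p F) + rho F p (DGL (inB (jh μ u')))) -
      (s' • rho F p (vEl p F) + rho F p (DGL (inB (jh μ u')))) * x =
    rho F p (DGL (inB (jh μ (s' • (β • nvEl μ - γ • mb (p ^ 2 - 1) 0) +
      (β • Del F p u' - γ • dd μ u'))))) := by
  have h := hx.lie (rep_prime μ s' u')
  rw [lie_cop_prime hp] at h
  exact h.unique (rep_jh μ _)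

theorem CmuPrime_comm (hp : 3 < p) {μ : F} {x y : EndS F p} (hx : x ∈ CmuPrime p μ)
    (hy : y ∈ CmuPrime p μ) : x * y - y * x = 0 := by
  obtain ⟨s, u, rfl⟩ := mem_CmuPrime_iff.1 hx
  obtain ⟨s', u', rfl⟩ := mem_CmuPrime_iff.1 hy
  rw [lie_prime_eq hp (rep_prime μ s u)]
  simp

theorem CmuPrime_ideal (hp : 3 < p) {μ : F} {x y : EndS F p} (hx : x ∈ Cmu p μ)
    (hy : y ∈ CmuPrime p μ) : x * y - y * x ∈ CmuPrime p μ := by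
  obtain ⟨β, γ, s, u, -, hx', -⟩ := exists_of_mem_Cmu hp hx
  obtain ⟨s', u', rfl⟩ := mem_CmuPrime_iff.1 hy
  rw [lie_prime_eq hp hx']
  exact mem_CmuPrime_iff.2 ⟨0, _, by rw [zero_smul, zero_add]⟩

theorem commutator_add_add {R : Type*} [Ring R] (a b c d : R) :
    (a + b) * (c + d) - (c + d) * (a + b) =
      (a * c - c * a) - (c * b - b * c) + ((a + b) * d - d * (a + b)) := by noncomm_ring

theorem lie_nEl_hEl (μ β γ β' γ' : F) :
    (β • nEl p μ + γ • rho F p (hEl p μ)) * (β' • nEl p μ + γ' • rho F p (hEl p μ)) -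
      (β' • nEl p μ + γ' • rho F p (hEl p μ)) * (β • nEl p μ + γ • rho F p (hEl p μ)) = 0 := by
  have h := Rep.lie (((rep_nEl (p := p) μ).smul β).add ((rep_hEl μ).smul γ))
    (((rep_nEl (p := p) μ).smul β').add ((rep_hEl μ).smul γ'))
  rw [lie_nop_hop] at h
  exact h.unique Rep.zero

theorem exists_decomp_of_mem_Cmu (hp : 3 < p) {μ : F} {x : EndS F p} (hx : x ∈ Cmu p μ) :
    ∃ (β γ : F) (x₁ : EndS F p), x₁ ∈ CmuPrime p μ ∧
      x = (β • nEl p μ + γ • rho F p (hEl p μ)) + x₁ := by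
  obtain ⟨β, γ, s, u, -, -, h⟩ := exists_of_mem_Cmu hp hx
  exact ⟨β, γ, _, mem_CmuPrime_iff.2 ⟨s, u, rfl⟩, by rw [h, add_assoc]⟩

theorem lie_mem_CmuPrime (hp : 3 < p) {μ : F} {x y : EndS F p} (hx : x ∈ Cmu p μ)
    (hy : y ∈ Cmu p μ) : x * y - y * x ∈ CmuPrime p μ := by
  obtain ⟨β, γ, x₁, hx₁, rfl⟩ := exists_decomp_of_mem_Cmu hp hx
  obtain ⟨β', γ', y₁, hy₁, rfl⟩ := exists_decomp_of_mem_Cmu hp hy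
  rw [commutator_add_add, lie_nEl_hEl, zero_sub]
  exact add_mem (neg_mem (CmuPrime_ideal hp (add_mem ((Cmu p μ).smul_mem _ (nEl_mem_Cmu μ))
    ((Cmu p μ).smul_mem _ (hEl_mem_Cmu μ))) hx₁)) (CmuPrime_ideal hp hx hy₁)

/-- C_μ' kills all j(w). Testing on w = x₁ isolates b, because ∂x₁ has constant term 1, and then w =
x₁^{(p)} isolates a. -/
theorem Cmu_independent (hp : 3 < p) {μ a b : F}
    (h : a • nEl p μ + b • rho F p (hEl p μ) ∈ CmuPrime p μ) : a = 0 ∧ b = 0 := by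
  obtain ⟨s, u, hs⟩ := mem_CmuPrime_iff.1 h
  have h1 := rep_prime μ s u
  rw [← hs] at h1
  have h2 := ((rep_nEl (p := p) μ).smul a).add ((rep_hEl μ).smul b)
  have h3 := h2.der_eq hp h1 (((nop_isDer μ).smul a).add ((hop_isDer μ).smul b))
    (cop_isPD _ _ _ _ _).1
  have key : ∀ w, a • jh μ (Del F p w) - b • jh μ (dd μ w) = 0 := by
    intro w
    have := LinearMap.congr_fun h3 (jh μ w)
    rw [cop_jh hp, LinearMap.add_apply, LinearMap.smul_apply, LinearMap.smul_apply, nop_jh,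
      hop_jh] at this
    simpa [sub_eq_add_neg] using this
  have hb : b = 0 := by
    have := congrArg eps (key gX)
    simpa [Del_gX, dd_apply, d1_gX] using this
  have ha : a = 0 := by
    have := congrArg eps (key gY)
    simpa [Del_gY, hb] using this
  exact ⟨ha, hb⟩

theorem Cmu_eq (hp : 3 < p) (μ : F) : (Cmu p μ).toSubmodule =
    Submodule.span F {nEl p μ} ⊔ Submodule.span F {rho F p (hEl p μ)} ⊔ CmuPrime p μ := by
  refine le_antisymm (fun x hx => ?_) (sup_le (sup_le ?_ ?_) (CmuPrime_le hp μ))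
  · obtain ⟨β, γ, s, u, -, -, rfl⟩ := exists_of_mem_Cmu hp hx
    rw [add_assoc]
    exact Submodule.add_mem_sup (Submodule.add_mem_sup
      (Submodule.smul_mem _ _ (Submodule.mem_span_singleton_self _))
      (Submodule.smul_mem _ _ (Submodule.mem_span_singleton_self _)))
      (mem_CmuPrime_iff.2 ⟨_, _, rfl⟩)
  · rw [Submodule.span_singleton_le_iff_mem]; exact nEl_mem_Cmu μ
  · rw [Submodule.span_singleton_le_iff_mem]; exact hEl_mem_Cmu μ

theorem finiteDimensional_Cmu (μ : F) : FiniteDimensional F (Cmu p μ) :=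
  inferInstanceAs (FiniteDimensional F (Cmu p μ).toSubmodule)

theorem finrank_sup_span_pair {V : Type*} [AddCommGroup V] [Module F V] [FiniteDimensional F V]
    {C : Submodule F V} {n h : V} (hind : ∀ a b : F, a • n + b • h ∈ C → a = 0 ∧ b = 0) :
    Module.finrank F ↥(Submodule.span F {n} ⊔ Submodule.span F {h} ⊔ C) =
      Module.finrank F C + 2 := by
  let f : ((F × F) × C) →ₗ[F] V :=
    LinearMap.coprod (LinearMap.coprod (LinearMap.toSpanSingleton F V n)
      (LinearMap.toSpanSingleton F V h)) C.subtype
  have hf : ∀ a b (c : C), f ((a, b), c) = a • n + b • h + (c : V) := fun a b c => rfl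
  have hinj : Function.Injective f := by
    rw [injective_iff_map_eq_zero]
    rintro ⟨⟨a, b⟩, c⟩ h0
    rw [hf] at h0
    obtain ⟨rfl, rfl⟩ := hind a b (by rw [eq_neg_of_add_eq_zero_left h0]; exact neg_mem c.2)
    rw [zero_smul, zero_smul, zero_add, zero_add] at h0
    have : c = 0 := Subtype.ext h0
    rw [this]; rfl
  have hrange : LinearMap.range f = Submodule.span F {n} ⊔ Submodule.span F {h} ⊔ C := by
    rw [LinearMap.range_coprod, LinearMap.range_coprod, Submodule.range_subtype,
      LinearMap.range_toSpanSingleton, LinearMap.range_toSpanSingleton]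
  rw [← hrange, LinearMap.finrank_range_of_inj hinj, Module.finrank_prod, Module.finrank_prod,
    Module.finrank_self]
  omega

theorem finrank_Cmu (hp : 3 < p) (μ : F) :
    Module.finrank F (Cmu p μ) = Module.finrank F (CmuPrime p μ) + 2 := by
  change Module.finrank F (Cmu p μ).toSubmodule = _
  rw [Cmu_eq hp, finrank_sup_span_pair fun a b => Cmu_independent hp]

/-! ### The eigenspaces of `t_μ` -/

theorem mem_eigenT_iff {μ a : F} {x : EndS F p} : x ∈ eigenT p μ a ↔
    x ∈ GG F p ∧ rho F p (tEl p μ) * x - x * rho F p (tEl p μ) = a • x := Iff.rfl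

/-- If [t, T] = kT with k ≠ 0, then T is Hamiltonian with potential g = −k⁻¹·T(t). This potential is
an eigenvector of {t, ·} only up to a constant c, and adding k⁻¹c repairs it. -/
theorem exists_of_mem_eigenT (hp : 3 < p) {μ : F} {k : ℕ} (hk : (k : F) ≠ 0) {x : EndS F p}
    (hx : x ∈ eigenT p μ (k : F)) :
    ∃ u : BAlg F p, ev u = u ∧ x = rho F p (DGL (inB (jh μ u * y0 μ ^ k))) := by
  obtain ⟨hx1, hx2⟩ := mem_eigenT_iff.1 hx
  obtain ⟨T, hT, hxT⟩ := GG_exists hx1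
  have h := rep_lie_tEl hxT μ
  rw [hx2] at h
  have h1 : pbL (tt μ) * T - T * pbL (tt μ) = (k : F) • T :=
    h.der_eq hp (hxT.smul _) ((IsPD.pb_left _).lie hT).1 (hT.1.smul _)
  set g : BAlg F p := (-(k : F)⁻¹) • T (tt μ) with hg
  have hTg : T = pbL g := by
    refine LinearMap.ext fun f => ?_
    have h2 := LinearMap.congr_fun h1 f
    rw [← neg_sub, hT.lie_pbL, LinearMap.neg_apply, LinearMap.smul_apply, pbL_apply] at h2
    rw [hg, pbL_apply, pb_smul_left, neg_smul, ← smul_neg, h2, smul_smul, inv_mul_cancel₀ hk,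
      one_smul]
  have h3 : (pbL (pb (tt μ) g - (k : F) • g) : EndB F p) = 0 := by
    rw [map_sub, map_smul, ← pbL_lie, ← hTg, h1, sub_self]
  have h4 := const_of_pbL_eq_zero h3
  set c := eps (pb (tt μ) g - (k : F) • g)
  set g' : BAlg F p := g + algebraMap F _ ((k : F)⁻¹ * c) with hg'
  have h5 : pb (tt μ) g' = (k : F) • g' := by
    rw [hg', pb_add_right, pb_algebraMap_right, add_zero, smul_add, Algebra.smul_def (k : F)
      (algebraMap F _ _), ← map_mul, mul_inv_cancel_left₀ hk, ← h4]
    abel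
  have h6 := eq_jh_mul_y0_pow hp h5
  refine ⟨ev g', ev_ev g', hxT.unique ?_⟩
  rw [jh_ev, ← h6, hTg]
  have h7 : (pbL g : EndB F p) = pbL g' := by rw [hg', map_add, pbL_algebraMap, add_zero]
  rw [h7]
  exact rep_rho_inB g'

theorem mem_eigenT (hp : 3 < p) (μ : F) (k : ℕ) (u : BAlg F p) :
    rho F p (DGL (inB (jh μ u * y0 μ ^ k))) ∈ eigenT p μ (k : F) := by
  refine mem_eigenT_iff.2 ⟨rho_mem_GG _, ?_⟩
  have h := rep_lie_tEl (rep_rho_inB (jh μ u * y0 μ ^ k)) μ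
  rw [pbL_lie, pb_tt_jh_y0_pow hp, map_smul] at h
  exact h.unique ((rep_rho_inB _).smul _)

theorem jh_y0_mem_SAlg (hp : 3 < p) (μ : F) {k : ℕ} (hk : (k : F) ≠ 0) (u : BAlg F p) :
    DGL (inB (jh μ u * y0 μ ^ k)) ∈ SAlg F p := by
  have : jh μ u * y0 μ ^ k = pb ((k : F)⁻¹ • tt μ) (jh μ u * y0 μ ^ k) := by
    rw [pb_smul_left, pb_tt_jh_y0_pow hp, smul_smul, inv_mul_cancel₀ hk, one_smul]
  rw [this]; exact DGL_pb_mem_SAlg _ _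

theorem finrank_range_ev_eq :
    Module.finrank F (LinearMap.range (ev (F := F) (p := p)).toLinearMap) = p ^ 2 := by
  refine le_antisymm finrank_range_ev ?_
  have hli : LinearIndependent F (fun i : Fin (p ^ 2) => (mb (i : ℕ) 0 : BAlg F p)) :=
    linearIndependent_mb.comp (fun i : Fin (p ^ 2) => (i, (⟨0, pos_p⟩ : Fin p)))
      fun i j h => (Prod.mk.inj h).1
  have h1 := finrank_span_eq_card hli
  rw [Fintype.card_fin] at h1
  rw [← h1]
  refine Submodule.finrank_mono (Submodule.span_le.2 ?_)
  rintro _ ⟨i, rfl⟩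
  exact ⟨mb i 0, ev_mb_zero _⟩

theorem eigenT_props (hp : 3 < p) (μ : F) {k : ℕ} (hk1 : 1 ≤ k) (hkp : k < p) :
    (∀ (u : O2 F) (hu : u ∈ O21x1 F p 0), phi p μ (k : F) u hu ∈ SAlg F p) ∧
      Module.finrank F (eigenT p μ (k : F)) = p ^ 2 ∧
      eigenT p μ (k : F) =
        Submodule.span F {x | ∃ (u : O2 F) (hu : u ∈ O21x1 F p 0),
          x = rho F p (phi p μ (k : F) u hu)} := by
  have hk : (k : F) ≠ 0 := cast_ne_zero' p (by omega) hkp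
  have hphi : ∀ (u : O2 F) (hu : u ∈ O21x1 F p 0), phi p μ (k : F) u hu =
      DGL (inB (jh μ (⟨u, O21x1_le hu⟩ : BAlg F p) * y0 μ ^ k)) := fun u hu =>
    phi_eq (u := ⟨u, O21x1_le hu⟩) (ev_mk_of_mem hu) hu hk1 hkp
  refine ⟨fun u hu => ?_, ?_, ?_⟩
  · rw [hphi]; exact jh_y0_mem_SAlg hp μ hk _
  · let f : LinearMap.range (ev (F := F) (p := p)).toLinearMap →ₗ[F] EndS F p :=
      ((rho F p : GAlg F p →ₗ[F] EndS F p).comp (DGL.comp (inB.comp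
        ((LinearMap.mulRight F (y0 μ ^ k)).comp (jh μ).toLinearMap)))).comp (Submodule.subtype _)
    have hf : ∀ u, f u = rho F p (DGL (inB (jh μ (u : BAlg F p) * y0 μ ^ k))) := fun u => rfl
    have hinj : Function.Injective f := by
      rw [injective_iff_map_eq_zero]
      rintro ⟨_, v, rfl⟩ h
      rw [hf] at h
      have h1 := rep_rho_inB (jh μ (ev v) * y0 μ ^ k)
      change rho F p (DGL (inB (jh μ (ev v) * y0 μ ^ k))) = 0 at h
      rw [h] at h1
      have h2 := const_of_pbL_eq_zero (h1.der_eq_zero hp (IsPD.pb_left _).1)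
      have h3 := pb_tt_jh_y0_pow hp μ (ev v) k
      rw [h2, pb_algebraMap_right, ← h2] at h3
      have h4 := congrArg ev ((smul_eq_zero.1 h3.symm).resolve_left hk)
      rw [map_mul, map_pow, ev_y0, ev_jh, one_pow, mul_one, ev_ev, map_zero] at h4
      exact Subtype.ext h4
    have hrange : LinearMap.range f = eigenT p μ (k : F) := by
      refine le_antisymm ?_ fun x hx => ?_
      · rintro _ ⟨u, rfl⟩
        exact mem_eigenT hp μ k _
      · obtain ⟨u, hu, rfl⟩ := exists_of_mem_eigenT hp hk hx
        exact ⟨⟨u, ⟨u, hu⟩⟩, rfl⟩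
    rw [← hrange, LinearMap.finrank_range_of_inj hinj, finrank_range_ev_eq]
  · refine le_antisymm (fun x hx => ?_) (Submodule.span_le.2 ?_)
    · obtain ⟨u, hu, rfl⟩ := exists_of_mem_eigenT hp hk hx
      refine Submodule.subset_span ⟨u, coe_mem_O21x1 hu, ?_⟩
      rw [phi_eq hu _ hk1 hkp]
    · rintro _ ⟨u, hu, rfl⟩
      rw [hphi]
      exact mem_eigenT hp μ k _

/-! ### Powers of `h_μ`, `n_μ`, `t_μ` -/

theorem hEl_pow_p (hp : 3 < p) (μ : F) :
    rho F p (hEl p μ) ^ p = -(μ • rho F p (hEl p μ)) - nEl p μ := by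
  have h := (rep_hEl (p := p) μ).pow p
  rw [hop_pow_p hp] at h
  have h' := ((rep_hEl (p := p) μ).smul (-μ)).sub (rep_nEl μ)
  rw [h.unique h', neg_smul]

theorem nEl_pow_p (hp : 3 < p) (μ : F) : nEl p μ ^ p = 0 := by
  have h := (rep_nEl (p := p) μ).pow p
  rw [nop_pow_p hp] at h
  exact h.unique Rep.zero

theorem isToral_tEl (hp : 3 < p) (μ : F) : IsToral (rho F p (tEl p μ)) := by
  have h := (rep_tEl (p := p) μ).pow p
  rw [pbL_tt_pow_p hp] at h
  exact h.unique (rep_tEl μ)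

/-! ### Nilpotency of the centralizer and maximality of the torus for `μ = 0` -/

theorem eq_pow_mul_pow_mul {M : Type*} [Monoid M] {a b : M} (h : Commute b a) (h' : a = b * a * a)
    (n : ℕ) : a = b ^ n * a ^ n * a := by
  induction n with
  | zero => rw [pow_zero, pow_zero, one_mul, one_mul]
  | succ n ih =>
    symm
    calc b ^ (n + 1) * a ^ (n + 1) * a = b ^ n * (b * a ^ n) * a * a := by
          simp only [pow_succ, mul_assoc]
      _ = b ^ n * a ^ n * (b * a * a) := by rw [(h.pow_right n).eq]; simp only [mul_assoc]
      _ = a := by rw [← h', ← ih]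

section Generic

variable {A : Type*} [Ring A] [Algebra F A]

/-- The inner derivations of an associative algebra. -/
def adE (x : A) : Module.End F A := LinearMap.mulLeft F x - LinearMap.mulRight F x

theorem adE_apply (x y : A) : adE (F := F) x y = x * y - y * x := rfl

theorem adE_pow_char_pow (x : A) (i : ℕ) : adE (F := F) (x ^ p ^ i) = adE x ^ p ^ i := by
  rcases subsingleton_or_nontrivial A with h | h
  · exact LinearMap.ext fun y => Subsingleton.elim _ _
  · have : CharP (Module.End F A) p :=
      charP_of_injective_algebraMap (algebraMap F (Module.End F A)).injective p
    rw [adE, adE, sub_pow_char_pow_of_commute _ _ (LinearMap.commute_mulLeft_right x x),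
      LinearMap.pow_mulLeft, LinearMap.pow_mulRight]

/-- In characteristic p one has ad(x^{p^i}) = (ad x)^{p^i}. Since i ≥ 1, each summand is divisible
by (ad x)². -/
theorem exists_adE_eq_of_mem_span {x : A}
    (hx : x ∈ Submodule.span F {y | ∃ i : ℕ, 1 ≤ i ∧ y = x ^ p ^ i}) :
    ∃ B : Module.End F A, Commute B (adE x) ∧ adE x = B * adE x * adE x := by
  have key : ∀ y ∈ Submodule.span F {y | ∃ i : ℕ, 1 ≤ i ∧ y = x ^ p ^ i},
      ∃ B : Module.End F A, Commute B (adE x) ∧ adE y = B * adE x * adE x := by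
    intro y hy
    induction hy using Submodule.span_induction with
    | mem y hy =>
      obtain ⟨i, hi, rfl⟩ := hy
      refine ⟨adE x ^ (p ^ i - 2), (Commute.refl _).pow_left _, ?_⟩
      have h2 : 2 ≤ p ^ i := (Fact.out : p.Prime).two_le.trans (Nat.le_self_pow (by omega) p)
      rw [adE_pow_char_pow, mul_assoc, ← sq, pow_sub_mul_pow _ h2]
    | zero =>
      exact ⟨0, Commute.zero_left _, by simp [adE]⟩
    | add y z _ _ hy hz =>
      obtain ⟨B, hB, hB'⟩ := hy
      obtain ⟨C, hC, hC'⟩ := hz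
      refine ⟨B + C, hB.add_left hC, ?_⟩
      rw [add_mul, add_mul, ← hB', ← hC']
      refine LinearMap.ext fun w => ?_
      simp only [LinearMap.add_apply, adE_apply]
      noncomm_ring
    | smul c y _ hy =>
      obtain ⟨B, hB, hB'⟩ := hy
      refine ⟨c • B, hB.smul_left c, ?_⟩
      rw [smul_mul_assoc, smul_mul_assoc, ← hB']
      refine LinearMap.ext fun w => ?_
      simp only [LinearMap.smul_apply, adE_apply, smul_mul_assoc, mul_smul_comm, smul_sub]
  exact key x hx

/-- Iterating ad x = B·(ad x)² writes ad x as B^N·(ad x)^{N+1}. So on a p-semisimple element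
nilpotent action means trivial action. -/
theorem adE_apply_eq_zero {x y : A}
    (hx : x ∈ Submodule.span F {y | ∃ i : ℕ, 1 ≤ i ∧ y = x ^ p ^ i}) {N : ℕ}
    (hN : (adE (F := F) x ^ N) y = 0) : adE (F := F) x y = 0 := by
  obtain ⟨B, hB, hB'⟩ := exists_adE_eq_of_mem_span hx
  rw [eq_pow_mul_pow_mul hB hB' N, mul_assoc, ← pow_succ, pow_succ', ← mul_assoc, Module.End.mul_apply, hN, map_zero]

end Generic

theorem isNilpotent_of_adE {V : Type*} [AddCommGroup V] [Module F V] [FiniteDimensional F V]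
    {L : LieSubalgebra F (Module.End F V)}
    (h : ∀ x ∈ L, ∃ N, ∀ y ∈ L, (adE (F := F) x ^ N) y = 0) : LieRing.IsNilpotent L := by
  have hfin : FiniteDimensional F L := inferInstanceAs (FiniteDimensional F L.toSubmodule)
  rw [LieAlgebra.isNilpotent_iff_forall (R := F)]
  intro x
  obtain ⟨N, hN⟩ := h x x.2
  have hpow : ∀ (n : ℕ) (y : L), (((LieAlgebra.ad F L x ^ n) y : L) : Module.End F V) =
      (adE (F := F) (x : Module.End F V) ^ n) (y : Module.End F V) := by
    intro n
    induction n with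
    | zero => intro y; rfl
    | succ n ih =>
      intro y
      rw [pow_succ, Module.End.mul_apply, ih, pow_succ, Module.End.mul_apply]
      rfl
  refine ⟨N, LinearMap.ext fun y => Subtype.ext ?_⟩
  rw [hpow]
  exact hN y y.2

theorem adE_jh (hp : 3 < p) {μ β γ s : F} {u : BAlg F p} {x : EndS F p}
    (hx : Rep x (cop μ β γ s u)) (u' : BAlg F p) :
    adE (F := F) x (rho F p (DGL (inB (jh μ u')))) =
      rho F p (DGL (inB (jh μ ((β • Del F p - γ • dd μ : EndB F p) u')))) := by
  have h := lie_prime_eq hp hx 0 u'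
  rw [zero_smul, zero_smul, zero_add, zero_add] at h
  exact h

theorem adE_pow_jh (hp : 3 < p) {μ β γ s : F} {u : BAlg F p} {x : EndS F p}
    (hx : Rep x (cop μ β γ s u)) (n : ℕ) (u' : BAlg F p) :
    (adE (F := F) x ^ n) (rho F p (DGL (inB (jh μ u')))) =
      rho F p (DGL (inB (jh μ (((β • Del F p - γ • dd μ : EndB F p) ^ n) u')))) := by
  induction n generalizing u' with
  | zero => rfl
  | succ n ih =>
    rw [pow_succ, Module.End.mul_apply, adE_jh hp hx, ih, ← Module.End.mul_apply, ← pow_succ]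

/-- The first bracket lands in C_μ'. The second also removes the component along D_H(x₁^{(p²)}), so
that only the action on functions of x₁ remains. -/
theorem exists_adE_adE (hp : 3 < p) {μ : F} {x y : EndS F p} (hx : x ∈ Cmu p μ)
    (hy : y ∈ Cmu p μ) : ∃ u', adE (F := F) x (adE (F := F) x y) = rho F p (DGL (inB (jh μ u'))) := by
  obtain ⟨β, γ, s, u, -, hx', -⟩ := exists_of_mem_Cmu hp hx
  obtain ⟨s', u', h⟩ := mem_CmuPrime_iff.1 (lie_mem_CmuPrime hp hx hy)
  refine ⟨s' • (β • nvEl μ - γ • mb (p ^ 2 - 1) 0) + (β • Del F p u' - γ • dd μ u'), ?_⟩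
  rw [adE_apply x y, h, adE_apply, lie_prime_eq hp hx']

theorem dd_zero : dd (0 : F) = d1L F p := by
  refine LinearMap.ext fun u => ?_
  rw [dd_apply, ri, zero_smul, sub_zero, one_mul, d1L_apply]

/-- For μ = 0 the operator ∂ is D₁, which is nilpotent and commutes with its power D₁^p. -/
theorem isNilpotent_dd_zero (β γ : F) :
    IsNilpotent (β • Del F p - γ • dd (0 : F) : EndB F p) := by
  have h : IsNilpotent (d1L F p) := by
    refine ⟨p * p, ?_⟩
    rw [pow_mul]; exact Del_pow_p
  rw [dd_zero]
  have hD : IsNilpotent (Del F p) := ⟨p, Del_pow_p⟩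
  have hc : Commute (Del F p) (d1L F p) := (Commute.refl (d1L F p)).pow_left p
  exact ((hc.smul_left β).smul_right γ).isNilpotent_sub (hD.smul β) (h.smul γ)

theorem exists_adE_pow_eq_zero (hp : 3 < p) {x : EndS F p} (hx : x ∈ Cmu p (0 : F)) :
    ∃ N, ∀ y ∈ Cmu p (0 : F), (adE (F := F) x ^ N) y = 0 := by
  obtain ⟨β, γ, s, u, -, hx', -⟩ := exists_of_mem_Cmu hp hx
  obtain ⟨N, hN⟩ := isNilpotent_dd_zero (p := p) β γ
  refine ⟨N + 2, fun y hy => ?_⟩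
  obtain ⟨u', hu'⟩ := exists_adE_adE hp hx hy
  rw [pow_add, Module.End.mul_apply, sq, Module.End.mul_apply, hu', adE_pow_jh hp hx', hN,
    LinearMap.zero_apply, map_zero, map_zero, map_zero, map_zero]

theorem isNilpotent_Cmu_zero (hp : 3 < p) : LieRing.IsNilpotent (Cmu p (0 : F)) :=
  isNilpotent_of_adE fun _ hx => exists_adE_pow_eq_zero hp hx

/-! ### The centre of C_0 -/

theorem const_of_rho_eq_zero (hp : 3 < p) {f : BAlg F p} (h : rho F p (DGL (inB f)) = 0) :
    f = algebraMap F _ (eps f) := by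
  have h1 := rep_rho_inB f
  rw [h] at h1
  exact const_of_pbL_eq_zero (h1.der_eq_zero hp (IsPD.pb_left _).1)

theorem rho_algebraMap (c : F) : rho F p (DGL (inB (algebraMap F (BAlg F p) c))) = 0 := by
  rw [DGL_inB_algebraMap, map_zero]

theorem ev_const_of_jh {μ : F} {w : BAlg F p} {c : F} (h : jh μ w = algebraMap F _ c) :
    ev w = algebraMap F _ c := by
  rw [← ev_jh μ, h, AlgHom.commutes]

theorem cf_algebraMap {i : ℕ} (hi : i ≠ 0) (c : F) : cf i 0 (algebraMap F (BAlg F p) c) = 0 := by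
  rw [Algebra.algebraMap_eq_smul_one, map_smul, ← mb_zero_zero, cf_mb (pow_pos pos_p 2) pos_p,
    if_neg (by omega), smul_zero]

theorem rep_hEl_cop (μ : F) : Rep (rho F p (hEl p μ)) (cop μ 0 1 0 0) := by
  have : (cop μ 0 1 0 0 : EndB F p) = hop μ := by
    rw [cop, zero_smul, one_smul, zero_smul, map_zero, map_zero, zero_add, add_zero, add_zero]
  rw [this]; exact rep_hEl μ

theorem eq_zero_of_ev_const {β γ : F}
    (key : ∀ u' : BAlg F p, ∃ c : F, ev (β • Del F p u' - γ • dd 0 u') = algebraMap F _ c) :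
    β = 0 ∧ γ = 0 := by
  have hp1 := one_lt_p p
  -- For u' = x₁^{(p)} the coefficient at x₁^{(p-1)} is −γ. Below, u' = x₁·x₁^{(p)} turns β·D₁^p u'
  -- into β·x₁, which is constant only for β = 0.
  have hγ : γ = 0 := by
    obtain ⟨c, hc⟩ := key gY
    have h1 := congrArg (cf (p - 1) 0) hc
    rw [cf_ev, map_sub, map_smul, map_smul, Del_gY, dd_zero, d1L_apply, d1_gY_mb,
      cf_algebraMap (by omega), ← map_one (algebraMap F (BAlg F p)), cf_algebraMap (by omega),
      cf_mb (lt_of_le_of_lt (Nat.sub_le _ _) prime_lt_sq) pos_p, if_pos ⟨rfl, rfl⟩] at h1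
    simpa using h1
  refine ⟨?_, hγ⟩
  obtain ⟨c, hc⟩ := key (gX * gY)
  have h1 := congrArg d1 hc
  rw [hγ, zero_smul, sub_zero, Del_isPD.1, Del_gX, Del_gY, mul_one, mul_zero, add_zero, map_smul,
    ev_gX, Derivation.map_smul, d1_gX, Derivation.map_algebraMap] at h1
  exact (smul_eq_zero.1 h1).resolve_right one_ne_zero

/-- The monomial x₁^{(p²-1)} has no antiderivative in 𝒪(2;(2,1)), so s = 0, and integrating a
constant gives an affine function of x₁. -/
theorem eq_of_smul_topX_add_d1 {s c : F} {u : BAlg F p} (hu : ev u = u)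
    (h : s • mb (p ^ 2 - 1) 0 + d1 u = algebraMap F _ c) :
    s = 0 ∧ ∃ c' : F, u = c • gX + algebraMap F _ c' := by
  have hsq := one_lt_sq p
  have hs : s = 0 := by
    have h3 := congrArg (cf (p ^ 2 - 1) 0) h
    rw [map_add, map_smul, cf_d1, cf_algebraMap (by omega),
      cf_mb (by omega) pos_p, if_pos ⟨rfl, rfl⟩, cf_eq_zero u (by omega)] at h3
    simpa using h3
  rw [hs, zero_smul, zero_add] at h
  refine ⟨hs, eps (u - c • gX), ?_⟩
  rw [← BAlg_const_of_d]
  · abel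
  · rw [map_sub, Derivation.map_smul, d1_gX, h, Algebra.algebraMap_eq_smul_one, sub_self]
  · rw [map_sub, Derivation.map_smul, d2_gX, ← hu, d2_ev, smul_zero, sub_zero]

/-- Commuting with all j(u') forces β = γ = 0. Commuting with h_0 then says that s·x₁^{(p²-1)} + u'
is constant, so u is a multiple of x₁ plus a constant, and j(x₁) is the potential of t_0. -/
theorem mem_span_tEl_of_central (hp : 3 < p) {x : EndS F p} (hx : x ∈ Cmu p (0 : F))
    (h : ∀ y ∈ Cmu p (0 : F), x * y - y * x = 0) :
    ∃ c : F, x = c • rho F p (tEl p 0) := by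
  obtain ⟨β, γ, s, u, hu, hxr, hxe⟩ := exists_of_mem_Cmu hp hx
  obtain ⟨hβ, hγ⟩ := eq_zero_of_ev_const (p := p) (β := β) (γ := γ) fun u' => by
    have h1 := h _ (jh_mem_Cmu hp 0 u')
    have h2 := adE_jh hp (x := x) hxr u'
    rw [adE_apply, h1] at h2
    exact ⟨_, ev_const_of_jh (const_of_rho_eq_zero hp h2.symm)⟩
  rw [hβ, hγ, zero_smul, zero_smul, zero_add, zero_add] at hxe
  have h1 := lie_prime_eq hp (rep_hEl_cop (F := F) (p := p) 0) s u
  rw [← hxe, ← neg_sub, h _ (hEl_mem_Cmu 0), neg_zero] at h1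
  obtain ⟨c, h2⟩ : ∃ c : F, ev _ = algebraMap F (BAlg F p) c :=
    ⟨_, ev_const_of_jh (const_of_rho_eq_zero hp h1.symm)⟩
  rw [zero_smul, zero_smul, one_smul, one_smul, zero_sub, zero_sub, dd_zero, d1L_apply, map_add,
    map_smul, map_neg, map_neg, ev_mb_zero, ev_d1, hu] at h2
  obtain ⟨hs, c', hc'⟩ := eq_of_smul_topX_add_d1 (s := s) (c := -c) hu (by
    rw [map_neg, ← h2, smul_neg]; abel)
  refine ⟨-c, ?_⟩
  have hrt : (rt 0 : BAlg F p) = gX := by rw [rt, zero_smul, add_zero]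
  have h4 : jh 0 u = (-c) • tt 0 + algebraMap F _ c' := by
    rw [hc', map_add, map_smul, AlgHom.commutes, tt, hrt]
  rw [hxe, hs, zero_smul, zero_add, h4, map_add, map_add, map_add, rho_algebraMap, add_zero,
    map_smul, map_smul, map_smul, tEl_eq]

theorem commutator_smul_smul {A : Type*} [Ring A] [Algebra F A] (a b : F) (t : A) :
    (a • t) * (b • t) = (b • t) * (a • t) := by
  rw [smul_mul_smul_comm, smul_mul_smul_comm, mul_comm]

/-- The line spanned by an element of an associative algebra as a Lie subalgebra. -/
def lineLie {A : Type*} [Ring A] [Algebra F A] (t : A) : LieSubalgebra F A :=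
  { Submodule.span F {t} with
    lie_mem' := fun {x y} hx hy => by
      obtain ⟨a, rfl⟩ := Submodule.mem_span_singleton.1 hx
      obtain ⟨b, rfl⟩ := Submodule.mem_span_singleton.1 hy
      change (a • t) * (b • t) - (b • t) * (a • t) ∈ Submodule.span F {t}
      rw [commutator_smul_smul a b t, sub_self]
      exact zero_mem _ }

theorem mem_lineLie {A : Type*} [Ring A] [Algebra F A] {t x : A} :
    x ∈ lineLie (F := F) t ↔ ∃ a : F, a • t = x := Submodule.mem_span_singleton

theorem isPSemisimple_smul {t : EndS F p} (ht : IsToral t) (a : F) : IsPSemisimple (a • t) := by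
  by_cases ha : a = 0
  · rw [ha, zero_smul]; exact zero_mem _
  · have h : a • t = (a * (a ^ p)⁻¹) • (a • t) ^ p ^ 1 := by
      rw [pow_one, smul_pow, ht, smul_smul, mul_assoc, inv_mul_cancel₀ (pow_ne_zero _ ha), mul_one]
    have h2 : (a * (a ^ p)⁻¹) • (a • t) ^ p ^ 1 ∈
        Submodule.span F {y | ∃ i : ℕ, 1 ≤ i ∧ y = (a • t) ^ p ^ i} :=
      Submodule.smul_mem _ _ (Submodule.subset_span ⟨1, le_rfl, rfl⟩)
    rw [← h] at h2
    exact h2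

/-- An element of a larger torus commutes with t_0, hence lies in C_0 and acts nilpotently there.
Being p-semisimple, it acts trivially, so it is central in C_0 and a multiple of t_0. -/
theorem isMaximalTorus_tEl_zero (hp : 3 < p) :
    IsMaximalTorus (lineLie (F := F) (rho F p (tEl p (0 : F)))) := by
  have ht := isToral_tEl (F := F) hp 0
  refine ⟨⟨?_, ?_, ?_, ?_⟩, ?_⟩
  · intro x hx
    obtain ⟨a, rfl⟩ := mem_lineLie.1 hx
    exact (GG F p).smul_mem a (rho_mem_GG _)
  · intro x hx
    obtain ⟨a, rfl⟩ := mem_lineLie.1 hx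
    rw [smul_pow, ht]
    exact mem_lineLie.2 ⟨_, rfl⟩
  · intro x hx y hy
    obtain ⟨a, rfl⟩ := mem_lineLie.1 hx
    obtain ⟨b, rfl⟩ := mem_lineLie.1 hy
    exact commutator_smul_smul a b _
  · intro x hx
    obtain ⟨a, rfl⟩ := mem_lineLie.1 hx
    exact isPSemisimple_smul ht a
  · intro T' hT' hle
    refine le_antisymm (fun x hx => ?_) hle
    have hxC : x ∈ Cmu p (0 : F) := mem_Cmu_iff.2 ⟨hT'.1 hx,
      sub_eq_zero.2 (hT'.2.2.1 _ (hle (mem_lineLie.2 ⟨1, one_smul _ _⟩)) _ hx)⟩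
    obtain ⟨N, hN⟩ := exists_adE_pow_eq_zero hp hxC
    obtain ⟨c, hc⟩ := mem_span_tEl_of_central hp hxC fun y hy =>
      adE_apply_eq_zero (F := F) (p := p) (hT'.2.2.2 x hx) (hN y hy)
    exact mem_lineLie.2 ⟨c, hc.symm⟩

/-! ### Automorphisms which fix `t_μ` -/

/-- Multiplying y by j(b) does not change its brackets with the commuting elements j(u), except for
the factor itself. As j is unchanged, the resulting automorphisms fix t_μ = j(r̃). -/
theorem isFrame_mul (hp : 3 < p) (μ : F) {b : BAlg F p} (hb : eps b = 1) :
    IsFrame μ 1 (jh μ) (jh μ b * y0 μ) where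
  ev := jh_ev μ
  pow := by rw [mul_pow, y0_pow_p, mul_one, pow_p_eq_one (by rw [eps_jh, hb])]
  comm := pb_jh_jh hp μ
  act u := by
    rw [pb_mul_right, pb_jh_jh hp, pb_jh_y0, one_smul]; ring

theorem exists_frame_equiv (hp : 3 < p) (μ : F) {b : BAlg F p} (hb : eps b = 1) :
    ∃ Φ : BAlg F p ≃ₗ[F] BAlg F p, (∀ f g, Φ (pb f g) = pb (Φ f) (Φ g)) ∧
      ∀ u k, Φ (jh μ u * y0 μ ^ k) = jh μ (u * b ^ k) * y0 μ ^ k := by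
  obtain ⟨Φ, h1, h2⟩ := (isFrame_mul hp μ hb).exists_equiv hp one_ne_zero
  refine ⟨Φ, h1, fun u k => ?_⟩
  rw [h2, inv_one, one_smul, mul_pow, map_mul, map_pow, mul_assoc]

theorem top_tt (hp : 3 < p) (μ : F) : top (tt μ : BAlg F p) = 0 := by
  -- The potential j(r̃) is a value of the Poisson derivation of h_μ, because ∂(r̃²/2) = r̃. Such
  -- values have no highest monomial.
  have h : hop μ (jh μ (-(2 : F)⁻¹ • (rt μ * rt μ))) = (tt μ : BAlg F p) := by
    rw [hop_jh, map_smul, dd_isDer, dd_rt, mul_one, ← two_smul F (rt μ), smul_smul, neg_mul,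
      inv_mul_cancel₀ (two_ne_zero' hp), neg_smul, one_smul, map_neg, neg_neg, tt]
  rw [← h]
  exact (hop_isPD μ).top_apply _

theorem mem_Zt (hp : 3 < p) {μ : F} {Φ : BAlg F p ≃ₗ[F] BAlg F p} {b : BAlg F p}
    (hΦ : ∀ u k, Φ (jh μ u * y0 μ ^ k) = jh μ (u * b ^ k) * y0 μ ^ k)
    {z : SAlg F p ≃ₗ⁅F⁆ SAlg F p} (hz : ∀ f, top f = 0 → z (K f) = K (Φ f)) : z ∈ Zt p μ := by
  refine ⟨K (tt μ), by rw [coe_K (top_tt hp μ), tEl_eq], ?_⟩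
  rw [hz _ (top_tt hp μ)]
  have := hΦ (rt μ) 0
  rw [pow_zero, pow_zero, mul_one, mul_one, mul_one] at this
  rw [tt, this]

/-- Linear maps agree if they agree on the frame. -/
theorem linearMap_ext_frame (hp : 3 < p) (μ : F) {A B : EndB F p}
    (h : ∀ u k, A (jh μ u * y0 μ ^ k) = B (jh μ u * y0 μ ^ k)) : A = B := by
  refine LinearMap.ext fun f => ?_
  induction f using frame_induction hp μ with
  | h u k => exact h u k
  | hadd f g hf hg => rw [map_add, map_add, hf, hg]

/-- The derivations which kill the functions `u + u' r̃ x₂^{(p-1)}`. -/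
theorem pow_apply_frame {T : EndB F p} (hT : IsDer T) {μ : F} {g : BAlg F p}
    (h1 : ∀ u, T (jh μ u) = 0) (h2 : T (y0 μ) = jh μ g * y0 μ) (n k : ℕ) (u : BAlg F p) :
    (T ^ n) (jh μ u * y0 μ ^ k) = (k : F) ^ n • (jh μ (g ^ n * u) * y0 μ ^ k) := by
  induction n generalizing u with
  | zero => simp
  | succ n ih =>
    rw [pow_succ, Module.End.mul_apply, hT, h1, mul_zero, add_zero, hT.map_pow h2, mul_smul_comm,
      map_smul, ← mul_assoc, ← map_mul, ih, smul_smul, ← pow_succ']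
    congr 3
    ring

/-- For m = p² the monomial is not in 𝒪(2;(2,1)) and the operator is that of D_H(x₁^{(p²)}). The
value on y has the same form in both cases, because x₁^{(p²-1)}·r⁻¹ = x₁^{(p²-1)}. -/
theorem exists_rep_cEl (hp : 3 < p) (μ : F) {m : ℕ} (hm0 : 1 ≤ m) (hm : m ≤ p ^ 2) :
    ∃ T : EndB F p, IsDer T ∧ Rep (rho F p (cEl p μ (mon (m, 0)) (x1_mem_Pot hm))) T ∧
      (∀ u, T (jh μ u) = 0) ∧ T (y0 μ) = jh μ (ri μ * mb (m - 1) 0) * y0 μ := by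
  rcases hm.lt_or_eq with h | h
  · refine ⟨pbL (jh μ (mb m 0)), (IsPD.pb_left _).1, ?_, fun u => pb_jh_jh hp μ _ _, ?_⟩
    · have h1 : cEl p μ (mon (m, 0)) (x1_mem_Pot hm) =
          cEl p μ ((mb m 0 : BAlg F p) : O2 F) (O21_le_Pot (mb m 0 : BAlg F p).2) := by
        congr 1
        rw [coe_mb h pos_p]
      rw [h1, cEl_eq (ev_mb_zero m)]
      exact rep_jh μ _
    · obtain ⟨i, rfl⟩ : ∃ i, m = i + 1 := ⟨m - 1, by omega⟩
      rw [pbL_apply, pb_jh_y0, dd_apply, d1_mb_succ h pos_p, Nat.add_sub_cancel]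
  · subst h
    refine ⟨vop F p, vop_isDer, ?_, vop_jh μ, ?_⟩
    · rw [cEl_top]; exact rep_vEl
    · rw [vop_y0, mul_comm (ri μ), topX_mul_ri]

/-- D kills all j(u) and multiplies y^k by k·j(g) with g = r⁻¹x₁^{(m-1)} and g^p = 0. So exp(cD) is
the substitution y ↦ j(exp(cg))·y. -/
theorem exp_mem_Zt (hp : 3 < p) (μ : F) {m : ℕ} (hm3 : 3 ≤ m) (hm : m ≤ p ^ 2) (c : F) :
    rho F p (cEl p μ (mon (m, 0)) (x1_mem_Pot hm)) ^ p = 0 ∧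
      ∃ z ∈ Zt p μ, ((z : SAlg F p ≃ₗ⁅F⁆ SAlg F p).toLinearEquiv : SAlg F p →ₗ[F] SAlg F p) =
        ∑ i ∈ Finset.range p, (c ^ i * ((i.factorial : F))⁻¹) •
          rho F p (cEl p μ (mon (m, 0)) (x1_mem_Pot hm)) ^ i := by
  obtain ⟨T, hT, hrep, h1, h2⟩ := exists_rep_cEl hp μ (by omega) hm
  set g : BAlg F p := ri μ * mb (m - 1) 0 with hg
  have hg0 : eps g = 0 := by rw [hg, map_mul, eps_mb (Or.inl (by omega)), mul_zero]
  have hgp : g ^ p = 0 := pow_p_eq_zero hg0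
  constructor
  · have : T ^ p = 0 := linearMap_ext_frame hp μ fun u k => by
      rw [pow_apply_frame hT h1 h2, hgp, zero_mul, map_zero, zero_mul, smul_zero,
        LinearMap.zero_apply]
    have h := hrep.pow p
    rw [this] at h
    exact h.unique Rep.zero
  · obtain ⟨Φ, hΦ, hΦ'⟩ := exists_frame_equiv hp μ (eps_ex (F := F) hg0 c)
    obtain ⟨z, hz, -⟩ := exists_aut Φ hΦ
    refine ⟨z, mem_Zt hp hΦ' hz, ?_⟩
    have hexp : ∑ i ∈ Finset.range p, (c ^ i * ((i.factorial : F))⁻¹) • T ^ i = Φ.toLinearMap := by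
      refine linearMap_ext_frame hp μ fun u k => ?_
      rw [LinearEquiv.coe_coe, hΦ', ex_pow hgp, ex, Finset.mul_sum, map_sum, Finset.sum_mul,
        LinearMap.sum_apply]
      refine Finset.sum_congr rfl fun i _ => ?_
      rw [LinearMap.smul_apply, pow_apply_frame hT h1 h2, smul_smul, dpw, smul_smul, mul_smul_comm,
        map_smul, smul_mul_assoc, mul_comm u, mul_pow]
      congr 1
      ring
    have hR := Rep.sum (s := Finset.range p) fun i _ =>
      (hrep.pow i).smul (c ^ i * ((i.factorial : F))⁻¹)
    rw [hexp] at hR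
    refine LinearMap.ext fun s => ?_
    obtain ⟨f, hf, rfl⟩ := exists_K s
    rw [(hR f hf).2]
    exact hz f hf

/-! ### Logarithmic derivatives -/

theorem topX_mul_ev (f : BAlg F p) : mb (p ^ 2 - 1) 0 * ev f = eps f • mb (p ^ 2 - 1) 0 := by
  induction f using gen_induction with
  | hX => rw [ev_gX, eps_gX, zero_smul]; exact topX_mul_mb one_ne_zero
  | hY => rw [ev_gY, eps_gY, zero_smul]; exact topX_mul_mb (Fact.out : p.Prime).ne_zero
  | hZ => rw [ev_gZ, eps_gZ, zero_smul, mul_zero]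
  | hc c => rw [AlgHom.commutes, AlgHom.commutes, mul_comm, ← Algebra.smul_def]; rfl
  | hadd f g hf hg => rw [map_add, map_add, mul_add, hf, hg, add_smul]
  | hmul f g hf hg => rw [map_mul, map_mul, ← mul_assoc, hf, smul_mul_assoc, hg, smul_smul]

/-- `u'/r` is, up to a constant and a multiple of `x₁^{(p²-1)}`, a logarithmic derivative. -/
def HasLog (μ : F) (u : BAlg F p) : Prop :=
  ∃ (b : BAlg F p) (c₀ c₁ : F), eps b = 1 ∧ ev b = b ∧
    dd μ b = b * (dd μ u + algebraMap F _ c₀ + c₁ • mb (p ^ 2 - 1) 0)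

theorem HasLog.add {μ : F} {u v : BAlg F p} (hu : HasLog μ u) (hv : HasLog μ v) :
    HasLog μ (u + v) := by
  obtain ⟨b, c₀, c₁, h1, h2, h3⟩ := hu
  obtain ⟨b', c₀', c₁', h1', h2', h3'⟩ := hv
  refine ⟨b * b', c₀ + c₀', c₁ + c₁', by rw [map_mul, h1, h1', mul_one],
    by rw [map_mul, h2, h2'], ?_⟩
  rw [dd_isDer, h3, h3', map_add, map_add, add_smul]
  ring

/-- The exponential of c·w has logarithmic derivative c·∂w except for the truncation error
c^p·∂w·w^{p-1}. The hypothesis makes this error a multiple of x₁^{(p²-1)}, which is unaffected by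
multiplication with a function of value 1 at the origin. -/
theorem hasLog_smul {μ c e : F} {w : BAlg F p} (hw : ev w = w) (h0 : eps w = 0)
    (h : dd μ w * w ^ (p - 1) = e • mb (p ^ 2 - 1) 0) : HasLog μ (c • w) := by
  refine ⟨ex c w, 0, c ^ p * e, eps_ex h0 c, by rw [map_ex, hw], ?_⟩
  have hm := topX_mul_ev (F := F) (p := p) (ex c w)
  rw [map_ex, hw, eps_ex h0, one_smul] at hm
  have hcp : c ^ p = c * c ^ (p - 1) := (mul_pow_sub_one (Fact.out : p.Prime).ne_zero c).symm
  rw [(dd_isDer μ).map_ex, map_smul, map_zero, add_zero, hcp]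
  simp only [Algebra.smul_def, map_mul, map_pow] at h ⊢
  linear_combination (algebraMap F (BAlg F p) c * algebraMap F (BAlg F p) c ^ (p - 1)) * h
    - (algebraMap F (BAlg F p) c * algebraMap F (BAlg F p) c ^ (p - 1) * algebraMap F (BAlg F p) e) * hm

/-- The truncation error vanishes for monomials of degree at least 2 in x₁ or in x₁^{(p)}, and for
x₁·x₁^{(p)}. For x₁^{(p)} it is a multiple of x₁^{(p²-1)}. The monomial x₁ is replaced by
−μ·x₁^{(p)}, because r̃ = x₁ + μ·x₁^{(p)} has constant derivative ∂r̃ = 1. -/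
theorem hasLog_gX_gY (μ c : F) (a b : ℕ) : HasLog μ (c • (gX ^ a * gY ^ b : BAlg F p)) := by
  have hp1 := one_lt_p p
  have hev : ∀ a b : ℕ, ev (gX ^ a * gY ^ b : BAlg F p) = gX ^ a * gY ^ b := by
    intro a b; simp
  have hY : ∀ c : F, HasLog μ (c • (gY : BAlg F p)) := by
    intro c
    refine hasLog_smul (e := (((p - 1 + p * (p - 1)).choose (p - 1) : ℕ) : F) * ((p - 1).factorial : F)) ev_gY eps_gY ?_
    have hlt : p - 1 + p * (p - 1) = p ^ 2 - 1 := by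
      obtain ⟨q, rfl⟩ : ∃ q, p = q + 1 := ⟨p - 1, by omega⟩
      rw [Nat.add_sub_cancel]
      have : (q + 1) ^ 2 = q + (q + 1) * q + 1 := by ring
      omega
    have hsq := one_lt_sq p
    have hxp : (ri μ * mb (p - 1) 0 : BAlg F p) = mb (p - 1) 0 := by
      rw [ri, sub_mul, one_mul, smul_mul_assoc, xp_mul_xp, smul_zero, sub_zero]
    rw [dd_apply, d1_gY_mb, hxp, gY_pow (by omega), mul_smul_comm, mb_mul_mb (by omega) (by omega),
      smul_smul, hlt]
    simp [mul_comm]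
  by_cases h2 : 2 ≤ a ∨ 2 ≤ b
  · refine hasLog_smul (e := 0) (hev a b) ?_ ?_
    · rw [map_mul, map_pow, map_pow, eps_gX, eps_gY]
      rcases h2 with h | h
      · rw [zero_pow (by omega), zero_mul]
      · rw [zero_pow (n := b) (by omega), mul_zero]
    · have hz : ∀ {x : BAlg F p} {a : ℕ}, x ^ p = 0 → 2 ≤ a → x ^ (a * (p - 1)) = 0 := by
        intro x a hx ha
        refine pow_eq_zero_of_le ?_ hx
        have : 2 * (p - 1) ≤ a * (p - 1) := Nat.mul_le_mul_right _ ha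
        omega
      rw [mul_pow, ← pow_mul, ← pow_mul, zero_smul]
      rcases h2 with h | h
      · rw [hz gX_pow_p h, zero_mul, mul_zero]
      · rw [hz gY_pow_p h, mul_zero, mul_zero]
  · have ha : a = 0 ∨ a = 1 := by omega
    have hb : b = 0 ∨ b = 1 := by omega
    rcases ha with rfl | rfl <;> rcases hb with rfl | rfl
    · refine ⟨1, 0, 0, map_one _, map_one _, ?_⟩
      rw [pow_zero, pow_zero, mul_one, map_smul, (dd_isDer μ).map_one]
      simp
    · rw [pow_zero, pow_one, one_mul]; exact hY c
    · rw [pow_zero, pow_one, mul_one]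
      obtain ⟨b, c₀, c₁, h1, h2, h3⟩ := hY (-(c * μ))
      refine ⟨b, c₀ - c, c₁, h1, h2, ?_⟩
      have h4 := dd_rt (F := F) (p := p) μ
      rw [rt, map_add, map_smul] at h4
      rw [h3, map_smul, map_smul, map_sub]
      simp only [Algebra.smul_def, map_mul, map_neg] at h4 ⊢
      linear_combination (-(b * algebraMap F (BAlg F p) c)) * h4
    · refine hasLog_smul (e := 0) (hev 1 1) (by simp) ?_
      have h1 := gX_mul_xp (F := F) (p := p)
      have h2 : (gY : BAlg F p) * gY ^ (p - 1) = 0 := by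
        rw [← pow_succ', Nat.sub_add_cancel hp1.le, gY_pow_p]
      rw [pow_one, pow_one, dd_apply, Derivation.leibniz, d1_gX, d1_gY_mb, smul_eq_mul, smul_eq_mul,
        mul_one, h1, zero_add, zero_smul, mul_pow]
      linear_combination (ri μ * gX ^ (p - 1)) * h2

theorem hasLog (μ : F) {u : BAlg F p} (hu : ev u = u) : HasLog μ u := by
  rw [← hu, eq_sum_mb u, map_sum]
  refine Finset.sum_induction _ (HasLog μ) (fun _ _ => HasLog.add) ?_ fun i _ => ?_
  · have := hasLog_gX_gY (p := p) μ 0 0 0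
    rwa [zero_smul] at this
  · rw [map_smul, ev_mb]
    split_ifs
    · rw [mb_eq_dpw i.1.2 pos_p, dpw_zero, mul_one, dpw, dpw, smul_mul_smul_comm, smul_smul]
      exact hasLog_gX_gY _ _ _ _
    · rw [smul_zero]
      have := hasLog_gX_gY (p := p) μ 0 0 0
      rwa [zero_smul] at this

/-! ### Elements of `G ∩ C_μ` outside of `C_μ'` -/

theorem eps_xp : eps (mb (p - 1) 0 : BAlg F p) = 0 :=
  eps_mb (Or.inl (by have := one_lt_p p; omega))

theorem eps_op_gY (f : Pot F p) : eps (op f (gY : BAlg F p)) = 0 := by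
  rw [op_apply, d2_gY, d1_gY_mb, map_sub, map_mul, map_mul, eps_xp]; simp

theorem eps_cop_gY (μ β γ s : F) (u : BAlg F p) : eps (cop μ β γ s u gY) = β := by
  rw [cop, nop_eq, ← op_hPot, ← op_vPot, ← op_inB]
  simp only [LinearMap.add_apply, LinearMap.smul_apply, map_add, map_smul, eps_op_gY, Del_gY,
    map_one]
  simp

/-- The coefficient β of n_μ is the constant term of the value on x₁^{(p)}, and Hamiltonian
derivations have none there. If γ also vanished, the element would lie in C_μ'. -/
theorem exists_op_eq_cop (hp : 3 < p) {μ : F} {h : GAlg F p} (h1 : rho F p h ∈ Cmu p μ)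
    (h2 : rho F p h ∉ CmuPrime p μ) : ∃ (a s : F) (u : BAlg F p) (f : Pot F p),
      a ≠ 0 ∧ ev u = u ∧ h = DGL f ∧ op f = cop μ 0 a s u := by
  obtain ⟨β, γ, s, u, hu, hr, he⟩ := exists_of_mem_Cmu hp h1
  obtain ⟨f, rfl⟩ := DGL_surjective h
  have e : op f = cop μ β γ s u :=
    (rep_rho f).der_eq hp hr (op_isPD f).1 (cop_isPD μ β γ s u).1
  have hβ : β = 0 := by rw [← eps_cop_gY μ β γ s u, ← e, eps_op_gY]
  subst hβ
  refine ⟨γ, s, u, f, ?_, hu, rfl, e⟩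
  rintro rfl
  refine h2 (mem_CmuPrime_iff.2 ⟨s, u, ?_⟩)
  rw [he, zero_smul, zero_smul, zero_add, zero_add]

theorem cop_frame (hp : 3 < p) (μ a s : F) (u v : BAlg F p) (k : ℕ) :
    cop μ 0 a s u (jh μ v * y0 μ ^ k) =
      jh μ ((k : F) • ((s • mb (p ^ 2 - 1) 0 + dd μ u) * v) - a • dd μ v) * y0 μ ^ k := by
  rw [(cop_isPD μ 0 a s u).1, (cop_isPD μ 0 a s u).1.map_pow (cop_y0 μ 0 a s u), cop_jh hp,
    zero_smul, zero_sub, map_neg, map_sub, map_smul, map_smul, map_mul]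
  simp only [Algebra.smul_def]
  ring

/-- The substitution y ↦ j(b)·y changes the multiplier of h on y by a·∂b/b. Choosing ∂b/b = −a⁻¹∂u +
c₀ + c₁·x₁^{(p²-1)} cancels u. The constant becomes a multiple of t_μ, and the last term a multiple
of D_H(x₁^{(p²)}). -/
theorem exists_conj_normal (hp : 3 < p) {μ : F} {h : GAlg F p} (h1 : rho F p h ∈ Cmu p μ)
    (h2 : rho F p h ∉ CmuPrime p μ) : ∃ z ∈ Zt p μ, ∃ a b s : F, a ≠ 0 ∧
      autAct z (rho F p h) = a • rho F p (hEl p μ) + b • rho F p (tEl p μ) +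
        s • rho F p (vEl p F) := by
  obtain ⟨a, s, u, f, ha, hu, rfl, hf⟩ := exists_op_eq_cop hp h1 h2
  obtain ⟨b, c₀, c₁, hb1, hb2, hb3⟩ := hasLog μ (u := (-a⁻¹) • u) (by rw [map_smul, hu])
  obtain ⟨Φ, hΦ, hΦ'⟩ := exists_frame_equiv hp μ hb1
  obtain ⟨z, hz, hz'⟩ := exists_aut Φ hΦ
  refine ⟨z, mem_Zt hp hΦ' hz, a, a * c₀, s + a * c₁, ha, ?_⟩
  have h3 := hz' _ _ (rep_rho f)
  rw [hf] at h3
  have h4 : Φ.toLinearMap.comp ((cop μ 0 a s u).comp Φ.symm.toLinearMap) =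
      a • hop μ + (a * c₀) • pbL (tt μ) + (s + a * c₁) • vop F p := by
    have h5 : Φ.toLinearMap.comp (cop μ 0 a s u) =
        (a • hop μ + (a * c₀) • pbL (tt μ) + (s + a * c₁) • vop F p : EndB F p).comp
          Φ.toLinearMap := by
      refine linearMap_ext_frame hp μ fun v k => ?_
      have hb4 : dd μ (b ^ k) = (k : F) • ((dd μ ((-a⁻¹) • u) + algebraMap F _ c₀ +
          c₁ • mb (p ^ 2 - 1) 0) * b ^ k) :=
        (dd_isDer μ).map_pow (by rw [hb3, mul_comm]) k
      rw [LinearMap.comp_apply, LinearMap.comp_apply, cop_frame hp, LinearEquiv.coe_coe, hΦ', hΦ',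
        LinearMap.add_apply, LinearMap.add_apply, LinearMap.smul_apply, LinearMap.smul_apply,
        LinearMap.smul_apply, pbL_apply, pb_tt_jh_y0_pow hp, hop_isDer, hop_jh, hop_y0_pow,
        vop_isDer, vop_jh, vop_y0_pow, dd_isDer, hb4, map_smul (dd μ)]
      have ha' : algebraMap F (BAlg F p) a * algebraMap F (BAlg F p) a⁻¹ = 1 := by
        rw [← map_mul, mul_inv_cancel₀ ha, map_one]
      simp only [Algebra.smul_def, map_add, map_sub, map_mul, map_neg, map_pow, AlgHom.commutes]
      linear_combination (-(algebraMap F (BAlg F p) k * jh μ (dd μ u) * jh μ v * jh μ b ^ k *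
        y0 μ ^ k)) * ha'
    rw [← LinearMap.comp_assoc, h5, LinearMap.comp_assoc]
    refine LinearMap.ext fun f => ?_
    simp
  rw [h4] at h3
  exact h3.unique ((((rep_hEl μ).smul a).add ((rep_tEl μ).smul _)).add (rep_vEl.smul _))

/-! ### Eigenvectors of `h` in the eigenspaces of `t_μ` -/

/-- All derivatives D₁^n v are multiples of v, so every coefficient of v is a multiple of its
constant term. This is uniqueness for a first order linear differential equation. -/
theorem eq_zero_of_d1_eq_mul {v c : BAlg F p} (hv : ev v = v) (h : d1 v = c * v) (h0 : eps v = 0) :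
    v = 0 := by
  have key : ∀ n : ℕ, ∃ c, (d1L F p ^ n) v = c * v := by
    intro n
    induction n with
    | zero => exact ⟨1, by simp⟩
    | succ n ih =>
      obtain ⟨c', hc'⟩ := ih
      refine ⟨c' * c + d1 c', ?_⟩
      rw [pow_succ', Module.End.mul_apply, hc', d1L_apply, Derivation.leibniz, h, smul_eq_mul,
        smul_eq_mul]
      ring
  refine BAlg_ext fun i j => ?_
  by_cases hj : j = 0
  · subst hj
    obtain ⟨c', hc'⟩ := key i
    have h1 := d1_pow_cf i 0 0 v
    change cf 0 0 ((d1L F p ^ i) v) = _ at h1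
    rw [hc', ← eps_eq_cf, map_mul, h0, mul_zero, zero_add] at h1
    rw [← h1, map_zero]
  · rw [ev_eq_self_iff.1 hv i j hj, map_zero]

/-- Over an algebraically closed field, the operator `v ↦ g v - a v'/r` on functions of `x₁`
has an eigenvector with constant term `1`. -/
theorem exists_eigen_dd [IsAlgClosed F] (μ : F) {a : F} (ha : a ≠ 0) {g : BAlg F p}
    (hg : ev g = g) :
    ∃ (v : BAlg F p) (η : F), ev v = v ∧ eps v = 1 ∧ g * v - a • dd μ v = η • v := by
  let V := LinearMap.range (ev (F := F) (p := p)).toLinearMap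
  let T : EndB F p := LinearMap.mulLeft F g - a • dd μ
  have hTapply : ∀ v, T v = g * v - a • dd μ v := fun v => rfl
  have hT : ∀ v ∈ V, T v ∈ V := by
    rintro _ ⟨v, rfl⟩
    refine ⟨T (ev v), ?_⟩
    simp only [AlgHom.toLinearMap_apply, hTapply]
    rw [map_sub, map_mul, map_smul, ev_dd, hg, ev_ev]
  have hnt : Nontrivial V := ⟨⟨⟨1, ⟨1, map_one ev⟩⟩, 0, fun h => one_ne_zero (congrArg Subtype.val h)⟩⟩
  obtain ⟨η, hη⟩ := Module.End.exists_eigenvalue (T.restrict hT)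
  obtain ⟨⟨v, hv⟩, hv1, hv2⟩ := hη.exists_hasEigenvector
  have h1 : T v = η • v := congrArg Subtype.val (Module.End.mem_eigenspace_iff.1 hv1)
  have hv0 : v ≠ 0 := fun h => hv2 (Subtype.ext h)
  obtain ⟨w, rfl⟩ := hv
  have hev : ev (ev w) = ev w := ev_ev w
  change T (ev w) = η • ev w at h1
  change ev w ≠ 0 at hv0
  -- The eigenvalue equation is a first order equation v' = c·v, so an eigenvector cannot vanish at
  -- the origin and can be normalized.
  have he : eps (ev w) ≠ 0 := by
    intro h0
    refine hv0 (eq_zero_of_d1_eq_mul hev (c := rr μ * (algebraMap F _ a⁻¹ * (g - algebraMap F _ η))) ?_ h0)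
    rw [hTapply, dd_apply] at h1
    have ha' : algebraMap F (BAlg F p) a * algebraMap F (BAlg F p) a⁻¹ = 1 := by
      rw [← map_mul, mul_inv_cancel₀ ha, map_one]
    simp only [Algebra.smul_def] at h1
    have h2 := rr_mul_ri (F := F) (p := p) μ
    linear_combination (-(rr μ * algebraMap F (BAlg F p) a⁻¹)) * h1 - (d1 (ev w)) * h2
      - (rr μ * ri μ * d1 (ev w)) * ha'
  refine ⟨(eps (ev w))⁻¹ • ev w, η, by rw [map_smul, ev_ev], ?_, ?_⟩
  · rw [map_smul, smul_eq_mul, inv_mul_cancel₀ he]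
  · rw [hTapply] at h1
    rw [map_smul, mul_smul_comm, smul_comm a, ← smul_sub, h1, smul_comm]

/-! ### The p-th powers of the elements φ_k(v) -/

theorem pbL_y0_pow (μ : F) (k : ℕ) : (pbL (y0 μ ^ k) : EndB F p) =
    (k : F) • (LinearMap.mulLeft F (y0 μ ^ k) * hop μ) := by
  refine (IsPD.pb_left _).1.eq_of_frame (((hop_isDer μ).mulLeft _).smul _) μ (fun u => ?_) ?_
  · rw [pbL_apply, pb_comm, pb_jh_y0_pow, LinearMap.smul_apply, Module.End.mul_apply, hop_jh,
      LinearMap.mulLeft_apply, mul_neg, smul_neg, mul_comm]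
  · have := pb_pow_pow (y0 μ : BAlg F p) k 1
    rw [pow_one] at this
    rw [pbL_apply, this, LinearMap.smul_apply, Module.End.mul_apply, hop_y0, map_zero, smul_zero]

/-- {y^k, ·} is k times multiplication by y^k after h_μ. The two factors commute because h_μ kills
y, and y^{kp} = 1, k^p = k. -/
theorem pbL_y0_pow_pow_p (μ : F) (k : ℕ) :
    (pbL (y0 μ ^ k) : EndB F p) ^ p = (k : F) • hop μ ^ p := by
  have hc : Commute (LinearMap.mulLeft F (y0 μ ^ k)) (hop μ : EndB F p) := by
    refine LinearMap.ext fun f => ?_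
    rw [Module.End.mul_apply, Module.End.mul_apply, LinearMap.mulLeft_apply, LinearMap.mulLeft_apply,
      hop_isDer, hop_y0_pow, mul_zero, add_zero]
  rw [pbL_y0_pow, smul_pow, hc.mul_pow, LinearMap.pow_mulLeft, ← pow_mul, mul_comm k, pow_mul,
    y0_pow_p, one_pow, LinearMap.mulLeft_one, cast_pow_p]
  congr 1

theorem smul_sub_pow_p {A : Type*} [Ring A] [Nontrivial A] [Algebra F A] {x y : A}
    (h : Commute x y) (c : F) : (c • x - y) ^ p = c ^ p • x ^ p - y ^ p := by
  have : CharP A p := charP_of_injective_algebraMap (algebraMap F A).injective p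
  rw [sub_pow_char_of_commute p (h.smul_left c), smul_pow]

/-- The operators of h_μ and n_μ commute, so raising h_μ^p = −μh_μ − n_μ to the p-th power is
additive, and n_μ^p = 0 leaves only the term with h_μ^p. -/
theorem hop_pow_p_pow_p (hp : 3 < p) {μ : F} (hμ : μ ^ p = μ) :
    ((hop μ : EndB F p) ^ p) ^ p = (-μ) • hop μ ^ p := by
  have hodd : Odd p := (Fact.out : p.Prime).odd_of_ne_two (by omega)
  have hcom := lie_nop_hop (F := F) (p := p) μ 0 1 1 0
  have h1 : Commute (hop μ : EndB F p) (nop μ) := by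
    rw [zero_smul, zero_smul, one_smul, one_smul, zero_add, add_zero] at hcom
    exact sub_eq_zero.1 hcom
  have h2 := smul_sub_pow_p (F := F) (p := p) h1 (-μ)
  rw [← hop_pow_p hp, nop_pow_p hp, sub_zero, hodd.neg_pow, hμ] at h2
  exact h2

theorem eps_dd_gY (μ : F) : eps (dd μ (gY : BAlg F p)) = 0 := by
  rw [dd_apply, d1_gY_mb, map_mul, eps_xp, mul_zero]

theorem hop_pow_p_ne_zero (hp : 3 < p) (μ : F) : (hop μ : EndB F p) ^ p ≠ 0 := by
  intro h
  have h1 := congrArg (fun T : EndB F p => eps (T (jh μ gY))) h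
  simp only [hop_pow_p hp, LinearMap.sub_apply, LinearMap.smul_apply, hop_jh, nop_jh, Del_gY,
    map_one, map_sub, map_smul, map_neg, eps_jh, eps_dd_gY, LinearMap.zero_apply, map_zero] at h1
  simp at h1

/-- The powers of the elements of the frame `j(b)^k y₀^k` are conjugate to those of `y₀^k`. -/
theorem pow_pbL_frame (hp : 3 < p) {μ : F} (hμ : μ ^ p = μ) {b : BAlg F p} (hb : eps b = 1)
    {k : ℕ} (hk : (k : F) ≠ 0) :
    (pbL (jh μ (b ^ k) * y0 μ ^ k) : EndB F p) ^ p ≠ 0 ∧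
      ((pbL (jh μ (b ^ k) * y0 μ ^ k) : EndB F p) ^ p) ^ p =
        (-μ) • (pbL (jh μ (b ^ k) * y0 μ ^ k) : EndB F p) ^ p := by
  obtain ⟨Φ, h1, h2⟩ := exists_frame_equiv hp μ hb
  have h3 : jh μ (b ^ k) * y0 μ ^ k = Φ (y0 μ ^ k) := by
    have := h2 1 k
    rw [map_one, one_mul, one_mul] at this
    exact this.symm
  have h4 : (pbL (Φ (y0 μ ^ k)) : EndB F p) = Φ.conjAlgEquiv F (pbL (y0 μ ^ k)) := by
    refine LinearMap.ext fun f => ?_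
    have : Φ (Φ.symm f) = f := Φ.apply_symm_apply f
    rw [LinearEquiv.conjAlgEquiv_apply_apply, pbL_apply, pbL_apply, h1, this]
  have h5 : (pbL (jh μ (b ^ k) * y0 μ ^ k) : EndB F p) ^ p =
      (k : F) • Φ.conjAlgEquiv F (hop μ ^ p) := by
    rw [h3, h4, ← map_pow, pbL_y0_pow_pow_p, map_smul]
  have hkp : (k : F) ^ p = (k : F) := cast_pow_p k
  constructor
  · rw [h5]
    refine smul_ne_zero hk fun h => hop_pow_p_ne_zero (F := F) hp μ ?_
    exact (map_eq_zero_iff _ (Φ.conjAlgEquiv F).injective).1 h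
  · rw [h5, smul_pow, ← map_pow, hop_pow_p_pow_p hp hμ, hkp, map_smul, smul_comm]

/-- Since v^p = 1, an inverse l of k modulo p gives the root v^l. -/
theorem exists_pow_eq {k : ℕ} (hk : 1 ≤ k) (hkp : k < p) {v : BAlg F p} (hv : eps v = 1) :
    ∃ b : BAlg F p, eps b = 1 ∧ b ^ k = v := by
  have hc : Nat.Coprime k p := ((Fact.out : p.Prime).coprime_iff_not_dvd.2
    fun h => absurd (Nat.le_of_dvd (by omega) h) (by omega)).symm
  obtain ⟨l, -, hl⟩ := Nat.exists_mul_mod_eq_one_of_coprime hc (one_lt_p p)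
  refine ⟨v ^ l, by rw [map_pow, hv, one_pow], ?_⟩
  rw [← pow_mul, mul_comm l, ← Nat.div_add_mod (k * l) p, hl, pow_add, pow_mul, pow_p_eq_one hv,
    one_pow, one_mul, pow_one]

/-- Bracketing with h on j(v)·y^k is a first order operator on v, which has an eigenvector with v(0)
= 1. Writing v = b^k shows that φ_k(v) is the image of y^k under a substitution fixing t_μ. Its p-th
power x then satisfies x^p = −μx and is conjugate to k·h_μ^p. -/
theorem exists_eigen_phi [IsAlgClosed F] (hp : 3 < p) {μ : F} (hμ : μ ^ p = μ) (hμ0 : μ ≠ 0)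
    {h : GAlg F p} (h1 : rho F p h ∈ Cmu p μ)
    (h2 : rho F p h ∉ CmuPrime p μ) {k : ℕ} (hk : 1 ≤ k) (hkp : k < p) :
    ∃ (v : O2 F) (hv : v ∈ O21x1 F p 0), v - 1 ∈ O21x1 F p 1 ∧
      phi p μ (k : F) v hv ≠ 0 ∧
      (∃ η : F, ⁅h, phi p μ (k : F) v hv⁆ = η • phi p μ (k : F) v hv) ∧
      rho F p (phi p μ (k : F) v hv) ^ p ≠ 0 ∧
      rho F p (phi p μ (k : F) v hv) ^ p ∈ GG F p ∧
      IsPSemisimple (rho F p (phi p μ (k : F) v hv) ^ p) := by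
  obtain ⟨a, s, u, f, ha, hu, rfl, hf⟩ := exists_op_eq_cop hp h1 h2
  have hk0 : (k : F) ≠ 0 := cast_ne_zero' p (by omega) hkp
  obtain ⟨v, η, hv1, hv2, hv3⟩ := exists_eigen_dd μ ha
    (g := (k : F) • (s • mb (p ^ 2 - 1) 0 + dd μ u))
    (by rw [map_smul, map_add, map_smul, ev_mb_zero, ev_dd, hu])
  have hmem := coe_mem_O21x1 hv1
  obtain ⟨b, hb1, hb2⟩ := exists_pow_eq hk hkp hv2
  obtain ⟨h5, h6⟩ := pow_pbL_frame hp hμ hb1 hk0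
  rw [hb2] at h5 h6
  have hrep := (rep_rho_inB (jh μ v * y0 μ ^ k)).pow p
  have hne : rho F p (DGL (inB (jh μ v * y0 μ ^ k))) ^ p ≠ 0 := fun h0 => by
    rw [h0] at hrep
    exact h5 (hrep.der_eq_zero hp (IsPD.pb_left _).1.pow_p)
  refine ⟨v, hmem, ?_, ?_⟩
  · have := coe_mem_O21x1_one (f := v - 1) (by rw [map_sub, hv1, map_one])
      (by rw [map_sub, hv2, map_one, sub_self])
    exact this
  rw [phi_eq hv1 hmem hk hkp]
  refine ⟨fun h0 => hne ?_, ⟨η, ?_⟩, hne, pow_mem_pEnvelope (rho_mem_GG _), ?_⟩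
  · rw [h0, map_zero, zero_pow (Fact.out : p.Prime).ne_zero]
  · rw [lie_DGL_inB, hf, cop_frame hp, ← smul_mul_assoc, hv3, map_smul, smul_mul_assoc, map_smul,
      map_smul]
  · have h7 := hrep.pow p
    rw [h6] at h7
    have h8 := h7.unique (hrep.smul (-μ))
    have h9 : rho F p (DGL (inB (jh μ v * y0 μ ^ k))) ^ p =
        (-μ)⁻¹ • (rho F p (DGL (inB (jh μ v * y0 μ ^ k))) ^ p) ^ p ^ 1 := by
      rw [pow_one, h8, smul_smul, inv_mul_cancel₀ (neg_ne_zero.2 hμ0), one_smul]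
    rw [IsPSemisimple, h9]
    refine Submodule.smul_mem _ _ (Submodule.subset_span ⟨1, le_rfl, ?_⟩)
    rw [← h9]

/-! ### Eigenvectors of `h` in the centralizer of `t_μ` -/

theorem ex_gX_mul_xp (c : F) : ex c gX * mb (p - 1) 0 = (mb (p - 1) 0 : BAlg F p) := by
  rw [ex, Finset.sum_mul, Finset.sum_eq_single 0]
  · rw [pow_zero, one_smul, dpw_zero, one_mul]
  · intro i _ hi
    obtain ⟨j, rfl⟩ := Nat.exists_eq_succ_of_ne_zero hi
    rw [dpw, smul_mul_assoc, smul_mul_assoc, pow_succ gX, mul_assoc, gX_mul_xp, mul_zero, smul_zero,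
      smul_zero]
  · intro h
    exact absurd (Finset.mem_range.2 pos_p) h

/-- With c^{p-1} = −μ the truncation error of exp(c·x₁) turns its derivative into c·r·exp(c·x₁), and
∂ divides by r. -/
theorem dd_ex_gX {μ c : F} (hc : c ^ (p - 1) = -μ) :
    dd μ (ex c gX : BAlg F p) = c • ex c gX := by
  have h1 : (gX : BAlg F p) ^ (p - 1) = -mb (p - 1) 0 := by rw [mb_pred, neg_neg]
  have h2 := rr_mul_ri (F := F) (p := p) μ
  have h3 := ex_gX_mul_xp (F := F) (p := p) c
  have h4 := d1_isDer.map_ex (F := F) (p := p) c gX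
  rw [d1L_apply, d1L_apply, d1_gX, one_mul, hc, h1] at h4
  rw [dd_apply, h4, mul_smul_comm]
  congr 1
  rw [rr] at h2
  simp only [Algebra.smul_def, map_neg] at h2 ⊢
  linear_combination (ex c gX) * h2 - (algebraMap F (BAlg F p) μ * ri μ) * h3

theorem top_jh_ex {μ c : F} (hc0 : c ≠ 0) (hc : c ^ (p - 1) = -μ) :
    top (jh μ (ex c gX) : BAlg F p) = 0 := by
  have h : hop μ (jh μ ((-c⁻¹) • ex c gX)) = (jh μ (ex c gX) : BAlg F p) := by
    rw [hop_jh, map_smul, dd_ex_gX hc, smul_smul, neg_mul, inv_mul_cancel₀ hc0, neg_smul, one_smul,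
      map_neg, neg_neg]
  rw [← h]
  exact (hop_isPD μ).top_apply _

theorem top_y0 (μ : F) : top (y0 μ : BAlg F p) = 0 := by
  have h := pb_tt_y0_pow (F := F) (p := p) μ 1
  rw [pow_one, Nat.cast_one, one_smul] at h
  rw [← h]
  exact top_pb _ _

/-- The n-th power sends y to j(∂E)^n·y with E = exp(c·x₁) and constant term c^n ≠ 0. This cannot be
a constant function, because it is an eigenvector of t_μ for the eigenvalue 1. -/
theorem not_isNilpotent_rho_jh_ex (hp : 3 < p) {μ c : F} (hc0 : c ≠ 0) (hc : c ^ (p - 1) = -μ) :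
    ¬ IsNilpotent (rho F p (K (jh μ (ex c gX)) : SAlg F p)) := by
  rintro ⟨n, hn⟩
  have hrep := rep_rho_inB (jh μ (ex c gX) : BAlg F p)
  rw [← coe_K (top_jh_ex hc0 hc)] at hrep
  have h1 := (hrep.pow n) (y0 μ) (top_y0 μ)
  have h2 := pow_apply_frame (IsPD.pb_left (jh μ (ex c gX))).1 (F := F) (p := p) (μ := μ)
    (g := dd μ (ex c gX)) (fun u => pb_jh_jh hp μ _ _) (pb_jh_y0 _ _) n 1 1
  rw [map_one, one_mul, pow_one, Nat.cast_one, one_pow, one_smul, mul_one] at h2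
  have h3 := h1.2
  have h0 : (K 0 : SAlg F p) = 0 := map_zero _
  rw [hn, LinearMap.zero_apply, ← h0, eq_comm, K_eq_iff h1.1 (map_zero _), h2] at h3
  obtain ⟨e, he⟩ := h3
  have h4 := pb_tt_jh_y0_pow (F := F) hp μ (dd μ (ex c gX) ^ n) 1
  rw [pow_one, he, zero_add, pb_algebraMap_right, Nat.cast_one, one_smul] at h4
  rw [zero_add, ← h4] at he
  have h5 := congrArg eps he
  rw [map_mul, eps_jh, eps_y0, map_pow, dd_ex_gX hc, map_smul, eps_ex eps_gX, mul_one, smul_eq_mul,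
    mul_one, map_zero] at h5
  exact pow_ne_zero n hc0 h5

theorem exists_eigen_centralizer [IsAlgClosed F] (hp : 3 < p) {μ : F} (hμ0 : μ ≠ 0)
    {h : GAlg F p} (h1 : rho F p h ∈ Cmu p μ) (h2 : rho F p h ∉ CmuPrime p μ) :
    ∃ x : SAlg F p, x ≠ 0 ∧ ⁅tEl p μ, (x : GAlg F p)⁆ = 0 ∧ ¬ IsNilpotent (rho F p x) ∧
      ∃ c : F, c ≠ 0 ∧ ⁅h, (x : GAlg F p)⁆ = c • (x : GAlg F p) := by
  obtain ⟨a, s, u, f, ha, hu, rfl, hf⟩ := exists_op_eq_cop hp h1 h2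
  obtain ⟨c, hc⟩ := IsAlgClosed.exists_pow_nat_eq (-μ) (n := p - 1) (by omega)
  have hc0 : c ≠ 0 := by
    rintro rfl
    rw [zero_pow (by omega)] at hc
    exact hμ0 (neg_eq_zero.1 hc.symm)
  have hnil := not_isNilpotent_rho_jh_ex hp hc0 hc
  refine ⟨K (jh μ (ex c gX)), fun h0 => hnil ?_, ?_, hnil, -(a * c), neg_ne_zero.2 (mul_ne_zero ha hc0), ?_⟩
  · rw [h0]
    exact ⟨1, by rw [pow_one]; exact map_zero (rho F p)⟩
  · rw [coe_K (top_jh_ex hc0 hc), tEl_eq, lie_DGL_inB_inB, pb_tt_jh hp, map_zero, map_zero]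
  · rw [coe_K (top_jh_ex hc0 hc), lie_DGL_inB, hf, cop_jh hp, zero_smul, zero_sub, dd_ex_gX hc,
      smul_smul, map_neg, map_smul, ← neg_smul, map_smul, map_smul]

/-! ### Toral elements of `S` outside of `S_(0)` -/

/-- At the origin only the terms survive in which each of the n derivations hits a different factor
x₁. -/
theorem IsDer.eps_pow_apply {D : EndB F p} (hD : IsDer D) (n : ℕ) (u : BAlg F p) :
    eps ((D ^ n) (gX ^ n * u)) = (n.factorial : F) * eps (D gX) ^ n * eps u := by
  induction n generalizing u with
  | zero => simp
  | succ n ih =>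
    have h : D (gX ^ (n + 1) * u) =
        gX ^ n * (((n + 1 : ℕ) : F) • (D gX * u) + gX * D u) := by
      rw [hD, hD.map_pow_succ]
      simp only [Algebra.smul_def]
      ring
    rw [pow_succ D, Module.End.mul_apply, h, ih, map_add, map_smul, map_mul, map_mul, eps_gX,
      Nat.factorial_succ, smul_eq_mul]
    push_cast
    ring

/-- T(x₁^{(p)}) = x₁^{p-1}·D₂f vanishes at the origin. But T^p(x₁^{(p)}) has constant term −e^p with
e = D₂f(0), because p − 1 is even, so torality forces e = 0. -/
theorem eps_d2_of_toral {f : BAlg F p} (hT : (pbL f : EndB F p) ^ p = pbL f) :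
    eps (d2 f) = 0 := by
  have hX : (pbL f : EndB F p) gX = -d2 f := by
    rw [pbL_apply, pb, d1_gX, d2_gX]; ring
  have hY : (pbL f : EndB F p) gY = gX ^ (p - 1) * d2 f := by
    rw [pbL_apply, pb, d1_gY, d2_gY]; ring
  have h1 := congrArg (fun T : EndB F p => eps (T gY)) hT
  have h2 : ((pbL f : EndB F p) ^ p) gY = ((pbL f : EndB F p) ^ (p - 1)) ((pbL f : EndB F p) gY) := by
    rw [← Module.End.mul_apply, ← pow_succ, Nat.sub_add_cancel (one_lt_p p).le]
  simp only [h2, hY, (IsPD.pb_left f).1.eps_pow_apply, hX, factorial_pred, map_mul, map_pow, eps_gX]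
    at h1
  rw [zero_pow (by have := one_lt_p p; omega), zero_mul, map_neg] at h1
  by_contra h0
  exact (mul_ne_zero (mul_ne_zero (neg_ne_zero.2 one_ne_zero)
    (pow_ne_zero _ (neg_ne_zero.2 h0))) h0) h1

theorem K_mem_SFil {f : BAlg F p} (hf : top f = 0) (h1 : eps (d1 f) = 0) (h2 : eps (d2 f) = 0) :
    (K f : SAlg F p) ∈ SFil F p 0 := by
  have key : ∀ g : BAlg F p, eps g = 0 →
      (g : O2 F) ∈ monSpan F {a | a ∈ box p ∧ 0 + 1 ≤ a.1 + a.2} := by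
    intro g hg
    refine mem_monSpan_iff.2 ?_
    rintro ⟨i, j⟩ h
    by_cases hb : i < p ^ 2 ∧ j < p
    · have : i = 0 ∧ j = 0 := by
        by_contra hij
        exact h ⟨hb, by change 0 + 1 ≤ i + j; omega⟩
      rw [this.1, this.2]
      rw [eps_eq_cf] at hg
      exact hg
    · exact cf_eq_zero g hb
  change (((K f : SAlg F p) : GAlg F p) : Derivation F (O2 F) (O2 F)) ∈ WFil F p 0
  rw [coe_K hf, coe_DGL]
  refine ⟨((-d2 f : BAlg F p) : O2 F), key _ (by rw [map_neg, h2, neg_zero]), (d1 f : BAlg F p),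
    key _ h1, ?_⟩
  rw [coe_inB]
  change D1 (f : O2 F) • (D2 : Derivation F (O2 F) (O2 F)) - D2 (f : O2 F) • D1 =
    (-(D2 (f : O2 F))) • D1 + D1 (f : O2 F) • D2
  rw [neg_smul]
  abel

/-! ### Integration in one variable -/

theorem exists_d1_eq {w : BAlg F p} (hw : ev w = w) (h : cf (p ^ 2 - 1) 0 w = 0) :
    ∃ u : BAlg F p, ev u = u ∧ eps u = 0 ∧ d1 u = w := by
  refine ⟨∑ i ∈ Finset.range (p ^ 2 - 1), cf i 0 w • mb (i + 1) 0, ?_, ?_, ?_⟩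
  · rw [map_sum]
    exact Finset.sum_congr rfl fun i _ => by rw [map_smul, ev_mb_zero]
  · rw [map_sum]
    exact Finset.sum_eq_zero fun i _ => by
      rw [map_smul, eps_mb (Or.inl (Nat.succ_ne_zero i)), smul_zero]
  · have hsq := one_lt_sq p
    refine BAlg_ext fun i j => ?_
    rw [cf_d1, map_sum]
    by_cases hj : j = 0
    · subst hj
      by_cases hi : i < p ^ 2 - 1
      · rw [Finset.sum_eq_single i]
        · rw [map_smul, cf_mb (by omega) pos_p, if_pos ⟨rfl, rfl⟩, smul_eq_mul, mul_one]
        · intro k hk hki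
          have := Finset.mem_range.1 hk
          rw [map_smul, cf_mb (by omega) pos_p, if_neg (by omega), smul_zero]
        · intro h'; exact absurd (Finset.mem_range.2 hi) h'
      · have h0 : cf i 0 w = 0 := by
          by_cases hi2 : i = p ^ 2 - 1
          · rw [hi2, h]
          · exact cf_eq_zero w fun h' => hi2 (by omega)
        rw [h0]
        refine Finset.sum_eq_zero fun k hk => ?_
        have := Finset.mem_range.1 hk
        rw [map_smul, cf_mb (by omega) pos_p, if_neg (by omega), smul_zero]
    · rw [ev_eq_self_iff.1 hw i j hj]
      refine Finset.sum_eq_zero fun k hk => ?_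
      have := Finset.mem_range.1 hk
      rw [map_smul, cf_mb (by omega) pos_p, if_neg (by omega), smul_zero]

/-- Truncated logarithms. -/
theorem exists_log (hp : 3 < p) {D : EndB F p} (hD : IsDer D) {c : F} {E : BAlg F p} (hE : eps E = 1)
    (hev : ev E = E) (h : D E = c • E) :
    ∃ l : BAlg F p, ev l = l ∧ eps l = 0 ∧ D l = c • (1 - l ^ (p - 1)) := by
  have hp1 := one_lt_p p
  obtain ⟨n, rfl⟩ : ∃ n, E = 1 + n := ⟨E - 1, by ring⟩
  have hn0 : eps n = 0 := by rw [map_add, map_one] at hE; simpa using hE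
  have hnev : ev n = n := by rw [map_add, map_one] at hev; exact add_left_cancel hev
  have hnp : n * n ^ (p - 1) = 0 := by
    rw [← pow_succ', Nat.sub_add_cancel hp1.le, pow_p_eq_zero hn0]
  have hDn : D n = c • (1 + n) := by rw [← h, map_add, hD.map_one, zero_add]
  -- n·w is the logarithm of 1 + n truncated below degree p. The geometric sum appearing in its
  -- derivative, times 1 + n, is 1 − n^{p-1}, and n^{p-1} = (n·w)^{p-1}.
  let w : BAlg F p := ∑ i ∈ Finset.range (p - 1), (((i + 1 : ℕ) : F)⁻¹ * (-1) ^ i) • n ^ i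
  have hwn : ∃ g, w = 1 + n * g := by
    obtain ⟨m, hm⟩ : ∃ m, p - 1 = m + 1 := ⟨p - 2, by omega⟩
    refine ⟨∑ i ∈ Finset.range m, (((i + 1 + 1 : ℕ) : F)⁻¹ * (-1) ^ (i + 1)) • n ^ i, ?_⟩
    simp only [w]
    rw [hm, Finset.sum_range_succ', Finset.mul_sum, add_comm]
    congr 1
    · simp
    · exact Finset.sum_congr rfl fun i _ => by rw [mul_smul_comm, pow_succ' n]
  have hw1 : ∀ k : ℕ, n ^ (p - 1) * w ^ k = n ^ (p - 1) := by
    obtain ⟨g, hg⟩ := hwn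
    intro k
    induction k with
    | zero => rw [pow_zero, mul_one]
    | succ k ih =>
      rw [pow_succ, ← mul_assoc, ih, hg]
      linear_combination g * hnp
  have hl : (n * w) ^ (p - 1) = n ^ (p - 1) := by rw [mul_pow, hw1]
  refine ⟨n * w, ?_, by rw [map_mul, hn0, zero_mul], ?_⟩
  · rw [map_mul, hnev, map_sum]
    congr 1
    exact Finset.sum_congr rfl fun i _ => by rw [map_smul, map_pow, hnev]
  · have hterm : ∀ i ∈ Finset.range (p - 1),
        D ((((i + 1 : ℕ) : F)⁻¹ * (-1) ^ i) • n ^ (i + 1)) = (-n) ^ i * D n := by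
      intro i hi
      have hi' := Finset.mem_range.1 hi
      rw [map_smul, hD.map_pow_succ, smul_smul, mul_right_comm,
        inv_mul_cancel₀ (cast_ne_zero' p (Nat.succ_ne_zero i) (by omega)), one_mul, neg_pow n,
        Algebra.smul_def, map_pow, map_neg, map_one, mul_assoc]
    have hsum : D (n * w) = (∑ i ∈ Finset.range (p - 1), (-n) ^ i) * D n := by
      simp only [w]
      rw [Finset.mul_sum, map_sum, Finset.sum_mul]
      refine Finset.sum_congr rfl fun i hi => ?_
      rw [← hterm i hi, mul_smul_comm, pow_succ']
    have hgeom := mul_neg_geom_sum (-n) (p - 1)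
    have hsgn : (-n) ^ (p - 1) = n ^ (p - 1) :=
      (Nat.Odd.sub_odd ((Fact.out : p.Prime).odd_of_ne_two (by omega)) odd_one).neg_pow n
    rw [hsum, hDn, hl, mul_smul_comm, ← hsgn, ← hgeom]
    congr 1
    ring

/-! ### A normal form for derivations in one variable -/

theorem isNilpotent_of_forall_not_hasEigenvalue {L V : Type*} [Field L] [IsAlgClosed L]
    [AddCommGroup V] [Module L V] [FiniteDimensional L V] {N : Module.End L V}
    (h : ∀ c : L, c ≠ 0 → ¬ N.HasEigenvalue c) : IsNilpotent N := by
  have htop := Module.End.iSup_maxGenEigenspace_eq_top N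
  have h0 : N.maxGenEigenspace 0 = ⊤ := by
    rw [← htop]
    refine le_antisymm (le_iSup _ 0) (iSup_le fun c => ?_)
    by_cases hc : c = 0
    · rw [hc]
    · rw [Module.End.maxGenEigenspace_eq_genEigenspace_finrank]
      have : N.genEigenspace c (Module.finrank L V) = ⊥ := by
        by_contra hne
        exact h c hc (Module.End.hasEigenvalue_of_hasGenEigenvalue hne)
      rw [this]
      exact bot_le
  refine ⟨Module.finrank L V, LinearMap.ext fun v => ?_⟩
  have hv : v ∈ N.maxGenEigenspace 0 := by rw [h0]; trivial
  rw [Module.End.maxGenEigenspace_eq_genEigenspace_finrank, Module.End.mem_genEigenspace_nat] at hv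
  simpa using hv

theorem mem_range_ev {v : BAlg F p} :
    v ∈ LinearMap.range (ev (F := F) (p := p)).toLinearMap ↔ ev v = v := by
  constructor
  · rintro ⟨w, rfl⟩; exact ev_ev w
  · exact fun h => ⟨v, h⟩

/-- A derivation of the functions of `x₁` without nonzero eigenvalues is nilpotent. -/
theorem exists_pow_apply_eq_zero [IsAlgClosed F] {D : EndB F p} (hD : ∀ v, ev v = v → ev (D v) = D v)
    (h : ∀ (c : F) (E : BAlg F p), ev E = E → D E = c • E → c ≠ 0 → E = 0) :
    ∃ n : ℕ, ∀ v, ev v = v → (D ^ n) v = 0 := by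
  have hD' : ∀ v ∈ LinearMap.range (ev (F := F) (p := p)).toLinearMap,
      D v ∈ LinearMap.range (ev (F := F) (p := p)).toLinearMap :=
    fun v hv => mem_range_ev.2 (hD v (mem_range_ev.1 hv))
  obtain ⟨n, hn⟩ := isNilpotent_of_forall_not_hasEigenvalue (N := D.restrict hD') fun c hc hE => by
    obtain ⟨⟨v, hv⟩, hv1, hv2⟩ := hE.exists_hasEigenvector
    refine hv2 (Subtype.ext ?_)
    exact h c v (mem_range_ev.1 hv)
      (congrArg Subtype.val (Module.End.mem_eigenspace_iff.1 hv1)) hc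
  refine ⟨n, fun v hv => ?_⟩
  have h1 := congrArg Subtype.val (LinearMap.congr_fun hn ⟨v, mem_range_ev.2 hv⟩)
  rw [Module.End.pow_restrict n] at h1
  exact h1

theorem not_forall_mem_span_pow (f : BAlg F p) :
    ¬ ∀ v : BAlg F p, ev v = v → v ∈ Submodule.span F (Set.range fun i : Fin p => f ^ (i : ℕ)) := by
  intro h
  have hli : LinearIndependent F (fun a : Fin (p ^ 2) => (mb (a : ℕ) 0 : BAlg F p)) :=
    linearIndependent_mb.comp (fun a : Fin (p ^ 2) => (a, (⟨0, pos_p⟩ : Fin p)))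
      fun a b hab => congrArg Prod.fst hab
  have h1 := finrank_span_eq_card hli
  have h2 : Submodule.span F (Set.range fun a : Fin (p ^ 2) => (mb (a : ℕ) 0 : BAlg F p)) ≤
      Submodule.span F (Set.range fun i : Fin p => f ^ (i : ℕ)) := by
    rw [Submodule.span_le]
    rintro _ ⟨a, rfl⟩
    exact h _ (ev_mb_zero _)
  have h3 := (Submodule.finrank_mono h2).trans (finrank_range_le_card _)
  rw [h1, Fintype.card_fin, Fintype.card_fin] at h3
  have := prime_lt_sq (p := p)
  omega

/-- The image of D = G·D₁ on functions of x₁ is a hyperplane, and D is nilpotent because it has no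
nonzero eigenvalue. If f^{p-1} were outside the image, every function would be, modulo the span of
1, f, …, f^{p-1}, in the image of every power of D. Then these p powers would span a space of
dimension p². -/
theorem exists_integral_pow [IsAlgClosed F] (hp : 3 < p) {f G : BAlg F p} (hf : ev f = f)
    (hG : ev G = G) (h : G * d1 f = 1)
    (hE : ∀ (c : F) (E : BAlg F p), ev E = E → G * d1 E = c • E → c ≠ 0 → E = 0) :
    ∃ Y : BAlg F p, ev Y = Y ∧ eps Y = 0 ∧ G * d1 Y = -f ^ (p - 1) := by
  let D : EndB F p := LinearMap.mulLeft F G * d1L F p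
  have hDap : ∀ v, D v = G * d1 v := fun v => rfl
  have hDder : IsDer D := d1_isDer.mulLeft G
  obtain ⟨n, hn⟩ := exists_pow_apply_eq_zero (D := D)
    (fun v hv => by rw [hDap, map_mul, hG, ev_d1, hv]) hE
  have hsolve : ∀ u : BAlg F p, ev u = u → cf (p ^ 2 - 1) 0 (d1 f * u) = 0 →
      ∃ Y : BAlg F p, ev Y = Y ∧ eps Y = 0 ∧ D Y = u := by
    intro u hu h0
    obtain ⟨Y, h1, h2, h3⟩ := exists_d1_eq (w := d1 f * u) (by rw [map_mul, ev_d1, hf, hu]) h0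
    refine ⟨Y, h1, h2, ?_⟩
    rw [hDap, h3]
    linear_combination u * h
  have hpow : ∀ i : ℕ, ev (f ^ i) = f ^ i := fun i => by rw [map_pow, hf]
  by_cases hq : cf (p ^ 2 - 1) 0 (d1 f * f ^ (p - 1)) = 0
  · obtain ⟨Y, h1, h2, h3⟩ := hsolve (-f ^ (p - 1)) (by rw [map_neg, hpow])
      (by rw [mul_neg, map_neg, hq, neg_zero])
    exact ⟨Y, h1, h2, h3⟩
  exfalso
  set W := Submodule.span F (Set.range fun i : Fin p => f ^ (i : ℕ)) with hW
  have hWD : ∀ v ∈ W, D v ∈ W := by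
    intro v hv
    have : W ≤ W.comap D := by
      rw [hW, Submodule.span_le]
      rintro _ ⟨⟨i, hi⟩, rfl⟩
      change D (f ^ i) ∈ W
      rcases i with _ | i
      · rw [pow_zero, hDder.map_one]; exact zero_mem _
      · rw [hDder.map_pow_succ, hDap, h, mul_one]
        exact Submodule.smul_mem _ _ (Submodule.subset_span ⟨⟨i, by omega⟩, rfl⟩)
    exact this hv
  have hWn : ∀ (m : ℕ), ∀ v ∈ W, (D ^ m) v ∈ W := by
    intro m
    induction m with
    | zero => intro v hv; exact hv
    | succ m ih => intro v hv; rw [pow_succ, Module.End.mul_apply]; exact ih _ (hWD v hv)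
  have hmem : f ^ (p - 1) ∈ W :=
    Submodule.subset_span ⟨⟨p - 1, by omega⟩, rfl⟩
  have key : ∀ m : ℕ, ∀ v, ev v = v → ∃ u, ev u = u ∧ v - (D ^ m) u ∈ W := by
    intro m
    induction m with
    | zero => intro v hv; exact ⟨v, hv, by simp⟩
    | succ m ih =>
      intro v hv
      obtain ⟨u, hu, hu'⟩ := ih v hv
      set c : F := cf (p ^ 2 - 1) 0 (d1 f * u) / cf (p ^ 2 - 1) 0 (d1 f * f ^ (p - 1)) with hc
      obtain ⟨u', h1, -, h3⟩ := hsolve (u - c • f ^ (p - 1))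
        (by rw [map_sub, map_smul, hpow, hu]) (by
          rw [mul_sub, mul_smul_comm, map_sub, map_smul, smul_eq_mul, hc, div_mul_cancel₀ _ hq,
            sub_self])
      refine ⟨u', h1, ?_⟩
      rw [pow_succ, Module.End.mul_apply, h3, map_sub, map_smul]
      have := add_mem hu' (W.smul_mem c (hWn m _ hmem))
      convert this using 1
      abel
  refine not_forall_mem_span_pow f fun v hv => ?_
  obtain ⟨u, hu, hu'⟩ := key n v hv
  rwa [hn u hu, sub_zero] at hu'

/-- Let D = G·D₁, so D f = 1. If D has no nonzero eigenvalue, X = f and an integral of −f^{p-1}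
serve with μ = 0. Otherwise the logarithm l of an eigenvector satisfies D l = c(1 − l^{p-1}).
Rescaling by z with z^{p-1} = −1 turns the sign, so μ = 1 and κ = z·c, and Y is the difference κ·f −
X. -/
theorem exists_normal_form [IsAlgClosed F] (hp : 3 < p) {f G : BAlg F p} (hf : ev f = f)
    (h0 : eps f = 0) (hG : ev G = G) (h : G * d1 f = 1) :
    ∃ (μ κ : F) (X Y : BAlg F p), (μ = 0 ∨ μ = 1) ∧ κ ≠ 0 ∧ ev X = X ∧ ev Y = Y ∧ eps X = 0 ∧
      eps Y = 0 ∧ G * d1 X = κ • (1 + μ • X ^ (p - 1)) ∧ G * d1 Y = -(κ • X ^ (p - 1)) ∧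
      X + μ • Y = κ • f := by
  by_cases hE : ∀ (c : F) (E : BAlg F p), ev E = E → G * d1 E = c • E → c ≠ 0 → E = 0
  · obtain ⟨Y, h1, h2, h3⟩ := exists_integral_pow hp hf hG h hE
    refine ⟨0, 1, f, Y, Or.inl rfl, one_ne_zero, hf, h1, h0, h2, ?_, ?_, ?_⟩
    · rw [h, zero_smul, add_zero, one_smul]
    · rw [h3, one_smul]
    · rw [zero_smul, add_zero, one_smul]
  · push Not at hE
    obtain ⟨c, E, hE1, hE2, hc, hE3⟩ := hE
    have heps : eps E ≠ 0 := fun he => hE3 (eq_zero_of_d1_eq_mul hE1 (c := d1 f * algebraMap F _ c)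
      (by rw [Algebra.smul_def] at hE2; linear_combination d1 f * hE2 - d1 E * h) he)
    obtain ⟨l, hl1, hl2, hl3⟩ := exists_log hp (d1_isDer.mulLeft G) (c := c) (E := (eps E)⁻¹ • E)
      (by rw [map_smul, smul_eq_mul, inv_mul_cancel₀ heps]) (by rw [map_smul, hE1])
      (by
        rw [map_smul, smul_comm c]
        congr 1)
    obtain ⟨z, hz⟩ := IsAlgClosed.exists_pow_nat_eq (-1 : F) (n := p - 1) (by omega)
    have hz0 : z ≠ 0 := by
      rintro rfl
      rw [zero_pow (by omega)] at hz
      exact neg_ne_zero.2 one_ne_zero hz.symm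
    have hX : G * d1 (z • l) = (z * c) • (1 + (1 : F) • (z • l) ^ (p - 1)) := by
      rw [Derivation.map_smul, mul_smul_comm, smul_pow, hz, one_smul, neg_smul, one_smul,
        ← sub_eq_add_neg, mul_smul, ← hl3]
      rfl
    refine ⟨1, z * c, z • l, (z * c) • f - z • l, Or.inr rfl, mul_ne_zero hz0 hc,
      by rw [map_smul, hl1], by rw [map_sub, map_smul, map_smul, hl1, hf],
      by rw [map_smul, hl2, smul_zero], by rw [map_sub, map_smul, map_smul, hl2, h0]; simp, hX, ?_,
      by rw [one_smul]; abel⟩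
    rw [map_sub, mul_sub, hX, Derivation.map_smul, mul_smul_comm, h, one_smul, smul_add]
    abel

/-! ### Conjugacy to `t_μ` -/

theorem pb_eq_zero_of_pb_eq_zero {f g a b : BAlg F p} (hg : g * d1 f = 1) (ha : pb f a = 0)
    (hb : pb f b = 0) : pb a b = 0 := by
  rw [pb] at ha hb ⊢
  linear_combination (g * d1 a) * hb - (g * d1 b) * ha - (d1 a * d2 b - d2 a * d1 b) * hg

/-- Where D₁f is invertible, {f, a} = 0 makes da proportional to df with ratio g·D₁a, so bracketing
y with a is this ratio times bracketing with f. -/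
theorem pb_eq_mul_of_pb_eq_self {f g a y : BAlg F p} (hg : g * d1 f = 1) (ha : pb f a = 0)
    (hy : pb f y = y) : pb a y = g * d1 a * y := by
  rw [pb] at ha hy ⊢
  linear_combination (g * d1 a) * hy - (g * d1 y) * ha - (d1 a * d2 y - d2 a * d1 y) * hg

/-- Both sides of the relation for {j(u), y} are eigenvectors of {f, ·} for the eigenvalue 1, hence
need only be compared at x₂ = 0. There the hypotheses on P and Q say that G·D₁ corresponds to κ∂ on
the generators x₁ and x₁^{(p)}. -/
theorem isFrame_of_toral {f g P Q y : BAlg F p} {μ κ : F} (hf : eps (d1 f) ≠ 0) (hg : g * d1 f = 1)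
    (hP : pb f P = 0) (hQ : pb f Q = 0) (hy : pb f y = y) (hy1 : ev y = 1) (hPp : P ^ p = 0)
    (hQp : Q ^ p = 0) (hX : ev g * d1 (ev P) = κ • (1 + μ • ev P ^ (p - 1)))
    (hY : ev g * d1 (ev Q) = -(κ • ev P ^ (p - 1))) :
    IsFrame μ κ (tau P Q 0 hPp hQp (zero_pow (Fact.out : p.Prime).ne_zero)) y := by
  set j : BAlg F p →ₐ[F] BAlg F p := tau P Q 0 hPp hQp (zero_pow (Fact.out : p.Prime).ne_zero)
  have jX : j gX = P := tau_gX _ _ _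
  have jY : j gY = Q := tau_gY _ _ _
  have jZ : j gZ = 0 := tau_gZ _ _ _
  have hker : ∀ u, pb f (j u) = 0 := by
    intro u
    induction u using gen_induction with
    | hX => rw [jX, hP]
    | hY => rw [jY, hQ]
    | hZ => rw [jZ, pb_zero_right]
    | hc c => rw [AlgHom.commutes, pb_algebraMap_right]
    | hadd u v hu hv => rw [map_add, pb_add_right, hu, hv, add_zero]
    | hmul u v hu hv => rw [map_mul, pb_mul_right, hu, hv, mul_zero, mul_zero, add_zero]
  have jxp : j (mb (p - 1) 0) = -P ^ (p - 1) := by rw [mb_pred, map_neg, map_pow, jX]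
  have jri : j (ri μ) = 1 + μ • P ^ (p - 1) := by
    rw [ri, map_sub, map_one, map_smul, jxp, smul_neg, sub_neg_eq_add]
  have hev : ∀ u, j (ev u) = j u := by
    have : j.comp ev = j := algHom_ext_gen (by simp) (by simp) (by simp [jZ])
    exact fun u => congrArg (fun φ => φ u) this
  have hder : ∀ u, ev g * d1 (ev (j u)) = κ • ev (j (dd μ u)) := by
    intro u
    have := map_der_of_gen (φ := ev.comp j) (D := κ • dd μ)
      (D' := LinearMap.mulLeft F (ev g) * d1L F p) ((dd_isDer μ).smul κ) (d1_isDer.mulLeft _)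
      (by
        simp only [LinearMap.smul_apply, map_smul, dd_apply, d1_gX, mul_one, AlgHom.comp_apply,
          Module.End.mul_apply, LinearMap.mulLeft_apply, d1L_apply, jX, hX, jri, map_add, map_one,
          map_pow])
      (by
        have : (ri μ * mb (p - 1) 0 : BAlg F p) = mb (p - 1) 0 := by
          rw [ri, sub_mul, one_mul, smul_mul_assoc, xp_mul_xp, smul_zero, sub_zero]
        simp only [LinearMap.smul_apply, map_smul, dd_apply, d1_gY_mb, this, AlgHom.comp_apply,
          Module.End.mul_apply, LinearMap.mulLeft_apply, d1L_apply, jY, hY, jxp, map_neg, map_pow,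
          smul_neg])
      (by
        simp only [LinearMap.smul_apply, dd_apply, d1_gZ, mul_zero, map_zero, smul_zero,
          AlgHom.comp_apply, jZ])
      u
    rw [LinearMap.smul_apply, map_smul] at this
    exact this.symm
  refine ⟨hev, pow_p_eq_one (by rw [← eps_ev, hy1, map_one]), fun u v => pb_eq_zero_of_pb_eq_zero hg
    (hker u) (hker v), fun u => ?_⟩
  refine sub_eq_zero.1 (eq_zero_of_pb_eigen hf (k := 1) ?_ ?_)
  · have h1 : pb f (pb (j u) y) = pb (j u) y := by
      have := pb_jacobi f (j u) y
      rw [hker, pb_zero_left, hy, zero_add] at this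
      exact this
    rw [pb_sub_right, h1, pb_smul_right, pb_mul_right, hker, hy, one_smul, mul_zero, add_zero]
  · rw [map_sub, pb_eq_mul_of_pb_eq_self hg (hker u) hy, map_mul, map_mul, ev_d1, hder, map_smul,
      map_mul, hy1, mul_one, mul_one, sub_self]

/-- The normal coordinates X, Y lift to elements commuting with f, and 1 lifts to an eigenvector for
the eigenvalue 1. The relation X + μY = κf survives the lifting, so the automorphism given by the
frame sends j(r̃) to f. -/
theorem exists_equiv_tt [IsAlgClosed F] (hp : 3 < p) {f : BAlg F p} (h0 : eps f = 0)
    (hf : eps (d1 f) ≠ 0) (hT : (pbL f : EndB F p) ^ p = pbL f) :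
    ∃ (μ : F) (Φ : BAlg F p ≃ₗ[F] BAlg F p), (μ = 0 ∨ μ = 1) ∧
      (∀ a b, Φ (pb a b) = pb (Φ a) (Φ b)) ∧ Φ (tt μ) = f := by
  obtain ⟨g, hg⟩ := exists_mul_eq_one hf
  obtain ⟨μ, κ, X, Y, hμ, hκ, hX1, hY1, hX2, hY2, hX3, hY3, hXY⟩ :=
    exists_normal_form hp (f := ev f) (G := ev g) (ev_ev f) (by rw [eps_ev, h0]) (ev_ev g)
      (by rw [← ev_d1, ← map_mul, hg, map_one])
  obtain ⟨P, hP, hP'⟩ := ev_eigen_lift hf hT pos_p X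
  obtain ⟨Q, hQ, hQ'⟩ := ev_eigen_lift hf hT pos_p Y
  obtain ⟨y, hy, hy'⟩ := ev_eigen_lift hf hT (one_lt_p p) 1
  rw [Nat.cast_zero, zero_smul] at hP hQ
  rw [Nat.cast_one, one_smul] at hy
  rw [hX1] at hP'
  rw [hY1] at hQ'
  rw [map_one] at hy'
  have hfr := isFrame_of_toral hf hg hP hQ hy hy'
    (pow_p_eq_zero (by rw [← eps_ev, hP', hX2])) (pow_p_eq_zero (by rw [← eps_ev, hQ', hY2]))
    (by rw [hP']; exact hX3) (by rw [hQ', hP']; exact hY3)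
  obtain ⟨Φ, hΦ, hΦ'⟩ := hfr.exists_equiv hp hκ
  refine ⟨μ, Φ, hμ, hΦ, ?_⟩
  have h1 := hΦ' (rt μ) 0
  rw [pow_zero, pow_zero, mul_one, mul_one] at h1
  rw [tt, h1, rt, map_add, map_smul, tau_gX, tau_gY]
  have h2 : P + μ • Q = κ • f := by
    refine sub_eq_zero.1 (eq_zero_of_pb_eigen hf (k := 0) ?_ ?_)
    · rw [pb_sub_right, pb_add_right, pb_smul_right, pb_smul_right, hP, hQ, pb_self]; simp
    · rw [map_sub, map_add, map_smul, map_smul, hP', hQ', hXY, sub_self]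
  rw [h2, smul_smul, inv_mul_cancel₀ hκ, one_smul]

theorem exists_conj_tEl [IsAlgClosed F] (hp : 3 < p) {t : SAlg F p} (ht : IsToral (rho F p t))
    (h : t ∉ SFil F p 0) : ∃ (g : SAlg F p ≃ₗ⁅F⁆ SAlg F p) (μ : F), (μ = 0 ∨ μ = 1) ∧
      (g t : GAlg F p) = tEl p μ := by
  obtain ⟨f, hf, h0, rfl⟩ : ∃ f : BAlg F p, top f = 0 ∧ eps f = 0 ∧ t = K f := by
    obtain ⟨f, hf, rfl⟩ := exists_K t
    have h1 : top (f - algebraMap F _ (eps f)) = 0 := by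
      rw [map_sub, hf, top_algebraMap, sub_zero]
    refine ⟨f - algebraMap F _ (eps f), h1, ?_, (K_eq_iff hf h1).2 ⟨eps f, by ring⟩⟩
    rw [map_sub, AlgHom.commutes]
    simp
  have hrep := rep_rho_inB f
  rw [← coe_K hf] at hrep
  have hT : (pbL f : EndB F p) ^ p = pbL f := by
    have h1 := hrep.pow p
    rw [ht] at h1
    exact h1.der_eq hp hrep (IsPD.pb_left f).1.pow_p (IsPD.pb_left f).1
  have hf1 : eps (d1 f) ≠ 0 := fun h1 => h (K_mem_SFil hf h1 (eps_d2_of_toral hT))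
  obtain ⟨μ, Φ, hμ, hΦ, hΦt⟩ := exists_equiv_tt hp h0 hf1 hT
  have hΨ : ∀ a b, Φ.symm (pb a b) = pb (Φ.symm a) (Φ.symm b) := by
    intro a b
    apply Φ.injective
    rw [hΦ]; simp
  obtain ⟨g, hg, -⟩ := exists_aut Φ.symm hΨ
  refine ⟨g, μ, hμ, ?_⟩
  rw [hg f hf, ← hΦt, LinearEquiv.symm_apply_apply, coe_K (top_tt hp μ), tEl_eq]

/-! ### Toral elements of `S_p` outside of `S` -/

theorem evY_xp : evY (mb (p - 1) 0 : BAlg F p) = mb (p - 1) 0 := by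
  rw [evY_mb, if_pos (by have := one_lt_p p; omega)]

variable (F p) in
/-- The partial derivative with respect to `x₁`, where `x₁`, `x₁^{(p)}` and `x₂` are viewed as
independent variables. -/
def dX : EndB F p := d1L F p - LinearMap.mulLeft F (mb (p - 1) 0) * Del F p

theorem dX_apply (f : BAlg F p) : dX F p f = d1 f - mb (p - 1) 0 * Del F p f := rfl

theorem dX_isDer : IsDer (dX F p) := d1_isDer.sub (Del_isPD.1.mulLeft _)

theorem dX_Del (f : BAlg F p) : dX F p (Del F p f) = Del F p (dX F p f) := by
  rw [dX_apply, dX_apply, map_sub, Del_d1, Del_isPD.1, Del_xp, mul_zero, add_zero]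

theorem evY_dX (f : BAlg F p) : evY (dX F p f) = dX F p (evY f) := by
  refine map_der_of_gen dX_isDer dX_isDer ?_ ?_ ?_ f
  · simp [dX_apply, d1_gX, Del_gX]
  · simp [dX_apply, d1_gY_mb, Del_gY]
  · simp [dX_apply, d1_gZ, Del_gZ]

theorem evY_d1 (f : BAlg F p) : evY (d1 f) = d1 (evY f) + mb (p - 1) 0 * evY (Del F p f) := by
  have h := evY_dX f
  rw [dX_apply, dX_apply, Del_evY, map_sub, map_mul, evY_xp] at h
  linear_combination h

/-- The operator `{s, ·} + β D₁^p`. -/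
def sop (s : BAlg F p) (β : F) : EndB F p := pbL s + β • Del F p

theorem sop_apply (s : BAlg F p) (β : F) (a : BAlg F p) :
    sop s β a = pb s a + β • Del F p a := rfl

theorem sop_isPD (s : BAlg F p) (β : F) : IsPD (sop s β) :=
  (IsPD.pb_left s).add (Del_isPD.smul β)

/-- Viewing x₁, x₁^{(p)}, x₂ as independent variables, D₁ = ∂_X + x₁^{(p-1)}·D₁^p. The coefficient β
− D₂s·x₁^{(p-1)} of D₁^p is a unit, so the equation can be solved for D₁^p a. -/
theorem eq_zero_of_sop_eigen {s a : BAlg F p} {β k : F} (hβ : β ≠ 0) (h : sop s β a = k • a)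
    (h0 : evY a = 0) : a = 0 := by
  obtain ⟨g, hg⟩ := exists_mul_eq_one (f := algebraMap F _ β - d2 s * mb (p - 1) 0)
    (by rw [map_sub, map_mul, eps_xp, mul_zero, sub_zero, AlgHom.commutes]; exact hβ)
  refine eq_zero_of_ev (ev := evY) (E := Del F p) (d := d2L F p) (d' := dX F p)
    (c := algebraMap F _ k * g) (c₁ := -(g * d1 s)) (c₂ := g * d2 s) Del_isPD.1
    (fun a => (Del_d2 a).symm) dX_Del (fun a => evY_d2 a) evY_dX eq_zero_of_evY_Del ?_ h0
  rw [sop_apply, pb, Algebra.smul_def, Algebra.smul_def] at h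
  rw [d2L_apply, dX_apply]
  linear_combination g * h - Del F p a * hg

theorem sop_eigen_lift {s : BAlg F p} {β : F} (hβ : β ≠ 0) (hT : sop s β ^ p = sop s β)
    {k : ℕ} (hk : k < p) (r : BAlg F p) : ∃ a, sop s β a = (k : F) • a ∧ evY a = evY r :=
  exists_eigen_lift hT evY.toLinearMap finrank_range_evY
    (fun _ _ _ h h0 => eq_zero_of_sop_eigen hβ h h0) hk r

/-- At x₁^{(p)} = 0 the derivative D₁ still sees D₁^p a, multiplied by x₁^{(p-1)}. As the square of
x₁^{(p-1)} is zero, the eigenvalue equation expresses exactly this product through the restriction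
of a. -/
theorem xp_mul_evY_Del {s a : BAlg F p} {β k : F} (hβ : β ≠ 0) (h : sop s β a = k • a) :
    mb (p - 1) 0 * evY (Del F p a) =
      β⁻¹ • (mb (p - 1) 0 * (k • evY a - pb (evY s) (evY a))) := by
  have h1 := congrArg evY h
  rw [sop_apply, pb, map_add, map_sub, map_mul, map_mul, map_smul, map_smul, evY_d1, evY_d1, evY_d2,
    evY_d2] at h1
  have hx := xp_mul_xp (F := F) (p := p)
  have hb : algebraMap F (BAlg F p) β * algebraMap F (BAlg F p) β⁻¹ = 1 := by
    rw [← map_mul, mul_inv_cancel₀ hβ, map_one]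
  rw [pb]
  simp only [Algebra.smul_def] at h1 ⊢
  linear_combination (algebraMap F (BAlg F p) β⁻¹ * mb (p - 1) 0) * h1
    - (mb (p - 1) 0 * evY (Del F p a)) * hb
    - (algebraMap F (BAlg F p) β⁻¹ * (evY (Del F p s) * d2 (evY a) - d2 (evY s) * evY (Del F p a))) * hx

theorem evY_pb {s a b : BAlg F p} {β k : F} (hβ : β ≠ 0) (ha : sop s β a = 0)
    (hb : sop s β b = k • b) :
    evY (pb a b) = (1 + β⁻¹ • (mb (p - 1) 0 * d2 (evY s))) * pb (evY a) (evY b) -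
      (β⁻¹ * k) • (mb (p - 1) 0 * evY b * d2 (evY a)) := by
  have h1 := xp_mul_evY_Del hβ (k := 0) (by rw [ha, zero_smul])
  have h2 := xp_mul_evY_Del hβ hb
  rw [zero_smul, zero_sub] at h1
  rw [pb, map_sub, map_mul, map_mul, evY_d1, evY_d1, evY_d2, evY_d2, pb]
  rw [pb] at h1 h2
  simp only [Algebra.smul_def, map_mul] at h1 h2 ⊢
  linear_combination d2 (evY b) * h1 - d2 (evY a) * h2

theorem sop_pb {s a b : BAlg F p} {β k : F} (ha : sop s β a = 0)
    (hb : sop s β b = k • b) : sop s β (pb a b) = k • pb a b := by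
  rw [(sop_isPD s β).2, ha, hb, pb_zero_left, pb_smul_right, zero_add]

/-- Canonical coordinates for a toral derivation `{s, ·} + β D₁^p`. -/
theorem exists_canonical [IsAlgClosed F] {s : BAlg F p} {β : F} (hβ : β ≠ 0)
    (hT : sop s β ^ p = sop s β) :
    ∃ P Q y : BAlg F p, eps P = 0 ∧ eps Q = 0 ∧ eps y = 1 ∧ sop s β P = 0 ∧ sop s β Q = 0 ∧
      sop s β y = y ∧ pb P Q = 1 ∧ pb Q y = 0 ∧ pb P y = -y := by
  -- With l^p = β⁻¹ the truncation error of exp(l·x₁) equals the correction term that restricting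
  -- {Q, y} to x₁^{(p)} = 0 produces.
  obtain ⟨l, hl⟩ := IsAlgClosed.exists_pow_nat_eq β⁻¹ (n := p) pos_p
  have hl0 : l ≠ 0 := by
    rintro rfl
    rw [zero_pow (Fact.out : p.Prime).ne_zero] at hl
    exact inv_ne_zero hβ hl.symm
  have hlp : l * l ^ (p - 1) = β⁻¹ := by rw [← hl, mul_pow_sub_one (Fact.out : p.Prime).ne_zero]
  have hx := xp_mul_xp (F := F) (p := p)
  obtain ⟨P, hP, hP'⟩ := sop_eigen_lift hβ hT pos_p gX
  -- The term −β⁻¹·x₁^{(p-1)}·s compensates the factor 1 + β⁻¹·x₁^{(p-1)}·D₂s in `evY_pb`, so that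
  -- {P, Q} restricts to 1.
  obtain ⟨Q, hQ, hQ'⟩ := sop_eigen_lift hβ hT pos_p (gZ - β⁻¹ • (mb (p - 1) 0 * s))
  obtain ⟨y, hy, hy'⟩ := sop_eigen_lift hβ hT (one_lt_p p) (ex l gX)
  rw [Nat.cast_zero, zero_smul] at hP hQ
  rw [Nat.cast_one] at hy
  rw [evY_gX] at hP'
  rw [map_sub, evY_gZ, map_smul, map_mul, evY_xp] at hQ'
  rw [map_ex, evY_gX] at hy'
  have hd2x : d2 (mb (p - 1) 0 : BAlg F p) = 0 := d2_mb_zero _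
  have hd2X : d2 (gX : BAlg F p) = 0 := d2_gX
  have hdQ : d2 (evY Q) = 1 - β⁻¹ • (mb (p - 1) 0 * d2 (evY s)) := by
    rw [hQ', map_sub, d2_gZ, Derivation.map_smul, Derivation.leibniz, hd2x, smul_zero, add_zero,
      smul_eq_mul]
  have hdy : d1 (evY y) = l • evY y - β⁻¹ • mb (p - 1) 0 := by
    have := d1_isDer.map_ex (F := F) (p := p) l gX
    rw [d1L_apply, d1L_apply, d1_gX, one_mul, smul_add, smul_smul, hlp] at this
    rw [hy', this, mb_pred, smul_neg, sub_neg_eq_add]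
  have hdy2 : d2 (evY y) = 0 := by
    have := d2_isDer.map_ex (F := F) (p := p) l gX
    rw [d2L_apply, d2L_apply, d2_gX, zero_mul, smul_zero] at this
    rw [hy', this]
  have hyx : evY y * mb (p - 1) 0 = mb (p - 1) 0 := by rw [hy', ex_gX_mul_xp]
  have hone : sop s β (1 : BAlg F p) = 0 := (sop_isPD s β).1.map_one
  have hPQ : pb P Q = 1 := by
    refine sub_eq_zero.1 (eq_zero_of_sop_eigen hβ (s := s) (k := 0) ?_ ?_)
    · rw [map_sub, hone, sop_pb hP (k := 0) (by rw [hQ, zero_smul])]; simp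
    · rw [map_sub, evY_pb hβ hP (k := 0) (by rw [hQ, zero_smul]), pb, hP', d1_gX, hd2X, hdQ, map_one]
      simp only [Algebra.smul_def, map_mul, map_zero]
      linear_combination (-(algebraMap F (BAlg F p) β⁻¹ ^ 2 * d2 (evY s) ^ 2)) * hx
  have hPy : pb P y = 0 := by
    refine eq_zero_of_sop_eigen hβ (sop_pb hP hy) ?_
    rw [evY_pb hβ hP hy, pb, hP', d1_gX, hd2X, hdy2]
    simp
  have hQy : pb Q y = -(l • y) := by
    refine sub_eq_zero.1 (eq_zero_of_sop_eigen hβ (s := s) (k := 1) ?_ ?_)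
    · rw [map_sub, sop_pb hQ hy, map_neg, map_smul, hy]; simp
    · rw [map_sub, evY_pb hβ hQ hy, pb, hdy2, hdy, hdQ, map_neg, map_smul]
      simp only [Algebra.smul_def, map_mul, map_one]
      set B := algebraMap F (BAlg F p) β⁻¹
      linear_combination (B ^ 2 * d2 (evY s) ^ 2 *
        (algebraMap F (BAlg F p) l * evY y - B * mb (p - 1) 0) + B ^ 2 * evY y * d2 (evY s)) * hx -
        B * hyx
  -- Exchanging P and Q and rescaling by l turns {P, Q} = 1, {P, y} = 0, {Q, y} = −l·y into the
  -- normalized relations.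
  refine ⟨l⁻¹ • Q, -(l • P), y, ?_, ?_, ?_, ?_, ?_, ?_, ?_, ?_, ?_⟩
  · rw [map_smul, ← eps_evY, hQ', map_sub, eps_gZ, map_smul, map_mul, eps_xp]; simp
  · rw [map_neg, map_smul, ← eps_evY, hP', eps_gX]; simp
  · rw [← eps_evY, hy', eps_ex eps_gX]
  · rw [map_smul, hQ, smul_zero]
  · rw [map_neg, map_smul, hP, smul_zero, neg_zero]
  · rw [hy, one_smul]
  · rw [pb_neg_right, pb_smul_left, pb_smul_right, pb_comm, hPQ, smul_smul, inv_mul_cancel₀ hl0,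
      one_smul, neg_neg]
  · rw [pb_neg_left, pb_smul_left, hPy, smul_zero, neg_zero]
  · rw [pb_smul_left, hQy, smul_neg, smul_smul, inv_mul_cancel₀ hl0, one_smul]

/-! ### Poisson homomorphisms -/

theorem pb_map_of_gen {φ : BAlg F p →ₐ[F] BAlg F p} (hXZ : pb (φ gX) (φ gZ) = 1)
    (hXY : pb (φ gY) (φ gX) = 0) (hYZ : pb (φ gY) (φ gZ) = -φ gX ^ (p - 1)) (f g : BAlg F p) :
    φ (pb f g) = pb (φ f) (φ g) := by
  have key : ∀ g : BAlg F p, φ (pb gX g) = pb (φ gX) (φ g) → φ (pb gY g) = pb (φ gY) (φ g) →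
      φ (pb gZ g) = pb (φ gZ) (φ g) → ∀ f, φ (pb f g) = pb (φ f) (φ g) := by
    intro g h1 h2 h3 f
    have h := derivation_along_ext (φ := φ) (A := φ.toLinearMap.comp (-pbL g))
      (B := (-pbL (φ g) : EndB F p).comp φ.toLinearMap)
      (fun a b => by
        simp only [LinearMap.comp_apply, LinearMap.neg_apply, pbL_apply, AlgHom.toLinearMap_apply,
          pb_mul_right, map_neg, map_add, map_mul]
        ring)
      (fun a b => by
        simp only [LinearMap.comp_apply, LinearMap.neg_apply, pbL_apply, AlgHom.toLinearMap_apply,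
          pb_mul_right, map_mul]
        ring)
      (by
        simp only [LinearMap.comp_apply, LinearMap.neg_apply, pbL_apply, AlgHom.toLinearMap_apply]
        rw [← pb_comm, ← pb_comm, h1])
      (by
        simp only [LinearMap.comp_apply, LinearMap.neg_apply, pbL_apply, AlgHom.toLinearMap_apply]
        rw [← pb_comm, ← pb_comm, h2])
      (by
        simp only [LinearMap.comp_apply, LinearMap.neg_apply, pbL_apply, AlgHom.toLinearMap_apply]
        rw [← pb_comm, ← pb_comm, h3])
    have h' := LinearMap.congr_fun h f
    simp only [LinearMap.comp_apply, LinearMap.neg_apply, pbL_apply, AlgHom.toLinearMap_apply] at h'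
    rwa [← pb_comm, ← pb_comm] at h'
  have key' : ∀ f : BAlg F p, φ (pb f gX) = pb (φ f) (φ gX) → φ (pb f gY) = pb (φ f) (φ gY) →
      φ (pb f gZ) = pb (φ f) (φ gZ) → ∀ g, φ (pb f g) = pb (φ f) (φ g) := by
    intro f h1 h2 h3 g
    have hs : ∀ h, φ (pb f h) = pb (φ f) (φ h) → φ (pb h f) = pb (φ h) (φ f) := by
      intro h hh
      rw [pb_comm, map_neg, hh, ← pb_comm]
    rw [pb_comm f, map_neg, key f (hs _ h1) (hs _ h2) (hs _ h3), ← pb_comm]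
  have bXX : φ (pb gX gX) = pb (φ gX) (φ gX) := by rw [pb_self, pb_self, map_zero]
  have bYY : φ (pb gY gY) = pb (φ gY) (φ gY) := by rw [pb_self, pb_self, map_zero]
  have bZZ : φ (pb gZ gZ) = pb (φ gZ) (φ gZ) := by rw [pb_self, pb_self, map_zero]
  have bXZ : φ (pb gX gZ) = pb (φ gX) (φ gZ) := by
    rw [hXZ, pb, d1_gX, d2_gZ, d2_gX, zero_mul, sub_zero, one_mul, map_one]
  have bYX : φ (pb gY gX) = pb (φ gY) (φ gX) := by
    rw [hXY, pb, d2_gY, d2_gX, zero_mul, mul_zero, sub_zero, map_zero]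
  have bYZ : φ (pb gY gZ) = pb (φ gY) (φ gZ) := by
    rw [hYZ, pb, d1_gY, d2_gZ, d2_gY, zero_mul, sub_zero, mul_one, map_neg, map_pow]
  have hs : ∀ f h, φ (pb f h) = pb (φ f) (φ h) → φ (pb h f) = pb (φ h) (φ f) := by
    intro f h hh
    rw [pb_comm, map_neg, hh, ← pb_comm]
  exact key g (key' gX bXX (hs _ _ bYX) bXZ g) (key' gY bYX bYY bYZ g)
    (key' gZ (hs _ _ bXZ) (hs _ _ bYZ) bZZ g) f

/-- The truncated logarithm of `1 - x`. -/
def lg (x : BAlg F p) : BAlg F p :=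
  -∑ i ∈ Finset.range (p - 1), (((i + 1 : ℕ) : F)⁻¹) • x ^ (i + 1)

theorem IsDer.map_lg {D : EndB F p} (hD : IsDer D) (x : BAlg F p) :
    D (lg x) = -((∑ i ∈ Finset.range (p - 1), x ^ i) * D x) := by
  rw [lg, map_neg, map_sum, Finset.sum_mul]
  congr 1
  refine Finset.sum_congr rfl fun i hi => ?_
  have := Finset.mem_range.1 hi
  rw [map_smul, hD.map_pow_succ, smul_smul,
    inv_mul_cancel₀ (cast_ne_zero' p (Nat.succ_ne_zero i) (by omega)), one_smul]

theorem eps_lg {x : BAlg F p} (hx : eps x = 0) : eps (lg x) = 0 := by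
  rw [lg, map_neg, map_sum, Finset.sum_eq_zero, neg_zero]
  intro i _
  rw [map_smul, map_pow, hx, zero_pow (Nat.succ_ne_zero i), smul_zero]

/-- The operator of `D₁^p + D₁ + D_H(x₁ x₂)`. -/
def t4 (F : Type*) [Field F] (p : ℕ) [Fact p.Prime] [CharP F p] : EndB F p :=
  Del F p + d1L F p + pbL (gX * gZ)

theorem t4_isDer : IsDer (t4 F p) := (Del_isPD.1.add d1_isDer).add (IsPD.pb_left _).1

theorem t4_apply (f : BAlg F p) : t4 F p f = Del F p f + d1 f + (gZ * d2 f - gX * d1 f) := by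
  have h : pb (gX * gZ) f = gZ * d2 f - gX * d1 f := by
    rw [pb_mul_left, pb, pb, d1_gX, d2_gX, d1_gZ, d2_gZ]; ring
  rw [← h]
  rfl

/-- The model operator sends x₁ to 1 − x₁, x₂ to x₂ and x₁^{(p)} to 1 − x₁^{p-1}. The elements x = 1
− y⁻¹, z = P·y and Y = Q + log y, with the logarithm truncated, behave in the same way and have the
brackets of the three generators. Sending generators to them is thus a Poisson automorphism. -/
theorem exists_canonical_equiv [IsAlgClosed F] {s : BAlg F p} {β : F} (hβ : β ≠ 0)
    (hT : sop s β ^ p = sop s β) :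
    ∃ Φ : BAlg F p ≃ₗ[F] BAlg F p, (∀ a b, Φ (pb a b) = pb (Φ a) (Φ b)) ∧
      ∀ a, Φ (t4 F p a) = sop s β (Φ a) := by
  have hp1 := one_lt_p p
  obtain ⟨P, Q, y, hP0, hQ0, hy0, hP, hQ, hy, hPQ, hQy, hPy⟩ := exists_canonical hβ hT
  have hTD := (sop_isPD s β).1
  obtain ⟨w, hw⟩ := exists_mul_eq_one (f := y) (by rw [hy0]; exact one_ne_zero)
  have hinv : ∀ D : EndB F p, IsDer D → D w = -(w ^ 2 * D y) := by
    intro D hD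
    have h1 := hD w y
    rw [hw, hD.map_one] at h1
    linear_combination (-w) * h1 - D w * hw
  set x := 1 - w with hx
  set S := ∑ i ∈ Finset.range (p - 1), x ^ i with hS
  have hw0 : eps w = 1 := by
    have := congrArg eps hw
    rwa [map_mul, hy0, mul_one, map_one] at this
  have hx0 : eps x = 0 := by rw [hx, map_sub, map_one, hw0, sub_self]
  have hxp : x * x ^ (p - 1) = 0 := by
    rw [← pow_succ', Nat.sub_add_cancel hp1.le, pow_p_eq_zero hx0]
  have hwS : w * S = 1 - x ^ (p - 1) := by
    have := mul_neg_geom_sum x (p - 1)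
    rw [← this, hx]; ring
  have hyx : y * x ^ (p - 1) = x ^ (p - 1) := by
    have h1 : w = 1 - x := by rw [hx]; ring
    have h2 : w * x ^ (p - 1) = x ^ (p - 1) := by rw [h1]; linear_combination -hxp
    linear_combination (-y) * h2 + x ^ (p - 1) * hw
  have hder : ∀ D : EndB F p, IsDer D → D x = w ^ 2 * D y := by
    intro D hD
    rw [hx, map_sub, hD.map_one, hinv D hD]; ring
  have hTx : sop s β x = 1 - x := by
    rw [hder _ hTD, hy, hx]; linear_combination w * hw
  have hPx : pb P x = -w := by
    have := hder _ (IsPD.pb_left P).1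
    rw [pbL_apply, pbL_apply, hPy] at this
    rw [this]; linear_combination (-w) * hw
  have hQx : pb Q x = 0 := by
    have := hder _ (IsPD.pb_left Q).1
    rwa [pbL_apply, pbL_apply, hQy, mul_zero] at this
  have hxy : pb x y = 0 := by
    have := hder _ (IsPD.pb_left y).1
    rw [pbL_apply, pbL_apply, pb_self, mul_zero] at this
    rw [pb_comm, this, neg_zero]
  set z := P * y with hz
  have hz0 : eps z = 0 := by rw [hz, map_mul, hP0, zero_mul]
  have hTz : sop s β z = z := by rw [hz, hTD, hP, hy, mul_zero, add_zero]
  have hxz : pb x z = 1 := by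
    rw [hz, pb_mul_right, hxy, pb_comm x P, hPx]; linear_combination hw
  have hQz : pb Q z = -y := by
    rw [hz, pb_mul_right, hQy, pb_comm Q P, hPQ]; ring
  have hlg : ∀ D : EndB F p, IsDer D → D (lg x) = -(S * D x) := fun D hD => hD.map_lg x
  -- Since 1 − x = y⁻¹, this adds the truncated logarithm of y to Q. The truncation produces the
  -- terms x^{p-1} required in {Y, z} and in the value of the toral operator on Y.
  set Y := Q - lg x with hY
  have hY0 : eps Y = 0 := by rw [hY, map_sub, hQ0, eps_lg hx0, sub_zero]
  have hTY : sop s β Y = 1 - x ^ (p - 1) := by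
    rw [hY, map_sub, hQ, hlg _ hTD, hTx, ← hwS, hx]; ring
  have hYx : pb Y x = 0 := by
    have := hlg _ (IsPD.pb_left x).1
    rw [pbL_apply, pbL_apply, pb_self, mul_zero, neg_zero] at this
    rw [hY, pb_sub_left, hQx, pb_comm (lg x), this, neg_zero, sub_zero]
  have hYz : pb Y z = -x ^ (p - 1) := by
    have := hlg _ (IsPD.pb_left z).1
    rw [pbL_apply, pbL_apply, pb_comm z x, hxz] at this
    rw [hY, pb_sub_left, hQz, pb_comm (lg x), this]
    linear_combination y * hwS - S * hw - hyx
  let φ : BAlg F p →ₐ[F] BAlg F p :=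
    tau x Y z (pow_p_eq_zero hx0) (pow_p_eq_zero hY0) (pow_p_eq_zero hz0)
  have φX : φ gX = x := tau_gX _ _ _
  have φY : φ gY = Y := tau_gY _ _ _
  have φZ : φ gZ = z := tau_gZ _ _ _
  have hφ : ∀ f g, φ (pb f g) = pb (φ f) (φ g) :=
    pb_map_of_gen (by rw [φX, φZ, hxz]) (by rw [φX, φY, hYx]) (by rw [φX, φY, φZ, hYz])
  have hinj : Function.Injective φ.toLinearMap := injective_of_pb hφ (by
    rw [AlgHom.toLinearMap_apply, map_one]; exact one_ne_zero)
  refine ⟨LinearEquiv.ofInjectiveEndo _ hinj, hφ, ?_⟩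
  refine map_der_of_gen (φ := φ) t4_isDer hTD ?_ ?_ ?_
  · rw [t4_apply, Del_gX, d1_gX, d2_gX, φX, hTx]
    simp [φX, sub_eq_add_neg]
  · have h1 : gX * d1 (gY : BAlg F p) = 0 := by rw [d1_gY_mb, gX_mul_xp]
    rw [t4_apply, h1, Del_gY, d1_gY, d2_gY, φY, hTY]
    simp [φX, sub_eq_add_neg]
  · rw [t4_apply, Del_gZ, d1_gZ, d2_gZ, φZ, hTz]
    simp [φZ]

theorem rep_t4 : Rep (rho F p (d1El p F) ^ p + rho F p (d1El p F) +
    rho F p (DG (mon (1, 1)) (O21_le_Pot (mon_mem_O21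
      (lt_of_lt_of_le (Fact.out : p.Prime).one_lt (le_of_lt prime_lt_sq))
      (Fact.out : p.Prime).one_lt)))) (t4 F p) := by
  refine (rep_d1El_pow.add rep_d1El).add ?_
  rw [DG_eq_DGL (g := gX * gZ)]
  · exact rep_rho_inB _
  · rw [Subalgebra.coe_mul, coe_gX, coe_gZ, mon_mul_mon]
    simp [binom2]

theorem exists_conj_t4 [IsAlgClosed F] (hp : 3 < p) {t : EndS F p} (ht : t ∈ Sp F p)
    (hT : IsToral t) (hS : t ∉ SIm F p) : ∃ g : SAlg F p ≃ₗ⁅F⁆ SAlg F p,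
      autAct g t = rho F p (d1El p F) ^ p + rho F p (d1El p F) +
        rho F p (DG (mon (1, 1)) (O21_le_Pot (mon_mem_O21
          (lt_of_lt_of_le (Fact.out : p.Prime).one_lt (le_of_lt prime_lt_sq))
          (Fact.out : p.Prime).one_lt))) := by
  obtain ⟨s, β, hs, hrep⟩ := Sp_exists hp ht
  change Rep t (sop s β) at hrep
  -- By `Sp_exists` the D₁^p-component is the only obstruction to lying in `S`.
  have hβ : β ≠ 0 := by
    rintro rfl
    refine hS ⟨K s, hrep.unique ?_⟩
    rw [coe_K hs, sop, zero_smul, add_zero]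
    exact rep_rho_inB s
  have hT' : sop s β ^ p = sop s β := by
    have h1 := hrep.pow p
    rw [hT] at h1
    exact h1.der_eq hp hrep (sop_isPD s β).1.pow_p (sop_isPD s β).1
  obtain ⟨Φ, hΦ, hΦ'⟩ := exists_canonical_equiv hβ hT'
  have hΨ : ∀ a b, Φ.symm (pb a b) = pb (Φ.symm a) (Φ.symm b) := by
    intro a b
    apply Φ.injective
    rw [hΦ]; simp
  obtain ⟨g, -, hg⟩ := exists_aut Φ.symm hΨ
  refine ⟨g, (hg _ _ hrep).unique ?_⟩
  have : Φ.symm.toLinearMap.comp ((sop s β).comp Φ.symm.symm.toLinearMap) = t4 F p := by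
    refine LinearMap.ext fun a => ?_
    apply Φ.injective
    rw [hΦ']
    simp
  rw [this]
  exact rep_t4

end

end Ham21

theorem mainTheorem6 (F : Type*) [Field F] [IsAlgClosed F] (p : ℕ) [Fact p.Prime] [CharP F p]
    (hp : 3 < p) :
    -- toral elements of `S_p` in `S ∖ S_(0)`, up to `Aut S`
    ((∀ t : SAlg F p, IsToral (rho F p t) → t ∉ SFil F p 0 →
        ∃ (g : SAlg F p ≃ₗ⁅F⁆ SAlg F p) (μ : F), (μ = 0 ∨ μ = 1) ∧ (g t : GAlg F p) = tEl p μ) ∧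
      (∀ μ : F, (μ = 0 ∨ μ = 1) → IsToral (rho F p (tEl p μ)))) ∧
    -- the centralizer and the eigenspaces of `t_μ`, `μ ∈ {0, 1}`
    (∀ μ : F, (μ = 0 ∨ μ = 1) →
      -- `C_μ'` is an abelian ideal of codimension `2`, and `C_μ = F n_μ ⊕ F h_μ ⊕ C_μ'`
      (CmuPrime p μ ≤ (Cmu p μ).toSubmodule ∧
        (∀ x ∈ CmuPrime p μ, ∀ y ∈ CmuPrime p μ, x * y - y * x = 0) ∧
        (∀ x ∈ Cmu p μ, ∀ y ∈ CmuPrime p μ, x * y - y * x ∈ CmuPrime p μ) ∧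
        FiniteDimensional F (Cmu p μ) ∧
        Module.finrank F (Cmu p μ) = Module.finrank F (CmuPrime p μ) + 2 ∧
        (Cmu p μ).toSubmodule =
          Submodule.span F {nEl p μ} ⊔ Submodule.span F {rho F p (hEl p μ)} ⊔ CmuPrime p μ ∧
        (∀ a b : F, a • nEl p μ + b • rho F p (hEl p μ) ∈ CmuPrime p μ → a = 0 ∧ b = 0)) ∧
      -- the eigenspaces for the eigenvalues `k ∈ 𝔽_p^×`
      (∀ k : ℕ, 1 ≤ k → k < p →
        (∀ (u : O2 F) (hu : u ∈ O21x1 F p 0), phi p μ (k : F) u hu ∈ SAlg F p) ∧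
        Module.finrank F (eigenT p μ (k : F)) = p ^ 2 ∧
        eigenT p μ (k : F) =
          Submodule.span F {x | ∃ (u : O2 F) (hu : u ∈ O21x1 F p 0),
            x = rho F p (phi p μ (k : F) u hu)}) ∧
      -- the `p`-th powers of `h_μ` and `n_μ`
      (rho F p (hEl p μ) ^ p = -(μ • rho F p (hEl p μ)) - nEl p μ ∧ nEl p μ ^ p = 0) ∧
      -- the case `μ = 0`
      (μ = 0 → LieRing.IsNilpotent (Cmu p μ) ∧
        ∃ T : LieSubalgebra F (EndS F p),
          T.toSubmodule = Submodule.span F {rho F p (tEl p μ)} ∧ IsMaximalTorus T)) ∧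
    -- the stabilizer of `t_μ` for `μ ∈ {0, 1}`, `μ ≠ 0`
    (∀ μ : F, (μ = 0 ∨ μ = 1) → μ ≠ 0 →
      -- exponentials in the stabilizer
      (∀ (m : ℕ) (_ : 3 ≤ m) (hm : m ≤ p ^ 2) (c : F),
        rho F p (cEl p μ (mon (m, 0)) (x1_mem_Pot hm)) ^ p = 0 ∧
        ∃ z ∈ Zt p μ, ((z : SAlg F p ≃ₗ⁅F⁆ SAlg F p).toLinearEquiv : SAlg F p →ₗ[F] SAlg F p) =
          ∑ i ∈ Finset.range p, (c ^ i * ((i.factorial : F))⁻¹) •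
            rho F p (cEl p μ (mon (m, 0)) (x1_mem_Pot hm)) ^ i) ∧
      -- elements `h ∈ (G ∩ C_μ) ∖ C_μ'`
      (∀ h : GAlg F p, rho F p h ∈ Cmu p μ → rho F p h ∉ CmuPrime p μ →
        (∃ z ∈ Zt p μ, ∃ a b s : F, a ≠ 0 ∧
          autAct z (rho F p h) = a • rho F p (hEl p μ) + b • rho F p (tEl p μ) +
            s • rho F p (vEl p F)) ∧
        (∀ k : ℕ, 1 ≤ k → k < p →
          ∃ (v : O2 F) (hv : v ∈ O21x1 F p 0), v - 1 ∈ O21x1 F p 1 ∧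
            phi p μ (k : F) v hv ≠ 0 ∧
            (∃ η : F, ⁅h, phi p μ (k : F) v hv⁆ = η • phi p μ (k : F) v hv) ∧
            rho F p (phi p μ (k : F) v hv) ^ p ≠ 0 ∧
            rho F p (phi p μ (k : F) v hv) ^ p ∈ GG F p ∧
            IsPSemisimple (rho F p (phi p μ (k : F) v hv) ^ p)) ∧
        (∃ x : SAlg F p, x ≠ 0 ∧ ⁅tEl p μ, (x : GAlg F p)⁆ = 0 ∧ ¬ IsNilpotent (rho F p x) ∧
          ∃ c : F, c ≠ 0 ∧ ⁅h, (x : GAlg F p)⁆ = c • (x : GAlg F p)))) ∧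
    -- toral elements of `S_p` outside `S`
    (∀ t ∈ Sp F p, IsToral t → t ∉ SIm F p →
      ∃ g : SAlg F p ≃ₗ⁅F⁆ SAlg F p,
        autAct g t = rho F p (d1El p F) ^ p + rho F p (d1El p F) +
          rho F p (DG (mon (1, 1)) (O21_le_Pot (mon_mem_O21
            (lt_of_lt_of_le (Fact.out : p.Prime).one_lt (le_of_lt prime_lt_sq))
            (Fact.out : p.Prime).one_lt)))) := by
  have hμp : ∀ μ : F, (μ = 0 ∨ μ = 1) → μ ^ p = μ := by
    rintro μ (rfl | rfl)
    · exact zero_pow (Fact.out : p.Prime).ne_zero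
    · exact one_pow p
  refine ⟨⟨fun t ht h => exists_conj_tEl hp ht h, fun μ _ => isToral_tEl hp μ⟩, fun μ _ => ?_,
    fun μ hμ hμ0 => ⟨fun m hm3 hm c => exp_mem_Zt hp μ hm3 hm c, fun h h1 h2 => ?_⟩,
    fun t ht hT hS => exists_conj_t4 hp ht hT hS⟩
  · refine ⟨⟨CmuPrime_le hp μ, fun x hx y hy => CmuPrime_comm hp hx hy,
      fun x hx y hy => CmuPrime_ideal hp hx hy, finiteDimensional_Cmu μ, finrank_Cmu hp μ,
      Cmu_eq hp μ, fun a b h => Cmu_independent hp h⟩,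
      fun k hk1 hkp => eigenT_props hp μ hk1 hkp, ⟨hEl_pow_p hp μ, nEl_pow_p hp μ⟩, ?_⟩
    rintro rfl
    exact ⟨isNilpotent_Cmu_zero hp, lineLie (rho F p (tEl p 0)), rfl, isMaximalTorus_tEl_zero hp⟩
  · exact ⟨exists_conj_normal hp h1 h2,
      fun k hk hkp => exists_eigen_phi hp (hμp μ hμ) hμ0 h1 h2 hk hkp,
      exists_eigen_centralizer hp hμ0 h1 h2⟩
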